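/- All graphs are finite and simple. A *path in* a graph $G$ is an induced subgraph of $G$ that is a path; its interior is the set of its vertices other than its two ends, and paths between the same two vertices are internally disjoint if their interiors are disjoint. A *hole* is an induced cycle on at least four vertices. A *theta* is a graph consisting of two non-adjacent vertices $a,b$ and three paths from $a$ to $b$, each of length at least two, whose interiors are pairwise disjoint with no edges between them. A *prism* is a graph consisting of two vertex-disjoint triangles $\{a_1,a_2,a_3\}$, $\{b_1,b_2,b_3\}$ and three pairwise disjoint paths $P_1,P_2,P_3$, where $P_i$ has ends $a_i,b_i$, and for $i\ne j$ the only edges between $P_i$ and $P_j$ are $a_ia_j$ and $b_ib_j$. An *even wheel* in $G$ is a pair $(C,v)$ where $C$ is a hole of $G$ and $v\notin C$ is a vertex whose number of neighbours in $C$ is even and at least three. A graph is (theta, prism, even wheel, $K_t$)-free if it has no induced subgraph that is a theta or a prism, contains no even wheel, and has no clique on $t$ vertices. For an integer $d\ge 1$, a vertex $v$ of $G$ is *$d$-substantial* if there is a hole $C$ in $G\setminus\{v\}$ such that $v$ has at least $d+1$ neighbours in $C$ and the subgraph induced by the vertices of $C$ non-adjacent to $v$ is disconnected, i.e. has at least two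 components. **Corollary.** For all integers $d,t\ge 1$ there is an integer $k=k(d,t)$ with the following property. Let $G$ be a (theta, prism, even wheel, $K_t$)-free graph and let $a,b\in V(G)$ be distinct and non-adjacent. Assume that no neighbour of $a$ is $d$-substantial in $G$. Then there do not exist $k$ pairwise internally disjoint paths in $G$ from $a$ to $b$. -/

import Mathlib

namespace SimpleGraph

variable {V : Type*} (G : SimpleGraph V)

/-- A walk that traverses a path of `G` in the induced sense: no repeated vertex, and the only edges
of `G` between vertices of the walk are the edges of the walk. -/
def Walk.IsInducedPath {G : SimpleGraph V} {u v : V} (p : G.Walk u v) : Prop :=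
  p.IsPath ∧ p.IsChordless

/-- The interior of a path: its vertices other than its two ends. -/
def Walk.interior {G : SimpleGraph V} {u v : V} (p : G.Walk u v) : Set V :=
  {x | x ∈ p.support ∧ x ≠ u ∧ x ≠ v}

/-- `X` is anticomplete to `Y`: no edge of `G` has an end in `X` and an end in `Y`. -/
def Anticomplete (X Y : Set V) : Prop :=
  ∀ x ∈ X, ∀ y ∈ Y, ¬ G.Adj x y

/-- `C` is the vertex set of a hole of `G`, that is, of an induced cycle on at least four vertices. -/
def IsHole (C : Set V) : Prop :=
  ∃ (u : V) (c : G.Walk u u),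
    c.IsCycle ∧ c.IsChordless ∧ 4 ≤ c.length ∧ C = {x | x ∈ c.support}

/-- `G` has an induced subgraph that is a theta with ends `a`, `b` and paths `P 0`, `P 1`, `P 2`. -/
def HasTheta : Prop :=
  ∃ (a b : V) (P : Fin 3 → G.Walk a b),
    a ≠ b ∧ ¬ G.Adj a b ∧
    (∀ i, (P i).IsInducedPath ∧ 2 ≤ (P i).length) ∧
    ∀ i j, i ≠ j →
      Disjoint (P i).interior (P j).interior ∧ G.Anticomplete (P i).interior (P j).interior

/-- `G` has an induced subgraph that is a prism with triangles `{a 0, a 1, a 2}`, `{b 0, b 1, b 2}`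
and paths `P 0`, `P 1`, `P 2`. -/
def HasPrism : Prop :=
  ∃ (a b : Fin 3 → V) (P : ∀ i, G.Walk (a i) (b i)),
    (∀ i j, i ≠ j → G.Adj (a i) (a j)) ∧
    (∀ i j, i ≠ j → G.Adj (b i) (b j)) ∧
    (∀ i j, a i ≠ b j) ∧
    (∀ i, (P i).IsInducedPath) ∧
    ∀ i j, i ≠ j → ∀ x ∈ (P i).support, ∀ y ∈ (P j).support,
      x ≠ y ∧ (G.Adj x y → (x = a i ∧ y = a j) ∨ (x = b i ∧ y = b j))

/-- `G` has an even wheel: a hole `C` and a vertex `v` outside `C` whose number of neighbours in `C`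
is even and at least three. -/
def HasEvenWheel : Prop :=
  ∃ (C : Set V) (v : V), G.IsHole C ∧ v ∉ C ∧
    3 ≤ (C ∩ G.neighborSet v).ncard ∧ Even (C ∩ G.neighborSet v).ncard

/-- `v` is `d`-substantial: some hole `C` avoiding `v` contains at least `d + 1` neighbours of `v`,
and the non-neighbours of `v` in `C` induce a graph with at least two components
(the empty graph does not count as disconnected). -/
def IsSubstantial (d : ℕ) (v : V) : Prop :=
  ∃ C : Set V, G.IsHole C ∧ v ∉ C ∧
    d + 1 ≤ (C ∩ G.neighborSet v).ncard ∧ ¬ (G.induce (C \ G.neighborSet v)).Preconnected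

end SimpleGraph

/-! ### Connected sets, separation, and shortest paths inside connected sets. -/

namespace SimpleGraph
variable {V : Type*} {G : SimpleGraph V}

/-! Suppose that there are very many internally disjoint induced paths from `a` to `b`. By Ramsey's
theorem and the bound on cliques, many of the neighbours of `a` on these paths form a stable set
`X`. Let `D` be the union of what remains of the corresponding paths, including `b` but not `a`;
then `a` has no neighbour in `D`. This is the situation of `Setting` and `Fan`, and the task is to
bound the size of `X` (`exists_fan_bound`).

Three obstructions do most of the work. Two separated connected subsets of `D` with two common
attachments in `X` form a theta, whose third path runs through `a` (`eq_of_touches`). A vertex of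
`D` with three separated connections to `X` forms a theta with `a` (`not_trident`, called a trident
below). An induced path with ends in `X` and interior in `D` closes through `a` to a hole; hence no
vertex of `D` off the path has an even number, at least three, of neighbours on it, and a vertex of
`X` other than its ends has at most `d`, since it is not `d`-substantial (`card_contacts_le`). This
last point is the only use of the hypothesis on the neighbours of `a`.

The engine of the final contradictions is `exists_chunk_bound`. Consider disjoint induced paths
between connected sets `L` and `R`, each with at most `c` neighbours of a vertex `x`, such that the
neighbours of `x` separate `L` from `R` in the union. There are boundedly many such paths. The proof
is by induction on `c`: a path with edges from its non-neighbours of `x` to many other paths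
supplies a new side, with fewer neighbours of `x` per path; otherwise Ramsey's theorem gives
separated paths, two of which close to a hole on which `x` has an even number of neighbours, or else
to a theta.

To find such an `x`, take a minimal connected subset `M` of `D` that touches all of `X`. Minimality
turns every claw of `M` into a trident, so `M` is claw-free and resembles the line graph of a tree.
Walking from a leaf of `M` into the branch with most attachments gives an induced path, the spine
(`exists_data`). Either many vertices of `X` have neighbours on the spine, or many branches hang
from it, each joined to it by a triangle.

In the first case each such vertex, apart from two pendant ones, has at least two neighbours on the
spine, and many of these vertices occupy disjoint intervals. For a vertex `z` in the middle, a
connection in `D` from one side of the spine to the other that avoids the neighbours of `z` would be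
a `Bypass`, which `false_of_pair` and `false_of_wide` exclude. So the component of `b` avoiding the
neighbours of `z` misses one side, and the fan paths cross from that side to this component
(`exists_directSystem_bound`).

In the second case every branch contains a leg, an induced path from `X` to the triangle. Every
connection between the two sides of a middle leg meets the leg or its neighbours. Menger's theorem
then gives either many disjoint crossings avoiding the neighbours of the first vertex of the leg,
each with one or two neighbours of its last vertex, or few vertices meeting all such crossings. In
both cases the fan paths yield a forbidden system, centred at the last or the first vertex of the
leg (`exists_leg_bound`, `exists_branch_bound`). -/

/-- `C` is nonempty and induces a connected subgraph. -/
def Conn (G : SimpleGraph V) (C : Set V) : Prop :=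
  C.Nonempty ∧ ∀ S : Set V, (C ∩ S).Nonempty →
    (∀ x ∈ C, x ∈ S → ∀ y ∈ C, G.Adj x y → y ∈ S) → C ⊆ S

/-- `A` and `B` are disjoint and anticomplete. -/
def Sep (G : SimpleGraph V) (A B : Set V) : Prop :=
  ∀ x ∈ A, ∀ y ∈ B, x ≠ y ∧ ¬ G.Adj x y

/-- `v` has a neighbour in `C`. -/
def Touches (G : SimpleGraph V) (v : V) (C : Set V) : Prop := ∃ c ∈ C, G.Adj v c

/-- `u 0, …, u n` are the vertices, in order, of an induced path. -/
structure IndPath (G : SimpleGraph V) (u : ℕ → V) (n : ℕ) : Prop where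
  inj : ∀ i ≤ n, ∀ j ≤ n, u i = u j → i = j
  adj : ∀ i ≤ n, ∀ j ≤ n, (G.Adj (u i) (u j) ↔ i + 1 = j ∨ j + 1 = i)

/-- The vertices `u i, …, u j`. -/
def seg (u : ℕ → V) (i j : ℕ) : Set V := {v | ∃ k, i ≤ k ∧ k ≤ j ∧ u k = v}

theorem mem_seg {u : ℕ → V} {i j : ℕ} {v : V} : v ∈ seg u i j ↔ ∃ k, i ≤ k ∧ k ≤ j ∧ u k = v :=
  Iff.rfl

theorem mem_seg_of {u : ℕ → V} {i j k : ℕ} (h1 : i ≤ k) (h2 : k ≤ j) : u k ∈ seg u i j :=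
  ⟨k, h1, h2, rfl⟩

theorem Sep.symm {A B : Set V} (h : G.Sep A B) : G.Sep B A :=
  fun x hx y hy => ⟨(h y hy x hx).1.symm, fun e => (h y hy x hx).2 e.symm⟩

theorem Sep.mono {A B A' B' : Set V} (h : G.Sep A B) (hA : A' ⊆ A) (hB : B' ⊆ B) : G.Sep A' B' :=
  fun x hx y hy => h x (hA hx) y (hB hy)

theorem sep_union_left {A B C : Set V} : G.Sep (A ∪ B) C ↔ G.Sep A C ∧ G.Sep B C :=
  ⟨fun h => ⟨h.mono Set.subset_union_left le_rfl, h.mono Set.subset_union_right le_rfl⟩,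
    fun h x hx => hx.elim (h.1 x) (h.2 x)⟩

theorem sep_union_right {A B C : Set V} : G.Sep C (A ∪ B) ↔ G.Sep C A ∧ G.Sep C B :=
  ⟨fun h => ⟨h.mono le_rfl Set.subset_union_left, h.mono le_rfl Set.subset_union_right⟩,
    fun h x hx y hy => hy.elim (h.1 x hx y) (h.2 x hx y)⟩

theorem sep_singleton_left {x : V} {C : Set V} : G.Sep {x} C ↔ x ∉ C ∧ ¬ G.Touches x C := by
  simp only [Sep, Touches, Set.mem_singleton_iff]
  grind

theorem sep_singleton_right {x : V} {C : Set V} : G.Sep C {x} ↔ x ∉ C ∧ ¬ G.Touches x C :=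
  ⟨fun h => sep_singleton_left.1 h.symm, fun h => (sep_singleton_left.2 h).symm⟩

theorem Touches.mono {x : V} {A B : Set V} (h : G.Touches x A) (hAB : A ⊆ B) : G.Touches x B :=
  let ⟨c, hc, h⟩ := h; ⟨c, hAB hc, h⟩

theorem touches_singleton {x y : V} : G.Touches x {y} ↔ G.Adj x y := by
  simp [Touches]

theorem Conn.singleton (x : V) : G.Conn {x} :=
  ⟨Set.singleton_nonempty x, by
    rintro S ⟨y, rfl, hy⟩ - z rfl
    exact hy⟩

theorem Conn.union {A B : Set V} (hA : G.Conn A) (hB : G.Conn B)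
    (h : ∃ x ∈ A, ∃ y ∈ B, x = y ∨ G.Adj x y) : G.Conn (A ∪ B) := by
  refine ⟨hA.1.inl, ?_⟩
  intro S hS hcl
  obtain ⟨x, hx, y, hy, hxy⟩ := h
  have key1 : (A ∩ S).Nonempty → A ⊆ S := fun h => hA.2 S h
    fun p hp hpS q hq hpq => hcl p (Or.inl hp) hpS q (Or.inl hq) hpq
  have key2 : (B ∩ S).Nonempty → B ⊆ S := fun h => hB.2 S h
    fun p hp hpS q hq hpq => hcl p (Or.inr hp) hpS q (Or.inr hq) hpq
  have hxyS : x ∈ S ↔ y ∈ S := by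
    rcases hxy with rfl | hxy
    · rfl
    · exact ⟨fun h => hcl x (Or.inl hx) h y (Or.inr hy) hxy,
        fun h => hcl y (Or.inr hy) h x (Or.inl hx) hxy.symm⟩
  obtain ⟨p, hp | hp, hpS⟩ := hS
  · have h1 := key1 ⟨p, hp, hpS⟩
    exact Set.union_subset h1 (key2 ⟨y, hy, hxyS.1 (h1 hx)⟩)
  · have h1 := key2 ⟨p, hp, hpS⟩
    exact Set.union_subset (key1 ⟨x, hx, hxyS.2 (h1 hy)⟩) h1

theorem Conn.union_adj {A B : Set V} (hA : G.Conn A) (hB : G.Conn B) {x y : V} (hx : x ∈ A)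
    (hy : y ∈ B) (h : G.Adj x y) : G.Conn (A ∪ B) := hA.union hB ⟨x, hx, y, hy, Or.inr h⟩

theorem Conn.union_mem {A B : Set V} (hA : G.Conn A) (hB : G.Conn B) {x : V} (hx : x ∈ A)
    (hy : x ∈ B) : G.Conn (A ∪ B) := hA.union hB ⟨x, hx, x, hy, Or.inl rfl⟩

theorem Conn.insert {A : Set V} {x : V} (hA : G.Conn A) (h : G.Touches x A) :
    G.Conn (insert x A) := by
  obtain ⟨c, hc, h⟩ := h
  exact (Conn.singleton x).union_adj hA rfl hc h

theorem Conn.biUnion {ι : Type*} {s : Set ι} {f : ι → Set V} {A : Set V} (hA : G.Conn A)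
    (hf : ∀ i ∈ s, G.Conn (A ∪ f i)) : G.Conn (A ∪ ⋃ i ∈ s, f i) := by
  refine ⟨hA.1.inl, ?_⟩
  intro S hS hcl
  have hAS : (A ∩ S).Nonempty := by
    obtain ⟨p, hp | hp, hpS⟩ := hS
    · exact ⟨p, hp, hpS⟩
    · simp only [Set.mem_iUnion, exists_prop] at hp
      obtain ⟨i, hi, hp⟩ := hp
      have hsub : A ∪ f i ⊆ A ∪ ⋃ i ∈ s, f i :=
        Set.union_subset_union_right _ (Set.subset_biUnion_of_mem hi)
      have := (hf i hi).2 S ⟨p, Or.inr hp, hpS⟩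
        fun p hp hpS q hq hpq => hcl p (hsub hp) hpS q (hsub hq) hpq
      obtain ⟨a, ha⟩ := hA.1
      exact ⟨a, ha, this (Or.inl ha)⟩
  have h1 : A ⊆ S := hA.2 S hAS
    fun p hp hpS q hq hpq => hcl p (Or.inl hp) hpS q (Or.inl hq) hpq
  refine Set.union_subset h1 ?_
  simp only [Set.iUnion_subset_iff]
  intro i hi
  have hsub : A ∪ f i ⊆ A ∪ ⋃ i ∈ s, f i :=
    Set.union_subset_union_right _ (Set.subset_biUnion_of_mem hi)
  obtain ⟨a, ha⟩ := hA.1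
  exact fun x hx => (hf i hi).2 S ⟨a, Or.inl ha, h1 ha⟩
    (fun p hp hpS q hq hpq => hcl p (hsub hp) hpS q (hsub hq) hpq) (Or.inr hx)

/-- The component of `v` in the subgraph induced by `insert v H`. -/
def comp (G : SimpleGraph V) (H : Set V) (v : V) : Set V :=
  {w | Relation.ReflTransGen (fun p q => G.Adj p q ∧ q ∈ H) v w}

theorem mem_comp_self {H : Set V} {v : V} : v ∈ G.comp H v := Relation.ReflTransGen.refl

theorem comp_closed {H : Set V} {v x y : V} (hx : x ∈ G.comp H v) (hy : y ∈ H)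
    (h : G.Adj x y) : y ∈ G.comp H v := Relation.ReflTransGen.tail hx ⟨h, hy⟩

theorem comp_subset {H : Set V} {v : V} (hv : v ∈ H) : G.comp H v ⊆ H := by
  intro w hw
  induction hw with
  | refl => exact hv
  | tail _ h _ => exact h.2

theorem conn_comp {H : Set V} {v : V} (hv : v ∈ H) : G.Conn (G.comp H v) := by
  refine ⟨⟨v, mem_comp_self⟩, ?_⟩
  intro S hS hcl
  have hvS : v ∈ S := by
    obtain ⟨w, hw, hwS⟩ := hS
    induction hw with
    | refl => exact hwS
    | tail h1 h2 ih =>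
      exact ih (hcl _ (comp_closed h1 h2.2 h2.1) hwS _ h1 h2.1.symm)
  intro w hw
  induction hw with
  | refl => exact hvS
  | tail h1 h2 ih => exact hcl _ h1 ih _ (comp_closed h1 h2.2 h2.1) h2.1

theorem Conn.subset_comp {H C : Set V} {v w : V} (hC : G.Conn C) (hCH : C ⊆ H) (hw : w ∈ C)
    (hwv : w ∈ G.comp H v) : C ⊆ G.comp H v :=
  hC.2 _ ⟨w, hw, hwv⟩ fun _ _ hxS _ hy hxy => comp_closed hxS (hCH hy) hxy

theorem sep_comp {H : Set V} {v : V} : G.Sep (G.comp H v) (H \ G.comp H v) := by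
  intro x hx y hy
  exact ⟨fun e => hy.2 (e ▸ hx), fun e => hy.2 (comp_closed hx hy.1 e)⟩

theorem comp_eq {H : Set V} {v w : V} (hv : v ∈ H) (hw : w ∈ G.comp H v) :
    G.comp H w = G.comp H v := by
  have hwH := comp_subset hv hw
  refine subset_antisymm ?_ ?_
  · exact (conn_comp hwH).subset_comp (comp_subset hwH) mem_comp_self hw
  · refine (conn_comp hv).subset_comp (comp_subset hv) hw mem_comp_self

theorem Conn.exists_adj_of_ne {C S : Set V} (hC : G.Conn C) (h1 : (C ∩ S).Nonempty)
    (h2 : ¬ C ⊆ S) : ∃ x ∈ C ∩ S, ∃ y ∈ C \ S, G.Adj x y := by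
  by_contra! h
  refine h2 (hC.2 S h1 ?_)
  intro x hx hxS y hy hxy
  by_contra hyS
  exact h x ⟨hx, hxS⟩ y ⟨hy, hyS⟩ hxy

/-- A shortest path, inside a connected set, from a vertex satisfying `P` to one satisfying `Q`. -/
theorem Conn.exists_minPath {C : Set V} (hC : G.Conn C) (P Q : V → Prop)
    (hP : ∃ p ∈ C, P p) (hQ : ∃ q ∈ C, Q q) :
    ∃ u n, G.IndPath u n ∧ (∀ i ≤ n, u i ∈ C) ∧ P (u 0) ∧ Q (u n) ∧
      (∀ i ≤ n, P (u i) → i = 0) ∧ (∀ i ≤ n, Q (u i) → i = n) := by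
  classical
  -- Minimality is taken among walks; a repeated vertex, a chord, or a second vertex satisfying `P`
  -- or `Q` would each give a shorter one.
  have ex : ∃ n, ∃ u : ℕ → V, P (u 0) ∧ Q (u n) ∧ (∀ i ≤ n, u i ∈ C) ∧
      ∀ i < n, G.Adj (u i) (u (i + 1)) := by
    obtain ⟨p, hp, hPp⟩ := hP
    obtain ⟨q, hq, hQq⟩ := hQ
    have : C ⊆ {w | ∃ n, ∃ u : ℕ → V, P (u 0) ∧ u n = w ∧ (∀ i ≤ n, u i ∈ C) ∧
      ∀ i < n, G.Adj (u i) (u (i + 1))} := by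
      refine hC.2 _ ⟨p, hp, 0, fun _ => p, hPp, rfl, fun _ _ => hp, by simp⟩ ?_
      rintro x hx ⟨n, u, h1, rfl, h3, h4⟩ y hy hxy
      refine ⟨n + 1, fun k => if k ≤ n then u k else y, by simpa using h1, by simp, ?_, ?_⟩
      · intro i hi
        by_cases h : i ≤ n <;> simp [h, hy, h3]
      · intro i hi
        rcases Nat.lt_succ_iff_lt_or_eq.1 hi with h | rfl
        · simpa [h.le, Nat.succ_le_of_lt h] using h4 i h
        · simpa using hxy
    obtain ⟨n, u, h1, h2, h3, h4⟩ := this hq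
    exact ⟨n, u, h1, h2 ▸ hQq, h3, h4⟩
  obtain ⟨u, h1, h2, h3, h4⟩ := Nat.find_spec ex
  set n := Nat.find ex with hn
  have hmin : ∀ m < n, ∀ v : ℕ → V, P (v 0) → Q (v m) → (∀ i ≤ m, v i ∈ C) →
      (∀ i < m, G.Adj (v i) (v (i + 1))) → False :=
    fun m hm v a1 a2 a3 a4 => Nat.find_min ex hm ⟨v, a1, a2, a3, a4⟩
  -- A repeated vertex allows the closed part of length `j - i` to be cut out. When `j = n` nothing
  -- remains after `u i`.
  have hinj : ∀ i j, i < j → j ≤ n → u i = u j → False := by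
    intro i j hij hj e
    refine hmin (n - (j - i)) (by omega) (fun k => if k ≤ i then u k else u (k + (j - i)))
      (by simpa using h1) ?_ ?_ ?_
    · rcases hj.eq_or_lt with rfl | hj
      · have : n - (n - i) = i := by omega
        simpa [this, e] using h2
      · have h : ¬ n - (j - i) ≤ i := by omega
        have h' : n - (j - i) + (j - i) = n := by omega
        simpa [h, h'] using h2
    · intro k hk
      split_ifs <;> exact h3 _ (by omega)
    · intro k hk
      by_cases hki : k < i
      · simpa [hki.le, Nat.succ_le_of_lt hki] using h4 k (by omega)
      · by_cases hki' : k = i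
        · subst hki'
          have h' : k + 1 + (j - k) = j + 1 := by omega
          simpa [h', e] using h4 j (by omega)
        · have a1 : ¬ k ≤ i := by omega
          have a2 : ¬ k + 1 ≤ i := by omega
          have h' : k + 1 + (j - i) = k + (j - i) + 1 := by omega
          simpa [a1, a2, h'] using h4 (k + (j - i)) (by omega)
  -- A chord replaces `j - i` steps by one, whence the shift by `j - i - 1`.
  have hadj : ∀ i j, i + 1 < j → j ≤ n → ¬ G.Adj (u i) (u j) := by
    intro i j hij hj e
    refine hmin (n - (j - i - 1)) (by omega)
      (fun k => if k ≤ i then u k else u (k + (j - i - 1))) (by simpa using h1) ?_ ?_ ?_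
    · have h : ¬ n - (j - i - 1) ≤ i := by omega
      have h' : n - (j - i - 1) + (j - i - 1) = n := by omega
      simpa [h, h'] using h2
    · intro k hk
      split_ifs <;> exact h3 _ (by omega)
    · intro k hk
      by_cases hki : k < i
      · simpa [hki.le, Nat.succ_le_of_lt hki] using h4 k (by omega)
      · by_cases hki' : k = i
        · subst hki'
          have h' : k + 1 + (j - k - 1) = j := by omega
          simpa [h', e] using e
        · have a1 : ¬ k ≤ i := by omega
          have a2 : ¬ k + 1 ≤ i := by omega
          have h' : k + 1 + (j - i - 1) = k + (j - i - 1) + 1 := by omega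
          simpa [a1, a2, h'] using h4 (k + (j - i - 1)) (by omega)
  refine ⟨u, n, ⟨?_, ?_⟩, h3, h1, h2, ?_, ?_⟩
  · intro i hi j hj e
    rcases lt_trichotomy i j with h | h | h
    · exact (hinj i j h hj e).elim
    · exact h
    · exact (hinj j i h hi e.symm).elim
  · intro i hi j hj
    constructor
    · intro e
      by_contra hc
      rcases lt_trichotomy i j with h | h | h
      · exact hadj i j (by omega) hj e
      · subst h; exact G.loopless.irrefl _ e
      · exact hadj j i (by omega) hi e.symm
    · rintro (rfl | rfl)
      · exact h4 i (by omega)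
      · exact (h4 j (by omega)).symm
  · intro i hi hPi
    by_contra h0
    refine hmin (n - i) (by omega) (fun k => u (k + i)) (by simpa using hPi) ?_
      (fun k hk => h3 _ (by omega)) fun k hk => ?_
    · have : n - i + i = n := by omega
      simpa [this] using h2
    · have : k + 1 + i = k + i + 1 := by omega
      simpa [this] using h4 (k + i) (by omega)
  · intro i hi hQi
    by_contra h0
    exact hmin i (by omega) u h1 hQi (fun k hk => h3 _ (by omega)) fun k hk => h4 k (by omega)

/-! ### Induced paths: segments, concatenation, and the holes, thetas and prisms built from them. -/

namespace IndPath
variable {u v : ℕ → V} {n m : ℕ}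

theorem single (x : V) : G.IndPath (fun _ => x) 0 :=
  ⟨fun i hi j hj _ => by omega, fun i hi j hj => by
    obtain rfl : i = 0 := by omega
    obtain rfl : j = 0 := by omega
    simp⟩

theorem shift (h : G.IndPath u n) {i j : ℕ} (hij : i ≤ j) (hj : j ≤ n) :
    G.IndPath (fun k => u (i + k)) (j - i) :=
  ⟨fun a ha b hb e => by have := h.inj _ (by omega) _ (by omega) e; omega,
    fun a ha b hb => by rw [h.adj _ (by omega) _ (by omega)]; omega⟩

theorem reverse (h : G.IndPath u n) : G.IndPath (fun k => u (n - k)) n :=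
  ⟨fun a ha b hb e => by have := h.inj _ (by omega) _ (by omega) e; omega,
    fun a ha b hb => by rw [h.adj _ (by omega) _ (by omega)]; omega⟩

theorem prefix_le (h : G.IndPath u n) {j : ℕ} (hj : j ≤ n) : G.IndPath u j :=
  ⟨fun a ha b hb e => h.inj _ (by omega) _ (by omega) e,
    fun a ha b hb => h.adj _ (by omega) _ (by omega)⟩

theorem ne (h : G.IndPath u n) {i j : ℕ} (hi : i ≤ n) (hj : j ≤ n) (hij : i ≠ j) : u i ≠ u j :=
  fun e => hij (h.inj i hi j hj e)

theorem adj_succ (h : G.IndPath u n) {i : ℕ} (hi : i < n) : G.Adj (u i) (u (i + 1)) :=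
  (h.adj i hi.le _ hi).2 (Or.inl rfl)

theorem conn_seg (h : G.IndPath u n) {i j : ℕ} (hij : i ≤ j) (hj : j ≤ n) :
    G.Conn (seg u i j) := by
  induction j, hij using Nat.le_induction with
  | base =>
    have : seg u i i = {u i} := by
      ext x; simp only [mem_seg, Set.mem_singleton_iff]
      exact ⟨fun ⟨k, h1, h2, h3⟩ => by rw [← h3, le_antisymm h2 h1],
        fun h => ⟨i, le_rfl, le_rfl, h.symm⟩⟩
    rw [this]; exact Conn.singleton _
  | succ j hij ih =>
    have : seg u i (j + 1) = seg u i j ∪ {u (j + 1)} := by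
      ext x; simp only [mem_seg, Set.mem_union, Set.mem_singleton_iff]
      constructor
      · rintro ⟨k, h1, h2, rfl⟩
        rcases h2.lt_or_eq with h | rfl
        · exact Or.inl ⟨k, h1, by omega, rfl⟩
        · exact Or.inr rfl
      · rintro (⟨k, h1, h2, rfl⟩ | rfl)
        · exact ⟨k, h1, by omega, rfl⟩
        · exact ⟨j + 1, by omega, le_rfl, rfl⟩
    rw [this]
    exact (ih (by omega)).union_adj (Conn.singleton _) (mem_seg_of hij le_rfl) rfl
      (h.adj_succ (by omega))

end IndPath

/-- Concatenation of `u 0, …, u n` with `v 0, v 1, …`. -/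
def app (u : ℕ → V) (n : ℕ) (v : ℕ → V) : ℕ → V := fun k => if k ≤ n then u k else v (k - n - 1)

theorem app_left {u v : ℕ → V} {n k : ℕ} (h : k ≤ n) : app u n v k = u k := if_pos h

theorem app_right {u v : ℕ → V} {n k : ℕ} : app u n v (n + 1 + k) = v k := by
  unfold app
  rw [if_neg (by omega)]
  congr 1; omega

theorem app_cases {u v : ℕ → V} {n m i : ℕ} (hi : i ≤ n + 1 + m) :
    (i ≤ n ∧ app u n v i = u i) ∨ ∃ k, k ≤ m ∧ i = n + 1 + k ∧ app u n v i = v k := by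
  by_cases h : i ≤ n
  · exact Or.inl ⟨h, app_left h⟩
  · obtain ⟨k, rfl⟩ := Nat.exists_eq_add_of_le (show n + 1 ≤ i by omega)
    exact Or.inr ⟨k, by omega, rfl, app_right⟩

theorem seg_app {u v : ℕ → V} {n m : ℕ} :
    seg (app u n v) 0 (n + 1 + m) = seg u 0 n ∪ seg v 0 m := by
  ext x
  simp only [mem_seg, Set.mem_union]
  constructor
  · rintro ⟨k, -, hk, rfl⟩
    rcases app_cases (u := u) (v := v) hk with ⟨h, e⟩ | ⟨l, hl, rfl, e⟩
    · exact Or.inl ⟨k, by omega, h, e.symm⟩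
    · exact Or.inr ⟨l, by omega, hl, e.symm⟩
  · rintro (⟨k, -, hk, rfl⟩ | ⟨k, -, hk, rfl⟩)
    · exact ⟨k, by omega, by omega, app_left hk⟩
    · exact ⟨n + 1 + k, by omega, by omega, app_right⟩

theorem IndPath.app {u v : ℕ → V} {n m : ℕ} (hu : G.IndPath u n) (hv : G.IndPath v m)
    (hne : ∀ i ≤ n, ∀ j ≤ m, u i ≠ v j)
    (hadj : ∀ i ≤ n, ∀ j ≤ m, (G.Adj (u i) (v j) ↔ i = n ∧ j = 0)) :
    G.IndPath (app u n v) (n + 1 + m) := by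
  constructor
  · intro i hi j hj e
    rcases app_cases (u := u) (v := v) hi with ⟨h, e1⟩ | ⟨k, hk, rfl, e1⟩ <;>
      rcases app_cases (u := u) (v := v) hj with ⟨h', e2⟩ | ⟨l, hl, rfl, e2⟩ <;> rw [e1, e2] at e
    · exact hu.inj _ h _ h' e
    · exact (hne _ h _ hl e).elim
    · exact (hne _ h' _ hk e.symm).elim
    · rw [hv.inj _ hk _ hl e]
  · intro i hi j hj
    rcases app_cases (u := u) (v := v) hi with ⟨h, e1⟩ | ⟨k, hk, rfl, e1⟩ <;>
      rcases app_cases (u := u) (v := v) hj with ⟨h', e2⟩ | ⟨l, hl, rfl, e2⟩ <;> rw [e1, e2]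
    · exact hu.adj _ h _ h'
    · rw [hadj _ h _ hl]; omega
    · rw [G.adj_comm, hadj _ h' _ hk]; omega
    · rw [hv.adj _ hk _ hl]; omega

/-- The walk `u 0, …, u n`. -/
def walkOf (u : ℕ → V) : ∀ n, (∀ i < n, G.Adj (u i) (u (i + 1))) → G.Walk (u 0) (u n)
  | 0, _ => Walk.nil
  | n + 1, h => (walkOf u n fun i hi => h i (by omega)).concat (h n (by omega))

theorem support_walkOf {u : ℕ → V} {n : ℕ} (h : ∀ i < n, G.Adj (u i) (u (i + 1))) :
    (walkOf u n h).support = (List.range (n + 1)).map u := by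
  induction n with
  | zero => simp [walkOf, List.range_succ]
  | succ n ih => rw [walkOf, Walk.support_concat, ih, List.range_succ (n := n + 1)]; simp

theorem edges_walkOf {u : ℕ → V} {n : ℕ} (h : ∀ i < n, G.Adj (u i) (u (i + 1))) :
    (walkOf u n h).edges = (List.range n).map fun i => s(u i, u (i + 1)) := by
  induction n with
  | zero => simp [walkOf]
  | succ n ih => rw [walkOf, Walk.edges_concat, ih, List.range_succ (n := n)]; simp

theorem length_walkOf {u : ℕ → V} {n : ℕ} (h : ∀ i < n, G.Adj (u i) (u (i + 1))) :
    (walkOf u n h).length = n := by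
  induction n with
  | zero => simp [walkOf]
  | succ n ih => rw [walkOf, Walk.length_concat, ih]

theorem IndPath.isInducedPath {u : ℕ → V} {n : ℕ} (hu : G.IndPath u n) :
    (walkOf u n fun _ hi => hu.adj_succ hi).IsInducedPath := by
  constructor
  · rw [Walk.isPath_def, support_walkOf]
    refine List.Nodup.map_on ?_ List.nodup_range
    intro x hx y hy e
    rw [List.mem_range] at hx hy
    exact hu.inj x (by omega) y (by omega) e
  · rw [Walk.isChordless_iff_forall_mem_edges]
    intro x y hx hy hxy
    rw [support_walkOf, List.mem_map] at hx hy
    obtain ⟨i, hi, rfl⟩ := hx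
    obtain ⟨j, hj, rfl⟩ := hy
    rw [List.mem_range] at hi hj
    rw [edges_walkOf, List.mem_map]
    rcases (hu.adj i (by omega) j (by omega)).1 hxy with rfl | rfl
    · exact ⟨i, by simp; omega, rfl⟩
    · exact ⟨j, by simp; omega, Sym2.eq_swap⟩

theorem IndPath.exists_walk {u : ℕ → V} {n : ℕ} (hu : G.IndPath u n) {x y : V} (hx : u 0 = x)
    (hy : u n = y) : ∃ p : G.Walk x y, p.IsInducedPath ∧ p.length = n ∧
      ∀ z, z ∈ p.support ↔ z ∈ seg u 0 n := by
  subst hx hy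
  refine ⟨_, hu.isInducedPath, length_walkOf _, ?_⟩
  intro z
  rw [support_walkOf, List.mem_map]
  simp only [List.mem_range, mem_seg]
  exact ⟨fun ⟨k, h1, h2⟩ => ⟨k, by omega, by omega, h2⟩, fun ⟨k, _, h1, h2⟩ => ⟨k, by omega, h2⟩⟩

/-- A vertex `w` adjacent to exactly the two ends of an induced path closes it to a hole. -/
theorem IndPath.isHole {u : ℕ → V} {n : ℕ} (hu : G.IndPath u n) (hn : 2 ≤ n) {w : V}
    (hw : ∀ i ≤ n, u i ≠ w) (hadj : ∀ i ≤ n, (G.Adj w (u i) ↔ i = 0 ∨ i = n)) :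
    G.IsHole (insert w (seg u 0 n)) := by
  have h0 : G.Adj w (u 0) := (hadj 0 (by omega)).2 (Or.inl rfl)
  have hnw : G.Adj (u n) w := ((hadj n le_rfl).2 (Or.inr rfl)).symm
  set p := walkOf u n fun _ hi => hu.adj_succ hi with hp
  have hind := hu.isInducedPath
  have hsup : ∀ z, z ∈ p.support ↔ z ∈ seg u 0 n := by
    intro z
    rw [hp, support_walkOf, List.mem_map]
    simp only [List.mem_range, mem_seg]
    exact ⟨fun ⟨k, h1, h2⟩ => ⟨k, by omega, by omega, h2⟩,
      fun ⟨k, _, h1, h2⟩ => ⟨k, by omega, h2⟩⟩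
  have hwp : w ∉ p.support := by
    rw [hsup]; rintro ⟨k, -, hk, e⟩; exact hw k hk e
  refine ⟨w, Walk.cons h0 (p.concat hnw), ?_, ?_, ?_, ?_⟩
  · rw [Walk.cons_isCycle_iff]
    refine ⟨hind.1.concat hwp hnw, ?_⟩
    rw [Walk.edges_concat, List.concat_eq_append, List.mem_append, not_or]
    refine ⟨fun h => hwp (Walk.fst_mem_support_of_mem_edges _ h), ?_⟩
    simp only [List.mem_singleton, Sym2.eq_iff, not_or, not_and]
    exact ⟨fun e => (hw n le_rfl e.symm).elim, fun _ e =>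
      absurd (hu.inj 0 (by omega) n le_rfl e) (by omega)⟩
  · rw [Walk.isChordless_iff_forall_mem_edges]
    have key : ∀ y, y ∈ seg u 0 n → G.Adj w y → s(w, y) ∈ (Walk.cons h0 (p.concat hnw)).edges := by
      rintro _ ⟨i, -, hi, rfl⟩ h
      rcases (hadj i hi).1 h with rfl | rfl
      · simp
      · simp [Sym2.eq_swap]
    have hmem : ∀ z, z ∈ (Walk.cons h0 (p.concat hnw)).support → z = w ∨ z ∈ seg u 0 n := by
      intro z hz
      simp only [Walk.support_cons, Walk.support_concat, List.mem_cons,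
        List.mem_append, hsup, List.not_mem_nil, or_false] at hz
      tauto
    intro x y hx hy hxy
    rcases hmem x hx with rfl | hx' <;> rcases hmem y hy with rfl | hy'
    · exact (G.loopless.irrefl _ hxy).elim
    · exact key y hy' hxy
    · rw [Sym2.eq_swap]; exact key x hx' hxy.symm
    · have := hind.2.mem_edges ((hsup x).2 hx') ((hsup y).2 hy') hxy
      simp [hp, this]
  · rw [Walk.length_cons, Walk.length_concat, hp, length_walkOf]; omega
  · ext z
    simp only [Set.mem_insert_iff, Set.mem_ofPred_eq, Walk.support_cons, Walk.support_concat,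
      List.mem_cons, List.mem_append, hsup]
    simp only [List.not_mem_nil, or_false]; tauto

theorem IndPath.cons {u : ℕ → V} {n : ℕ} (hu : G.IndPath u n) {w : V} (hw : ∀ i ≤ n, u i ≠ w)
    (hadj : ∀ i ≤ n, (G.Adj w (u i) ↔ i = 0)) :
    G.IndPath (SimpleGraph.app (fun _ => w) 0 u) (n + 1) := by
  have := (IndPath.single (G := G) w).app hu (fun i _ j hj => (hw j hj).symm)
    (fun i hi j hj => by rw [hadj j hj]; omega)
  rwa [show 0 + 1 + n = n + 1 by omega] at this

theorem IndPath.snoc {u : ℕ → V} {n : ℕ} (hu : G.IndPath u n) {w : V} (hw : ∀ i ≤ n, u i ≠ w)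
    (hadj : ∀ i ≤ n, (G.Adj w (u i) ↔ i = n)) :
    G.IndPath (SimpleGraph.app u n (fun _ => w)) (n + 1) :=
  hu.app (IndPath.single (G := G) w) (fun i hi j _ => hw i hi)
    (fun i hi j hj => by rw [G.adj_comm, hadj i hi]; omega)

/-- A shortest path in `C i` between a neighbour of `a` and a neighbour of `b` has no further
neighbours of either, so it is the interior of an induced path from `a` to `b`. Later arguments can
therefore exhibit three separated connected sets instead of three paths. -/
theorem hasTheta_of_conn {a b : V} (hab : a ≠ b) (hnab : ¬ G.Adj a b) {C : Fin 3 → Set V}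
    (hC : ∀ i, G.Conn (C i)) (hsep : ∀ i j, i ≠ j → G.Sep (C i) (C j))
    (haC : ∀ i, a ∉ C i) (hbC : ∀ i, b ∉ C i)
    (ha : ∀ i, G.Touches a (C i)) (hb : ∀ i, G.Touches b (C i)) : G.HasTheta := by
  have key : ∀ i, ∃ p : G.Walk a b, p.IsInducedPath ∧ 2 ≤ p.length ∧ p.interior ⊆ C i := by
    intro i
    obtain ⟨u, n, hu, huC, h0, hn, hu0, hun⟩ := (hC i).exists_minPath (G.Adj a) (G.Adj b)
      (ha i) (hb i)
    have h1 := hu.cons (w := a) (fun k hk e => haC i (e ▸ huC k hk))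
      (fun k hk => ⟨hu0 k hk, fun e => e ▸ h0⟩)
    have h2 := h1.snoc (w := b) (fun k hk e => by
        rcases app_cases (u := fun _ => a) (v := u) (show k ≤ 0 + 1 + n by omega) with
          ⟨_, e'⟩ | ⟨l, hl, _, e'⟩
        · exact hab (e'.symm.trans e)
        · exact hbC i ((e'.symm.trans e) ▸ huC l hl)) (fun k hk => by
        rcases app_cases (u := fun _ => a) (v := u) (show k ≤ 0 + 1 + n by omega) with
          ⟨_, e'⟩ | ⟨l, hl, _, e'⟩ <;> rw [e']
        · exact iff_of_false (fun e => hnab e.symm) (by omega)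
        · constructor
          · intro h; have := hun l hl h; omega
          · intro h; obtain rfl : l = n := by omega
            exact hn)
    obtain ⟨p, hp, hl, hs⟩ := h2.exists_walk (x := a) (y := b)
      (by rw [app_left (by omega), app_left le_rfl]) (app_right (k := 0))
    refine ⟨p, hp, by omega, ?_⟩
    rintro z ⟨hz, hza, hzb⟩
    obtain ⟨k, -, hk, rfl⟩ := (hs z).1 hz
    rcases app_cases (v := fun _ => b) (show k ≤ n + 1 + 0 + 1 + 0 by omega) with
      ⟨hk', e⟩ | ⟨l, hl, _, e⟩
    · rw [e] at hza hzb ⊢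
      rcases app_cases (u := fun _ => a) (v := u) (show k ≤ 0 + 1 + n by omega) with
          ⟨_, e'⟩ | ⟨l, hl, _, e'⟩
      · exact (hza e').elim
      · rw [e']; exact huC l hl
    · exact (hzb e).elim
  choose p hp hl hi using key
  refine ⟨a, b, p, hab, hnab, fun i => ⟨hp i, hl i⟩, fun i j hij => ⟨?_, ?_⟩⟩
  · rw [Set.disjoint_left]
    intro x hx hy
    exact (hsep i j hij x (hi i hx) x (hi j hy)).1 rfl
  · intro x hx y hy
    exact (hsep i j hij x (hi i hx) y (hi j hy)).2

/-- As for thetas, the paths are shortest paths inside the connected sets, and inherit from them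
that the triangle edges are the only edges in between. -/
theorem hasPrism_of_conn {a b : Fin 3 → V} {C : Fin 3 → Set V}
    (ha : ∀ i j, i ≠ j → G.Adj (a i) (a j)) (hb : ∀ i j, i ≠ j → G.Adj (b i) (b j))
    (hab : ∀ i, a i ≠ b i) (haC : ∀ i, a i ∈ C i) (hbC : ∀ i, b i ∈ C i)
    (hC : ∀ i, G.Conn (C i))
    (hsep : ∀ i j, i < j → ∀ x ∈ C i, ∀ y ∈ C j,
      x ≠ y ∧ (G.Adj x y → (x = a i ∧ y = a j) ∨ (x = b i ∧ y = b j))) : G.HasPrism := by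
  have hsep' : ∀ i j, i ≠ j → ∀ x ∈ C i, ∀ y ∈ C j,
      x ≠ y ∧ (G.Adj x y → (x = a i ∧ y = a j) ∨ (x = b i ∧ y = b j)) := by
    intro i j hij x hx y hy
    rcases lt_or_gt_of_ne hij with h | h
    · exact hsep i j h x hx y hy
    · have := hsep j i h y hy x hx
      exact ⟨this.1.symm, fun e => (this.2 e.symm).imp And.symm And.symm⟩
  have key : ∀ i, ∃ p : G.Walk (a i) (b i), p.IsInducedPath ∧ ∀ x ∈ p.support, x ∈ C i := by
    intro i
    obtain ⟨u, n, hu, huC, h0, hn, -, -⟩ := (hC i).exists_minPath (· = a i) (· = b i)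
      ⟨_, haC i, rfl⟩ ⟨_, hbC i, rfl⟩
    obtain ⟨p, hp, -, hs⟩ := hu.exists_walk h0 hn
    refine ⟨p, hp, fun x hx => ?_⟩
    obtain ⟨k, -, hk, rfl⟩ := (hs x).1 hx
    exact huC k hk
  choose p hp hpC using key
  refine ⟨a, b, p, ha, hb, ?_, hp, ?_⟩
  · intro i j
    by_cases h : i = j
    · subst h; exact hab i
    · exact (hsep' i j h _ (haC i) _ (hbC j)).1
  · exact fun i j hij x hx y hy => hsep' i j hij x (hpC i x hx) y (hpC j y hy)


/-- A hole closed by `w`, seen from a vertex `z` that is not adjacent to `w`. -/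
theorem IndPath.hasEvenWheel {u : ℕ → V} {n : ℕ} (hu : G.IndPath u n) (hn : 2 ≤ n) {w z : V}
    (hw : ∀ i ≤ n, u i ≠ w) (hadj : ∀ i ≤ n, (G.Adj w (u i) ↔ i = 0 ∨ i = n))
    (hz : ∀ i ≤ n, u i ≠ z) (hzw : z ≠ w) (hnzw : ¬ G.Adj z w) (s : Finset ℕ)
    (hs : ∀ i, i ∈ s ↔ i ≤ n ∧ G.Adj z (u i)) (h3 : 3 ≤ s.card) (heven : Even s.card) :
    G.HasEvenWheel := by
  have e : insert w (seg u 0 n) ∩ G.neighborSet z = u '' (s : Set ℕ) := by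
    ext x
    simp only [Set.mem_inter_iff, Set.mem_insert_iff, mem_seg, mem_neighborSet, Set.mem_image,
      Finset.mem_coe, hs]
    constructor
    · rintro ⟨rfl | ⟨k, -, hk, rfl⟩, h⟩
      · exact (hnzw h).elim
      · exact ⟨k, ⟨hk, h⟩, rfl⟩
    · rintro ⟨k, ⟨hk, h⟩, rfl⟩
      exact ⟨Or.inr ⟨k, by omega, hk, rfl⟩, h⟩
  have hcard : (insert w (seg u 0 n) ∩ G.neighborSet z).ncard = s.card := by
    rw [e, Set.InjOn.ncard_image, Set.ncard_coe_finset]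
    intro i hi j hj h
    exact hu.inj _ ((hs i).1 hi).1 _ ((hs j).1 hj).1 h
  refine ⟨_, z, hu.isHole hn hw hadj, ?_, hcard ▸ h3, hcard ▸ heven⟩
  rintro (rfl | ⟨k, -, hk, rfl⟩)
  · exact hzw rfl
  · exact hz k hk rfl

/-- A hole closed by `w`, seen from a vertex `z` that is adjacent to `w`. -/
theorem IndPath.hasEvenWheel_of_adj {u : ℕ → V} {n : ℕ} (hu : G.IndPath u n) (hn : 2 ≤ n) {w z : V}
    (hw : ∀ i ≤ n, u i ≠ w) (hadj : ∀ i ≤ n, (G.Adj w (u i) ↔ i = 0 ∨ i = n))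
    (hz : ∀ i ≤ n, u i ≠ z) (hzw : G.Adj z w) (s : Finset ℕ)
    (hs : ∀ i, i ∈ s ↔ i ≤ n ∧ G.Adj z (u i)) (h3 : 2 ≤ s.card) (hodd : Odd s.card) :
    G.HasEvenWheel := by
  have e : insert w (seg u 0 n) ∩ G.neighborSet z = insert w (u '' (s : Set ℕ)) := by
    ext x
    simp only [Set.mem_inter_iff, Set.mem_insert_iff, mem_seg, mem_neighborSet, Set.mem_image,
      Finset.mem_coe, hs]
    constructor
    · rintro ⟨rfl | ⟨k, -, hk, rfl⟩, h⟩
      · exact Or.inl rfl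
      · exact Or.inr ⟨k, ⟨hk, h⟩, rfl⟩
    · rintro (rfl | ⟨k, ⟨hk, h⟩, rfl⟩)
      · exact ⟨Or.inl rfl, hzw⟩
      · exact ⟨Or.inr ⟨k, by omega, hk, rfl⟩, h⟩
  -- The closing vertex `w` is itself a neighbour of `z`, so an odd count on the path is an even
  -- count on the hole.
  have hcard : (insert w (seg u 0 n) ∩ G.neighborSet z).ncard = s.card + 1 := by
    rw [e, Set.ncard_insert_of_notMem _ (s.finite_toSet.image u), Set.InjOn.ncard_image,
      Set.ncard_coe_finset]
    · intro i hi j hj h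
      exact hu.inj _ ((hs i).1 hi).1 _ ((hs j).1 hj).1 h
    · rintro ⟨i, hi, h⟩
      exact hw i ((hs i).1 hi).1 h
  refine ⟨_, z, hu.isHole hn hw hadj, ?_, by omega, ?_⟩
  · rintro (rfl | ⟨k, -, hk, rfl⟩)
    · exact hzw.ne rfl
    · exact hz k hk rfl
  · rw [hcard]; exact hodd.add_one

theorem hasTheta_of_conn' {a b : V} (hab : a ≠ b) (hnab : ¬ G.Adj a b) {A B C : Set V}
    (hA : G.Conn A) (hB : G.Conn B) (hC : G.Conn C)
    (hAB : G.Sep A B) (hAC : G.Sep A C) (hBC : G.Sep B C)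
    (ha : a ∉ A ∧ a ∉ B ∧ a ∉ C) (hb : b ∉ A ∧ b ∉ B ∧ b ∉ C)
    (ta : G.Touches a A ∧ G.Touches a B ∧ G.Touches a C)
    (tb : G.Touches b A ∧ G.Touches b B ∧ G.Touches b C) : G.HasTheta := by
  refine hasTheta_of_conn hab hnab (C := ![A, B, C]) ?_ ?_ ?_ ?_ ?_ ?_
  · intro i; fin_cases i <;> assumption
  · intro i j hij
    fin_cases i <;> fin_cases j <;> simp at hij ⊢ <;>
      first | assumption | (apply Sep.symm; assumption)
  · intro i; fin_cases i <;> simp [ha]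
  · intro i; fin_cases i <;> simp [hb]
  · intro i; fin_cases i <;> simp [ta]
  · intro i; fin_cases i <;> simp [tb]

theorem hasPrism_of_conn' {a1 a2 a3 b1 b2 b3 : V} {A B C : Set V}
    (ha12 : G.Adj a1 a2) (ha13 : G.Adj a1 a3) (ha23 : G.Adj a2 a3)
    (hb12 : G.Adj b1 b2) (hb13 : G.Adj b1 b3) (hb23 : G.Adj b2 b3)
    (h1 : a1 ≠ b1) (h2 : a2 ≠ b2) (h3 : a3 ≠ b3)
    (hA : G.Conn A) (hB : G.Conn B) (hC : G.Conn C)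
    (haA : a1 ∈ A) (hbA : b1 ∈ A) (haB : a2 ∈ B) (hbB : b2 ∈ B) (haC : a3 ∈ C) (hbC : b3 ∈ C)
    (hAB : ∀ x ∈ A, ∀ y ∈ B, x ≠ y ∧ (G.Adj x y → (x = a1 ∧ y = a2) ∨ (x = b1 ∧ y = b2)))
    (hAC : ∀ x ∈ A, ∀ y ∈ C, x ≠ y ∧ (G.Adj x y → (x = a1 ∧ y = a3) ∨ (x = b1 ∧ y = b3)))
    (hBC : ∀ x ∈ B, ∀ y ∈ C, x ≠ y ∧ (G.Adj x y → (x = a2 ∧ y = a3) ∨ (x = b2 ∧ y = b3))) :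
    G.HasPrism := by
  refine hasPrism_of_conn (a := ![a1, a2, a3]) (b := ![b1, b2, b3]) (C := ![A, B, C])
    ?_ ?_ ?_ ?_ ?_ ?_ ?_
  · intro i j hij
    fin_cases i <;> fin_cases j <;> simp at hij ⊢ <;>
      first | assumption | (apply Adj.symm; assumption)
  · intro i j hij
    fin_cases i <;> fin_cases j <;> simp at hij ⊢ <;>
      first | assumption | (apply Adj.symm; assumption)
  · intro i; fin_cases i <;> assumption
  · intro i; fin_cases i <;> assumption
  · intro i; fin_cases i <;> assumption
  · intro i; fin_cases i <;> assumption
  · intro i j hij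
    fin_cases i <;> fin_cases j <;> simp at hij ⊢ <;> assumption

end SimpleGraph

/-! ### Ramsey's theorem. -/

namespace SimpleGraph

theorem exists_large_fiber {ι κ : Type*} [Fintype κ] [DecidableEq κ] (s : Finset ι) (f : ι → κ)
    (n : ℕ) (h : Fintype.card κ * n ≤ s.card) (hs : 0 < s.card) :
    ∃ k : κ, n ≤ (s.filter fun i => f i = k).card := by
  have : Nonempty κ := by
    obtain ⟨x, -⟩ := Finset.card_pos.1 hs
    exact ⟨f x⟩
  obtain ⟨k, -, hk⟩ := Finset.exists_le_card_fiber_of_mul_le_card_of_maps_to (s := s)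
    (t := Finset.univ) (f := f) (n := n) (fun _ _ => Finset.mem_univ _) Finset.univ_nonempty
    (by simpa using h)
  exact ⟨k, hk⟩

/-- The first half of Ramsey's theorem: choose a vertex, keep a large colour class of the others as
seen from it, and repeat. The colour of a pair then depends on its earlier member only. -/
theorem exists_end_homogeneous (κ : Type) [Fintype κ] (m : ℕ) :
    ∃ N : ℕ, ∀ {ι : Type*} (s : Finset ι) (_ : N ≤ s.card) (col : ι → ι → κ),
      ∃ (f : ℕ → ι) (g : ℕ → κ), (∀ i < m, f i ∈ s) ∧ ∀ i j, i < j → j < m →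
        f i ≠ f j ∧ col (f i) (f j) = g i := by
  classical
  induction m with
  | zero =>
    refine ⟨1, fun s hs col => ?_⟩
    obtain ⟨x, -⟩ := Finset.card_pos.1 hs
    exact ⟨fun _ => x, fun _ => col x x, fun i hi => by omega, fun i j _ hj => by omega⟩
  | succ m ih =>
    obtain ⟨N, hN⟩ := ih
    -- One element is `x`; the other extra one keeps the remaining set nonempty even if the product
    -- vanishes, as the pigeonhole step needs.
    refine ⟨Fintype.card κ * N + 2, fun {ι} s hs col => ?_⟩
    obtain ⟨x, hx⟩ := Finset.card_pos.1 (show 0 < s.card by omega)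
    have hc : (s.erase x).card = s.card - 1 := Finset.card_erase_of_mem hx
    obtain ⟨k, hk⟩ := exists_large_fiber (s.erase x) (col x) N (by omega) (by omega)
    obtain ⟨f, g, hf, hg⟩ := hN _ hk col
    refine ⟨fun i => if i = 0 then x else f (i - 1), fun i => if i = 0 then k else g (i - 1),
      ?_, ?_⟩
    · intro i hi
      by_cases h : i = 0
      · simp [h, hx]
      · have := hf (i - 1) (by omega)
        simp only [Finset.mem_filter, Finset.mem_erase] at this
        simp [h, this]
    · intro i j hij hj
      have hj0 : j ≠ 0 := by omega
      by_cases h : i = 0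
      · have := hf (j - 1) (by omega)
        simp only [Finset.mem_filter, Finset.mem_erase] at this
        simp only [h, if_true, hj0, if_false]
        exact ⟨this.1.1.symm, this.2⟩
      · simp only [h, hj0, if_false]
        exact hg _ _ (by omega) (by omega)

/-- Ramsey's theorem for ordered pairs and finitely many colours. -/
theorem exists_ramsey (κ : Type) [Fintype κ] (n : ℕ) :
    ∃ N : ℕ, ∀ {ι : Type*} (s : Finset ι) (_ : N ≤ s.card) (col : ι → ι → κ),
      ∃ (f : Fin n → ι) (k : κ), (∀ i, f i ∈ s) ∧ Function.Injective f ∧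
        ∀ i j, i < j → col (f i) (f j) = k := by
  classical
  -- In an end-homogeneous sequence it remains to apply the pigeonhole principle to the colours of
  -- the single vertices.
  obtain ⟨N, hN⟩ := exists_end_homogeneous κ (Fintype.card κ * n + 1)
  refine ⟨N, fun s hs col => ?_⟩
  obtain ⟨f, g, hf, hg⟩ := hN s hs col
  obtain ⟨k, hk⟩ := exists_large_fiber (Finset.range (Fintype.card κ * n + 1)) g n
    (by simp) (by simp)
  obtain ⟨t, ht, htc⟩ := Finset.exists_subset_card_eq hk
  have hlt : ∀ i, t.orderEmbOfFin htc i < Fintype.card κ * n + 1 ∧ g (t.orderEmbOfFin htc i) = k := by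
    intro i
    simpa using ht (t.orderEmbOfFin_mem htc i)
  refine ⟨fun i => f (t.orderEmbOfFin htc i), k, fun i => hf _ (hlt i).1, ?_, ?_⟩
  · intro i j e
    by_contra hij
    rcases lt_or_gt_of_ne hij with h | h
    · exact (hg _ _ ((t.orderEmbOfFin htc).lt_iff_lt.2 h) (hlt j).1).1 e
    · exact (hg _ _ ((t.orderEmbOfFin htc).lt_iff_lt.2 h) (hlt i).1).1 e.symm
  · intro i j hij
    rw [(hg _ _ ((t.orderEmbOfFin htc).lt_iff_lt.2 hij) (hlt j).1).2, (hlt i).2]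

theorem not_cliqueFree_of_fin {V : Type*} {G : SimpleGraph V} {t : ℕ} (f : Fin t → V)
    (h : ∀ i j, i < j → G.Adj (f i) (f j)) : ¬ G.CliqueFree t := by
  classical
  have hadj : ∀ i j, i ≠ j → G.Adj (f i) (f j) := fun i j hij =>
    (lt_or_gt_of_ne hij).elim (h i j) fun h' => (h j i h').symm
  have hinj : Function.Injective f := fun i j e => by
    by_contra hij
    exact (hadj i j hij).ne e
  intro hf
  refine hf (Finset.univ.image f) ⟨?_, ?_⟩
  · intro x hx y hy hxy
    simp only [Finset.coe_image, Finset.coe_univ, Set.image_univ, Set.mem_range] at hx hy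
    obtain ⟨i, rfl⟩ := hx
    obtain ⟨j, rfl⟩ := hy
    exact hadj i j fun e => hxy (e ▸ rfl)
  · rw [Finset.card_image_of_injective _ hinj]; simp

theorem exists_stable_of_cliqueFree (t n : ℕ) :
    ∃ N : ℕ, ∀ {V : Type*} (G : SimpleGraph V), G.CliqueFree t → ∀ s : Finset V, N ≤ s.card →
      ∃ s' ⊆ s, s'.card = n ∧ ∀ x ∈ s', ∀ y ∈ s', ¬ G.Adj x y := by
  classical
  obtain ⟨N, hN⟩ := exists_ramsey Bool (max t n)
  refine ⟨N, fun G hG s hs => ?_⟩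
  obtain ⟨f, k, hf, hinj, hcol⟩ := hN s hs fun x y => decide (G.Adj x y)
  have hn : n ≤ max t n := le_max_right _ _
  have ht : t ≤ max t n := le_max_left _ _
  cases k with
  | true =>
    refine (not_cliqueFree_of_fin (G := G) (fun i : Fin t => f (Fin.castLE ht i)) ?_ hG).elim
    intro i j hij
    simpa using hcol (Fin.castLE ht i) (Fin.castLE ht j) (by simpa using hij)
  | false =>
    refine ⟨Finset.univ.image fun i : Fin n => f (Fin.castLE hn i), ?_, ?_, ?_⟩
    · intro x hx
      simp only [Finset.mem_image, Finset.mem_univ, true_and] at hx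
      obtain ⟨i, rfl⟩ := hx
      exact hf _
    · exact (Finset.card_image_of_injective _ (hinj.comp (Fin.castLE_injective hn))).trans (by simp)
    · intro x hx y hy hxy
      simp only [Finset.mem_image, Finset.mem_univ, true_and] at hx hy
      obtain ⟨i, rfl⟩ := hx
      obtain ⟨j, rfl⟩ := hy
      rcases lt_trichotomy i j with h | h | h
      · simpa [hxy] using hcol (Fin.castLE hn i) (Fin.castLE hn j) (by simpa using h)
      · subst h; exact hxy.ne rfl
      · simpa [hxy.symm] using hcol (Fin.castLE hn j) (Fin.castLE hn i) (by simpa using h)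

end SimpleGraph

/-! ### The setting around `a`, tridents, and paths with ends in `X`. -/

namespace SimpleGraph
variable {V : Type*} {G : SimpleGraph V}

/-- A (theta, prism, even wheel)-free graph with a vertex `a`, a stable set `X` of neighbours of `a`
that are not `d`-substantial, and a set `D` disjoint from `X` without neighbours of `a`. -/
structure Setting (G : SimpleGraph V) (d : ℕ) (a : V) (X D : Set V) : Prop where
  theta : ¬ G.HasTheta
  prism : ¬ G.HasPrism
  evenWheel : ¬ G.HasEvenWheel
  adj_a : ∀ x ∈ X, G.Adj a x
  not_adj_a : ∀ y ∈ D, ¬ G.Adj a y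
  a_notMem : a ∉ D
  stable : ∀ x ∈ X, ∀ y ∈ X, ¬ G.Adj x y
  disj : ∀ x ∈ X, x ∉ D
  not_subst : ∀ x ∈ X, ¬ G.IsSubstantial d x

/-- An induced path of length at least two with ends in `X` and interior in `D`. -/
structure XPath (G : SimpleGraph V) (X D : Set V) (u : ℕ → V) (n : ℕ) : Prop extends
    G.IndPath u n where
  two_le : 2 ≤ n
  left_mem : u 0 ∈ X
  right_mem : u n ∈ X
  mem : ∀ i, 0 < i → i < n → u i ∈ D

namespace Setting
variable {d : ℕ} {a : V} {X D : Set V}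

theorem a_notMem_X (h : Setting G d a X D) : a ∉ X := fun hx => (h.adj_a a hx).ne rfl

/-- Two separated connected subsets of `D` have at most one common neighbour in `X`. -/
theorem eq_of_touches (h : Setting G d a X D) {C₁ C₂ : Set V} (h1 : G.Conn C₁) (h2 : G.Conn C₂)
    (hD1 : C₁ ⊆ D) (hD2 : C₂ ⊆ D) (hs : G.Sep C₁ C₂) {x y : V} (hx : x ∈ X) (hy : y ∈ X)
    (hx1 : G.Touches x C₁) (hx2 : G.Touches x C₂) (hy1 : G.Touches y C₁) (hy2 : G.Touches y C₂) :
    x = y := by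
  by_contra hxy
  have hsep : ∀ C ⊆ D, G.Sep {a} C := fun C hC => sep_singleton_left.2
    ⟨fun e => h.a_notMem (hC e), fun ⟨c, hc, e⟩ => h.not_adj_a c (hC hc) e⟩
  have hnm : ∀ z ∈ X, z ∉ ({a} : Set V) ∧ z ∉ C₁ ∧ z ∉ C₂ := fun z hz =>
    ⟨fun e => h.a_notMem_X (e ▸ hz), fun e => h.disj z hz (hD1 e), fun e => h.disj z hz (hD2 e)⟩
  -- The theta has ends `x` and `y`, and its paths run through `a`, `C₁` and `C₂`.
  exact h.theta (hasTheta_of_conn' hxy (h.stable x hx y hy) (Conn.singleton a) h1 h2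
    (hsep _ hD1) (hsep _ hD2) hs (hnm x hx) (hnm y hy)
    ⟨touches_singleton.2 (h.adj_a x hx).symm, hx1, hx2⟩
    ⟨touches_singleton.2 (h.adj_a y hy).symm, hy1, hy2⟩)

/-- A vertex of `D` does not have three separated connections to `X`. -/
theorem not_trident (h : Setting G d a X D) {v : V} (hv : v ∈ D) {A B C : Set V}
    (hA : G.Conn A) (hB : G.Conn B) (hC : G.Conn C)
    (hAB : G.Sep A B) (hAC : G.Sep A C) (hBC : G.Sep B C)
    (sA : A ⊆ D ∪ X) (sB : B ⊆ D ∪ X) (sC : C ⊆ D ∪ X)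
    (nA : v ∉ A) (nB : v ∉ B) (nC : v ∉ C)
    (tA : G.Touches v A) (tB : G.Touches v B) (tC : G.Touches v C)
    (xA : (A ∩ X).Nonempty) (xB : (B ∩ X).Nonempty) (xC : (C ∩ X).Nonempty) : False := by
  have ha : a ∉ D ∪ X := fun e => e.elim h.a_notMem h.a_notMem_X
  have ht : ∀ C : Set V, (C ∩ X).Nonempty → G.Touches a C := fun C ⟨x, hx, hxX⟩ =>
    ⟨x, hx, h.adj_a x hxX⟩
  -- The theta has ends `v` and `a`; each of the three sets touches `a` at its vertex in `X`.
  exact h.theta (hasTheta_of_conn' (fun e : v = a => h.a_notMem (e ▸ hv))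
    (fun e => h.not_adj_a v hv e.symm) hA hB hC hAB hAC hBC ⟨nA, nB, nC⟩
    ⟨fun e => ha (sA e), fun e => ha (sB e), fun e => ha (sC e)⟩ ⟨tA, tB, tC⟩
    ⟨ht _ xA, ht _ xB, ht _ xC⟩)

theorem sep_singletons (h : Setting G d a X D) {x y : V} (hx : x ∈ X) (hy : y ∈ X) (hxy : x ≠ y) :
    G.Sep {x} {y} := sep_singleton_left.2 ⟨hxy, fun e => h.stable x hx y hy (touches_singleton.1 e)⟩

/-- The trident whose arms are the single vertices `x`, `y` and `z`. -/
theorem not_three_nbrs (h : Setting G d a X D) {v x y z : V} (hv : v ∈ D)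
    (hx : x ∈ X) (hy : y ∈ X) (hz : z ∈ X) (hxy : x ≠ y) (hxz : x ≠ z) (hyz : y ≠ z)
    (ax : G.Adj v x) (ay : G.Adj v y) (az : G.Adj v z) : False := by
  have hnm : ∀ w ∈ X, v ∉ ({w} : Set V) := fun w hw e => h.disj w hw ((show v = w from e) ▸ hv)
  have hs : ∀ w ∈ X, ({w} : Set V) ⊆ D ∪ X := fun w hw => by simp [hw]
  have ht : ∀ w ∈ X, (({w} : Set V) ∩ X).Nonempty := fun w hw => ⟨w, rfl, hw⟩
  exact h.not_trident hv (Conn.singleton x) (Conn.singleton y) (Conn.singleton z)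
    (h.sep_singletons hx hy hxy) (h.sep_singletons hx hz hxz) (h.sep_singletons hy hz hyz)
    (hs x hx) (hs y hy) (hs z hz) (hnm x hx) (hnm y hy) (hnm z hz)
    (touches_singleton.2 ax) (touches_singleton.2 ay) (touches_singleton.2 az)
    (ht x hx) (ht y hy) (ht z hz)

end Setting

namespace XPath
variable {d : ℕ} {a : V} {X D : Set V} {u : ℕ → V} {n : ℕ}

theorem mem_union (hu : G.XPath X D u n) {i : ℕ} (hi : i ≤ n) : u i ∈ D ∪ X := by
  rcases Nat.eq_zero_or_pos i with rfl | h0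
  · exact Or.inr hu.left_mem
  · rcases hi.eq_or_lt with rfl | h1
    · exact Or.inr hu.right_mem
    · exact Or.inl (hu.mem i h0 h1)

theorem ne_a (hu : G.XPath X D u n) (h : Setting G d a X D) {i : ℕ} (hi : i ≤ n) : u i ≠ a :=
  fun e => (hu.mem_union hi).elim (fun h' => h.a_notMem (e ▸ h')) fun h' => h.a_notMem_X (e ▸ h')

theorem adj_a (hu : G.XPath X D u n) (h : Setting G d a X D) {i : ℕ} (hi : i ≤ n) :
    G.Adj a (u i) ↔ i = 0 ∨ i = n := by
  constructor
  · intro e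
    by_contra hc
    exact h.not_adj_a _ (hu.mem i (by omega) (by omega)) e
  · rintro (rfl | rfl)
    · exact h.adj_a _ hu.left_mem
    · exact h.adj_a _ hu.right_mem

theorem reverse (hu : G.XPath X D u n) : G.XPath X D (fun k => u (n - k)) n where
  toIndPath := hu.toIndPath.reverse
  two_le := hu.two_le
  left_mem := hu.right_mem
  right_mem := by simpa using hu.left_mem
  mem i h0 h1 := hu.mem _ (by omega) (by omega)

/-- No vertex of `D` off the path has an even number, at least three, of neighbours on it. -/
theorem not_even_contacts (hu : G.XPath X D u n) (h : Setting G d a X D) {z : V} (hz : z ∈ D)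
    (hzu : ∀ i ≤ n, u i ≠ z) (s : Finset ℕ) (hs : ∀ i, i ∈ s ↔ i ≤ n ∧ G.Adj z (u i))
    (h3 : 3 ≤ s.card) (he : Even s.card) : False :=
  h.evenWheel (hu.hasEvenWheel hu.two_le (w := a) (z := z) (fun _ hi => hu.ne_a h hi)
    (fun _ hi => hu.adj_a h hi) hzu (fun e => h.a_notMem (e ▸ hz))
    (fun e => h.not_adj_a z hz e.symm) s hs h3 he)

/-- The path closes through `a` to a hole. Its two ends are non-neighbours of `x` by stability,
while `a` is a neighbour; so any neighbour of `x` on the path separates the ends among the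
non-neighbours, and `d + 1` of them would make `x` `d`-substantial. -/
theorem card_contacts_le (hu : G.XPath X D u n) (h : Setting G d a X D) {x : V} (hx : x ∈ X)
    (h0 : x ≠ u 0) (hn : x ≠ u n) (s : Finset ℕ) (hs : ∀ i ∈ s, i ≤ n ∧ G.Adj x (u i)) :
    s.card ≤ d := by
  by_contra hc
  have hzu : ∀ i ≤ n, u i ≠ x := by
    intro i hi e
    rcases Nat.eq_zero_or_pos i with rfl | h1
    · exact h0 e.symm
    · rcases hi.eq_or_lt with rfl | h2
      · exact hn e.symm
      · exact h.disj x hx (e ▸ hu.mem i h1 h2)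
  obtain ⟨i₀, hi₀⟩ := Finset.card_pos.1 (show 0 < s.card by omega)
  obtain ⟨hi₀n, hi₀x⟩ := hs i₀ hi₀
  have hne0 : i₀ ≠ 0 := fun e => h.stable x hx _ hu.left_mem (e ▸ hi₀x)
  have hnen : i₀ ≠ n := fun e => h.stable x hx _ hu.right_mem (e ▸ hi₀x)
  refine h.not_subst x hx ⟨_, hu.isHole hu.two_le (w := a) (fun _ hi => hu.ne_a h hi)
    (fun _ hi => hu.adj_a h hi), ?_, ?_, ?_⟩
  · rintro (rfl | ⟨k, -, hk, e⟩)
    · exact h.a_notMem_X hx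
    · exact hzu k hk e
  · have hsub : insert a (u '' (s : Set ℕ)) ⊆ insert a (seg u 0 n) ∩ G.neighborSet x := by
      rintro y (rfl | ⟨i, hi, rfl⟩)
      · exact ⟨Or.inl rfl, (h.adj_a x hx).symm⟩
      · exact ⟨Or.inr ⟨i, by omega, (hs i hi).1, rfl⟩, (hs i hi).2⟩
    have hfin : (insert a (seg u 0 n) ∩ G.neighborSet x).Finite := by
      refine Set.Finite.inter_of_left (Set.Finite.insert a ?_) _
      refine ((Finset.range (n + 1)).finite_toSet.image u).subset ?_
      rintro y ⟨k, -, hk, rfl⟩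
      exact ⟨k, by simpa using Nat.lt_succ_of_le hk, rfl⟩
    have hinj : Set.InjOn u (s : Set ℕ) := fun i hi j hj e =>
      hu.inj i (hs i hi).1 j (hs j hj).1 e
    calc d + 1 ≤ s.card := by omega
      _ = (u '' (s : Set ℕ)).ncard := by rw [hinj.ncard_image, Set.ncard_coe_finset]
      _ ≤ _ := Set.ncard_le_ncard ((Set.subset_insert _ _).trans hsub) hfin
  · intro hpre
    set W := insert a (seg u 0 n) \ G.neighborSet x with hW
    have m0 : u 0 ∈ W := ⟨Or.inr (mem_seg_of (by omega) (by omega)), fun e =>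
      h.stable x hx _ hu.left_mem e⟩
    have mn : u n ∈ W := ⟨Or.inr (mem_seg_of (by omega) (by omega)), fun e =>
      h.stable x hx _ hu.right_mem e⟩
    have hreach := hpre ⟨u 0, m0⟩ ⟨u n, mn⟩
    -- A walk in the non-neighbours of `x` that starts before `u i₀` stays before it, as it can use
    -- neither `a` nor `u i₀`.
    have key : ∀ (p q : W), (G.induce W).Walk p q → (∃ k < i₀, u k = p) → ∃ k < i₀, u k = q := by
      intro p q w
      induction w with
      | nil => exact id
      | cons hadj _ ih =>
        rename_i p r q _
        rintro ⟨k, hk, hkp⟩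
        refine ih ?_
        have hadj' : G.Adj (p : V) r := hadj
        obtain ⟨hr | ⟨l, -, hl, hlr⟩, hrx⟩ := r.2
        · exact (hrx (hr ▸ (h.adj_a x hx).symm)).elim
        · refine ⟨l, ?_, hlr⟩
          rw [← hlr] at hrx
          have hl0 : l ≠ i₀ := fun e => hrx (e ▸ hi₀x)
          rw [← hkp, ← hlr, hu.adj k (by omega) l hl] at hadj'
          omega
    obtain ⟨w⟩ := hreach
    obtain ⟨k, hk, e⟩ := key _ _ w ⟨0, by omega, rfl⟩
    have := hu.inj k (by omega) n le_rfl e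
    omega

end XPath
end SimpleGraph

/-! ### Bypasses of a connected set attached to a path. -/

namespace SimpleGraph
variable {V : Type*} {G : SimpleGraph V}

/-- The vertices `u k` with `i ≤ k < j`. -/
def ico (u : ℕ → V) (i j : ℕ) : Set V := {v | ∃ k, i ≤ k ∧ k < j ∧ u k = v}

theorem mem_ico {u : ℕ → V} {i j : ℕ} {v : V} : v ∈ ico u i j ↔ ∃ k, i ≤ k ∧ k < j ∧ u k = v :=
  Iff.rfl

theorem mem_ico_of {u : ℕ → V} {i j k : ℕ} (h1 : i ≤ k) (h2 : k < j) : u k ∈ ico u i j :=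
  ⟨k, h1, h2, rfl⟩

theorem ico_subset {u : ℕ → V} {i j : ℕ} {S : Set V} (h : ∀ k, i ≤ k → k < j → u k ∈ S) :
    ico u i j ⊆ S := by
  rintro _ ⟨k, h1, h2, rfl⟩; exact h k h1 h2

theorem ico_empty {u : ℕ → V} {i j : ℕ} (h : j ≤ i) : ico u i j = ∅ := by
  ext; simp only [mem_ico, Set.mem_empty_iff_false, iff_false]; rintro ⟨k, h1, h2, -⟩; omega

theorem sep_ico {u v : ℕ → V} {i j k l : ℕ}
    (h : ∀ p, i ≤ p → p < j → ∀ q, k ≤ q → q < l → u p ≠ v q ∧ ¬ G.Adj (u p) (v q)) :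
    G.Sep (ico u i j) (ico v k l) := by
  rintro _ ⟨p, h1, h2, rfl⟩ _ ⟨q, h3, h4, rfl⟩; exact h p h1 h2 q h3 h4

theorem sep_ico_left {u : ℕ → V} {i j : ℕ} {T : Set V}
    (h : ∀ p, i ≤ p → p < j → u p ∉ T ∧ ¬ G.Touches (u p) T) :
    G.Sep (ico u i j) T := by
  rintro _ ⟨p, h1, h2, rfl⟩ y hy
  exact ⟨fun e => (h p h1 h2).1 (e ▸ hy), fun e => (h p h1 h2).2 ⟨y, hy, e⟩⟩

theorem Sep.notMem {A B : Set V} (h : G.Sep A B) {x : V} (hx : x ∈ A) : x ∉ B :=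
  fun hx' => (h x hx x hx').1 rfl

theorem Sep.not_touches {A B : Set V} (h : G.Sep A B) {x : V} (hx : x ∈ A) : ¬ G.Touches x B :=
  fun ⟨y, hy, e⟩ => (h x hx y hy).2 e

namespace IndPath
variable {u v : ℕ → V} {n m : ℕ}

theorem conn_ico (h : G.IndPath u n) {i j : ℕ} (hij : i < j) (hj : j ≤ n + 1) :
    G.Conn (ico u i j) := by
  have : ico u i j = seg u i (j - 1) := by
    ext x; simp only [mem_ico, mem_seg]
    exact ⟨fun ⟨k, h1, h2, h3⟩ => ⟨k, h1, by omega, h3⟩, fun ⟨k, h1, h2, h3⟩ =>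
      ⟨k, h1, by omega, h3⟩⟩
  rw [this]; exact h.conn_seg (by omega) (by omega)

theorem sep_ico (h : G.IndPath u n) {i j k l : ℕ} (hjk : j + 1 ≤ k) (hl : l ≤ n + 1) :
    G.Sep (ico u i j) (ico u k l) :=
  SimpleGraph.sep_ico fun p _ hp q hq hq' => ⟨h.ne (by omega) (by omega) (by omega), fun e => by
    rw [h.adj _ (by omega) _ (by omega)] at e; omega⟩

theorem notMem_ico (h : G.IndPath u n) {i j k : ℕ} (hk : k ≤ n) (hj : j ≤ n + 1)
    (hkij : k < i ∨ j ≤ k) : u k ∉ ico u i j := by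
  rintro ⟨l, h1, h2, e⟩
  have := h.inj l (by omega) k hk e
  omega

/-- The final segment of a path together with a connected set touched by its last vertex. -/
theorem conn_tail (h : G.IndPath u n) {B : Set V} (hB : G.Conn B) {i j : ℕ} (hj : j ≤ n)
    (ht : G.Touches (u j) B) (hi : i ≤ j + 1) : G.Conn (ico u i (j + 1) ∪ B) := by
  rcases hi.eq_or_lt with rfl | hi
  · rwa [ico_empty le_rfl, Set.empty_union]
  · obtain ⟨b, hb, hjb⟩ := ht
    exact (h.conn_ico hi (by omega)).union_adj hB (mem_ico_of (by omega) (by omega)) hb hjb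

theorem touches_tail (h : G.IndPath u n) {B : Set V} {i j : ℕ} (hj : j ≤ n)
    (ht : G.Touches (u j) B) (hi : i ≤ j) : G.Touches (u i) (ico u (i + 1) (j + 1) ∪ B) := by
  rcases hi.eq_or_lt with rfl | hi
  · exact ht.mono Set.subset_union_right
  · exact ⟨u (i + 1), Or.inl (mem_ico_of le_rfl (by omega)), h.adj_succ (by omega)⟩

/-- The initial segment of a path together with a connected set touched by its first vertex. -/
theorem conn_head (h : G.IndPath u n) {B : Set V} (hB : G.Conn B) {i j : ℕ} (hj : j ≤ n + 1)
    (ht : G.Touches (u i) B) : G.Conn (ico u i j ∪ B) := by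
  by_cases hij : j ≤ i
  · rwa [ico_empty hij, Set.empty_union]
  · obtain ⟨b, hb, hjb⟩ := ht
    exact (h.conn_ico (not_le.1 hij) hj).union_adj hB (mem_ico_of le_rfl (by omega)) hb hjb

theorem touches_head (h : G.IndPath u n) {B : Set V} {i j : ℕ} (hj : j ≤ n)
    (ht : G.Touches (u i) B) (hi : i ≤ j) : G.Touches (u j) (ico u i j ∪ B) := by
  rcases hi.eq_or_lt with rfl | hi
  · exact ht.mono Set.subset_union_right
  · refine ⟨u (j - 1), Or.inl (mem_ico_of (by omega) (by omega)), ?_⟩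
    rw [h.adj _ hj _ (by omega)]; omega

end IndPath

theorem XPath.ico_sub {X D : Set V} {u : ℕ → V} {n i j : ℕ} (h : G.XPath X D u n)
    (hj : j ≤ n + 1) : ico u i j ⊆ D ∪ X := ico_subset fun _ _ _ => h.mem_union (by omega)

/-- A path `f 0, …, f m` linking the parts of `u` before and after its contacts with `T`. -/
structure Bypass (G : SimpleGraph V) (X D : Set V) (u : ℕ → V) (n : ℕ) (T : Set V) (i j : ℕ)
    (f : ℕ → V) (m : ℕ) : Prop where
  path : G.XPath X D u n
  conn : G.Conn T
  sub : T ⊆ D ∪ X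
  meet : (T ∩ X).Nonempty
  notMem : ∀ k ≤ n, u k ∉ T
  two_le : 2 ≤ i
  lt : i < j
  add_two_le : j + 2 ≤ n
  touch_left : G.Touches (u i) T
  touch_right : G.Touches (u j) T
  touch : ∀ k ≤ n, G.Touches (u k) T → i ≤ k ∧ k ≤ j
  fpath : G.IndPath f m
  f_mem : ∀ g ≤ m, f g ∈ D
  f_notMem : ∀ g ≤ m, f g ∉ T
  f_touch : ∀ g ≤ m, ¬ G.Touches (f g) T
  f_ne : ∀ g ≤ m, ∀ k ≤ n, k ≤ i ∨ j ≤ k → u k ≠ f g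
  f_left : ∀ g ≤ m, ∀ k < i, G.Adj (u k) (f g) → 0 < k ∧ g = 0
  f_right : ∀ g ≤ m, ∀ k ≤ n, j < k → G.Adj (u k) (f g) → k < n ∧ g = m
  ex_left : ∃ k < i, G.Adj (u k) (f 0)
  ex_right : ∃ k ≤ n, j < k ∧ G.Adj (u k) (f m)

namespace Bypass
variable {d : ℕ} {a : V} {X D : Set V} {u : ℕ → V} {n : ℕ} {T : Set V} {i j : ℕ} {f : ℕ → V}
  {m : ℕ}

/-- Reversing both paths exchanges the two ends of the bypass, so that facts about the left end
carry over to the right one. -/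
theorem mirror (b : Bypass G X D u n T i j f m) :
    Bypass G X D (fun k => u (n - k)) n T (n - j) (n - i) (fun k => f (m - k)) m where
  path := b.path.reverse
  conn := b.conn
  sub := b.sub
  meet := b.meet
  notMem k hk := b.notMem _ (by omega)
  two_le := by have := b.add_two_le; omega
  lt := by have := b.add_two_le; have := b.lt; omega
  add_two_le := by have := b.add_two_le; have := b.two_le; have := b.lt; omega
  touch_left := by
    have := b.add_two_le
    simpa [show n - (n - j) = j by omega] using b.touch_right
  touch_right := by
    have := b.add_two_le; have := b.lt
    simpa [show n - (n - i) = i by omega] using b.touch_left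
  touch k hk h := by have := b.touch _ (by omega) h; omega
  fpath := b.fpath.reverse
  f_mem g hg := b.f_mem _ (by omega)
  f_notMem g hg := b.f_notMem _ (by omega)
  f_touch g hg := b.f_touch _ (by omega)
  f_ne g hg k hk h := b.f_ne _ (by omega) _ (by omega) (by
    have := b.add_two_le; have := b.lt; omega)
  f_left g hg k hk h := by
    have := b.f_right _ (by omega) _ (by omega) (by omega) h; omega
  f_right g hg k hk hk' h := by
    have := b.lt; have := b.add_two_le
    have := b.f_left _ (by omega) _ (by omega) h; omega
  ex_left := by
    obtain ⟨k, hk, hjk, h⟩ := b.ex_right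
    exact ⟨n - k, by omega, by simpa [show n - (n - k) = k by omega] using h⟩
  ex_right := by
    have := b.lt; have := b.add_two_le
    obtain ⟨k, hk, h⟩ := b.ex_left
    exact ⟨n - k, by omega, by omega, by simpa [show n - (n - k) = k by omega] using h⟩

theorem sep_T (b : Bypass G X D u n T i j f m) {k l : ℕ} (hl : l ≤ n + 1) (h : l ≤ i ∨ j < k) :
    G.Sep (ico u k l) T :=
  sep_ico_left fun p hp hp' => ⟨b.notMem p (by omega), fun e => by
    have := b.touch p (by omega) e; omega⟩

theorem sep_fT (b : Bypass G X D u n T i j f m) {k l : ℕ} (hl : l ≤ m + 1) :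
    G.Sep (ico f k l) T :=
  sep_ico_left fun p hp hp' => ⟨b.f_notMem p (by omega), b.f_touch p (by omega)⟩

theorem u_mem (b : Bypass G X D u n T i j f m) {k : ℕ} (h0 : 0 < k) (hn : k < n) : u k ∈ D :=
  b.path.mem k h0 hn

theorem f_sub (b : Bypass G X D u n T i j f m) {k l : ℕ} (hl : l ≤ m + 1) :
    ico f k l ⊆ D ∪ X := ico_subset fun p _ _ => Or.inl (b.f_mem p (by omega))

theorem touches_right (b : Bypass G X D u n T i j f m) :
    G.Touches (f m) (ico u (j + 1) (n + 1)) := by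
  obtain ⟨k, hk, hjk, h⟩ := b.ex_right
  exact ⟨_, mem_ico_of hjk (by omega), h.symm⟩

/-- Three separated targets in `X` are available: `u 0`, a vertex of `T` reached through `u i`, and
`u n` reached along the bypass. Consider the last vertex `f g` with neighbours among `u 0, …, u i`,
and let `lo` and `hi` be the first and last of these. If `lo = hi` there is a trident at `u lo`, and
if they differ by more than one there is a trident at `f g`. So they are consecutive, and then a
contact before `i` forces `g = 0`. -/
theorem exists_left (b : Bypass G X D u n T i j f m) (hS : Setting G d a X D) :
    ∃ c, 1 ≤ c ∧ c + 1 ≤ i ∧ ∀ g ≤ m, ∀ k ≤ i, (G.Adj (u k) (f g) ↔ g = 0 ∧ (k = c ∨ k = c + 1)) := by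
  classical
  have hi2 := b.two_le
  have hij := b.lt
  have hjn := b.add_two_le
  have hpos : ∀ g ≤ m, ∀ k ≤ i, G.Adj (u k) (f g) → 1 ≤ k := by
    intro g hg k hk h
    by_contra h0
    have := b.f_left g hg k (by omega) h
    omega
  -- the last vertex of the bypass with a contact up to `i`
  let P : ℕ → Prop := fun g => g ≤ m ∧ ∃ k ≤ i, G.Adj (u k) (f g)
  have hP0 : P 0 := by
    obtain ⟨k, hk, h⟩ := b.ex_left
    exact ⟨by omega, k, hk.le, h⟩
  obtain ⟨hgm, hgex⟩ : P (Nat.findGreatest P m) := Nat.findGreatest_spec (Nat.zero_le _) hP0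
  have hgmax : ∀ g ≤ m, ∀ k ≤ i, G.Adj (u k) (f g) → g ≤ Nat.findGreatest P m :=
    fun g hg k hk h => Nat.le_findGreatest hg ⟨hg, k, hk, h⟩
  set g := Nat.findGreatest P m
  have hlo := Nat.find_spec hgex
  have hlomin : ∀ k ≤ i, G.Adj (u k) (f g) → Nat.find hgex ≤ k := fun k hk h =>
    Nat.find_min' hgex ⟨hk, h⟩
  set lo := Nat.find hgex
  have hhi : lo ≤ i ∧ G.Adj (u lo) (f g) := hlo
  have hhi' := Nat.findGreatest_spec (P := fun k => G.Adj (u k) (f g)) hlo.1 hlo.2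
  have hhile := Nat.findGreatest_le (P := fun k => G.Adj (u k) (f g)) i
  have hhimax : ∀ k ≤ i, G.Adj (u k) (f g) → k ≤ Nat.findGreatest (fun k => G.Adj (u k) (f g)) i :=
    fun k hk h => Nat.le_findGreatest (P := fun k => G.Adj (u k) (f g)) hk h
  set hi := Nat.findGreatest (fun k => G.Adj (u k) (f g)) i
  have hlohi : lo ≤ hi := hhimax lo hlo.1 hlo.2
  have hlo1 : 1 ≤ lo := hpos g hgm lo hlo.1 hlo.2
  have hB : G.Conn (ico u (j + 1) (n + 1)) := b.path.conn_ico (by omega) le_rfl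
  have sepf : ∀ p q, q ≤ i + 1 → ∀ l, g < l → G.Sep (ico u p q) (ico f l (m + 1)) := by
    intro p q hq l hl
    refine sep_ico fun k hk hk' e he he' => ⟨b.f_ne e (by omega) k (by omega) (by omega), ?_⟩
    intro h
    have := hgmax e (by omega) k (by omega) h
    omega
  have hTB : G.Sep T (ico u (j + 1) (n + 1)) := (b.sep_T le_rfl (by omega)).symm
  have xT : ∀ A : Set V, ((A ∪ T) ∩ X).Nonempty := fun A =>
    b.meet.mono (Set.inter_subset_inter_left _ Set.subset_union_right)
  have xn : ∀ A : Set V, ((A ∪ ico u (j + 1) (n + 1)) ∩ X).Nonempty := fun A =>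
    ⟨u n, Or.inr (mem_ico_of (by omega) (by omega)), b.path.right_mem⟩
  have x0 : ∀ l, 0 < l → (ico u 0 l ∩ X).Nonempty := fun l hl =>
    ⟨u 0, mem_ico_of le_rfl hl, b.path.left_mem⟩
  rcases Nat.lt_or_ge lo hi with hlt | hge
  · by_cases hadj : hi = lo + 1
    · have hg0 : g = 0 := (b.f_left g hgm lo (by omega) hlo.2).2
      refine ⟨lo, hlo1, by omega, fun e he k hk => ⟨fun h => ?_, ?_⟩⟩
      · have he0 : e = 0 := by have := hgmax e he k hk h; omega
        have h' : G.Adj (u k) (f g) := by rwa [hg0, ← he0]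
        have h1 := hlomin k hk h'
        have h2 := hhimax k hk h'
        exact ⟨he0, by omega⟩
      · rintro ⟨rfl, rfl | rfl⟩
        · rw [← hg0]; exact hlo.2
        · rw [← hg0, ← hadj]; exact hhi'
    · exfalso
      refine hS.not_trident (b.f_mem g hgm) (A := ico u 0 (lo + 1)) (B := ico u hi (i + 1) ∪ T)
        (C := ico f (g + 1) (m + 1) ∪ ico u (j + 1) (n + 1)) ?_ ?_ ?_ ?_ ?_ ?_ ?_ ?_ ?_ ?_ ?_ ?_
        ?_ ?_ ?_ (x0 _ (by omega)) (xT _) (xn _)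
      · exact b.path.conn_ico (by omega) (by omega)
      · exact b.path.conn_tail b.conn (by omega) b.touch_left (by omega)
      · exact b.fpath.conn_tail hB le_rfl b.touches_right (by omega)
      · exact sep_union_right.2 ⟨b.path.toIndPath.sep_ico (by omega) (by omega),
          b.sep_T (by omega) (by omega)⟩
      · exact sep_union_right.2 ⟨sepf _ _ (by omega) _ (by omega),
          b.path.toIndPath.sep_ico (by omega) (by omega)⟩
      · exact sep_union_left.2 ⟨sep_union_right.2 ⟨sepf _ _ (by omega) _ (by omega),
          b.path.toIndPath.sep_ico (by omega) (by omega)⟩,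
          sep_union_right.2 ⟨(b.sep_fT le_rfl).symm, hTB⟩⟩
      · exact b.path.ico_sub (by omega)
      · exact Set.union_subset (b.path.ico_sub (by omega)) b.sub
      · exact Set.union_subset (b.f_sub (by omega)) (b.path.ico_sub (by omega))
      · rintro ⟨k, -, hk, e⟩
        exact b.f_ne g hgm k (by omega) (by omega) e
      · rintro (⟨k, -, hk, e⟩ | e)
        · exact b.f_ne g hgm k (by omega) (by omega) e
        · exact b.f_notMem g hgm e
      · rintro (e | ⟨k, hk, hk', e⟩)
        · exact b.fpath.notMem_ico hgm le_rfl (by omega) e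
        · exact b.f_ne g hgm k (by omega) (by omega) e
      · exact ⟨_, mem_ico_of (Nat.zero_le lo) (by omega), hlo.2.symm⟩
      · exact ⟨_, Or.inl (mem_ico_of (le_refl hi) (by omega)), hhi'.symm⟩
      · exact b.fpath.touches_tail le_rfl b.touches_right hgm
  · exfalso
    have hlh : hi = lo := le_antisymm hge hlohi
    have sepf' : ∀ p q, q ≤ i + 1 → (q ≤ lo ∨ lo < p) →
        G.Sep (ico u p q) (ico f g (m + 1)) := by
      intro p q hq hpq
      refine sep_ico fun k hk hk' e he he' => ⟨b.f_ne e (by omega) k (by omega) (by omega), ?_⟩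
      intro h
      have hge := hgmax e (by omega) k (by omega) h
      obtain rfl : e = g := by omega
      have h1 := hlomin k (by omega) h
      have h2 := hhimax k (by omega) h
      omega
    refine hS.not_trident (b.u_mem (k := lo) (by omega) (by omega)) (A := ico u 0 lo)
        (B := ico u (lo + 1) (i + 1) ∪ T)
        (C := ico f g (m + 1) ∪ ico u (j + 1) (n + 1)) ?_ ?_ ?_ ?_ ?_ ?_ ?_ ?_ ?_ ?_ ?_ ?_
        ?_ ?_ ?_ (x0 _ (by omega)) (xT _) (xn _)
    · exact b.path.conn_ico (by omega) (by omega)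
    · exact b.path.conn_tail b.conn (by omega) b.touch_left (by omega)
    · exact b.fpath.conn_tail hB le_rfl b.touches_right (by omega)
    · exact sep_union_right.2 ⟨b.path.toIndPath.sep_ico (by omega) (by omega),
        b.sep_T (by omega) (by omega)⟩
    · exact sep_union_right.2 ⟨sepf' _ _ (by omega) (by omega),
        b.path.toIndPath.sep_ico (by omega) (by omega)⟩
    · exact sep_union_left.2 ⟨sep_union_right.2 ⟨sepf' _ _ (by omega) (by omega),
        b.path.toIndPath.sep_ico (by omega) (by omega)⟩,
        sep_union_right.2 ⟨(b.sep_fT le_rfl).symm, hTB⟩⟩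
    · exact b.path.ico_sub (by omega)
    · exact Set.union_subset (b.path.ico_sub (by omega)) b.sub
    · exact Set.union_subset (b.f_sub (by omega)) (b.path.ico_sub (by omega))
    · exact b.path.notMem_ico (by omega) (by omega) (by omega)
    · rintro (e | e)
      · exact b.path.notMem_ico (by omega) (by omega) (by omega) e
      · exact b.notMem lo (by omega) e
    · rintro (⟨k, hk, hk', e⟩ | e)
      · exact b.f_ne k (by omega) lo (by omega) (by omega) e.symm
      · exact b.path.notMem_ico (by omega) (by omega) (by omega) e
    · refine ⟨u (lo - 1), mem_ico_of (by omega) (by omega), ?_⟩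
      rw [b.path.adj _ (by omega) _ (by omega)]; omega
    · exact b.path.touches_tail (by omega) b.touch_left (by omega)
    · exact ⟨_, Or.inl (mem_ico_of (le_refl g) (by omega)), hlo.2⟩

theorem exists_right (b : Bypass G X D u n T i j f m) (hS : Setting G d a X D) :
    ∃ h, j + 1 ≤ h ∧ h < n ∧
      ∀ g ≤ m, ∀ k ≤ n, j ≤ k → (G.Adj (u k) (f g) ↔ g = m ∧ (k = h - 1 ∨ k = h)) := by
  have hij := b.lt
  have hjn := b.add_two_le
  obtain ⟨c, h1, h2, h3⟩ := b.mirror.exists_left hS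
  refine ⟨n - c, by omega, by omega, fun g hg k hk hjk => ?_⟩
  have := h3 (m - g) (by omega) (n - k) (by omega)
  rw [show n - (n - k) = k by omega, show m - (m - g) = g by omega] at this
  rw [this]
  omega

/-- A bypass without contacts strictly between `i` and `j` is impossible. -/
theorem false_of_no_mid (b : Bypass G X D u n T i j f m) (hS : Setting G d a X D)
    (hmid : ∀ g ≤ m, ∀ k, i < k → k < j → ¬ G.Adj (u k) (f g)) : False := by
  have hi2 := b.two_le
  have hij := b.lt
  have hjn := b.add_two_le
  obtain ⟨c, hc1, hci, hc⟩ := b.exists_left hS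
  obtain ⟨h, hjh, hhn, hh⟩ := b.exists_right hS
  -- If a vertex strictly between `u i` and `u j` lay on the bypass, its predecessor would be a
  -- contact in a forbidden place.
  have hne : ∀ g ≤ m, ∀ k ≤ n, u k ≠ f g := by
    intro g hg k hk e
    by_cases hk' : k ≤ i ∨ j ≤ k
    · exact b.f_ne g hg k hk hk' e
    · have hadj : G.Adj (u (k - 1)) (f g) := by
        rw [← e, b.path.adj _ (by omega) _ (by omega)]; omega
      by_cases hk1 : k - 1 = i
      · obtain ⟨rfl, -⟩ := (hc g hg (k - 1) (by omega)).1 hadj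
        have := (hc 0 (by omega) c (by omega)).2 ⟨rfl, Or.inl rfl⟩
        rw [← e, b.path.adj _ (by omega) _ (by omega)] at this
        omega
      · exact hmid g hg (k - 1) (by omega) (by omega) hadj
  have hadj : ∀ g ≤ m, ∀ k ≤ n, (G.Adj (u k) (f g) ↔
      (g = 0 ∧ (k = c ∨ k = c + 1)) ∨ (g = m ∧ (k = h - 1 ∨ k = h))) := by
    intro g hg k hk
    rcases Nat.lt_or_ge i k with h1 | h1
    · rcases Nat.lt_or_ge k j with h2 | h2
      · exact iff_of_false (hmid g hg k h1 h2) (by omega)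
      · rw [hh g hg k hk h2]; omega
    · rw [hc g hg k h1]; omega
  -- A bypass of one vertex has exactly four neighbours on the path, two consecutive pairs, which is
  -- an even wheel. A longer one forms a prism with the part of `u` between the two pairs and the
  -- rest of the hole through `a`.
  rcases Nat.eq_zero_or_pos m with rfl | hm
  · refine b.path.not_even_contacts hS (b.f_mem 0 le_rfl) (hne 0 le_rfl) {c, c + 1, h - 1, h}
      (fun k => ?_) ?_ ?_
    · simp only [Finset.mem_insert, Finset.mem_singleton]
      constructor
      · intro hk
        exact ⟨by omega, ((hadj 0 le_rfl k (by omega)).2 (by omega)).symm⟩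
      · rintro ⟨hk, h'⟩
        have := (hadj 0 le_rfl k hk).1 h'.symm
        omega
    all_goals
      rw [Finset.card_insert_of_notMem, Finset.card_insert_of_notMem,
        Finset.card_insert_of_notMem, Finset.card_singleton]
      all_goals first | decide | (simp only [Finset.mem_insert, Finset.mem_singleton]; omega)
  · have hac : ∀ l, G.Sep {a} (ico f l (m + 1)) := fun l => sep_singleton_left.2
      ⟨fun ⟨k, _, hk, e⟩ => hS.a_notMem (e ▸ b.f_mem k (by omega)),
        fun ⟨_, ⟨k, _, hk, e⟩, h⟩ => hS.not_adj_a _ (b.f_mem k (by omega)) (e ▸ h)⟩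
    have ha0 : G.Touches a (ico u 0 (c + 1)) :=
      ⟨_, mem_ico_of le_rfl (by omega), hS.adj_a _ b.path.left_mem⟩
    have han : G.Adj a (u n) := hS.adj_a _ b.path.right_mem
    refine hS.prism (hasPrism_of_conn' (a1 := u (c + 1)) (a2 := f 0) (a3 := u c)
      (b1 := u (h - 1)) (b2 := f m) (b3 := u h) (A := ico u (c + 1) h) (B := ico f 0 (m + 1))
      (C := insert a (ico u 0 (c + 1)) ∪ ico u h (n + 1)) ?_ ?_ ?_ ?_ ?_ ?_ ?_ ?_ ?_ ?_ ?_ ?_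
      ?_ ?_ ?_ ?_ ?_ ?_ ?_ ?_ ?_)
    · exact (hadj 0 (by omega) _ (by omega)).2 (by omega)
    · exact (b.path.adj_succ (by omega)).symm
    · exact ((hadj 0 (by omega) _ (by omega)).2 (by omega)).symm
    · exact (hadj m (by omega) _ (by omega)).2 (by omega)
    · rw [b.path.adj _ (by omega) _ (by omega)]; omega
    · exact ((hadj m (by omega) _ (by omega)).2 (by omega)).symm
    · exact b.path.ne (by omega) (by omega) (by omega)
    · exact b.fpath.ne (by omega) (by omega) (by omega)
    · exact b.path.ne (by omega) (by omega) (by omega)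
    · exact b.path.conn_ico (by omega) (by omega)
    · exact b.fpath.conn_ico (by omega) (by omega)
    · exact ((b.path.conn_ico (by omega) (by omega)).insert ha0).union_adj
        (b.path.conn_ico (by omega) (by omega)) (Or.inl rfl) (mem_ico_of (k := n) (by omega)
        (by omega)) han
    · exact mem_ico_of (by omega) (by omega)
    · exact mem_ico_of (by omega) (by omega)
    · exact mem_ico_of (by omega) (by omega)
    · exact mem_ico_of (by omega) (by omega)
    · exact Or.inl (Or.inr (mem_ico_of (by omega) (by omega)))
    · exact Or.inr (mem_ico_of (by omega) (by omega))
    · rintro _ ⟨k, hk, hk', rfl⟩ _ ⟨g, hg, hg', rfl⟩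
      refine ⟨hne g (by omega) k (by omega), fun e => ?_⟩
      rcases (hadj g (by omega) k (by omega)).1 e with ⟨rfl, h1 | h1⟩ | ⟨rfl, h1 | h1⟩
      · omega
      · exact Or.inl ⟨h1 ▸ rfl, rfl⟩
      · exact Or.inr ⟨h1 ▸ rfl, rfl⟩
      · omega
    · rintro _ ⟨k, hk, hk', rfl⟩ _ ((rfl | ⟨l, hl, hl', rfl⟩) | ⟨l, hl, hl', rfl⟩)
      · refine ⟨b.path.ne_a hS (by omega), fun e => ?_⟩
        have := (b.path.adj_a hS (by omega)).1 e.symm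
        omega
      · refine ⟨b.path.ne (by omega) (by omega) (by omega), fun e => Or.inl ?_⟩
        rw [b.path.adj _ (by omega) _ (by omega)] at e
        exact ⟨congrArg u (by omega), congrArg u (by omega)⟩
      · refine ⟨b.path.ne (by omega) (by omega) (by omega), fun e => Or.inr ?_⟩
        rw [b.path.adj _ (by omega) _ (by omega)] at e
        exact ⟨congrArg u (by omega), congrArg u (by omega)⟩
    · rintro _ ⟨g, hg, hg', rfl⟩ _ ((rfl | ⟨l, hl, hl', rfl⟩) | ⟨l, hl, hl', rfl⟩)
      · have := hac 0 _ rfl _ (mem_ico_of hg hg')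
        exact ⟨this.1.symm, fun e => (this.2 e.symm).elim⟩
      · refine ⟨(hne g (by omega) l (by omega)).symm, fun e => Or.inl ?_⟩
        have := (hadj g (by omega) l (by omega)).1 e.symm
        exact ⟨congrArg f (by omega), congrArg u (by omega)⟩
      · refine ⟨(hne g (by omega) l (by omega)).symm, fun e => Or.inr ?_⟩
        have := (hadj g (by omega) l (by omega)).1 e.symm
        exact ⟨congrArg f (by omega), congrArg u (by omega)⟩

/-- Nothing lies strictly between two consecutive contacts. This form serves the intervals of length
one and the legs. -/
theorem false_of_pair (b : Bypass G X D u n T i j f m) (hS : Setting G d a X D)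
    (hij : j = i + 1) : False :=
  b.false_of_no_mid hS fun _ _ _ _ _ => by omega

end Bypass
end SimpleGraph

/-! ### Bypasses of a single vertex of `X`: the first contact in the middle. -/

namespace SimpleGraph
variable {V : Type*} {G : SimpleGraph V}

namespace Bypass
variable {d : ℕ} {a : V} {X D : Set V} {u : ℕ → V} {n : ℕ} {x : V} {i j : ℕ} {f : ℕ → V}
  {m : ℕ}

theorem adj_left (b : Bypass G X D u n {x} i j f m) : G.Adj (u i) x :=
  touches_singleton.1 b.touch_left

theorem adj_le (b : Bypass G X D u n {x} i j f m) {k : ℕ} (hk : k ≤ n) (h : G.Adj (u k) x) :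
    i ≤ k ∧ k ≤ j := b.touch k hk (touches_singleton.2 h)

theorem mem_x (b : Bypass G X D u n {x} i j f m) : x ∈ X := by
  obtain ⟨y, rfl, hy⟩ := b.meet; exact hy

theorem sep_ux (b : Bypass G X D u n {x} i j f m) {k l : ℕ} (hl : l ≤ n + 1)
    (h : ∀ p, k ≤ p → p < l → ¬ G.Adj (u p) x) : G.Sep (ico u k l) {x} :=
  sep_ico_left fun p hp hp' => ⟨b.notMem p (by omega), fun e =>
    h p hp hp' (touches_singleton.1 e)⟩

/-- Let `u μ` be the first middle vertex with a neighbour on the bypass. Tridents, a prism and even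
wheels successively determine the picture near the left end: the consecutive pair of contacts of `f
0` is `i - 1`, `i`, its only other contact is `μ`, and `u μ` sees nothing else of `f`. The
hypothesis on three spread-out neighbours keeps `f 0` from having contacts further right. -/
theorem exists_left_wide (b : Bypass G X D u n {x} i j f m) (hS : Setting G d a X D)
    (hSW : ∀ v ∈ D, ∀ c μ e, 0 < c → c + 2 ≤ μ → μ + 2 ≤ e → e < n →
      G.Adj (u c) v → G.Adj (u μ) v → G.Adj (u e) v → False)
    (hmid : ∃ k, i < k ∧ k < j ∧ ∃ g ≤ m, G.Adj (u k) (f g)) :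
    1 ≤ m ∧ ∃ μ, i < μ ∧ μ < j ∧ (∀ k ≤ n, (G.Adj (u k) (f 0) ↔ k = i - 1 ∨ k = i ∨ k = μ)) ∧
      (∀ g ≤ m, ∀ k, i < k → k < μ → ¬ G.Adj (u k) (f g)) ∧
      (∀ g ≤ m, (G.Adj (u μ) (f g) ↔ g = 0)) ∧
      (∀ k, i < k → k ≤ μ → ¬ G.Adj (u k) x) ∧
      ∀ g ≤ m, ∀ k ≤ i, (G.Adj (u k) (f g) ↔ g = 0 ∧ (k = i - 1 ∨ k = i)) := by
  classical
  have hi2 := b.two_le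
  have hij := b.lt
  have hjn := b.add_two_le
  obtain ⟨c, hc1, hci, hc⟩ := b.exists_left hS
  obtain ⟨h, hjh, hhn, hh⟩ := b.exists_right hS
  have hμ := Nat.find_spec hmid
  have hμmin : ∀ k, i < k → k < Nat.find hmid → ∀ g ≤ m, ¬ G.Adj (u k) (f g) := by
    intro k hik hk g hg e
    exact Nat.find_min hmid hk ⟨hik, hk.trans hμ.2.1, g, hg, e⟩
  set μ := Nat.find hmid
  obtain ⟨hiμ, hμj, g₀, hg₀, hμg₀⟩ := hμ
  have hfc0 : G.Adj (u c) (f 0) := (hc 0 (by omega) c (by omega)).2 ⟨rfl, Or.inl rfl⟩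
  have hfc1 : G.Adj (u (c + 1)) (f 0) := (hc 0 (by omega) (c + 1) (by omega)).2 ⟨rfl, Or.inr rfl⟩
  have hfh0 : G.Adj (u (h - 1)) (f m) := (hh m le_rfl (h - 1) (by omega) (by omega)).2 (by omega)
  have hfh1 : G.Adj (u h) (f m) := (hh m le_rfl h (by omega) (by omega)).2 (by omega)
  -- If `f` were a single vertex, it would have the three spread-out neighbours `u c`, `u μ` and `u
  -- h`.
  have hm : 1 ≤ m := by
    by_contra hm0
    obtain rfl : m = 0 := by omega
    obtain rfl : g₀ = 0 := by omega
    exact hSW (f 0) (b.f_mem 0 le_rfl) c μ h (by omega) (by omega) (by omega) (by omega)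
      hfc0 hμg₀ hfh1
  have hne : ∀ g ≤ m, ∀ k ≤ n, k ≤ μ ∨ j ≤ k → u k ≠ f g := by
    intro g hg k hk hk' e
    by_cases hk' : k ≤ i ∨ j ≤ k
    · exact b.f_ne g hg k hk hk' e
    · have hadj : G.Adj (u (k - 1)) (f g) := by
        rw [← e, b.path.adj _ (by omega) _ (by omega)]; omega
      by_cases hk1 : k - 1 = i
      · obtain ⟨rfl, -⟩ := (hc g hg (k - 1) (by omega)).1 hadj
        have := (hc 0 (by omega) c (by omega)).2 ⟨rfl, Or.inl rfl⟩
        rw [← e, b.path.adj _ (by omega) _ (by omega)] at this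
        omega
      · exact hμmin (k - 1) (by omega) (by omega) g hg hadj
  -- contacts with the parts of `u` up to `μ` and from `j` on
  have hadj : ∀ g ≤ m, ∀ k ≤ n, k < μ → (G.Adj (u k) (f g) ↔ g = 0 ∧ (k = c ∨ k = c + 1)) := by
    intro g hg k hk hkμ
    rcases Nat.lt_or_ge i k with h1 | h1
    · exact iff_of_false (hμmin k h1 hkμ g hg) (by omega)
    · exact hc g hg k h1
  have sepuf : ∀ p q, q ≤ μ → ∀ k l, l ≤ m + 1 → (1 ≤ k ∨ q ≤ c ∨ c + 2 ≤ p) →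
      G.Sep (ico u p q) (ico f k l) := by
    intro p q hq k l hl hkk
    refine sep_ico fun s hs hs' e he he' => ⟨hne e (by omega) s (by omega) (by omega), ?_⟩
    rw [hadj e (by omega) s (by omega) (by omega)]
    omega
  have seprf : ∀ p q, j ≤ p → q ≤ n + 1 → ∀ k l, l ≤ m → G.Sep (ico u p q) (ico f k l) := by
    intro p q hp hq k l hl
    refine sep_ico fun s hs hs' e he he' => ⟨hne e (by omega) s (by omega) (by omega), ?_⟩
    rw [hh e (by omega) s (by omega) (by omega)]
    omega
  -- the extreme contacts of `u μ` with `f`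
  have hex : ∃ g, g ≤ m ∧ G.Adj (u μ) (f g) := ⟨g₀, hg₀, hμg₀⟩
  have hlo := Nat.find_spec hex
  have hlomin : ∀ g ≤ m, G.Adj (u μ) (f g) → Nat.find hex ≤ g := fun k hk h =>
    Nat.find_min' hex ⟨hk, h⟩
  set lo := Nat.find hex
  have hhi' := Nat.findGreatest_spec (P := fun k => G.Adj (u μ) (f k)) hlo.1 hlo.2
  have hhile := Nat.findGreatest_le (P := fun k => G.Adj (u μ) (f k)) m
  have hhimax : ∀ k ≤ m, G.Adj (u μ) (f k) → k ≤ Nat.findGreatest (fun k => G.Adj (u μ) (f k)) m :=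
    fun k hk h => Nat.le_findGreatest (P := fun k => G.Adj (u μ) (f k)) hk h
  set hi := Nat.findGreatest (fun k => G.Adj (u μ) (f k)) m
  have hlohi : lo ≤ hi := hhimax lo hlo.1 hlo.2
  obtain ⟨hlom, hloadj⟩ := hlo
  have hRc : G.Conn (ico u h (n + 1)) := b.path.conn_ico (by omega) le_rfl
  have hRt : G.Touches (f m) (ico u h (n + 1)) := ⟨_, mem_ico_of le_rfl (by omega), hfh1.symm⟩
  have hLc : G.Conn (ico u 0 (c + 1)) := b.path.conn_ico (by omega) (by omega)
  have hLt : G.Touches (f 0) (ico u 0 (c + 1)) :=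
    ⟨_, mem_ico_of (Nat.zero_le c) (by omega), hfc0.symm⟩
  have sxr : G.Sep (ico u h (n + 1)) {x} := b.sep_T le_rfl (by omega)
  have xn : ∀ A : Set V, ((A ∪ ico u h (n + 1)) ∩ X).Nonempty := fun A =>
    ⟨u n, Or.inr (mem_ico_of (by omega) (by omega)), b.path.right_mem⟩
  have x0 : ∀ A : Set V, ∀ l, 0 < l → ((A ∪ ico u 0 l) ∩ X).Nonempty := fun A l hl =>
    ⟨u 0, Or.inr (mem_ico_of le_rfl hl), b.path.left_mem⟩
  have xx : ∀ A : Set V, ((A ∪ {x}) ∩ X).Nonempty := fun A => ⟨x, Or.inr rfl, b.mem_x⟩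
  have hac : ∀ l, G.Sep {a} (ico f l (m + 1)) := fun l => sep_singleton_left.2
      ⟨fun ⟨k, _, hk, e⟩ => hS.a_notMem (e ▸ b.f_mem k (by omega)),
        fun ⟨_, ⟨k, _, hk, e⟩, h⟩ => hS.not_adj_a _ (b.f_mem k (by omega)) (e ▸ h)⟩
  -- the contacts of `u μ` are not two consecutive vertices of `f`
  have hnot_pair : hi ≠ lo + 1 := by
    intro hpair
    rw [hpair] at hhi' hhile
    have hcon : ∀ g ≤ m, G.Adj (u μ) (f g) → g = lo ∨ g = lo + 1 := fun g hg e => by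
      have := hlomin g hg e; have := hhimax g hg e; omega
    -- If the pair is `f 0`, `f 1`, the path that leaves `u` at `u μ`, follows `f` from `f 1` and
    -- returns at `u h` contains exactly four neighbours of `f 0`. If the pair comes later, its
    -- triangle with `u μ` and the triangle at `f 0` are those of a prism.
    rcases Nat.eq_zero_or_pos lo with hlo0 | hlo0
    · rw [hlo0] at hhi' hhile hcon hloadj
      have p1 : G.IndPath (fun k => f (1 + k)) (m - 1) := b.fpath.shift hm le_rfl
      have p2 : G.IndPath (fun k => u (h + k)) (n - h) := b.path.shift hhn.le le_rfl
      have p3 : G.IndPath (app u μ fun k => f (1 + k)) (μ + 1 + (m - 1)) := by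
        refine (b.path.prefix_le (by omega)).app p1
          (fun s hs e he => hne _ (by omega) s (by omega) (by omega)) fun s hs e he => ?_
        rcases hs.eq_or_lt with rfl | hs
        · constructor
          · intro h'; have := hcon _ (by omega) h'; omega
          · rintro ⟨-, rfl⟩; exact hhi'
        · rw [hadj _ (by omega) s (by omega) hs]; omega
      have p4 := p3.app p2 (fun s hs e he => by
          rcases app_cases (v := fun k => f (1 + k)) hs with ⟨h1, h2⟩ | ⟨l, hl, -, h2⟩ <;> rw [h2]
          · exact b.path.ne (by omega) (by omega) (by omega)
          · exact (hne _ (by omega) _ (by omega) (by omega)).symm)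
        (fun s hs e he => by
          rcases app_cases (v := fun k => f (1 + k)) hs with ⟨h1, h2⟩ | ⟨l, hl, h1, h2⟩ <;> rw [h2]
          · rw [b.path.adj _ (by omega) _ (by omega)]; omega
          · rw [G.adj_comm, hh _ (by omega) _ (by omega) (by omega)]; omega)
      have hN : μ + 1 + (m - 1) + 1 + (n - h) = μ + m + 1 + (n - h) := by omega
      rw [hN] at p4
      set w := app (app u μ fun k => f (1 + k)) (μ + 1 + (m - 1)) fun k => u (h + k) with hw
      have w1 : ∀ k ≤ μ, w k = u k := fun k hk => by
        rw [hw, app_left (by omega), app_left hk]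
      have w2 : ∀ k, k ≤ m - 1 → w (μ + 1 + k) = f (1 + k) := fun k hk => by
        rw [hw, app_left (by omega), app_right]
      have w3 : ∀ k, w (μ + m + 1 + k) = u (h + k) := fun k => by
        rw [hw, show μ + m + 1 + k = μ + 1 + (m - 1) + 1 + k by omega, app_right]
      have wc : ∀ k ≤ μ + m + 1 + (n - h), k ≤ μ ∨ (∃ l ≤ m - 1, k = μ + 1 + l) ∨
          ∃ l ≤ n - h, k = μ + m + 1 + l := by
        intro k hk
        rcases Nat.lt_or_ge μ k with h1 | h1
        · rcases Nat.lt_or_ge (μ + m) k with h2 | h2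
          · exact Or.inr (Or.inr ⟨k - (μ + m + 1), by omega, by omega⟩)
          · exact Or.inr (Or.inl ⟨k - (μ + 1), by omega, by omega⟩)
        · exact Or.inl h1
      have hX : G.XPath X D w (μ + m + 1 + (n - h)) := by
        refine ⟨p4, by omega, ?_, ?_, ?_⟩
        · rw [w1 0 (by omega)]; exact b.path.left_mem
        · rw [w3, show h + (n - h) = n by omega]; exact b.path.right_mem
        · intro k hk0 hkn
          rcases wc k hkn.le with h1 | ⟨l, hl, rfl⟩ | ⟨l, hl, rfl⟩
          · rw [w1 k h1]; exact b.u_mem hk0 (by omega)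
          · rw [w2 l hl]; exact b.f_mem _ (by omega)
          · rw [w3]; exact b.u_mem (by omega) (by omega)
      refine hX.not_even_contacts hS (b.f_mem 0 (by omega)) ?_ {c, c + 1, μ, μ + 1} ?_ ?_ ?_
      · intro k hk
        rcases wc k hk with h1 | ⟨l, hl, rfl⟩ | ⟨l, hl, rfl⟩
        · rw [w1 k h1]; exact hne 0 (by omega) k (by omega) (by omega)
        · rw [w2 l hl]; exact b.fpath.ne (by omega) (by omega) (by omega)
        · rw [w3]; exact hne 0 (by omega) _ (by omega) (by omega)
      · intro k
        simp only [Finset.mem_insert, Finset.mem_singleton]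
        constructor
        · rintro (rfl | rfl | rfl | rfl)
          · rw [w1 _ (by omega)]; exact ⟨by omega, hfc0.symm⟩
          · rw [w1 _ (by omega)]; exact ⟨by omega, hfc1.symm⟩
          · rw [w1 _ (by omega)]; exact ⟨by omega, hloadj.symm⟩
          · refine ⟨by omega, ?_⟩
            have := w2 0 (by omega)
            rw [Nat.add_zero] at this
            rw [this]; exact b.fpath.adj_succ (by omega)
        · rintro ⟨hk, e⟩
          rcases wc k hk with h1 | ⟨l, hl, rfl⟩ | ⟨l, hl, rfl⟩
          · rw [w1 k h1, G.adj_comm] at e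
            rcases h1.eq_or_lt with rfl | h1
            · omega
            · have := (hadj 0 (by omega) k (by omega) h1).1 e; omega
          · rw [w2 l hl, b.fpath.adj _ (by omega) _ (by omega)] at e; omega
          · rw [w3, G.adj_comm, hh _ (by omega) _ (by omega) (by omega)] at e; omega
      all_goals
        rw [Finset.card_insert_of_notMem, Finset.card_insert_of_notMem,
          Finset.card_insert_of_notMem, Finset.card_singleton]
        all_goals first | decide | (simp only [Finset.mem_insert, Finset.mem_singleton]; omega)
    · have ha0 : G.Touches a (ico u 0 (c + 1)) :=
        ⟨_, mem_ico_of le_rfl (by omega), hS.adj_a _ b.path.left_mem⟩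
      have han : G.Adj a (u n) := hS.adj_a _ b.path.right_mem
      refine hS.prism (hasPrism_of_conn' (a1 := u (c + 1)) (a2 := f 0) (a3 := u c)
        (b1 := u μ) (b2 := f lo) (b3 := f (lo + 1)) (A := ico u (c + 1) (μ + 1))
        (B := ico f 0 (lo + 1))
        (C := insert a (ico u 0 (c + 1)) ∪ (ico f (lo + 1) (m + 1) ∪ ico u h (n + 1)))
        hfc1 (b.path.adj_succ (by omega)).symm hfc0.symm hloadj hhi'
        (b.fpath.adj_succ (by omega)) ?_ ?_ ?_ ?_ ?_ ?_ ?_ ?_ ?_ ?_ ?_ ?_ ?_ ?_ ?_)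
      · exact b.path.ne (by omega) (by omega) (by omega)
      · exact b.fpath.ne (by omega) (by omega) (by omega)
      · exact hne _ (by omega) _ (by omega) (by omega)
      · exact b.path.conn_ico (by omega) (by omega)
      · exact b.fpath.conn_ico (by omega) (by omega)
      · exact (hLc.insert ha0).union_adj (b.fpath.conn_tail hRc le_rfl hRt (by omega))
          (Or.inl rfl) (Or.inr (mem_ico_of (k := n) (by omega) (by omega))) han
      · exact mem_ico_of (by omega) (by omega)
      · exact mem_ico_of (by omega) (by omega)
      · exact mem_ico_of (by omega) (by omega)
      · exact mem_ico_of (by omega) (by omega)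
      · exact Or.inl (Or.inr (mem_ico_of (by omega) (by omega)))
      · exact Or.inr (Or.inl (mem_ico_of (by omega) (by omega)))
      · rintro _ ⟨k, hk, hk', rfl⟩ _ ⟨g, hg, hg', rfl⟩
        refine ⟨hne g (by omega) k (by omega) (by omega), fun e => ?_⟩
        rcases (Nat.le_of_lt_succ hk').eq_or_lt with rfl | hk'
        · have := hcon g (by omega) e
          exact Or.inr ⟨rfl, congrArg f (by omega)⟩
        · have := (hadj g (by omega) k (by omega) hk').1 e
          exact Or.inl ⟨congrArg u (by omega), congrArg f (by omega)⟩
      · rintro _ ⟨k, hk, hk', rfl⟩ _ ((rfl | ⟨l, hl, hl', rfl⟩) | (⟨l, hl, hl', rfl⟩ |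
          ⟨l, hl, hl', rfl⟩))
        · refine ⟨b.path.ne_a hS (by omega), fun e => ?_⟩
          have := (b.path.adj_a hS (by omega)).1 e.symm
          omega
        · refine ⟨b.path.ne (by omega) (by omega) (by omega), fun e => Or.inl ?_⟩
          rw [b.path.adj _ (by omega) _ (by omega)] at e
          exact ⟨congrArg u (by omega), congrArg u (by omega)⟩
        · refine ⟨hne l (by omega) k (by omega) (by omega), fun e => ?_⟩
          rcases (Nat.le_of_lt_succ hk').eq_or_lt with rfl | hk'
          · have := hcon l (by omega) e
            exact Or.inr ⟨rfl, congrArg f (by omega)⟩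
          · have := (hadj l (by omega) k (by omega) hk').1 e
            omega
        · have := b.path.toIndPath.sep_ico (i := c + 1) (j := μ + 1) (k := h) (l := n + 1)
            (by omega) le_rfl _ (mem_ico_of hk hk') _ (mem_ico_of hl hl')
          exact ⟨this.1, fun e => (this.2 e).elim⟩
      · rintro _ ⟨g, hg, hg', rfl⟩ _ ((rfl | ⟨l, hl, hl', rfl⟩) | (⟨l, hl, hl', rfl⟩ |
          ⟨l, hl, hl', rfl⟩))
        · have := hac 0 _ rfl _ (mem_ico_of hg (by omega))
          exact ⟨this.1.symm, fun e => (this.2 e.symm).elim⟩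
        · refine ⟨(hne g (by omega) l (by omega) (by omega)).symm, fun e => Or.inl ?_⟩
          have := (hadj g (by omega) l (by omega) (by omega)).1 e.symm
          exact ⟨congrArg f (by omega), congrArg u (by omega)⟩
        · refine ⟨b.fpath.ne (by omega) (by omega) (by omega), fun e => Or.inr ?_⟩
          rw [b.fpath.adj _ (by omega) _ (by omega)] at e
          exact ⟨congrArg f (by omega), congrArg f (by omega)⟩
        · refine ⟨(hne g (by omega) l (by omega) (by omega)).symm, fun e => ?_⟩
          have := (hh g (by omega) l (by omega) (by omega)).1 e.symm
          omega
  have suμ : ∀ p q, q ≤ μ + 1 → ∀ k l, l ≤ m + 1 → (1 ≤ k ∨ q ≤ c ∨ c + 2 ≤ p) →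
      (hi < k ∨ l ≤ lo ∨ (lo = hi ∧ (hi < k ∨ l ≤ lo)) ∨ q ≤ μ ∨
        ∀ g, k ≤ g → g < l → ¬ G.Adj (u μ) (f g)) →
      G.Sep (ico u p q) (ico f k l) := by
    intro p q hq k l hl hkk hlast
    refine sep_ico fun s hs hs' e he he' => ⟨hne e (by omega) s (by omega) (by omega), ?_⟩
    rcases (show s < μ ∨ s = μ by omega) with hsμ | rfl
    · rw [hadj e (by omega) s (by omega) hsμ]; omega
    · intro hadj'
      have h1 := hlomin e (by omega) hadj'
      have h2 := hhimax e (by omega) hadj'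
      rcases hlast with hl' | hl' | hl' | hl' | hl'
      · omega
      · omega
      · omega
      · omega
      · exact hl' e he he' hadj'
  -- there is no contact of `x` beyond `c + 1` and up to `μ`
  have hnoκ : ¬ ∃ κ, c + 2 ≤ κ ∧ κ ≤ μ ∧ G.Adj (u κ) x := by
    rintro ⟨κ, hcκ, hκμ, hκx⟩
    have hκt : G.Touches (u κ) {x} := touches_singleton.2 hκx
    -- With distinct extreme contacts, which are not consecutive by `hnot_pair`, the trident is at
    -- `u μ`; with a single contact it is at `f lo`. In both cases the arms lead to `u 0`, to `u n`,
    -- and through `u κ` to `x`.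
    rcases Nat.lt_or_ge lo hi with hlt | hge
    · refine hS.not_trident (b.u_mem (k := μ) (by omega) (by omega))
        (A := ico f 0 (lo + 1) ∪ ico u 0 (c + 1)) (B := ico f hi (m + 1) ∪ ico u h (n + 1))
        (C := ico u κ μ ∪ {x}) (b.fpath.conn_head hLc (by omega) hLt)
        (b.fpath.conn_tail hRc le_rfl hRt (by omega))
        (b.path.conn_head b.conn (by omega) hκt) ?_ ?_ ?_
        (Set.union_subset (b.f_sub (by omega)) (b.path.ico_sub (by omega)))
        (Set.union_subset (b.f_sub (by omega)) (b.path.ico_sub (by omega)))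
        (Set.union_subset (b.path.ico_sub (by omega)) b.sub) ?_ ?_ ?_
        ⟨_, Or.inl (mem_ico_of (Nat.zero_le lo) (by omega)), hloadj⟩
        ⟨_, Or.inl (mem_ico_of (le_refl hi) (by omega)), hhi'⟩
        (b.path.touches_head (by omega) hκt hκμ) (x0 _ _ (by omega)) (xn _) (xx _)
      · refine sep_union_left.2 ⟨sep_union_right.2 ⟨b.fpath.sep_ico (by omega) le_rfl,
          (seprf _ _ (by omega) le_rfl _ _ (by omega)).symm⟩,
          sep_union_right.2 ⟨sepuf _ _ (by omega) _ _ le_rfl (by omega),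
          b.path.toIndPath.sep_ico (by omega) le_rfl⟩⟩
      · refine sep_union_left.2 ⟨sep_union_right.2 ⟨(sepuf _ _ (by omega) _ _ (by omega)
          (by omega)).symm, b.sep_fT (by omega)⟩, sep_union_right.2
          ⟨b.path.toIndPath.sep_ico (by omega) (by omega), b.sep_T (by omega) (by omega)⟩⟩
      · refine sep_union_left.2 ⟨sep_union_right.2 ⟨(sepuf _ _ (by omega) _ _ (by omega)
          (by omega)).symm, b.sep_fT (by omega)⟩, sep_union_right.2
          ⟨(b.path.toIndPath.sep_ico (by omega) (by omega)).symm, sxr⟩⟩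
      · rintro (⟨g, hg, hg', e⟩ | e)
        · exact hne g (by omega) μ (by omega) (by omega) e.symm
        · exact b.path.notMem_ico (by omega) (by omega) (by omega) e
      · rintro (⟨g, hg, hg', e⟩ | e)
        · exact hne g (by omega) μ (by omega) (by omega) e.symm
        · exact b.path.notMem_ico (by omega) (by omega) (by omega) e
      · rintro (e | e)
        · exact b.path.notMem_ico (by omega) (by omega) (by omega) e
        · exact b.notMem μ (by omega) e
    · refine hS.not_trident (b.f_mem lo hlom)
        (A := ico f 0 lo ∪ ico u 0 (c + 1)) (B := ico f (lo + 1) (m + 1) ∪ ico u h (n + 1))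
        (C := ico u κ (μ + 1) ∪ {x}) (b.fpath.conn_head hLc (by omega) hLt)
        (b.fpath.conn_tail hRc le_rfl hRt (by omega))
        (b.path.conn_head b.conn (by omega) hκt) ?_ ?_ ?_
        (Set.union_subset (b.f_sub (by omega)) (b.path.ico_sub (by omega)))
        (Set.union_subset (b.f_sub (by omega)) (b.path.ico_sub (by omega)))
        (Set.union_subset (b.path.ico_sub (by omega)) b.sub) ?_ ?_ ?_
        (b.fpath.touches_head hlom hLt (by omega)) (b.fpath.touches_tail le_rfl hRt hlom)
        ⟨_, Or.inl (mem_ico_of hκμ (by omega)), hloadj.symm⟩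
        (x0 _ _ (by omega)) (xn _) (xx _)
      · refine sep_union_left.2 ⟨sep_union_right.2 ⟨b.fpath.sep_ico (by omega) le_rfl,
          (seprf _ _ (by omega) le_rfl _ _ (by omega)).symm⟩,
          sep_union_right.2 ⟨sepuf _ _ (by omega) _ _ le_rfl (by omega),
          b.path.toIndPath.sep_ico (by omega) le_rfl⟩⟩
      · refine sep_union_left.2 ⟨sep_union_right.2 ⟨(suμ _ _ le_rfl _ _ (by omega)
          (by omega) (by omega)).symm, b.sep_fT (by omega)⟩, sep_union_right.2
          ⟨b.path.toIndPath.sep_ico (by omega) (by omega), b.sep_T (by omega) (by omega)⟩⟩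
      · refine sep_union_left.2 ⟨sep_union_right.2 ⟨(suμ _ _ le_rfl _ _ (by omega)
          (by omega) (by omega)).symm, b.sep_fT (by omega)⟩, sep_union_right.2
          ⟨(b.path.toIndPath.sep_ico (by omega) (by omega)).symm, sxr⟩⟩
      · rintro (e | ⟨k, hk, hk', e⟩)
        · exact b.fpath.notMem_ico (by omega) (by omega) (by omega) e
        · exact hne lo (by omega) k (by omega) (by omega) e
      · rintro (e | ⟨k, hk, hk', e⟩)
        · exact b.fpath.notMem_ico (by omega) (by omega) (by omega) e
        · exact hne lo (by omega) k (by omega) (by omega) e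
      · rintro (⟨k, hk, hk', e⟩ | e)
        · exact hne lo (by omega) k (by omega) (by omega) e
        · exact b.f_notMem lo (by omega) e
  -- Otherwise `κ = i` would be a neighbour of `x` of the excluded kind.
  have hci' : c + 1 = i := by
    by_contra hne'
    exact hnoκ ⟨i, by omega, by omega, b.adj_left⟩
  have hxμ : ∀ k, i < k → k ≤ μ → ¬ G.Adj (u k) x := fun k h1 h2 e => hnoκ ⟨k, by omega, h2, e⟩
  -- Otherwise `u i` has a trident: back to `u 0`, directly to `x`, and forward to `u μ` and along
  -- `f` from `f hi` to `u n`, without touching the first arm.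
  have hhi0 : hi = 0 := by
    by_contra hpos
    have hcC : G.Conn (ico f hi (m + 1) ∪ ico u h (n + 1)) :=
      b.fpath.conn_tail hRc le_rfl hRt (by omega)
    have hμt : G.Touches (u μ) (ico f hi (m + 1) ∪ ico u h (n + 1)) :=
      ⟨_, Or.inl (mem_ico_of le_rfl (by omega)), hhi'⟩
    refine hS.not_trident (b.u_mem (k := i) (by omega) (by omega))
      (A := ico u 0 i) (B := {x})
      (C := ico u (i + 1) (μ + 1) ∪ (ico f hi (m + 1) ∪ ico u h (n + 1)))
      (b.path.conn_ico (by omega) (by omega)) b.conn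
      (b.path.conn_tail hcC (by omega) hμt (by omega))
      (b.sep_T (by omega) (by omega)) ?_ ?_ (b.path.ico_sub (by omega)) b.sub
      (Set.union_subset (b.path.ico_sub (by omega)) (Set.union_subset (b.f_sub (by omega))
        (b.path.ico_sub (by omega)))) ?_ ?_ ?_ ?_ b.touch_left ?_ ?_ b.meet ?_
    · exact sep_union_right.2 ⟨b.path.toIndPath.sep_ico (by omega) (by omega), sep_union_right.2
        ⟨sepuf _ _ (by omega) _ _ le_rfl (by omega),
        b.path.toIndPath.sep_ico (by omega) (by omega)⟩⟩
    · exact (sep_union_left.2 ⟨b.sep_ux (by omega) fun p hp hp' => hxμ p (by omega) (by omega),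
        sep_union_left.2 ⟨b.sep_fT le_rfl, sxr⟩⟩).symm
    · exact b.path.notMem_ico (by omega) (by omega) (by omega)
    · exact b.notMem i (by omega)
    · rintro (e | ⟨g, hg, hg', e⟩ | e)
      · exact b.path.notMem_ico (by omega) (by omega) (by omega) e
      · exact hne g (by omega) i (by omega) (by omega) e.symm
      · exact b.path.notMem_ico (by omega) (by omega) (by omega) e
    · refine ⟨u (i - 1), mem_ico_of (by omega) (by omega), ?_⟩
      rw [b.path.adj _ (by omega) _ (by omega)]; omega
    · exact b.path.touches_tail (by omega) hμt (by omega)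
    · exact ⟨_, mem_ico_of le_rfl (by omega), b.path.left_mem⟩
    · exact ⟨u n, Or.inr (Or.inr (mem_ico_of (by omega) (by omega))), b.path.right_mem⟩
  have hlo0 : lo = 0 := by omega
  have hμf : ∀ g ≤ m, (G.Adj (u μ) (f g) ↔ g = 0) := fun g hg =>
    ⟨fun e => by have := hhimax g hg e; omega, fun e => by rw [e]; rwa [hlo0] at hloadj⟩
  have hμ0 : G.Adj (u μ) (f 0) := (hμf 0 (by omega)).2 rfl
  have hf0u : ∀ k ≤ n, u k ≠ f 0 := by
    intro k hk e
    by_cases hk' : k ≤ i ∨ j ≤ k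
    · exact b.f_ne 0 (by omega) k hk hk' e
    · rw [← e, b.path.adj _ (by omega) _ (by omega)] at hfc0
      omega
  -- the contacts of `f 0` strictly between `i` and `j` lie in `{μ, μ + 1}`
  have hf0 : ∀ k ≤ n, μ < k → G.Adj (u k) (f 0) → k = μ + 1 := by
    intro k hk hμk e
    by_contra hk1
    rcases Nat.lt_or_ge k j with hkj | hkj
    · exact hSW (f 0) (b.f_mem 0 (by omega)) c μ k (by omega) (by omega) (by omega) (by omega)
        hfc0 hμ0 e
    · have := (hh 0 (by omega) k hk hkj).1 e
      omega
  refine ⟨hm, μ, hiμ, hμj, fun k hk => ?_, fun g hg k h1 h2 => hμmin k h1 h2 g hg, hμf, hxμ,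
    fun g hg k hk => by rw [hc g hg k hk]; omega⟩
  rcases lt_trichotomy k μ with hkμ | rfl | hkμ
  · rw [hadj 0 (by omega) k hk hkμ]; omega
  · exact iff_of_true hμ0 (by omega)
  · refine iff_of_false (fun e => ?_) (by omega)
    obtain rfl := hf0 k hk hkμ e
    -- A contact at `μ + 1` would leave `f 0` with exactly four neighbours on the path.
    refine b.path.not_even_contacts hS (b.f_mem 0 (by omega)) hf0u {c, c + 1, μ, μ + 1} ?_ ?_ ?_
    · intro k
      simp only [Finset.mem_insert, Finset.mem_singleton]
      constructor
      · rintro (rfl | rfl | rfl | rfl)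
        · exact ⟨by omega, hfc0.symm⟩
        · exact ⟨by omega, hfc1.symm⟩
        · exact ⟨by omega, hμ0.symm⟩
        · exact ⟨by omega, e.symm⟩
      · rintro ⟨hk, e⟩
        rcases lt_trichotomy k μ with hkμ | rfl | hkμ
        · have := (hadj 0 (by omega) k hk hkμ).1 e.symm; omega
        · omega
        · have := hf0 k hk hkμ e.symm; omega
    all_goals
      rw [Finset.card_insert_of_notMem, Finset.card_insert_of_notMem,
        Finset.card_insert_of_notMem, Finset.card_singleton]
      all_goals first | decide | (simp only [Finset.mem_insert, Finset.mem_singleton]; omega)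

end Bypass
end SimpleGraph

/-! ### Bypasses of a single vertex of `X`: the contradiction. -/

namespace SimpleGraph
variable {V : Type*} {G : SimpleGraph V}

namespace Bypass
variable {d : ℕ} {a : V} {X D : Set V} {u : ℕ → V} {n : ℕ} {x : V} {i j : ℕ} {f : ℕ → V}
  {m : ℕ}

/-- A bypass around the contacts of a single vertex of `X` is impossible if no vertex of `D` has
three spread-out neighbours in the interior of the path. -/
theorem false_of_wide (b : Bypass G X D u n {x} i j f m) (hS : Setting G d a X D)
    (hSW : ∀ v ∈ D, ∀ c μ e, 0 < c → c + 2 ≤ μ → μ + 2 ≤ e → e < n →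
      G.Adj (u c) v → G.Adj (u μ) v → G.Adj (u e) v → False) : False := by
  classical
  have hi2 := b.two_le
  have hij := b.lt
  have hjn := b.add_two_le
  by_cases hmid : ∃ k, i < k ∧ k < j ∧ ∃ g ≤ m, G.Adj (u k) (f g)
  swap
  · push Not at hmid
    exact b.false_of_no_mid hS fun g hg k h1 h2 => hmid k h1 h2 g hg
  obtain ⟨hm, μ, hiμ, hμj, hf0, hμmin, hμf, hxμ, hA⟩ := b.exists_left_wide hS hSW hmid
  have hSW' : ∀ v ∈ D, ∀ c μ e, 0 < c → c + 2 ≤ μ → μ + 2 ≤ e → e < n →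
      G.Adj (u (n - c)) v → G.Adj (u (n - μ)) v → G.Adj (u (n - e)) v → False :=
    fun v hv c μ e h1 h2 h3 h4 a1 a2 a3 =>
      hSW v hv (n - e) (n - μ) (n - c) (by omega) (by omega) (by omega) (by omega) a3 a2 a1
  have hmid' : ∃ k, n - j < k ∧ k < n - i ∧ ∃ g ≤ m, G.Adj (u (n - k)) (f (m - g)) := by
    obtain ⟨k, h1, h2, g, hg, e⟩ := hmid
    exact ⟨n - k, by omega, by omega, m - g, by omega, by
      rwa [show n - (n - k) = k by omega, show m - (m - g) = g by omega]⟩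
  -- The mirrored statement describes the right end; in particular it yields a middle vertex
  -- adjacent to `f m`, where `m ≥ 1`.
  obtain ⟨-, ν', hν1, hν2, -, -, hνf', -, hB'⟩ := b.mirror.exists_left_wide hS hSW' hmid'
  have hB : ∀ g ≤ m, ∀ k ≤ n, j ≤ k → (G.Adj (u k) (f g) ↔ g = m ∧ (k = j ∨ k = j + 1)) := by
    intro g hg k hk hjk
    have := hB' (m - g) (by omega) (n - k) (by omega)
    rw [show n - (n - k) = k by omega, show m - (m - g) = g by omega] at this
    rw [this]; omega
  have hνm : G.Adj (u (n - ν')) (f m) := by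
    have := (hνf' 0 (by omega)).2 rfl
    simpa using this
  -- The vertex `u σ` is the first in the middle with a neighbour on `f` other than `f 0`. It lies
  -- strictly beyond `u μ`, which sees only `f 0`.
  have hex : ∃ k, i < k ∧ k < j ∧ ∃ g, 1 ≤ g ∧ g ≤ m ∧ G.Adj (u k) (f g) :=
    ⟨n - ν', by omega, by omega, m, hm, le_rfl, hνm⟩
  have hμ2 := Nat.find_spec hex
  have hmin2 : ∀ k, i < k → k < Nat.find hex → ∀ g, 1 ≤ g → g ≤ m → ¬ G.Adj (u k) (f g) := by
    intro k hik hk g hg hgm e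
    exact Nat.find_min hex hk ⟨hik, hk.trans hμ2.2.1, g, hg, hgm, e⟩
  set σ := Nat.find hex
  obtain ⟨hiσ, hσj, g, hg1, hgm, hσg⟩ := hμ2
  have hμσ : μ < σ := by
    by_contra hc
    rcases (not_lt.1 hc).eq_or_lt with e | hlt
    · rw [e, hμf g hgm] at hσg; omega
    · exact hμmin g hgm σ hiσ hlt hσg
  have hfc0 : G.Adj (u (i - 1)) (f 0) := (hf0 _ (by omega)).2 (by omega)
  have hμ0 : G.Adj (u μ) (f 0) := (hf0 _ (by omega)).2 (by omega)
  have hfm : G.Adj (u (j + 1)) (f m) := (hB m le_rfl _ (by omega) (by omega)).2 (by omega)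
  have hf0u : ∀ k ≤ n, u k ≠ f 0 := by
    intro k hk e
    by_cases hk' : k ≤ i ∨ j ≤ k
    · exact b.f_ne 0 (by omega) k hk hk' e
    · rw [← e, b.path.adj _ (by omega) _ (by omega)] at hfc0
      omega
  have hne : ∀ e ≤ m, ∀ k ≤ n, k ≤ σ ∨ j ≤ k → u k ≠ f e := by
    intro e he k hk hk' heq
    rcases Nat.eq_zero_or_pos e with rfl | he0
    · exact hf0u k hk heq
    · by_cases hk' : k ≤ i ∨ j ≤ k
      · exact b.f_ne e he k hk hk' heq
      · have hadj : G.Adj (u (k - 1)) (f e) := by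
          rw [← heq, b.path.adj _ (by omega) _ (by omega)]; omega
        by_cases hk1 : k - 1 = i
        · have := (hA e he (k - 1) (by omega)).1 hadj
          omega
        · exact hmin2 (k - 1) (by omega) (by omega) e he0 he hadj
  have sepuf : ∀ p q, q ≤ σ → ∀ k l, 1 ≤ k → l ≤ m + 1 → G.Sep (ico u p q) (ico f k l) := by
    intro p q hq k l hk hl
    refine sep_ico fun s hs hs' e he he' => ⟨hne e (by omega) s (by omega) (by omega), ?_⟩
    rcases Nat.lt_or_ge i s with h1 | h1
    · exact hmin2 s h1 (by omega) e (by omega) (by omega)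
    · rw [hA e (by omega) s h1]; omega
  have hRc : G.Conn (ico u (j + 1) (n + 1)) := b.path.conn_ico (by omega) le_rfl
  have hRt : G.Touches (f m) (ico u (j + 1) (n + 1)) :=
    ⟨_, mem_ico_of le_rfl (by omega), hfm.symm⟩
  have sxr : G.Sep (ico u (j + 1) (n + 1)) {x} := b.sep_T le_rfl (by omega)
  have xA : (ico u 0 i ∩ X).Nonempty := ⟨u 0, mem_ico_of le_rfl (by omega), b.path.left_mem⟩
  -- Otherwise there is a trident at `u i`, with arms to `u 0`, to `x`, and along `u` to `u σ` and
  -- then along `f` to `u n`.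
  have hcont : ∃ k, i < k ∧ k ≤ σ ∧ G.Adj (u k) x := by
    by_contra! hno
    have hcC : G.Conn (ico f g (m + 1) ∪ ico u (j + 1) (n + 1)) :=
      b.fpath.conn_tail hRc le_rfl hRt (by omega)
    have hσt : G.Touches (u σ) (ico f g (m + 1) ∪ ico u (j + 1) (n + 1)) :=
      ⟨_, Or.inl (mem_ico_of le_rfl (by omega)), hσg⟩
    refine hS.not_trident (b.u_mem (k := i) (by omega) (by omega))
      (A := ico u 0 i) (B := {x})
      (C := ico u (i + 1) (σ + 1) ∪ (ico f g (m + 1) ∪ ico u (j + 1) (n + 1)))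
      (b.path.conn_ico (by omega) (by omega)) b.conn
      (b.path.conn_tail hcC (by omega) hσt (by omega))
      (b.sep_T (by omega) (by omega)) ?_ ?_ (b.path.ico_sub (by omega)) b.sub
      (Set.union_subset (b.path.ico_sub (by omega)) (Set.union_subset (b.f_sub (by omega))
        (b.path.ico_sub (by omega)))) ?_ ?_ ?_ ?_ b.touch_left ?_ xA b.meet ?_
    · exact sep_union_right.2 ⟨b.path.toIndPath.sep_ico (by omega) (by omega), sep_union_right.2
        ⟨sepuf _ _ (by omega) _ _ hg1 le_rfl,
        b.path.toIndPath.sep_ico (by omega) (by omega)⟩⟩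
    · exact (sep_union_left.2 ⟨b.sep_ux (by omega) fun p hp hp' => hno p (by omega) (by omega),
        sep_union_left.2 ⟨b.sep_fT le_rfl, sxr⟩⟩).symm
    · exact b.path.notMem_ico (by omega) (by omega) (by omega)
    · exact b.notMem i (by omega)
    · rintro (e | ⟨g, hg, hg', e⟩ | e)
      · exact b.path.notMem_ico (by omega) (by omega) (by omega) e
      · exact hne g (by omega) i (by omega) (by omega) e.symm
      · exact b.path.notMem_ico (by omega) (by omega) (by omega) e
    · refine ⟨u (i - 1), mem_ico_of (by omega) (by omega), ?_⟩
      rw [b.path.adj _ (by omega) _ (by omega)]; omega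
    · exact b.path.touches_tail (by omega) hσt (by omega)
    · exact ⟨u n, Or.inr (Or.inr (mem_ico_of (by omega) (by omega))), b.path.right_mem⟩
  -- A neighbour of `x` before `u σ` gives a trident at `f 0`, with arms to `u 0`, along `f` to `u
  -- n`, and through `u μ` to `x`. So `u σ` is the first neighbour of `x` after `u i`.
  have hno : ∀ k, i < k → k < σ → ¬ G.Adj (u k) x := by
    intro k hik hkσ hkx
    have hμk : μ < k := by
      by_contra hc
      exact hxμ k hik (by omega) hkx
    refine hS.not_trident (b.f_mem 0 (by omega)) (A := ico u 0 i)
      (B := ico f 1 (m + 1) ∪ ico u (j + 1) (n + 1)) (C := ico u μ (k + 1) ∪ {x})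
      (b.path.conn_ico (by omega) (by omega)) (b.fpath.conn_tail hRc le_rfl hRt (by omega))
      (b.path.conn_tail b.conn (by omega) (touches_singleton.2 hkx) (by omega))
      ?_ ?_ ?_ (b.path.ico_sub (by omega))
      (Set.union_subset (b.f_sub (by omega)) (b.path.ico_sub (by omega)))
      (Set.union_subset (b.path.ico_sub (by omega)) b.sub) ?_ ?_ ?_
      ⟨_, mem_ico_of (by omega) (by omega), hfc0.symm⟩
      (b.fpath.touches_tail le_rfl hRt (by omega))
      ⟨_, Or.inl (mem_ico_of le_rfl (by omega)), hμ0.symm⟩ xA ?_ ⟨x, Or.inr rfl, b.mem_x⟩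
    · exact sep_union_right.2 ⟨sepuf _ _ (by omega) _ _ le_rfl le_rfl,
        b.path.toIndPath.sep_ico (by omega) le_rfl⟩
    · exact sep_union_right.2 ⟨b.path.toIndPath.sep_ico (by omega) (by omega),
        b.sep_T (by omega) (by omega)⟩
    · refine sep_union_left.2 ⟨sep_union_right.2 ⟨(sepuf _ _ (by omega) _ _ (by omega)
        (by omega)).symm, b.sep_fT (by omega)⟩, sep_union_right.2
        ⟨(b.path.toIndPath.sep_ico (by omega) (by omega)).symm, sxr⟩⟩
    · rintro ⟨k, hk, hk', e⟩
      exact hf0u k (by omega) e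
    · rintro (e | ⟨k, hk, hk', e⟩)
      · exact b.fpath.notMem_ico (by omega) (by omega) (by omega) e
      · exact hf0u k (by omega) e
    · rintro (⟨k, hk, hk', e⟩ | e)
      · exact hf0u k (by omega) e
      · exact b.f_notMem 0 (by omega) e
    · exact ⟨u n, Or.inr (mem_ico_of (by omega) (by omega)), b.path.right_mem⟩
  have hσx : G.Adj (u σ) x := by
    obtain ⟨k, h1, h2, h3⟩ := hcont
    rcases h2.eq_or_lt with rfl | h2
    · exact h3
    · exact (hno k h1 h2 h3).elim
  have hf0x : ¬ G.Adj (f 0) x := fun e => b.f_touch 0 (by omega) (touches_singleton.2 e)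
  by_cases hμi : μ = i + 1
  · -- an even wheel centred at `u i`
    have q1 : G.IndPath (app (fun k => u (0 + k)) (i - 1) fun _ => f 0) (i - 1 + 1) :=
      (b.path.shift (Nat.zero_le _) (by omega : i - 1 ≤ n)).snoc
        (fun k hk => hf0u _ (by omega)) fun k hk => by
          rw [G.adj_comm, hf0 _ (by omega)]; omega
    have q2 : G.IndPath (app (fun k => u (i + 1 + k)) (σ - (i + 1)) fun _ => x)
        (σ - (i + 1) + 1) :=
      (b.path.shift (by omega : i + 1 ≤ σ) (by omega)).snoc
        (fun k hk e => b.notMem _ (by omega) e) fun k hk => by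
          rw [G.adj_comm]
          constructor
          · intro e
            by_contra hk'
            exact hno _ (by omega) (by omega) e
          · rintro rfl; rwa [show i + 1 + (σ - (i + 1)) = σ by omega]
    have q := q1.app q2 (fun s hs e he => by
        rcases app_cases (u := fun k => u (0 + k)) (v := fun _ => f 0) (show s ≤ i - 1 + 1 + 0 from hs) with
          ⟨h1, h2⟩ | ⟨l, hl, h1, h2⟩ <;>
        rcases app_cases (u := fun k => u (i + 1 + k)) (v := fun _ => x)
          (show e ≤ σ - (i + 1) + 1 + 0 from he) with ⟨h3, h4⟩ | ⟨l', hl', h3, h4⟩ <;> rw [h2, h4]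
        · exact b.path.ne (by omega) (by omega) (by omega)
        · exact fun e => b.notMem _ (by omega) e
        · exact (hf0u _ (by omega)).symm
        · exact fun e => b.f_notMem 0 (by omega) e)
      (fun s hs e he => by
        rcases app_cases (u := fun k => u (0 + k)) (v := fun _ => f 0) (show s ≤ i - 1 + 1 + 0 from hs) with
          ⟨h1, h2⟩ | ⟨l, hl, h1, h2⟩ <;>
        rcases app_cases (u := fun k => u (i + 1 + k)) (v := fun _ => x)
          (show e ≤ σ - (i + 1) + 1 + 0 from he) with ⟨h3, h4⟩ | ⟨l', hl', h3, h4⟩ <;> rw [h2, h4]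
        · rw [b.path.adj _ (by omega) _ (by omega)]; omega
        · refine iff_of_false (fun e => ?_) (by omega)
          have := b.adj_le (by omega) e; omega
        · rw [G.adj_comm, hf0 _ (by omega)]; omega
        · exact iff_of_false hf0x (by omega))
    have hN : i - 1 + 1 + 1 + (σ - (i + 1) + 1) = σ + 1 := by omega
    rw [hN] at q
    set w := app (app (fun k => u (0 + k)) (i - 1) fun _ => f 0) (i - 1 + 1)
      (app (fun k => u (i + 1 + k)) (σ - (i + 1)) fun _ => x) with hw
    have w1 : ∀ k < i, w k = u k := fun k hk => by
      rw [hw, app_left (by omega), app_left (by omega), Nat.zero_add]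
    have w2 : w i = f 0 := by
      rw [hw, app_left (by omega)]
      have := app_right (u := fun k => u (0 + k)) (v := fun _ => f 0) (n := i - 1) (k := 0)
      rwa [show i - 1 + 1 + 0 = i by omega] at this
    have w3 : ∀ k, i < k → k ≤ σ → w k = u k := fun k hk hk' => by
      have h1 : k = i - 1 + 1 + 1 + (k - (i + 1)) := by omega
      rw [hw]
      conv_lhs => rw [h1]
      rw [app_right, app_left (by omega)]
      congr 1; omega
    have w4 : w (σ + 1) = x := by
      have h1 : σ + 1 = i - 1 + 1 + 1 + (σ - (i + 1) + 1 + 0) := by omega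
      rw [hw]
      conv_lhs => rw [h1]
      rw [app_right, app_right]
    have wc : ∀ k ≤ σ + 1, k < i ∨ k = i ∨ (i < k ∧ k ≤ σ) ∨ k = σ + 1 := by omega
    have hX : G.XPath X D w (σ + 1) := by
      refine ⟨q, by omega, ?_, ?_, ?_⟩
      · rw [w1 0 (by omega)]; exact b.path.left_mem
      · rw [w4]; exact b.mem_x
      · intro k hk0 hkn
        rcases wc k hkn.le with h1 | rfl | h1 | h1
        · rw [w1 k h1]; exact b.u_mem hk0 (by omega)
        · rw [w2]; exact b.f_mem _ (by omega)
        · rw [w3 k h1.1 h1.2]; exact b.u_mem (by omega) (by omega)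
        · omega
    refine hX.not_even_contacts hS (b.u_mem (k := i) (by omega) (by omega)) ?_
      {i - 1, i, i + 1, σ + 1} ?_ ?_ ?_
    · intro k hk
      rcases wc k hk with h1 | rfl | h1 | rfl
      · rw [w1 k h1]; exact b.path.ne (by omega) (by omega) (by omega)
      · rw [w2]; exact (hf0u _ (by omega)).symm
      · rw [w3 k h1.1 h1.2]; exact b.path.ne (by omega) (by omega) (by omega)
      · rw [w4]; exact fun e => b.notMem i (by omega) e.symm
    · intro k
      simp only [Finset.mem_insert, Finset.mem_singleton]
      have e1 : ∀ k ≤ σ + 1, (G.Adj (u i) (w k) ↔ k = i - 1 ∨ k = i ∨ k = i + 1 ∨ k = σ + 1) := by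
        intro k hk
        rcases wc k hk with h1 | rfl | h1 | rfl
        · rw [w1 k h1, b.path.adj _ (by omega) _ (by omega)]; omega
        · rw [w2]; exact iff_of_true ((hf0 _ (by omega)).2 (by omega)) (by omega)
        · rw [w3 k h1.1 h1.2, b.path.adj _ (by omega) _ (by omega)]; omega
        · rw [w4]; exact iff_of_true b.adj_left (by omega)
      constructor
      · intro h; exact ⟨by omega, (e1 k (by omega)).2 h⟩
      · rintro ⟨h1, h2⟩; exact (e1 k h1).1 h2
    all_goals
      rw [Finset.card_insert_of_notMem, Finset.card_insert_of_notMem,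
        Finset.card_insert_of_notMem, Finset.card_singleton]
      all_goals first | decide | (simp only [Finset.mem_insert, Finset.mem_singleton]; omega)
  · -- a theta with ends `u i` and `u μ`
    have s0 : ∀ k l, l ≤ σ + 1 → i < k → (l ≤ μ ∨ μ < k) → G.Sep {f 0} (ico u k l) := by
      intro k l hl hk hkl
      rw [sep_singleton_left]
      constructor
      · rintro ⟨s, hs, hs', e⟩; exact hf0u s (by omega) e
      · rintro ⟨_, ⟨s, hs, hs', rfl⟩, e⟩
        have := (hf0 s (by omega)).1 e.symm
        omega
    refine hS.theta (hasTheta_of_conn' (a := u i) (b := u μ) (A := {f 0}) (B := ico u (i + 1) μ)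
      (C := ico u (μ + 1) (σ + 1) ∪ {x}) (b.path.ne (by omega) (by omega) (by omega)) ?_
      (Conn.singleton _) (b.path.conn_ico (by omega) (by omega))
      (b.path.conn_tail b.conn (by omega) (touches_singleton.2 hσx) (by omega))
      (s0 _ _ (by omega) (by omega) (by omega)) ?_ ?_ ⟨hf0u _ (by omega), ?_, ?_⟩
      ⟨hf0u _ (by omega), ?_, ?_⟩ ⟨?_, ?_, ?_⟩ ⟨?_, ?_, ?_⟩)
    · rw [b.path.adj _ (by omega) _ (by omega)]; omega
    · exact sep_union_right.2 ⟨s0 _ _ (by omega) (by omega) (by omega), sep_singleton_left.2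
        ⟨b.f_notMem 0 (by omega), b.f_touch 0 (by omega)⟩⟩
    · exact sep_union_right.2 ⟨b.path.toIndPath.sep_ico (by omega) (by omega),
        b.sep_ux (by omega) fun p hp hp' => hno p (by omega) (by omega)⟩
    · exact b.path.notMem_ico (by omega) (by omega) (by omega)
    · rintro (e | e)
      · exact b.path.notMem_ico (by omega) (by omega) (by omega) e
      · exact b.notMem i (by omega) e
    · exact b.path.notMem_ico (by omega) (by omega) (by omega)
    · rintro (e | e)
      · exact b.path.notMem_ico (by omega) (by omega) (by omega) e
      · exact b.notMem μ (by omega) e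
    · exact touches_singleton.2 ((hf0 _ (by omega)).2 (by omega))
    · exact ⟨_, mem_ico_of le_rfl (by omega), b.path.adj_succ (by omega)⟩
    · exact b.touch_left.mono Set.subset_union_right
    · exact touches_singleton.2 hμ0
    · refine ⟨u (μ - 1), mem_ico_of (by omega) (by omega), ?_⟩
      rw [b.path.adj _ (by omega) _ (by omega)]; omega
    · exact ⟨_, Or.inl (mem_ico_of le_rfl (by omega)), b.path.adj_succ (by omega)⟩

end Bypass
end SimpleGraph

/-! ### Disjoint paths between two sides separated by the neighbours of a vertex. -/

namespace SimpleGraph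
variable {V : Type*} {G : SimpleGraph V}

/-- Two induced paths with matching adjacent ends and no other edges between them form a hole. -/
theorem IndPath.isHole_union {u v : ℕ → V} {n m : ℕ} (hu : G.IndPath u n) (hv : G.IndPath v m)
    (hn : 2 ≤ n + m) (hn' : 1 ≤ n)
    (hne : ∀ i ≤ n, ∀ j ≤ m, u i ≠ v j)
    (hadj : ∀ i ≤ n, ∀ j ≤ m, (G.Adj (u i) (v j) ↔ (i = 0 ∧ j = 0) ∨ (i = n ∧ j = m))) :
    G.IsHole (seg u 0 n ∪ seg v 0 m) := by
  rcases Nat.eq_zero_or_pos m with rfl | hm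
  · have := hu.isHole (by omega) (w := v 0) (fun i hi => hne i hi 0 le_rfl)
      (fun i hi => by rw [G.adj_comm, hadj i hi 0 le_rfl]; omega)
    have e : seg u 0 n ∪ seg v 0 0 = insert (v 0) (seg u 0 n) := by
      ext x
      simp only [Set.mem_union, mem_seg, Set.mem_insert_iff]
      constructor
      · rintro (h | ⟨k, -, hk, rfl⟩)
        · exact Or.inr h
        · obtain rfl : k = 0 := by omega
          exact Or.inl rfl
      · rintro (rfl | h)
        · exact Or.inr ⟨0, le_rfl, le_rfl, rfl⟩
        · exact Or.inl h
    rwa [e]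
  -- The path `v` without `v 0` is appended backwards to `u`, and `v 0` then closes the hole.
  · have q := hu.app (v := fun k => v (m - k)) (m := m - 1) (hv.reverse.prefix_le (by omega))
      (fun i hi j hj => hne i hi _ (by omega))
      (fun i hi j hj => by rw [hadj i hi _ (by omega)]; omega)
    have hN : n + 1 + (m - 1) = n + m := by omega
    have := q.isHole (by omega) (w := v 0)
      (fun i hi => by
        rcases app_cases (u := u) (v := fun k => v (m - k)) hi with ⟨h, e⟩ | ⟨k, hk, rfl, e⟩ <;>
          rw [e]
        · exact hne i h 0 (by omega)
        · exact hv.ne (by omega) (by omega) (by omega))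
      (fun i hi => by
        rcases app_cases (u := u) (v := fun k => v (m - k)) hi with ⟨h, e⟩ | ⟨k, hk, rfl, e⟩ <;>
          rw [e]
        · rw [G.adj_comm, hadj i h 0 (by omega)]; omega
        · rw [hv.adj _ (by omega) _ (by omega)]; omega)
    rw [seg_app] at this
    have e : seg u 0 n ∪ seg v 0 m =
        insert (v 0) (seg u 0 n ∪ seg (fun k => v (m - k)) 0 (m - 1)) := by
      ext x
      simp only [Set.mem_union, mem_seg, Set.mem_insert_iff]
      constructor
      · rintro (h | ⟨k, -, hk, rfl⟩)
        · exact Or.inr (Or.inl h)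
        · rcases Nat.eq_zero_or_pos k with rfl | hk0
          · exact Or.inl rfl
          · exact Or.inr (Or.inr ⟨m - k, by omega, by omega, by congr 1; omega⟩)
      · rintro (rfl | h | ⟨k, -, hk, rfl⟩)
        · exact Or.inr ⟨0, le_rfl, by omega, rfl⟩
        · exact Or.inl h
        · exact Or.inr ⟨m - k, by omega, by omega, rfl⟩
    rwa [e]

theorem seg_reverse {u : ℕ → V} {n : ℕ} : seg (fun k => u (n - k)) 0 n = seg u 0 n := by
  ext x
  simp only [mem_seg]
  constructor
  · rintro ⟨k, -, hk, rfl⟩; exact ⟨n - k, by omega, by omega, rfl⟩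
  · rintro ⟨k, -, hk, rfl⟩; exact ⟨n - k, by omega, by omega, by congr 1; omega⟩

theorem seg_finite {u : ℕ → V} {i j : ℕ} : (seg u i j).Finite := by
  refine ((Finset.range (j + 1)).finite_toSet.image u).subset ?_
  rintro y ⟨k, -, hk, rfl⟩
  exact ⟨k, by simpa using Nat.lt_succ_of_le hk, rfl⟩

/-- Disjoint induced paths `p l` from `L` to `R`, each with at most `c` neighbours of `x`; the
neighbours of `x` separate `L` from `R` in the union. -/
structure ChunkSystem (G : SimpleGraph V) {ι : Type*} (x : V) (L R : Set V) (s : Finset ι)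
    (p : ι → ℕ → V) (e : ι → ℕ) (c : ℕ) : Prop where
  connL : G.Conn L
  connR : G.Conn R
  sepL : G.Sep {x} L
  sepR : G.Sep {x} R
  path : ∀ l ∈ s, G.IndPath (p l) (e l)
  disj : ∀ l ∈ s, ∀ m ∈ s, l ≠ m → ∀ i ≤ e l, ∀ j ≤ e m, p l i ≠ p m j
  x_ne : ∀ l ∈ s, ∀ i ≤ e l, p l i ≠ x
  left : ∀ l ∈ s, G.Touches (p l 0) L
  right : ∀ l ∈ s, G.Touches (p l (e l)) R
  contacts : ∀ l ∈ s, (seg (p l) 0 (e l) ∩ G.neighborSet x).ncard ≤ c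
  separated : ∀ C, G.Conn C → (∀ y ∈ C, y ∈ L ∨ y ∈ R ∨ ∃ l ∈ s, y ∈ seg (p l) 0 (e l)) →
    (∀ y ∈ C, ¬ G.Adj x y) → (C ∩ L).Nonempty → (C ∩ R).Nonempty → False

/-- A chunk system whose paths have no contacts with `L`, `R` beyond the necessary ones. -/
structure TightSystem (G : SimpleGraph V) {ι : Type*} (x : V) (L R : Set V) (s : Finset ι)
    (p : ι → ℕ → V) (e : ι → ℕ) (c : ℕ) : Prop where
  connL : G.Conn L
  connR : G.Conn R
  sepL : G.Sep {x} L
  sepR : G.Sep {x} R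
  sep : G.Sep L R
  path : ∀ l ∈ s, G.IndPath (p l) (e l)
  disj : ∀ l ∈ s, ∀ m ∈ s, l ≠ m → ∀ i ≤ e l, ∀ j ≤ e m, p l i ≠ p m j
  x_ne : ∀ l ∈ s, ∀ i ≤ e l, p l i ≠ x
  left : ∀ l ∈ s, ∀ i ≤ e l, (G.Touches (p l i) L ↔ i = 0)
  right : ∀ l ∈ s, ∀ i ≤ e l, (G.Touches (p l i) R ↔ i = e l)
  notMemL : ∀ l ∈ s, ∀ i ≤ e l, p l i ∉ L
  notMemR : ∀ l ∈ s, ∀ i ≤ e l, p l i ∉ R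
  adj_left : ∀ l ∈ s, G.Adj x (p l 0)
  adj_right : ∀ l ∈ s, G.Adj x (p l (e l))
  contacts : ∀ l ∈ s, (seg (p l) 0 (e l) ∩ G.neighborSet x).ncard ≤ c

variable {ι : Type*} {x : V} {L R : Set V} {s : Finset ι} {p : ι → ℕ → V} {e : ι → ℕ} {c : ℕ}

/-- Enlarge `L` and `R` to their components among the non-neighbours of `x` in the union of the
system; by assumption these are separated. Cut every path down to the piece from its last contact
with the new left side to the next contact with the right one. The ends of this piece are neighbours
of `x`, since otherwise they would belong to the components that they touch. -/
theorem ChunkSystem.exists_tight (h : ChunkSystem G x L R s p e c) :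
    ∃ L' R' p' e', TightSystem G x L' R' s p' e' c := by
  classical
  set H : Set V := {y | (y ∈ L ∨ y ∈ R ∨ ∃ l ∈ s, y ∈ seg (p l) 0 (e l)) ∧ ¬ G.Adj x y} with hH
  obtain ⟨vL, hvL⟩ := h.connL.1
  obtain ⟨vR, hvR⟩ := h.connR.1
  have hLH : L ⊆ H := fun y hy => ⟨Or.inl hy, (h.sepL x rfl y hy).2⟩
  have hRH : R ⊆ H := fun y hy => ⟨Or.inr (Or.inl hy), (h.sepR x rfl y hy).2⟩
  have hxH : x ∉ H := by
    rintro ⟨h1 | h1 | ⟨l, hl, k, -, hk, e⟩, -⟩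
    · exact (h.sepL x rfl x h1).1 rfl
    · exact (h.sepR x rfl x h1).1 rfl
    · exact h.x_ne l hl k hk e
  set L' := G.comp H vL with hL'
  set R' := G.comp H vR with hR'
  have hLL' : L ⊆ L' := h.connL.subset_comp hLH hvL mem_comp_self
  have hRR' : R ⊆ R' := h.connR.subset_comp hRH hvR mem_comp_self
  have cL' : G.Conn L' := conn_comp (hLH hvL)
  have cR' : G.Conn R' := conn_comp (hRH hvR)
  have sL' : L' ⊆ H := comp_subset (hLH hvL)
  have sR' : R' ⊆ H := comp_subset (hRH hvR)
  have hvRL : vR ∉ L' := fun hm => h.separated L' cL' (fun y hy => (sL' hy).1)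
    (fun y hy => (sL' hy).2) ⟨vL, mem_comp_self, hvL⟩ ⟨vR, hm, hvR⟩
  have hsep : G.Sep L' R' := by
    refine sep_comp.mono le_rfl fun y hy => ⟨sR' hy, fun hy' => hvRL ?_⟩
    rw [hL', ← comp_eq (hLH hvL) hy', comp_eq (hRH hvR) hy]
    exact mem_comp_self
  have clL : ∀ y ∈ H, G.Touches y L' → y ∈ L' := fun y hy ⟨z, hz, hyz⟩ =>
    comp_closed hz hy hyz.symm
  have clR : ∀ y ∈ H, G.Touches y R' → y ∈ R' := fun y hy ⟨z, hz, hyz⟩ =>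
    comp_closed hz hy hyz.symm
  have key : ∀ l ∈ s, ∃ i j, i ≤ j ∧ j ≤ e l ∧
      (∀ k, i ≤ k → k ≤ j → (G.Touches (p l k) L' ↔ k = i)) ∧
      (∀ k, i ≤ k → k ≤ j → (G.Touches (p l k) R' ↔ k = j)) ∧
      (∀ k, i ≤ k → k ≤ j → p l k ∉ L' ∧ p l k ∉ R') ∧ G.Adj x (p l i) ∧ G.Adj x (p l j) := by
    intro l hl
    have hmemH : ∀ k ≤ e l, ¬ G.Adj x (p l k) → p l k ∈ H := fun k hk hx =>
      ⟨Or.inr (Or.inr ⟨l, hl, mem_seg_of (Nat.zero_le _) hk⟩), hx⟩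
    have h0 : G.Touches (p l 0) L' := (h.left l hl).mono hLL'
    have hi := Nat.findGreatest_spec (P := fun k => G.Touches (p l k) L') (Nat.zero_le (e l)) h0
    have hile := Nat.findGreatest_le (P := fun k => G.Touches (p l k) L') (e l)
    have himax : ∀ k ≤ e l, G.Touches (p l k) L' →
        k ≤ Nat.findGreatest (fun k => G.Touches (p l k) L') (e l) :=
      fun k hk h => Nat.le_findGreatest (P := fun k => G.Touches (p l k) L') hk h
    set i := Nat.findGreatest (fun k => G.Touches (p l k) L') (e l)
    have hex : ∃ j, i ≤ j ∧ j ≤ e l ∧ G.Touches (p l j) R' :=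
      ⟨e l, hile, le_rfl, (h.right l hl).mono hRR'⟩
    have hj := Nat.find_spec hex
    have hjmin : ∀ k, i ≤ k → k ≤ e l → G.Touches (p l k) R' → Nat.find hex ≤ k :=
      fun k h1 h2 h3 => Nat.find_min' hex ⟨h1, h2, h3⟩
    set j := Nat.find hex
    obtain ⟨hij, hje, hjR⟩ := hj
    have hsucc : ∀ k < e l, G.Adj (p l k) (p l (k + 1)) := fun k hk => (h.path l hl).adj_succ hk
    have hnL : ∀ k, i ≤ k → k ≤ e l → p l k ∉ L' := by
      intro k hik hk hkL
      rcases hk.eq_or_lt with rfl | hk'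
      · obtain ⟨r, hr, hadj⟩ := h.right l hl
        exact (hsep _ hkL _ (hRR' hr)).2 hadj
      · have := himax (k + 1) hk' ⟨_, hkL, (hsucc k hk').symm⟩
        omega
    have hxi : G.Adj x (p l i) := by
      by_contra hx
      exact hnL i le_rfl hile (clL _ (hmemH i hile hx) hi)
    have hnR : ∀ k, i ≤ k → k ≤ j → p l k ∉ R' := by
      intro k hik hk hkR
      rcases hik.eq_or_lt with rfl | hik'
      · exact (sR' hkR).2 hxi
      · have e1 : G.Adj (p l (k - 1)) (p l k) := by
          have := hsucc (k - 1) (by omega)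
          rwa [show k - 1 + 1 = k by omega] at this
        have := hjmin (k - 1) (by omega) (by omega) ⟨_, hkR, e1⟩
        omega
    have hxj : G.Adj x (p l j) := by
      by_contra hx
      exact hnR j hij le_rfl (clR _ (hmemH j hje hx) hjR)
    refine ⟨i, j, hij, hje, fun k h1 h2 => ⟨fun ht => ?_, fun ht => ht ▸ hi⟩,
      fun k h1 h2 => ⟨fun ht => ?_, fun ht => ht ▸ hjR⟩,
      fun k h1 h2 => ⟨hnL k h1 (by omega), hnR k h1 h2⟩, hxi, hxj⟩
    · have := himax k (by omega) ht; omega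
    · have := hjmin k h1 (by omega) ht; omega
  have key' : ∀ l, ∃ i j, l ∈ s → i ≤ j ∧ j ≤ e l ∧
      (∀ k, i ≤ k → k ≤ j → (G.Touches (p l k) L' ↔ k = i)) ∧
      (∀ k, i ≤ k → k ≤ j → (G.Touches (p l k) R' ↔ k = j)) ∧
      (∀ k, i ≤ k → k ≤ j → p l k ∉ L' ∧ p l k ∉ R') ∧ G.Adj x (p l i) ∧ G.Adj x (p l j) := by
    intro l
    by_cases hl : l ∈ s
    · obtain ⟨i, j, h'⟩ := key l hl
      exact ⟨i, j, fun _ => h'⟩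
    · exact ⟨0, 0, fun h' => (hl h').elim⟩
  choose i j hij using key'
  refine ⟨L', R', fun l k => p l (i l + k), fun l => j l - i l, ?_⟩
  constructor
  · exact cL'
  · exact cR'
  · exact sep_singleton_left.2 ⟨fun hx => hxH (sL' hx), fun ⟨y, hy, hxy⟩ => (sL' hy).2 hxy⟩
  · exact sep_singleton_left.2 ⟨fun hx => hxH (sR' hx), fun ⟨y, hy, hxy⟩ => (sR' hy).2 hxy⟩
  · exact hsep
  · exact fun l hl => (h.path l hl).shift (hij l hl).1 (hij l hl).2.1
  · intro l hl m hm hlm a ha b hb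
    have := hij l hl; have := hij m hm
    exact h.disj l hl m hm hlm _ (by omega) _ (by omega)
  · intro l hl a ha
    have := hij l hl
    exact h.x_ne l hl _ (by omega)
  · intro l hl a ha
    have := hij l hl
    rw [this.2.2.1 _ (by omega) (by omega)]; omega
  · intro l hl a ha
    have := hij l hl
    rw [this.2.2.2.1 _ (by omega) (by omega)]; omega
  · intro l hl a ha
    have := hij l hl
    exact (this.2.2.2.2.1 _ (by omega) (by omega)).1
  · intro l hl a ha
    have := hij l hl
    exact (this.2.2.2.2.1 _ (by omega) (by omega)).2
  · exact fun l hl => (hij l hl).2.2.2.2.2.1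
  · intro l hl
    have := hij l hl
    have h2 := this.2.2.2.2.2.2
    rwa [show j l = i l + (j l - i l) by omega] at h2
  · intro l hl
    refine le_trans (Set.ncard_le_ncard ?_ (seg_finite.inter_of_left _)) (h.contacts l hl)
    refine Set.inter_subset_inter_left _ ?_
    rintro _ ⟨k, -, hk, rfl⟩
    have := hij l hl
    exact mem_seg_of (by omega) (by omega)

namespace TightSystem

/-- The non-neighbours of `x` on the paths. -/
theorem not_touches_of_gap (h : TightSystem G x L R s p e c) {l : ι} (hl : l ∈ s) {k : ℕ}
    (hk : k ≤ e l) (hx : ¬ G.Adj x (p l k)) :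
    ¬ G.Touches (p l k) L ∧ ¬ G.Touches (p l k) R := by
  constructor
  · intro ht
    obtain rfl := (h.left l hl k hk).1 ht
    exact hx (h.adj_left l hl)
  · intro ht
    obtain rfl := (h.right l hl k hk).1 ht
    exact hx (h.adj_right l hl)

/-- Few paths have contacts with a connected set of non-neighbours of `x`. -/
theorem false_of_gap_set (h : TightSystem G x L R s p e (c + 1)) {N : ℕ}
    (hN : ∀ (s' : Finset ι) (L' R' : Set V) (p' : ι → ℕ → V) (e' : ι → ℕ), N ≤ s'.card →
      ChunkSystem G x L' R' s' p' e' c → False)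
    {K : Set V} (hK : G.Conn K)
    (hgap : ∀ y ∈ K, ∃ l ∈ s, ∃ k ≤ e l, p l k = y ∧ ¬ G.Adj x y)
    {s' : Finset ι} (hs' : s' ⊆ s) (hcard : 2 * N ≤ s'.card)
    (ht : ∀ m ∈ s', ∃ k ≤ e m, G.Touches (p m k) K) : False := by
  classical
  have hKx : G.Sep {x} K := sep_singleton_left.2 ⟨fun hx => by
      obtain ⟨l, hl, k, hk, e, -⟩ := hgap x hx
      exact h.x_ne l hl k hk e, fun ⟨y, hy, hxy⟩ => by
      obtain ⟨l, hl, k, hk, -, h'⟩ := hgap y hy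
      exact h' hxy⟩
  -- A path containing a non-neighbour of `x` has two distinct ends, both of them neighbours of `x`,
  -- so `c + 1 ≥ 2`.
  have hc : 1 ≤ c := by
    obtain ⟨y, hy⟩ := hK.1
    obtain ⟨l, hl, k, hk, rfl, hx⟩ := hgap y hy
    have hk0 : k ≠ 0 := by rintro rfl; exact hx (h.adj_left l hl)
    have hsub : {p l 0, p l (e l)} ⊆ seg (p l) 0 (e l) ∩ G.neighborSet x := by
      rintro y (rfl | rfl)
      · exact ⟨mem_seg_of le_rfl (Nat.zero_le _), h.adj_left l hl⟩
      · exact ⟨mem_seg_of (Nat.zero_le _) le_rfl, h.adj_right l hl⟩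
    have h1 := Set.ncard_le_ncard hsub (seg_finite.inter_of_left _)
    rw [Set.ncard_pair ((h.path l hl).ne (Nat.zero_le _) le_rfl (by omega))] at h1
    have := h.contacts l hl
    omega
  have hsplit := Finset.card_filter_add_card_filter_not (s := s')
    (fun m => ∃ k < e m, G.Touches (p m k) K)
  -- If `N` of the paths touch `K` before their last vertices, their initial segments lead from `L`
  -- to `K` and lose the contact of `x` at the end. If not, `N` paths touch `K` at their last
  -- vertices only, and these vertices alone link `K` to `R`, with one contact each.
  rcases Nat.lt_or_ge (s'.filter fun m => ∃ k < e m, G.Touches (p m k) K).card N with hlt | hge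
  · refine hN (s'.filter fun m => ¬ ∃ k < e m, G.Touches (p m k) K) K R
      (fun m _ => p m (e m)) (fun _ => 0) (by omega) ?_
    have hm : ∀ m ∈ s'.filter fun m => ¬ ∃ k < e m, G.Touches (p m k) K,
        m ∈ s ∧ G.Touches (p m (e m)) K := by
      intro m hm
      rw [Finset.mem_filter] at hm
      refine ⟨hs' hm.1, ?_⟩
      obtain ⟨k, hk, ht⟩ := ht m hm.1
      rcases hk.eq_or_lt with rfl | hk
      · exact ht
      · exact (hm.2 ⟨k, hk, ht⟩).elim
    refine ⟨hK, h.connR, hKx, h.sepR, fun l hl => IndPath.single _, ?_, ?_, ?_, ?_, ?_, ?_⟩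
    · exact fun l hl m hm' hlm _ _ _ _ =>
        h.disj l (hm l hl).1 m (hm m hm').1 hlm _ le_rfl _ le_rfl
    · exact fun l hl _ _ => h.x_ne l (hm l hl).1 _ le_rfl
    · exact fun l hl => (hm l hl).2
    · exact fun l hl => (h.right l (hm l hl).1 _ le_rfl).2 rfl
    · intro l hl
      refine le_trans (Set.ncard_le_ncard (t := {p l (e l)}) ?_ (Set.finite_singleton _)) ?_
      · rintro y ⟨⟨k, -, -, rfl⟩, -⟩; rfl
      · rw [Set.ncard_singleton]; exact hc
    -- Separation persists: a connected set of non-neighbours of `x` can leave `R` only through a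
    -- vertex of a path that touches `R`, and such a vertex is a neighbour of `x`.
    · rintro C hC hsub hCx ⟨y, hyC, hyK⟩ hCR
      have hyR : y ∉ R := by
        obtain ⟨l, hl, k, hk, rfl, -⟩ := hgap y hyK
        exact h.notMemR l hl k hk
      obtain ⟨q, hq, r, hr, hqr⟩ := hC.exists_adj_of_ne hCR fun h' => hyR (h' hyC)
      have : ∃ l ∈ s, ∃ k ≤ e l, p l k = r := by
        rcases hsub r hr.1 with h1 | h1 | ⟨l, hl, k, -, -, rfl⟩
        · obtain ⟨l, hl, k, hk, e, -⟩ := hgap r h1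
          exact ⟨l, hl, k, hk, e⟩
        · exact (hr.2 h1).elim
        · exact ⟨l, (hm l hl).1, e l, le_rfl, rfl⟩
      obtain ⟨l, hl, k, hk, rfl⟩ := this
      exact (h.not_touches_of_gap hl hk (hCx _ hr.1)).2 ⟨q, hq.2, hqr.symm⟩
  · have hex : ∀ m ∈ s'.filter fun m => ∃ k < e m, G.Touches (p m k) K,
        ∃ k < e m, G.Touches (p m k) K := fun m hm => (Finset.mem_filter.1 hm).2
    let e' : ι → ℕ := fun m => if h : ∃ k < e m, G.Touches (p m k) K then h.choose else 0
    have he' : ∀ m ∈ s'.filter fun m => ∃ k < e m, G.Touches (p m k) K,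
        m ∈ s ∧ e' m < e m ∧ G.Touches (p m (e' m)) K := by
      intro m hm
      have h' := hex m hm
      refine ⟨hs' (Finset.mem_filter.1 hm).1, ?_⟩
      simp only [e', dif_pos h']
      exact h'.choose_spec
    refine hN (s'.filter fun m => ∃ k < e m, G.Touches (p m k) K) L K p e' hge ?_
    refine ⟨h.connL, hK, h.sepL, hKx, fun l hl => (h.path l (he' l hl).1).prefix_le
      (he' l hl).2.1.le, ?_, ?_, ?_, fun l hl => (he' l hl).2.2, ?_, ?_⟩
    · intro l hl m hm hlm i hi j hj
      have := he' l hl; have := he' m hm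
      exact h.disj l (he' l hl).1 m (he' m hm).1 hlm _ (by omega) _ (by omega)
    · intro l hl i hi
      have := he' l hl
      exact h.x_ne l this.1 _ (by omega)
    · exact fun l hl => (h.left l (he' l hl).1 0 (Nat.zero_le _)).2 rfl
    · intro l hl
      obtain ⟨h1, h2, h3⟩ := he' l hl
      refine Nat.le_of_lt_succ (lt_of_lt_of_le (Set.ncard_lt_ncard ?_
        (seg_finite.inter_of_left _)) (h.contacts l h1))
      refine Set.ssubset_iff_exists.2 ⟨?_, p l (e l), ⟨mem_seg_of (Nat.zero_le _) le_rfl,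
        h.adj_right l h1⟩, ?_⟩
      · rintro _ ⟨⟨k, -, hk, rfl⟩, h'⟩
        exact ⟨mem_seg_of (by omega) (by omega), h'⟩
      · rintro ⟨⟨k, -, hk, e'⟩, -⟩
        have := (h.path l h1).inj k (by omega) _ le_rfl e'
        omega
    · rintro C hC hsub hCx hCL ⟨y, hyC, hyK⟩
      have hyL : y ∉ L := by
        obtain ⟨l, hl, k, hk, rfl, -⟩ := hgap y hyK
        exact h.notMemL l hl k hk
      obtain ⟨q, hq, r, hr, hqr⟩ := hC.exists_adj_of_ne hCL fun h' => hyL (h' hyC)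
      have : ∃ l ∈ s, ∃ k ≤ e l, p l k = r := by
        rcases hsub r hr.1 with h1 | h1 | ⟨l, hl, k, -, hk, rfl⟩
        · exact (hr.2 h1).elim
        · obtain ⟨l, hl, k, hk, e, -⟩ := hgap r h1
          exact ⟨l, hl, k, hk, e⟩
        · have := he' l hl
          exact ⟨l, this.1, k, by omega, rfl⟩
      obtain ⟨l, hl, k, hk, rfl⟩ := this
      exact (h.not_touches_of_gap hl hk (hCx _ hr.1)).1 ⟨q, hq.2, hqr.symm⟩

/-- Two separated paths of a tight system with an even total number of neighbours of `x`. -/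
theorem false_of_sep (h : TightSystem G x L R s p e c) (hθ : ¬ G.HasTheta)
    (hew : ¬ G.HasEvenWheel) {l m : ι} (hl : l ∈ s) (hm : m ∈ s)
    (hsep : G.Sep (seg (p l) 0 (e l)) (seg (p m) 0 (e m)))
    (heven : Even ((seg (p l) 0 (e l) ∩ G.neighborSet x).ncard +
      (seg (p m) 0 (e m) ∩ G.neighborSet x).ncard)) : False := by
  have hlm : ∀ i ≤ e l, ∀ j ≤ e m, p l i ≠ p m j ∧ ¬ G.Adj (p l i) (p m j) := fun i hi j hj =>
    hsep _ (mem_seg_of (Nat.zero_le _) hi) _ (mem_seg_of (Nat.zero_le _) hj)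
  -- Two paths of one vertex each are the ends of a theta through `x`, `L` and `R`. Otherwise the
  -- paths, joined through `L` and `R`, form a hole with at least three neighbours of `x`, an even
  -- number by assumption.
  by_cases h0 : e l = 0 ∧ e m = 0
  · have cl := h.left l hl 0 (Nat.zero_le _)
    have cm := h.left m hm 0 (Nat.zero_le _)
    have dl := h.right l hl 0 (Nat.zero_le _)
    have dm := h.right m hm 0 (Nat.zero_le _)
    have h00 := hlm 0 (Nat.zero_le _) 0 (Nat.zero_le _)
    refine hθ (hasTheta_of_conn' h00.1 h00.2 (A := {x}) (Conn.singleton x) h.connL h.connR h.sepL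
      h.sepR h.sep
      ⟨h.x_ne l hl 0 (Nat.zero_le _), h.notMemL l hl 0 (Nat.zero_le _),
        h.notMemR l hl 0 (Nat.zero_le _)⟩
      ⟨h.x_ne m hm 0 (Nat.zero_le _), h.notMemL m hm 0 (Nat.zero_le _),
        h.notMemR m hm 0 (Nat.zero_le _)⟩
      ⟨touches_singleton.2 (h.adj_left l hl).symm, cl.2 rfl, dl.2 h0.1.symm⟩
      ⟨touches_singleton.2 (h.adj_left m hm).symm, cm.2 rfl, dm.2 h0.2.symm⟩)
  · obtain ⟨q, n, hq, hqL, q0, qn, q0', qn'⟩ := h.connL.exists_minPath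
      (fun v => G.Adj (p l 0) v) (fun v => G.Adj (p m 0) v)
      ((h.left l hl 0 (Nat.zero_le _)).2 rfl) ((h.left m hm 0 (Nat.zero_le _)).2 rfl)
    obtain ⟨r, k, hr, hrR, r0, rk, r0', rk'⟩ := h.connR.exists_minPath
      (fun v => G.Adj (p l (e l)) v) (fun v => G.Adj (p m (e m)) v)
      ((h.right l hl _ le_rfl).2 rfl) ((h.right m hm _ le_rfl).2 rfl)
    have p1 := (h.path l hl).reverse.app hq
      (fun i hi j hj heq => h.notMemL l hl _ (by omega) (heq ▸ hqL j hj))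
      (fun i hi j hj => by
        constructor
        · intro hadj
          have h1 := (h.left l hl (e l - i) (by omega)).1 ⟨_, hqL j hj, hadj⟩
          rw [h1] at hadj
          exact ⟨by omega, q0' j hj hadj⟩
        · rintro ⟨rfl, rfl⟩
          simpa using q0)
    have p2 := p1.app (h.path m hm)
      (fun i hi j hj heq => by
        rcases app_cases (u := fun i => p l (e l - i)) (v := q) hi with ⟨h1, h2⟩ | ⟨a, ha, h1, h2⟩
          <;> rw [h2] at heq
        · exact (hlm _ (by omega) j hj).1 heq
        · exact h.notMemL m hm j hj (heq ▸ hqL a ha))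
      (fun i hi j hj => by
        rcases app_cases (u := fun i => p l (e l - i)) (v := q) hi with ⟨h1, h2⟩ | ⟨a, ha, h1, h2⟩
          <;> rw [h2]
        · exact iff_of_false (hlm _ (by omega) j hj).2 (by omega)
        · constructor
          · intro hadj
            obtain rfl := (h.left m hm j hj).1 ⟨_, hqL a ha, hadj.symm⟩
            have := qn' a ha hadj.symm
            omega
          · rintro ⟨h3, rfl⟩
            obtain rfl : a = n := by omega
            exact qn.symm)
    have hhole := p2.isHole_union hr (by omega) (by omega)
      (fun i hi j hj heq => by
        rcases app_cases (v := p m) hi with ⟨h1, h2⟩ | ⟨a, ha, h1, h2⟩ <;> rw [h2] at heq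
        · rcases app_cases (u := fun i => p l (e l - i)) (v := q) h1 with
            ⟨h3, h4⟩ | ⟨a, ha, h3, h4⟩ <;> rw [h4] at heq
          · exact h.notMemR l hl _ (by omega) (heq ▸ hrR j hj)
          · exact (h.sep _ (hqL a ha) _ (hrR j hj)).1 heq
        · exact h.notMemR m hm a ha (heq ▸ hrR j hj))
      (fun i hi j hj => by
        rcases app_cases (v := p m) hi with ⟨h1, h2⟩ | ⟨a, ha, h1, h2⟩ <;> rw [h2]
        · rcases app_cases (u := fun i => p l (e l - i)) (v := q) h1 with
            ⟨h3, h4⟩ | ⟨a, ha, h3, h4⟩ <;> rw [h4]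
          · constructor
            · intro hadj
              have h5 := (h.right l hl (e l - i) (by omega)).1 ⟨_, hrR j hj, hadj⟩
              rw [h5] at hadj
              exact Or.inl ⟨by omega, r0' j hj hadj⟩
            · rintro (⟨rfl, rfl⟩ | ⟨h5, rfl⟩)
              · simpa using r0
              · omega
          · refine iff_of_false (h.sep _ (hqL a ha) _ (hrR j hj)).2 (by omega)
        · constructor
          · intro hadj
            obtain rfl := (h.right m hm a ha).1 ⟨_, hrR j hj, hadj⟩
            exact Or.inr ⟨by omega, rk' j hj hadj⟩
          · rintro (⟨h5, h6⟩ | ⟨h5, rfl⟩)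
            · omega
            · obtain rfl : a = e m := by omega
              exact rk)
    rw [seg_app, seg_app, seg_reverse] at hhole
    have hset : (seg (p l) 0 (e l) ∪ seg q 0 n ∪ seg (p m) 0 (e m) ∪ seg r 0 k) ∩ G.neighborSet x =
        (seg (p l) 0 (e l) ∩ G.neighborSet x) ∪ (seg (p m) 0 (e m) ∩ G.neighborSet x) := by
      ext y
      simp only [Set.mem_inter_iff, Set.mem_union, mem_neighborSet]
      constructor
      · rintro ⟨((h1 | ⟨a, -, ha, rfl⟩) | h1) | ⟨a, -, ha, rfl⟩, hy⟩
        · exact Or.inl ⟨h1, hy⟩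
        · exact ((h.sepL x rfl _ (hqL a ha)).2 hy).elim
        · exact Or.inr ⟨h1, hy⟩
        · exact ((h.sepR x rfl _ (hrR a ha)).2 hy).elim
      · tauto
    have hcard := Set.ncard_union_eq (s := seg (p l) 0 (e l) ∩ G.neighborSet x)
      (t := seg (p m) 0 (e m) ∩ G.neighborSet x)
      (Set.disjoint_left.2 fun y hy hy' => (hsep y hy.1 y hy'.1).1 rfl)
      (seg_finite.inter_of_left _) (seg_finite.inter_of_left _)
    have hpos : ∀ o ∈ s, 1 ≤ (seg (p o) 0 (e o) ∩ G.neighborSet x).ncard ∧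
        (e o ≠ 0 → 2 ≤ (seg (p o) 0 (e o) ∩ G.neighborSet x).ncard) := by
      intro o ho
      have hsub : {p o 0, p o (e o)} ⊆ seg (p o) 0 (e o) ∩ G.neighborSet x := by
        rintro y (rfl | rfl)
        · exact ⟨mem_seg_of le_rfl (Nat.zero_le _), h.adj_left o ho⟩
        · exact ⟨mem_seg_of (Nat.zero_le _) le_rfl, h.adj_right o ho⟩
      have h1 := Set.ncard_le_ncard hsub (seg_finite.inter_of_left _)
      constructor
      · refine le_trans ?_ h1
        rw [Nat.succ_le_iff, Set.ncard_pos (Set.toFinite _)]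
        exact ⟨_, Or.inl rfl⟩
      · intro h0
        rwa [Set.ncard_pair ((h.path o ho).ne (Nat.zero_le _) le_rfl (by omega))] at h1
    refine hew ⟨_, x, hhole, ?_, ?_, ?_⟩
    · rintro (((⟨a, -, ha, heq⟩ | ⟨a, -, ha, heq⟩) | ⟨a, -, ha, heq⟩) | ⟨a, -, ha, heq⟩)
      · exact h.x_ne l hl a ha heq
      · exact (h.sepL x rfl _ (hqL a ha)).1 heq.symm
      · exact h.x_ne m hm a ha heq
      · exact (h.sepR x rfl _ (hrR a ha)).1 heq.symm
    · rw [hset, hcard]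
      have h1 := hpos l hl; have h2 := hpos m hm
      by_contra hc
      have : e l = 0 ∧ e m = 0 := ⟨by by_contra h3; have := h1.2 h3; omega,
        by by_contra h3; have := h2.2 h3; omega⟩
      exact h0 this
    · rw [hset, hcard]; exact heven

end TightSystem
end SimpleGraph

namespace SimpleGraph

namespace TightSystem
variable {V : Type*} {G : SimpleGraph V}
variable {ι : Type*} {x : V} {L R : Set V} {s : Finset ι} {p : ι → ℕ → V} {e : ι → ℕ} {c : ℕ}

/-- Few paths have contacts with the non-neighbours of `x` on a given path. -/
theorem false_of_conflicts (h : TightSystem G x L R s p e (c + 1)) {N : ℕ}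
    (hN : ∀ (s' : Finset ι) (L' R' : Set V) (p' : ι → ℕ → V) (e' : ι → ℕ), N ≤ s'.card →
      ChunkSystem G x L' R' s' p' e' c → False)
    {l : ι} (hl : l ∈ s) {T : Finset ι} (hT : T ⊆ s) (hcard : (c + 1) * (2 * N) + 1 ≤ T.card)
    (hconf : ∀ m ∈ T, ∃ k ≤ e l, ¬ G.Adj x (p l k) ∧ ∃ i ≤ e m, G.Adj (p m i) (p l k)) : False := by
  classical
  have hex : ∀ m, ∃ k, m ∈ T → k ≤ e l ∧ ¬ G.Adj x (p l k) ∧ ∃ i ≤ e m, G.Adj (p m i) (p l k) := by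
    intro m
    by_cases hm : m ∈ T
    · obtain ⟨k, hk⟩ := hconf m hm; exact ⟨k, fun _ => hk⟩
    · exact ⟨0, fun h' => (hm h').elim⟩
  choose κ hκ using hex
  -- The last neighbour of `x` before the conflict names the gap in which the conflict occurs. There
  -- are at most `c + 1` gaps, so more than `2 * N` paths conflict with the same one.
  let φ : ι → ℕ := fun m => Nat.findGreatest (fun i => G.Adj x (p l i)) (κ m)
  let I : Finset ℕ := (Finset.range (e l + 1)).filter fun i => G.Adj x (p l i)
  have hI : I.card ≤ c + 1 := by
    refine le_trans (le_of_eq ?_) (h.contacts l hl)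
    have hinj : Set.InjOn (p l) (I : Set ℕ) := by
      intro i hi j hj hij
      simp only [I, Finset.coe_filter, Finset.mem_range] at hi hj
      exact (h.path l hl).inj i (Nat.le_of_lt_succ hi.1) j (Nat.le_of_lt_succ hj.1) hij
    rw [← Set.ncard_coe_finset, ← hinj.ncard_image]
    congr 1
    ext y
    simp only [I, Finset.coe_filter, Finset.mem_range, Set.mem_image, Set.mem_inter_iff, mem_seg,
      mem_neighborSet]
    constructor
    · rintro ⟨i, ⟨hi, hx⟩, rfl⟩; exact ⟨⟨i, by omega, by omega, rfl⟩, hx⟩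
    · rintro ⟨⟨i, -, hi, rfl⟩, hx⟩; exact ⟨i, ⟨by omega, hx⟩, rfl⟩
  have hφ : ∀ m ∈ T, φ m ∈ I ∧ φ m ≤ κ m ∧ ∀ i, φ m < i → i ≤ κ m → ¬ G.Adj x (p l i) := by
    intro m hm
    have h1 := Nat.findGreatest_spec (P := fun i => G.Adj x (p l i)) (Nat.zero_le (κ m))
      (h.adj_left l hl)
    have h2 := Nat.findGreatest_le (P := fun i => G.Adj x (p l i)) (κ m)
    refine ⟨?_, h2, fun i hi hi' hx => ?_⟩
    · have := (hκ m hm).1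
      simp only [I, Finset.mem_filter, Finset.mem_range]
      exact ⟨Nat.lt_succ_of_le (h2.trans this), h1⟩
    · exact absurd (Nat.le_findGreatest (P := fun i => G.Adj x (p l i)) hi' hx) (not_le.2 hi)
  have hTne : T.Nonempty := Finset.card_pos.1 (by omega)
  obtain ⟨m₀, hm₀⟩ := hTne
  obtain ⟨i₀, -, hi₀⟩ := Finset.exists_lt_card_fiber_of_mul_lt_card_of_maps_to (s := T) (t := I)
    (f := φ) (n := 2 * N) (fun m hm => (hφ m hm).1) (by
      have := Nat.mul_le_mul_right (2 * N) hI; omega)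
  set T' := T.filter fun m => φ m = i₀
  have hT' : ∀ m ∈ T', m ∈ T ∧ φ m = i₀ := fun m hm => Finset.mem_filter.1 hm
  obtain ⟨m₁, hm₁⟩ := Finset.card_pos.1 (show 0 < T'.card by omega)
  set W : Set V := {y | ∃ k ≤ e l, p l k = y ∧ ¬ G.Adj x y} with hW
  have hgt : ∀ m ∈ T', i₀ + 1 ≤ κ m := by
    intro m hm
    obtain ⟨h1, h2⟩ := hT' m hm
    have h3 := hφ m h1
    rw [h2] at h3
    by_contra hc
    have : κ m = i₀ := by omega
    have h4 := h3.1
    simp only [I, Finset.mem_filter] at h4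
    exact (hκ m h1).2.1 (this ▸ h4.2)
  have hbase : p l (i₀ + 1) ∈ W := by
    obtain ⟨h1, h2⟩ := hT' m₁ hm₁
    have h3 := hφ m₁ h1
    have h4 := hgt m₁ hm₁
    have h5 := (hκ m₁ h1).1
    exact ⟨i₀ + 1, by omega, rfl, h3.2.2 _ (by omega) h4⟩
  refine h.false_of_gap_set hN (conn_comp hbase) (fun y hy => ?_)
    (fun m hm => hT (hT' m hm).1) hi₀.le (fun m hm => ?_)
  · obtain ⟨k, hk, rfl, hx⟩ := comp_subset hbase hy
    exact ⟨l, hl, k, hk, rfl, hx⟩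
  · obtain ⟨h1, h2⟩ := hT' m hm
    have h3 := hφ m h1
    have h4 := hgt m hm
    obtain ⟨h5, h6, i, hi, hadj⟩ := hκ m h1
    refine ⟨i, hi, p l (κ m), ?_, hadj⟩
    have hc : G.Conn (ico (p l) (i₀ + 1) (κ m + 1)) :=
      (h.path l hl).conn_ico (by omega) (by omega)
    refine hc.subset_comp ?_ (mem_ico_of le_rfl (by omega)) mem_comp_self
      (mem_ico_of h4 (Nat.lt_succ_self _))
    refine ico_subset fun k hk hk' => ⟨k, by omega, rfl, h3.2.2 k (by omega) (by omega)⟩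

end TightSystem

/-- A large chunk system does not exist in a (theta, even wheel, `K_t`)-free graph. -/
theorem exists_chunk_bound (c t : ℕ) :
    ∃ N : ℕ, ∀ {V : Type*} {ι : Type*} (G : SimpleGraph V), ¬ G.HasTheta → ¬ G.HasEvenWheel →
      G.CliqueFree t → ∀ (x : V) (s : Finset ι) (L R : Set V) (p : ι → ℕ → V) (e : ι → ℕ),
        N ≤ s.card → ChunkSystem G x L R s p e c → False := by
  classical
  induction c with
  | zero =>
    -- For `c = 0` a single path suffices, as a tight path begins with a neighbour of `x`.
    refine ⟨1, fun G _ _ _ x s L R p e hs h => ?_⟩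
    obtain ⟨L', R', p', e', h'⟩ := h.exists_tight
    obtain ⟨l, hl⟩ := Finset.card_pos.1 (show 0 < s.card by omega)
    have h1 := h'.contacts l hl
    rw [Nat.le_zero, Set.ncard_eq_zero (seg_finite.inter_of_left _)] at h1
    have : p' l 0 ∈ seg (p' l) 0 (e' l) ∩ G.neighborSet x :=
      ⟨mem_seg_of le_rfl (Nat.zero_le _), h'.adj_left l hl⟩
    rw [h1] at this
    exact this
  | succ c ih =>
    obtain ⟨N, hN⟩ := ih
    -- Enough indices to apply `false_of_conflicts` to all but one of them, to find a clique of size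
    -- `t`, and to find a four-cycle.
    obtain ⟨n, hn⟩ : ∃ n, n = (c + 1) * (2 * N) + 2 + t + 4 := ⟨_, rfl⟩
    -- The colour of a pair of paths records conflicts in either direction, the parity of the total
    -- number of contacts, and the adjacencies between the enumerated contacts.
    obtain ⟨M, hM⟩ := exists_ramsey (Bool × Bool × Bool × (Fin (c + 1) → Fin (c + 1) → Bool)) n
    refine ⟨M, fun {V ι} G hθ hew hK x s L R p e hs h => ?_⟩
    obtain ⟨L', R', p', e', h'⟩ := h.exists_tight
    clear h
    let S : ι → Set V := fun l => seg (p' l) 0 (e' l) ∩ G.neighborSet x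
    have hSfin : ∀ l, (S l).Finite := fun l => seg_finite.inter_of_left _
    -- an enumeration of the neighbours of `x` on each path
    have henum : ∀ l, ∃ y : Fin (c + 1) → V, l ∈ s → Set.range y = S l := by
      intro l
      by_cases hl : l ∈ s
      · have hcard := h'.contacts l hl
        have hmem : p' l 0 ∈ S l := ⟨mem_seg_of le_rfl (Nat.zero_le _), h'.adj_left l hl⟩
        have hfc : (hSfin l).toFinset.card ≤ c + 1 := by
          rwa [← Set.ncard_eq_toFinset_card _ (hSfin l)]
        let eqv := (hSfin l).toFinset.equivFin
        -- Surplus indices repeat the contact `p' l 0`, so that all paths share one index set for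
        -- their contacts.
        refine ⟨fun i => if hi : (i : ℕ) < (hSfin l).toFinset.card then (eqv.symm ⟨i, hi⟩ : V)
          else p' l 0, fun _ => ?_⟩
        ext z
        constructor
        · rintro ⟨i, rfl⟩
          dsimp only
          split_ifs with hi
          · exact (hSfin l).mem_toFinset.1 (eqv.symm ⟨i, hi⟩).2
          · exact hmem
        · intro hz
          let j := eqv ⟨z, (hSfin l).mem_toFinset.2 hz⟩
          refine ⟨⟨j, lt_of_lt_of_le j.2 hfc⟩, ?_⟩
          simp [j]
      · exact ⟨fun _ => x, fun h => (hl h).elim⟩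
    choose y hy using henum
    let conf : ι → ι → Prop := fun l m =>
      ∃ k ≤ e' l, ¬ G.Adj x (p' l k) ∧ ∃ i ≤ e' m, G.Adj (p' m i) (p' l k)
    obtain ⟨f, ⟨k1, k2, k3, k4⟩, hf, hinj, hcol⟩ := hM s hs fun l m =>
      (decide (conf l m), decide (conf m l), decide (Even ((S l).ncard + (S m).ncard)),
        fun i j => decide (G.Adj (y l i) (y m j)))
    have hcol' : ∀ i j, i < j → (conf (f i) (f j) ↔ k1 = true) ∧ (conf (f j) (f i) ↔ k2 = true) ∧
        (Even ((S (f i)).ncard + (S (f j)).ncard) ↔ k3 = true) ∧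
        ∀ a b, G.Adj (y (f i) a) (y (f j) b) ↔ k4 a b = true := by
      intro i j hij
      have := hcol i j hij
      simp only [Prod.mk.injEq] at this
      obtain ⟨h1, h2, h3, h4⟩ := this
      rw [← h1, ← h2, ← h3, ← h4]
      simp
    have hN' : ∀ (s' : Finset ι) (L' R' : Set V) (p' : ι → ℕ → V) (e' : ι → ℕ), N ≤ s'.card →
      ChunkSystem G x L' R' s' p' e' c → False := fun s' L' R' p' e' h1 h2 =>
        hN G hθ hew hK x s' L' R' p' e' h1 h2
    have hbig : ∀ i₀ : Fin n, (c + 1) * (2 * N) + 1 ≤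
        ((Finset.univ.erase i₀).image f).card := by
      intro i₀
      rw [Finset.card_image_of_injective _ hinj, Finset.card_erase_of_mem (Finset.mem_univ _),
        Finset.card_univ, Fintype.card_fin]
      omega
    have hbigsub : ∀ i₀ : Fin n, ((Finset.univ.erase i₀).image f) ⊆ s := by
      intro i₀ l hl
      obtain ⟨i, -, rfl⟩ := Finset.mem_image.1 hl
      exact hf i
    -- With this colour the first path would conflict with all the others; for `k2` the last path
    -- plays this part.
    have hk1 : k1 ≠ true := by
      intro hk
      refine h'.false_of_conflicts hN' (hf ⟨0, by omega⟩) (hbigsub ⟨0, by omega⟩) (hbig _) ?_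
      intro m hm
      obtain ⟨i, hi, rfl⟩ := Finset.mem_image.1 hm
      refine ((hcol' ⟨0, by omega⟩ i ?_).1).2 hk
      rw [Finset.mem_erase] at hi
      have : (i : ℕ) ≠ 0 := fun h0 => hi.1 (Fin.ext h0)
      exact Fin.lt_def.2 (Nat.pos_of_ne_zero this)
    have hk2 : k2 ≠ true := by
      intro hk
      refine h'.false_of_conflicts hN' (hf ⟨n - 1, by omega⟩) (hbigsub ⟨n - 1, by omega⟩)
        (hbig _) ?_
      intro m hm
      obtain ⟨i, hi, rfl⟩ := Finset.mem_image.1 hm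
      refine ((hcol' i ⟨n - 1, by omega⟩ ?_).2.1).2 hk
      rw [Finset.mem_erase] at hi
      have : (i : ℕ) ≠ n - 1 := fun h0 => hi.1 (Fin.ext h0)
      have := i.2
      exact Fin.lt_def.2 (show (i : ℕ) < n - 1 by omega)
    have hadjx : ∀ l ∈ s, ∀ a, G.Adj x (y l a) ∧ ∃ i ≤ e' l, p' l i = y l a := by
      intro l hl a
      have : y l a ∈ S l := (hy l hl) ▸ Set.mem_range_self a
      obtain ⟨⟨i, -, hi, h1⟩, h2⟩ := this
      exact ⟨h2, i, hi, h1⟩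
    -- Otherwise the contacts with index `a` on `t` of the paths form a clique.
    have hdiag : ∀ a, k4 a a ≠ true := by
      intro a hk
      refine not_cliqueFree_of_fin (G := G)
        (fun i : Fin t => y (f (Fin.castLE (by omega) i)) a) ?_ hK
      intro i j hij
      exact ((hcol' _ _ (by simpa using hij)).2.2.2 a a).2 hk
    have hney : ∀ i j a b, i ≠ j → y (f i) a ≠ y (f j) b := by
      intro i j a b hij heq
      obtain ⟨-, i', hi', h1⟩ := hadjx _ (hf i) a
      obtain ⟨-, j', hj', h2⟩ := hadjx _ (hf j) b
      exact h'.disj _ (hf i) _ (hf j) (fun h0 => hij (hinj h0)) i' hi' j' hj'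
        (h1.trans (heq.trans h2.symm))
    have hoff : ∀ a b, k4 a b ≠ true := by
      intro a b hk
      -- a four-cycle complete to `x`
      have i0 : (⟨0, by omega⟩ : Fin n) < ⟨1, by omega⟩ := Fin.lt_def.2 (by norm_num)
      have i1 : (⟨1, by omega⟩ : Fin n) < ⟨2, by omega⟩ := Fin.lt_def.2 (by norm_num)
      have i2 : (⟨2, by omega⟩ : Fin n) < ⟨3, by omega⟩ := Fin.lt_def.2 (by norm_num)
      set j0 : Fin n := ⟨0, by omega⟩
      set j1 : Fin n := ⟨1, by omega⟩
      set j2 : Fin n := ⟨2, by omega⟩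
      set j3 : Fin n := ⟨3, by omega⟩
      have A : ∀ i j, i < j → G.Adj (y (f i) a) (y (f j) b) := fun i j hij =>
        ((hcol' i j hij).2.2.2 a b).2 hk
      have B : ∀ i j o, i < j → ¬ G.Adj (y (f i) o) (y (f j) o) := fun i j o hij hadj =>
        hdiag o (((hcol' i j hij).2.2.2 o o).1 hadj)
      have q1 : G.IndPath (app (fun _ => y (f j0) a) 0 fun _ => y (f j2) b) 1 :=
        (IndPath.single _).snoc (fun i hi => hney _ _ _ _ (i0.trans i1).ne) fun i hi =>
          iff_of_true (A _ _ (i0.trans i1)).symm (by omega)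
      have v0 : app (fun _ => y (f j0) a) 0 (fun _ => y (f j2) b) 0 = y (f j0) a := rfl
      have v1 : app (fun _ => y (f j0) a) 0 (fun _ => y (f j2) b) 1 = y (f j2) b := rfl
      set q := app (fun _ => y (f j0) a) 0 fun _ => y (f j2) b
      have q2 : G.IndPath (app q 1 fun _ => y (f j1) a) 2 := by
        refine q1.snoc (fun i hi => ?_) fun i hi => ?_
        · interval_cases i
          · rw [v0]; exact hney _ _ _ _ i0.ne
          · rw [v1]; exact hney _ _ _ _ i1.ne'
        · interval_cases i
          · rw [v0]; exact iff_of_false (fun h0 => B _ _ a i0 h0.symm) (by omega)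
          · rw [v1]; exact iff_of_true (A _ _ i1) rfl
      have w0 : app q 1 (fun _ => y (f j1) a) 0 = y (f j0) a := rfl
      have w1 : app q 1 (fun _ => y (f j1) a) 1 = y (f j2) b := rfl
      have w2 : app q 1 (fun _ => y (f j1) a) 2 = y (f j1) a := rfl
      set r := app q 1 fun _ => y (f j1) a
      refine hew (q2.hasEvenWheel_of_adj le_rfl (w := y (f j3) b) (z := x) ?_ ?_ ?_
        (hadjx _ (hf _) b).1 {0, 1, 2} ?_ (by decide) (by decide))
      · intro i hi
        interval_cases i
        · rw [w0]; exact hney _ _ _ _ (i0.trans (i1.trans i2)).ne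
        · rw [w1]; exact hney _ _ _ _ i2.ne
        · rw [w2]; exact hney _ _ _ _ (i1.trans i2).ne
      · intro i hi
        interval_cases i
        · rw [w0]; exact iff_of_true (A _ _ (i0.trans (i1.trans i2))).symm (by omega)
        · rw [w1]; exact iff_of_false (fun h0 => B _ _ b i2 h0.symm) (by omega)
        · rw [w2]; exact iff_of_true (A _ _ (i1.trans i2)).symm (by omega)
      · intro i hi
        interval_cases i
        · rw [w0]; exact (hadjx _ (hf _) a).1.ne'
        · rw [w1]; exact (hadjx _ (hf _) b).1.ne'
        · rw [w2]; exact (hadjx _ (hf _) a).1.ne'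
      · intro i
        simp only [Finset.mem_insert, Finset.mem_singleton]
        constructor
        · rintro (rfl | rfl | rfl)
          · rw [w0]; exact ⟨by omega, (hadjx _ (hf _) a).1⟩
          · rw [w1]; exact ⟨by omega, (hadjx _ (hf _) b).1⟩
          · rw [w2]; exact ⟨by omega, (hadjx _ (hf _) a).1⟩
        · rintro ⟨hi, -⟩; omega
    have hsepij : ∀ i j, i < j → G.Sep (seg (p' (f i)) 0 (e' (f i)))
        (seg (p' (f j)) 0 (e' (f j))) := by
      rintro i j hij _ ⟨a, -, ha, rfl⟩ _ ⟨b, -, hb, rfl⟩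
      refine ⟨h'.disj _ (hf i) _ (hf j) (fun h0 => hij.ne (hinj h0)) a ha b hb, fun hadj => ?_⟩
      obtain ⟨c1, c2, -, c4⟩ := hcol' i j hij
      by_cases hxa : G.Adj x (p' (f i) a)
      · by_cases hxb : G.Adj x (p' (f j) b)
        · have m1 : p' (f i) a ∈ Set.range (y (f i)) := by
            rw [hy _ (hf i)]; exact ⟨mem_seg_of (Nat.zero_le _) ha, hxa⟩
          have m2 : p' (f j) b ∈ Set.range (y (f j)) := by
            rw [hy _ (hf j)]; exact ⟨mem_seg_of (Nat.zero_le _) hb, hxb⟩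
          obtain ⟨a', ha'⟩ := m1
          obtain ⟨b', hb'⟩ := m2
          rw [← ha', ← hb'] at hadj
          exact hoff a' b' ((c4 a' b').1 hadj)
        · exact hk2 (c2.1 ⟨b, hb, hxb, a, ha, hadj⟩)
      · exact hk1 (c1.1 ⟨a, ha, hxa, b, hb, hadj.symm⟩)
    have i0 : (⟨0, by omega⟩ : Fin n) < ⟨1, by omega⟩ := Fin.lt_def.2 (by norm_num)
    have i1 : (⟨1, by omega⟩ : Fin n) < ⟨2, by omega⟩ := Fin.lt_def.2 (by norm_num)
    set j0 : Fin n := ⟨0, by omega⟩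
    set j1 : Fin n := ⟨1, by omega⟩
    set j2 : Fin n := ⟨2, by omega⟩
    -- Among three numbers two have an even sum, and the parity colour is constant.
    have hk3 : k3 = true := by
      have h1 := (hcol' _ _ i0).2.2.1
      have h2 := (hcol' _ _ i1).2.2.1
      have h3 := (hcol' _ _ (i0.trans i1)).2.2.1
      by_contra hk
      rw [iff_false_right hk, Nat.not_even_iff] at h1 h2 h3
      omega
    exact h'.false_of_sep hθ hew (hf j0) (hf j1) (hsepij _ _ i0) ((hcol' _ _ i0).2.2.1.2 hk3)

end SimpleGraph

/-! ### Minimal connected sets touching all of `X`, and their branches. -/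

namespace SimpleGraph
variable {V : Type*} {G : SimpleGraph V}

/-- The hypothesis applies to a closed set and to its complement alike; both would contain `v` if
both met `C`. -/
theorem conn_of_forall_mem {C : Set V} {v : V} (hv : v ∈ C)
    (h : ∀ S : Set V, (C ∩ S).Nonempty → (∀ x ∈ C, x ∈ S → ∀ y ∈ C, G.Adj x y → y ∈ S) → v ∈ S) :
    G.Conn C := by
  refine ⟨⟨v, hv⟩, fun S hS hcl => ?_⟩
  have h1 := h S hS hcl
  intro y hy
  by_contra hyS
  exact h Sᶜ ⟨y, hy, hyS⟩ (fun p hp hpS q hq hpq hqS => hpS (hcl q hq hqS p hp hpq.symm)) h1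

/-- `M` is a connected subset of `D`, of least cardinality, with contacts with all of `X`. -/
structure MinConn (G : SimpleGraph V) (X D M : Set V) : Prop where
  sub : M ⊆ D
  conn : G.Conn M
  touches : ∀ x ∈ X, G.Touches x M
  min : ∀ M' ⊆ D, G.Conn M' → (∀ x ∈ X, G.Touches x M') → M.ncard ≤ M'.ncard

theorem exists_minConn {X D : Set V} (hD : G.Conn D) (h : ∀ x ∈ X, G.Touches x D) :
    ∃ M, MinConn G X D M := by
  classical
  have hex : ∃ n, ∃ M ⊆ D, G.Conn M ∧ (∀ x ∈ X, G.Touches x M) ∧ M.ncard = n :=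
    ⟨_, D, le_rfl, hD, h, rfl⟩
  obtain ⟨M, h1, h2, h3, h4⟩ := Nat.find_spec hex
  exact ⟨M, h1, h2, h3, fun M' a b c => h4 ▸ Nat.find_min' hex ⟨M', a, b, c, rfl⟩⟩

/-- The part of `M` cut off from `v` by `g`, together with `g`. -/
def branch (G : SimpleGraph V) (M : Set V) (g v : V) : Set V := M \ G.comp (M \ {g}) v

theorem branch_subset {M : Set V} {g v : V} : G.branch M g v ⊆ M := Set.sdiff_subset

section branch
variable {M : Set V} {g g' v : V}

theorem self_mem_branch (hg : g ∈ M) (hv : v ∈ M) (hne : v ≠ g) : g ∈ G.branch M g v :=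
  ⟨hg, fun h => (comp_subset (show v ∈ M \ {g} from ⟨hv, hne⟩) h).2 rfl⟩

theorem notMem_branch : v ∉ G.branch M g v := fun h => h.2 mem_comp_self

theorem mem_compl_branch {y : V} (hy : y ∈ M) (hyb : y ∉ G.branch M g v) :
    y ∈ G.comp (M \ {g}) v := by
  by_contra h; exact hyb ⟨hy, h⟩

theorem eq_of_adj_branch {x y : V} (hx : x ∈ G.branch M g v) (hy : y ∈ M)
    (hyb : y ∉ G.branch M g v) (h : G.Adj x y) : x = g := by
  by_contra hne
  exact hx.2 (comp_closed (mem_compl_branch hy hyb) ⟨hx.1, hne⟩ h.symm)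

/-- In the connected set `M` one can leave the branch towards `v` only through `g`, so every part of
the branch is joined to `g` inside it. -/
theorem conn_branch (hM : G.Conn M) (hg : g ∈ M) (hv : v ∈ M) (hne : v ≠ g) :
    G.Conn (G.branch M g v) := by
  refine conn_of_forall_mem (self_mem_branch hg hv hne) fun S hS hcl => ?_
  by_contra hgS
  obtain ⟨x, hx, y, hy, hxy⟩ := hM.exists_adj_of_ne (S := G.branch M g v ∩ S)
    (by obtain ⟨x, hx, hxS⟩ := hS; exact ⟨x, hx.1, hx, hxS⟩)
    (fun h => notMem_branch (h hv).1)
  by_cases hyb : y ∈ G.branch M g v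
  · exact hy.2 ⟨hyb, hcl x hx.2.1 hx.2.2 y hyb hxy⟩
  · exact hgS (eq_of_adj_branch hx.2.1 hy.1 hyb hxy ▸ hx.2.2)

theorem branch_subset_comp (hM : G.Conn M) (hg' : g' ∈ M) (hv : v ∈ M) (hvg' : v ≠ g')
    (h1 : g ∈ G.comp (M \ {g'}) v) (h2 : g' ∈ G.comp (M \ {g}) v) :
    G.branch M g' v ⊆ G.comp (M \ {g}) v := by
  have hg'b := self_mem_branch (G := G) hg' hv hvg'
  exact (conn_branch hM hg' hv hvg').subset_comp (fun y hy => ⟨hy.1, fun e => hy.2 (e ▸ h1)⟩) hg'b h2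

/-- As neither `g` nor `g'` is cut off from `v` by the other, each branch lies in the component of
`v` that defines the other. Hence the branches are disjoint, and an edge between them leaves each at
its tip. -/
theorem branch_branch (hM : G.Conn M) (hg : g ∈ M) (hg' : g' ∈ M) (hv : v ∈ M)
    (hvg : v ≠ g) (hvg' : v ≠ g')
    (h1 : g ∈ G.comp (M \ {g'}) v) (h2 : g' ∈ G.comp (M \ {g}) v) {x y : V}
    (hx : x ∈ G.branch M g v) (hy : y ∈ G.branch M g' v) :
    x ≠ y ∧ (G.Adj x y → x = g ∧ y = g') := by
  have s1 := branch_subset_comp hM hg' hv hvg' h1 h2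
  have s2 := branch_subset_comp hM hg hv hvg h2 h1
  have hxy : x ≠ y := fun e => hx.2 (e ▸ s1 hy)
  refine ⟨hxy, fun h => ⟨eq_of_adj_branch hx hy.1 (fun h' => h'.2 (s1 hy)) h,
    eq_of_adj_branch hy hx.1 (fun h' => h'.2 (s2 hx)) h.symm⟩⟩

theorem mem_comp_of_adj (hg : g ∈ M) (hne : g ≠ g') (h : G.Adj v g) :
    g ∈ G.comp (M \ {g'}) v := comp_closed mem_comp_self ⟨hg, hne⟩ h

end branch

namespace MinConn
variable {d : ℕ} {a : V} {X D M : Set V}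

theorem notMem_of_X (hM : MinConn G X D M) (hS : Setting G d a X D) {z : V} (hz : z ∈ X) :
    z ∉ M := fun h => hS.disj z hz (hM.sub h)

variable [Finite V]

theorem exists_private (hM : MinConn G X D M) {C : Set V} (hC : G.Conn C) (hCM : C ⊂ M) :
    ∃ z ∈ X, ¬ G.Touches z C := by
  by_contra! h
  exact absurd (hM.min C (hCM.1.trans hM.sub) hC h) (not_le.2 (Set.ncard_lt_ncard hCM))

/-- The component of `v` in `M \ {g}` is connected and smaller than `M`, so by minimality it is not
touched by some `z` in `X`. All neighbours of `z` in `M` then lie in the branch. -/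
theorem exists_private_branch (hM : MinConn G X D M) {g v : V} (hg : g ∈ M) (hv : v ∈ M)
    (hne : v ≠ g) : ∃ z ∈ X, ∀ y ∈ M, G.Adj z y → y ∈ G.branch M g v := by
  have hv' : v ∈ M \ {g} := ⟨hv, hne⟩
  obtain ⟨z, hz, hnt⟩ := hM.exists_private (conn_comp hv')
    (Set.ssubset_iff_exists.2 ⟨(comp_subset hv').trans Set.sdiff_subset, g, hg,
      (self_mem_branch hg hv hne).2⟩)
  exact ⟨z, hz, fun y hy h => by
    by_contra hyb
    exact hnt ⟨y, mem_compl_branch hy hyb, h⟩⟩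

/-- An arm of a trident at `v` through its neighbour `g`. -/
theorem exists_arm (hM : MinConn G X D M) {g v : V} (hg : g ∈ M) (hv : v ∈ M)
    (h : G.Adj v g) : ∃ z ∈ X, (∀ y ∈ M, G.Adj z y → y ∈ G.branch M g v) ∧
      G.Conn (insert z (G.branch M g v)) := by
  obtain ⟨z, hz, hzb⟩ := hM.exists_private_branch hg hv h.ne
  obtain ⟨y, hy, hzy⟩ := hM.touches z hz
  exact ⟨z, hz, hzb, (conn_branch hM.conn hg hv h.ne).insert ⟨y, hzb y hy hzy, hzy⟩⟩

/-- With `g` and `g'` non-adjacent the branches are separated, and each private vertex has all its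
neighbours in `M` within its own branch. -/
theorem sep_arms (hM : MinConn G X D M) (hS : Setting G d a X D) {v g g' z z' : V} (hg : g ∈ M)
    (hg' : g' ∈ M) (hv : v ∈ M) (h : G.Adj v g) (h' : G.Adj v g') (hne : g ≠ g')
    (hn : ¬ G.Adj g g') (hz : z ∈ X) (hz' : z' ∈ X)
    (hzb : ∀ y ∈ M, G.Adj z y → y ∈ G.branch M g v)
    (hzb' : ∀ y ∈ M, G.Adj z' y → y ∈ G.branch M g' v) :
    G.Sep (insert z (G.branch M g v)) (insert z' (G.branch M g' v)) := by
  have hbb : ∀ x ∈ G.branch M g v, ∀ y ∈ G.branch M g' v, x ≠ y ∧ ¬ G.Adj x y := by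
    intro x hx y hy
    have := branch_branch hM.conn hg hg' hv h.ne h'.ne (mem_comp_of_adj hg hne h)
      (mem_comp_of_adj hg' hne.symm h') hx hy
    exact ⟨this.1, fun e => hn ((this.2 e).1 ▸ (this.2 e).2 ▸ e)⟩
  have hzz : z ≠ z' := by
    rintro rfl
    obtain ⟨y, hy, hzy⟩ := hM.touches z hz
    exact (hbb y (hzb y hy hzy) y (hzb' y hy hzy)).1 rfl
  rintro x (rfl | hx) y (rfl | hy)
  · exact ⟨hzz, hS.stable x hz y hz'⟩
  · exact ⟨fun e => hM.notMem_of_X hS hz (e ▸ hy.1), fun e =>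
      (hbb y (hzb y hy.1 e) y hy).1 rfl⟩
  · exact ⟨fun e => hM.notMem_of_X hS hz' (e ▸ hx.1), fun e =>
      (hbb x hx x (hzb' x hx.1 e.symm)).1 rfl⟩
  · exact hbb x hx y hy

/-- Trident at `v` with two arms through neighbours in `M`. -/
theorem false_of_arms (hM : MinConn G X D M) (hS : Setting G d a X D) {v g g' : V} (hg : g ∈ M)
    (hg' : g' ∈ M) (hv : v ∈ M) (h : G.Adj v g) (h' : G.Adj v g') (hne : g ≠ g')
    (hn : ¬ G.Adj g g') {C : Set V} (hC : G.Conn C) (sC : C ⊆ D ∪ X) (nC : v ∉ C)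
    (tC : G.Touches v C) (xC : (C ∩ X).Nonempty)
    (h1 : ∀ z ∈ X, (∀ y ∈ M, G.Adj z y → y ∈ G.branch M g v) →
      G.Sep (insert z (G.branch M g v)) C)
    (h2 : ∀ z ∈ X, (∀ y ∈ M, G.Adj z y → y ∈ G.branch M g' v) →
      G.Sep (insert z (G.branch M g' v)) C) : False := by
  obtain ⟨z, hz, hzb, hc⟩ := hM.exists_arm hg hv h
  obtain ⟨z', hz', hzb', hc'⟩ := hM.exists_arm hg' hv h'
  have sub : ∀ g, ∀ z ∈ X, insert z (G.branch M g v) ⊆ D ∪ X := by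
    rintro g z hz y (rfl | hy)
    · exact Or.inr hz
    · exact Or.inl (hM.sub hy.1)
  have nm : ∀ g, ∀ z ∈ X, v ∉ insert z (G.branch M g v) := by
    rintro g z hz (e | hy)
    · exact hM.notMem_of_X hS hz (e ▸ hv)
    · exact notMem_branch hy
  exact hS.not_trident (hM.sub hv) hc hc' hC
    (hM.sep_arms hS hg hg' hv h h' hne hn hz hz' hzb hzb') (h1 z hz hzb) (h2 z' hz' hzb')
    (sub _ _ hz) (sub _ _ hz') sC (nm _ _ hz) (nm _ _ hz') nC
    ⟨g, Or.inr (self_mem_branch hg hv h.ne), h⟩ ⟨g', Or.inr (self_mem_branch hg' hv h'.ne), h'⟩ tC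
    ⟨z, Or.inl rfl, hz⟩ ⟨z', Or.inl rfl, hz'⟩ xC

/-- The branches at the three leaves of a claw, with their private vertices, are the arms of a
trident at its centre. So `M` is claw-free. -/
theorem no_claw (hM : MinConn G X D M) (hS : Setting G d a X D) {v g g' g'' : V} (hg : g ∈ M)
    (hg' : g' ∈ M) (hg'' : g'' ∈ M) (hv : v ∈ M) (h : G.Adj v g) (h' : G.Adj v g')
    (h'' : G.Adj v g'') (n1 : g ≠ g') (n2 : g ≠ g'') (n3 : g' ≠ g'')
    (a1 : ¬ G.Adj g g') (a2 : ¬ G.Adj g g'') (a3 : ¬ G.Adj g' g'') : False := by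
  obtain ⟨z, hz, hzb, hc⟩ := hM.exists_arm hg'' hv h''
  refine hM.false_of_arms hS hg hg' hv h h' n1 a1 hc ?_ ?_ ⟨g'', Or.inr (self_mem_branch hg'' hv h''.ne), h''⟩
    ⟨z, Or.inl rfl, hz⟩ (fun y hy hyb => hM.sep_arms hS hg hg'' hv h h'' n2 a2 hy hz hyb hzb)
    (fun y hy hyb => hM.sep_arms hS hg' hg'' hv h' h'' n3 a3 hy hz hyb hzb)
  · rintro y (rfl | hy)
    · exact Or.inr hz
    · exact Or.inl (hM.sub hy.1)
  · rintro (e | hy)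
    · exact hM.notMem_of_X hS hz (e ▸ hv)
    · exact notMem_branch hy

/-- A vertex of `M` that is the only contact of some `z ∈ X` has no two nonadjacent neighbours. -/
theorem adj_of_private (hM : MinConn G X D M) (hS : Setting G d a X D) {v g g' z : V} (hg : g ∈ M)
    (hg' : g' ∈ M) (hv : v ∈ M) (h : G.Adj v g) (h' : G.Adj v g') (hne : g ≠ g') (hz : z ∈ X)
    (hzv : ∀ y ∈ M, G.Adj z y → y = v) : G.Adj g g' := by
  by_contra hn
  have hzv' : G.Adj z v := by
    obtain ⟨y, hy, e⟩ := hM.touches z hz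
    exact hzv y hy e ▸ e
  have key : ∀ g, ∀ y ∈ X, (∀ w ∈ M, G.Adj y w → w ∈ G.branch M g v) →
      G.Sep (insert y (G.branch M g v)) {z} := by
    intro g y hy hyb
    refine sep_singleton_right.2 ⟨?_, ?_⟩
    · rintro (e | e)
      · subst e
        exact notMem_branch (hyb v hv hzv')
      · exact hM.notMem_of_X hS hz e.1
    · rintro ⟨w, rfl | hw, e⟩
      · exact hS.stable z hz w hy e
      · exact notMem_branch (hzv w hw.1 e ▸ hw)
  -- The third arm of the trident is the private vertex `z` itself.
  exact hM.false_of_arms hS hg hg' hv h h' hne hn (Conn.singleton z)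
    (by rintro _ rfl; exact Or.inr hz) (fun e => hM.notMem_of_X hS hz ((show v = z from e) ▸ hv))
    (touches_singleton.2 hzv'.symm) ⟨z, rfl, hz⟩ (key g) (key g')

/-- Neighbours of `g` that `g` does not cut off from its neighbour `u` are adjacent to `u`. -/
theorem adj_of_mem_comp (hM : MinConn G X D M) (hS : Setting G d a X D) {u g y : V} (hu : u ∈ M)
    (hg : g ∈ M) (hug : G.Adj u g) (hy : y ∈ G.comp (M \ {g}) u) (hyu : y ≠ u)
    (hgy : G.Adj g y) : G.Adj u y := by
  by_contra hn
  have hyM : y ∈ M := (comp_subset (show u ∈ M \ {g} from ⟨hu, hug.ne⟩) hy).1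
  -- If the branch at `g` continues to some `w`, then `g` is the centre of a claw with leaves `u`,
  -- `y`, `w`. Otherwise the branch is `{g}`, its private vertex has `g` as only neighbour in `M`,
  -- and `adj_of_private` applies.
  by_cases hex : ∃ w ∈ G.branch M g u, G.Adj g w
  · obtain ⟨w, hw, hgw⟩ := hex
    have hyb : y ∉ G.branch M g u := fun h => h.2 hy
    refine hM.no_claw hS hu hyM hw.1 hg hug.symm hgy hgw hyu.symm
      (fun e => notMem_branch (e ▸ hw)) (fun e => hyb (e ▸ hw)) hn ?_ ?_
    · exact fun e => hgw.ne (eq_of_adj_branch hw hu notMem_branch e.symm).symm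
    · exact fun e => hgw.ne (eq_of_adj_branch hw hyM hyb e.symm).symm
  · push Not at hex
    obtain ⟨z, hz, hzb⟩ := hM.exists_private_branch hg hu hug.ne
    have hbg : G.branch M g u ⊆ {g} :=
      (conn_branch hM.conn hg hu hug.ne).2 {g} ⟨g, self_mem_branch hg hu hug.ne, rfl⟩
        (by rintro _ hx rfl w hw e; exact (hex w hw e).elim)
    exact hn (hM.adj_of_private hS hu hyM hg hug.symm hgy hyu.symm hz
      fun w hw e => hbg (hzb w hw e))

/-- No vertex of `D` has three spread-out neighbours on an induced path in `M`. -/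
theorem not_three_spread (hM : MinConn G X D M) (hS : Setting G d a X D) {q : ℕ → V} {n : ℕ}
    (hq : G.IndPath q n) (hqM : ∀ i ≤ n, q i ∈ M) {v : V} (hv : v ∈ D) {c μ e : ℕ}
    (h1 : c + 2 ≤ μ) (h2 : μ + 2 ≤ e) (h3 : e ≤ n) (a1 : G.Adj (q c) v) (a2 : G.Adj (q μ) v)
    (a3 : G.Adj (q e) v) : False := by
  have hnadj : ∀ i j, i + 2 ≤ j → j ≤ n → ¬ G.Adj (q i) (q j) := fun i j hij hj e => by
    rw [hq.adj _ (by omega) _ hj] at e; omega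
  have claw : ∀ M', MinConn G X D M' → v ∈ M' → q c ∈ M' → q μ ∈ M' → q e ∈ M' → False :=
    fun M' hM' hv' b1 b2 b3 => hM'.no_claw hS b1 b2 b3 hv' a1.symm a2.symm a3.symm
      (hq.ne (by omega) (by omega) (by omega)) (hq.ne (by omega) (by omega) (by omega))
      (hq.ne (by omega) (by omega) (by omega)) (hnadj _ _ h1 (by omega))
      (hnadj _ _ (by omega) h3) (hnadj _ _ h2 h3)
  by_cases hvM : v ∈ M
  · exact claw M hM hvM (hqM _ (by omega)) (hqM _ (by omega)) (hqM _ (by omega))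
  -- A vertex `v` outside `M` is exchanged for `q r`, which lies strictly between `q μ` and `q e`.
  -- The new set has the same size and is shown to be connected and to touch all of `X`, so it is
  -- again minimal; but it contains a claw at `v`.
  set r := μ + 1 with hr
  have hrM : q r ∈ M := hqM r (by omega)
  have el : G.Adj (q r) (q (r - 1)) := by rw [hq.adj _ (by omega) _ (by omega)]; omega
  have er : G.Adj (q r) (q (r + 1)) := hq.adj_succ (by omega)
  have hlr : q (r - 1) ≠ q (r + 1) := hq.ne (by omega) (by omega) (by omega)
  have hnlr : ¬ G.Adj (q (r - 1)) (q (r + 1)) := hnadj _ _ (by omega) (by omega)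
  have hlM : q (r - 1) ∈ M := hqM _ (by omega)
  have hgM : q (r + 1) ∈ M := hqM _ (by omega)
  have hvr : v ≠ q r := fun e => hvM (e ▸ hrM)
  have hcard : (insert v (M \ {q r})).ncard = M.ncard := by
    rw [Set.ncard_insert_of_notMem (fun h => hvM h.1), Set.ncard_sdiff_singleton_add_one hrM]
  have hmem : ∀ i ≤ n, i ≠ r → q i ∈ insert v (M \ {q r}) := fun i hi hir =>
    Or.inr ⟨hqM i hi, hq.ne hi (by omega) hir⟩
  have hM' : MinConn G X D (insert v (M \ {q r})) := by
    refine ⟨?_, ?_, ?_, fun M' h1 h2 h3 => hcard ▸ hM.min M' h1 h2 h3⟩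
    · rintro y (rfl | hy)
      · exact hv
      · exact hM.sub hy.1
    · refine conn_of_forall_mem (v := v) (Or.inl rfl) fun S hS' hcl => ?_
      by_contra hvS
      obtain ⟨y, hy, hyS⟩ := hS'
      have hyM : y ∈ M \ {q r} := by
        rcases hy with rfl | hy
        · exact (hvS hyS).elim
        · exact hy
      obtain ⟨x, ⟨hxM, hxr, hxS⟩, w, hw, hxw⟩ := hM.conn.exists_adj_of_ne
        (S := {y | y ≠ q r ∧ y ∈ S}) ⟨y, hyM.1, hyM.2, hyS⟩ (fun h' => (h' hrM).1 rfl)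
      have hwr : w = q r := by
        by_contra hwr
        exact hw.2 ⟨hwr, hcl x (Or.inr ⟨hxM, hxr⟩) hxS w (Or.inr ⟨hw.1, hwr⟩) hxw⟩
      subst hwr
      -- A part of `M \ {q r}` avoiding both neighbours of `q r` on the path would give a claw at `q
      -- r`. Both sides of the path remain attached to `v`, the left one by `q μ` and the right one
      -- by `q e`.
      have hside : q (r - 1) ∈ S ∨ q (r + 1) ∈ S := by
        by_contra! hc
        have nl : x ≠ q (r - 1) := fun e => hc.1 (e ▸ hxS)
        have nr : x ≠ q (r + 1) := fun e => hc.2 (e ▸ hxS)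
        refine hM.no_claw hS hxM hlM hgM hrM hxw.symm el er nl nr hlr ?_ ?_ hnlr
        · exact fun e => hc.1 (hcl x (Or.inr ⟨hxM, hxr⟩) hxS _ (hmem _ (by omega) (by omega)) e)
        · exact fun e => hc.2 (hcl x (Or.inr ⟨hxM, hxr⟩) hxS _ (hmem _ (by omega) (by omega)) e)
      have hseg : ∀ i j, i ≤ j → j ≤ n → (r < i ∨ j < r) →
          ((∃ k, i ≤ k ∧ k ≤ j ∧ q k ∈ S) → seg q i j ⊆ S) := by
        rintro i j hij hj hrij ⟨k, hk, hk', hkS⟩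
        have hsub : ∀ y ∈ seg q i j, y ∈ insert v (M \ {q r}) := by
          rintro _ ⟨k, hk, hk', rfl⟩; exact hmem k (by omega) (by omega)
        exact (hq.conn_seg hij hj).2 S ⟨q k, mem_seg_of hk hk', hkS⟩
          fun x hx hxS y hy hxy => hcl x (hsub x hx) hxS y (hsub y hy) hxy
      rcases hside with h' | h'
      · exact hvS (hcl (q μ) (hmem _ (by omega) (by omega)) h' v (Or.inl rfl) a2)
      · have := hseg (r + 1) e (by omega) h3 (by omega) ⟨r + 1, le_rfl, by omega, h'⟩
        exact hvS (hcl (q e) (hmem _ (by omega) (by omega))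
          (this (mem_seg_of (by omega) le_rfl)) v (Or.inl rfl) a3)
    -- A vertex of `X` that loses all its contacts had `q r` as its only one; then the two path
    -- neighbours of `q r` would be adjacent by `adj_of_private`.
    · intro z hz
      by_contra hnt
      have honly : ∀ y ∈ M, G.Adj z y → y = q r := by
        intro y hy e
        by_contra hne
        exact hnt ⟨y, Or.inr ⟨hy, hne⟩, e⟩
      exact hnlr (hM.adj_of_private hS hlM hgM hrM el er hlr hz honly)
  exact claw _ hM' (Or.inl rfl) (hmem _ (by omega) (by omega)) (hmem _ (by omega) (by omega))
    (hmem _ (by omega) (by omega))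

/-- `M` has a vertex that is the only contact of some vertex of `X`. -/
theorem exists_leaf (hM : MinConn G X D M) (h2 : 2 ≤ M.ncard) :
    ∃ p ∈ M, ∃ z ∈ X, ∀ y ∈ M, G.Adj z y → y = p := by
  -- Descent: a branch with more than one vertex properly contains the branch, seen from its tip, at
  -- some neighbour of the tip. When the branch has become a single vertex, its private vertex has
  -- that vertex as only contact.
  have key : ∀ N : ℕ, ∀ g ∈ M, ∀ v ∈ M, v ≠ g → (G.branch M g v).ncard ≤ N →
      ∃ p ∈ M, ∃ z ∈ X, ∀ y ∈ M, G.Adj z y → y = p := by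
    intro N
    induction N with
    | zero =>
      intro g hg v hv hne hcard
      have := Set.ncard_pos (Set.toFinite _) |>.2 ⟨g, self_mem_branch (G := G) hg hv hne⟩
      omega
    | succ N ih =>
      intro g hg v hv hne hcard
      by_cases hb : G.branch M g v ⊆ {g}
      · obtain ⟨z, hz, hzb⟩ := hM.exists_private_branch hg hv hne
        exact ⟨g, hg, z, hz, fun y hy e => hb (hzb y hy e)⟩
      · obtain ⟨x, ⟨hx, hxg⟩, y, ⟨hy, hyg⟩, hxy⟩ := (conn_branch hM.conn hg hv hne).exists_adj_of_ne
          (S := {g}) ⟨g, self_mem_branch hg hv hne, rfl⟩ hb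
        obtain rfl : x = g := hxg
        refine ih y hy.1 x hg hxy.ne (Nat.le_of_lt_succ (lt_of_lt_of_le
          (Set.ncard_lt_ncard (Set.ssubset_iff_exists.2 ⟨?_, x, self_mem_branch hg hv hne,
            notMem_branch⟩)) hcard))
        intro w hw
        by_contra hwb
        have hcv : v ∈ M \ {x} := ⟨hv, hne⟩
        have hconn : G.Conn (insert x (G.comp (M \ {x}) v)) := by
          refine (conn_comp hcv).insert ?_
          obtain ⟨p, hp, q, hq, hpq⟩ := hM.conn.exists_adj_of_ne (S := G.comp (M \ {x}) v)
            ⟨v, hv, mem_comp_self⟩ (fun h => (comp_subset hcv (h hg)).2 rfl)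
          have : q = x := by
            by_contra hqx
            exact hq.2 (comp_closed hp.2 ⟨hq.1, hqx⟩ hpq)
          exact ⟨p, hp.2, this ▸ hpq.symm⟩
        refine hw.2 (hconn.subset_comp ?_ (Or.inl rfl) mem_comp_self
          (Or.inr (mem_compl_branch hw.1 hwb)))
        rintro p (rfl | hp)
        · exact ⟨hg, hxy.ne⟩
        · exact ⟨(comp_subset hcv hp).1, fun e => hy.2 (e ▸ hp)⟩
  obtain ⟨g, hg, v, hv, hne⟩ := (Set.one_lt_ncard (Set.toFinite _)).1 (show 1 < M.ncard by omega)
  exact key _ g hg v hv hne.symm le_rfl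

end MinConn
end SimpleGraph

/-! ### The spine of a minimal connected set. -/

namespace SimpleGraph
variable {V : Type*} {G : SimpleGraph V}

theorem Setting.ncard_nbrs_le_two {d : ℕ} {a : V} {X D : Set V} [Finite V]
    (hS : Setting G d a X D) {v : V} (hv : v ∈ D) : {z ∈ X | G.Adj z v}.ncard ≤ 2 := by
  by_contra hc
  obtain ⟨x, hx, y, hy, z, hz, hxy, hxz, hyz⟩ := (Set.two_lt_ncard (Set.toFinite _)).1 (not_le.1 hc)
  exact hS.not_three_nbrs hv hx.1 hy.1 hz.1 hxy hxz hyz hx.2.symm hy.2.symm hz.2.symm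

theorem CliqueFree.ncard_lt [Finite V] {t : ℕ} (h : G.CliqueFree t) {S : Set V}
    (hS : ∀ x ∈ S, ∀ y ∈ S, x ≠ y → G.Adj x y) : S.ncard < t := by
  by_contra hc
  obtain ⟨T, hT, hcard⟩ := Set.exists_subset_card_eq (not_lt.1 hc)
  have hfin : T.Finite := Set.toFinite _
  refine h hfin.toFinset ⟨?_, ?_⟩
  · intro x hx y hy hxy
    exact hS x (hT (by simpa using hx)) y (hT (by simpa using hy)) hxy
  · rw [← Set.ncard_eq_toFinset_card _ hfin, hcard]

/-- The part `F` of `M` that remains to be explored from `u`. -/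
structure SpineState (G : SimpleGraph V) (X M : Set V) (p : V) (F : Set V) (u : V) : Prop where
  mem : u ∈ F
  sub : F ⊆ M
  conn : G.Conn F
  conn_compl : G.Conn (insert u (M \ F))
  clique : ∀ x ∈ F, ∀ y ∈ F, G.Adj u x → G.Adj u y → x ≠ y → G.Adj x y
  root : p ∈ F → u = p

/-- An induced path `w 0, …, w k` with branches `B j`, attached at corners `b j` adjacent to
`w j` and `w (j + 1)`. -/
structure SpineData (G : SimpleGraph V) (X M : Set V) (xL : V) (F : Set V) (w : ℕ → V) (k : ℕ)
    (J : Finset ℕ) (B : ℕ → Set V) (b ζ : ℕ → V) (ρ : V) : Prop where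
  path : G.IndPath w k
  mem : ∀ i ≤ k, w i ∈ F
  lt : ∀ j ∈ J, j < k
  conn : ∀ j ∈ J, G.Conn (B j)
  corner : ∀ j ∈ J, b j ∈ B j
  subB : ∀ j ∈ J, B j ⊆ F
  ne : ∀ j ∈ J, ∀ y ∈ B j, ∀ i ≤ k, y ≠ w i
  adj : ∀ j ∈ J, ∀ y ∈ B j, ∀ i ≤ k, (G.Adj y (w i) ↔ y = b j ∧ (i = j ∨ i = j + 1))
  sep : ∀ j ∈ J, ∀ l ∈ J, j ≠ l → G.Sep (B j) (B l)
  leaf : ∀ j ∈ J, ζ j ∈ X ∧ ∀ y ∈ M, G.Adj (ζ j) y → y ∈ B j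
  end_mem : ρ ∈ X
  end_ne : ρ ≠ xL
  end_adj : ∀ i ≤ k, (G.Adj ρ (w i) ↔ i = k)
  end_branch : ∀ j ∈ J, ∀ y ∈ B j, ¬ G.Adj ρ y
  end_sub : ∀ y ∈ M, G.Adj ρ y → y ∈ F

/-- How many vertices of `X` guarantee `nb` branches or `nd` direct contacts. -/
def spineBound (t : ℕ) : ℕ → ℕ → ℕ
  | 0, _ => 0
  | _ + 1, 0 => 0
  -- A step at a fork keeps at least a fraction `1 / t` of the attachments, up to two, and gains a
  -- branch. A step without a fork loses at most the two neighbours of `u` in `X`, and gains a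
  -- direct contact whenever it loses one. The `+ 3` absorbs these two and makes the comparison
  -- strict.
  | nb + 1, nd + 1 => t * spineBound t nb (nd + 1) + spineBound t (nb + 1) nd + 3

namespace SpineState
variable {d : ℕ} {a : V} {X D M : Set V} {p xL u g : V} {F : Set V} [Finite V]

/-- What has been explored is connected to `u` without `g`, so `g` cuts off only vertices of `F`. -/
theorem branch_subset (h : SpineState G X M p F u) (hg : g ∈ F) (hug : G.Adj u g) :
    G.branch M g u ⊆ F := by
  intro y hy
  by_contra hyF
  refine hy.2 (h.conn_compl.subset_comp ?_ (Or.inl rfl) mem_comp_self (Or.inr ⟨hy.1, hyF⟩))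
  rintro z (rfl | hz)
  · exact ⟨h.sub h.mem, hug.ne⟩
  · exact ⟨hz.1, fun e => hz.2 (e ▸ hg)⟩

/-- The clique condition is preserved because two non-adjacent neighbours of `g` in its branch would
form a claw at `g` with `u`. The root `p` is left behind: inside `F` it could only be `u`. -/
theorem next (h : SpineState G X M p F u) (hM : MinConn G X D M) (hS : Setting G d a X D)
    (hg : g ∈ F) (hug : G.Adj u g) : SpineState G X M p (G.branch M g u) g := by
  have huM := h.sub h.mem
  have hgM := h.sub hg
  have hgb := self_mem_branch (G := G) hgM huM hug.ne
  refine ⟨hgb, SimpleGraph.branch_subset, conn_branch hM.conn hgM huM hug.ne, ?_, ?_, ?_⟩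
  · have hu : u ∈ M \ {g} := ⟨huM, hug.ne⟩
    have e : M \ G.branch M g u = G.comp (M \ {g}) u := by
      ext y
      constructor
      · exact fun hy => mem_compl_branch hy.1 hy.2
      · exact fun hy => ⟨(comp_subset hu hy).1, fun hb => hb.2 hy⟩
    rw [e]
    exact (conn_comp hu).insert ⟨u, mem_comp_self, hug.symm⟩
  · intro x hx y hy hgx hgy hxy
    by_contra hn
    have hno : ∀ z ∈ G.branch M g u, G.Adj g z → ¬ G.Adj u z := fun z hz hgz e =>
      hgz.ne (eq_of_adj_branch hz huM notMem_branch e.symm).symm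
    exact hM.no_claw hS huM hx.1 hy.1 hgM hug.symm hgx hgy (fun e => notMem_branch (e ▸ hx))
      (fun e => notMem_branch (e ▸ hy)) hxy (hno x hx hgx) (hno y hy hgy) hn
  · intro hp
    have hup := h.root (h.branch_subset hg hug hp)
    exact (notMem_branch (hup ▸ hp : u ∈ G.branch M g u)).elim

/-- The branches at the neighbours of `u` exhaust `F`: a branch can be left only from its tip `g`,
and by `adj_of_mem_comp` this leads to `u` or to another neighbour of `u`. -/
theorem cover (h : SpineState G X M p F u) (hM : MinConn G X D M) (hS : Setting G d a X D)
    {y : V} (hy : y ∈ F) : y = u ∨ ∃ g ∈ F, G.Adj u g ∧ y ∈ G.branch M g u := by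
  have huM := h.sub h.mem
  have := h.conn.2 {y | y = u ∨ ∃ g ∈ F, G.Adj u g ∧ y ∈ G.branch M g u}
    ⟨u, h.mem, Or.inl rfl⟩ (by
      rintro x hxF (rfl | ⟨g, hg, hug, hx⟩) y hy hxy
      · exact Or.inr ⟨y, hy, hxy, self_mem_branch (h.sub hy) huM hxy.ne⟩
      · by_cases hyb : y ∈ G.branch M g u
        · exact Or.inr ⟨g, hg, hug, hyb⟩
        · by_cases hyu : y = u
          · exact Or.inl hyu
          · obtain rfl := eq_of_adj_branch hx (h.sub hy) hyb hxy
            have huy := hM.adj_of_mem_comp hS huM (h.sub hg) hug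
              (mem_compl_branch (h.sub hy) hyb) hyu hxy
            exact Or.inr ⟨y, hy, huy, self_mem_branch (h.sub hy) huM huy.ne⟩)
  exact this hy

/-- The base of the recursion, where a shortest path from `u` to a neighbour of `ρ` will do. -/
theorem exists_path (h : SpineState G X M p F u) (hM : MinConn G X D M)
    (hp : ∃ ρ ∈ X, ρ ≠ xL ∧ ∀ y ∈ M, G.Adj ρ y → y ∈ F) :
    ∃ w k ρ, w 0 = u ∧ SpineData G X M xL F w k ∅ (fun _ => ∅) (fun _ => u) (fun _ => u) ρ := by
  obtain ⟨ρ, hρ, hne, hρF⟩ := hp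
  obtain ⟨y, hy, hρy⟩ := hM.touches ρ hρ
  obtain ⟨w, k, hw, hwF, h0, hk, -, hk'⟩ := h.conn.exists_minPath (· = u) (G.Adj ρ)
    ⟨u, h.mem, rfl⟩ ⟨y, hρF y hy hρy, hρy⟩
  refine ⟨w, k, ρ, h0, hw, hwF, by simp, by simp, by simp, by simp, by simp, by simp, by simp,
    by simp, hρ, hne, fun i hi => ⟨hk' i hi, fun e => e ▸ hk⟩, by simp, hρF⟩

/-- Prepending `u` to the data of the next state, possibly with a branch at `u`. -/
theorem cons_data (h : SpineState G X M p F u) (hM : MinConn G X D M) (hg : g ∈ F)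
    (hug : G.Adj u g)
    {w : ℕ → V} {k : ℕ} {J : Finset ℕ} {B : ℕ → Set V} {b ζ : ℕ → V} {ρ : V} (h0 : w 0 = g)
    (hd : SpineData G X M xL (G.branch M g u) w k J B b ζ ρ) :
    SpineData G X M xL F (app (fun _ => u) 0 w) (k + 1) (J.image (· + 1)) (fun j => B (j - 1))
      (fun j => b (j - 1)) (fun j => ζ (j - 1)) ρ := by
  have huM := h.sub h.mem
  have hgM := h.sub hg
  have hbF := h.branch_subset hg hug
  have hu : ∀ y ∈ G.branch M g u, u ≠ y ∧ (G.Adj u y ↔ y = g) := fun y hy =>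
    ⟨fun e => notMem_branch (e ▸ hy), fun e => eq_of_adj_branch hy huM notMem_branch e.symm,
      fun e => e ▸ hug⟩
  have hw : G.IndPath (app (fun _ => u) 0 w) (k + 1) := hd.path.cons
    (fun i hi e => (hu _ (hd.mem i hi)).1 e.symm) fun i hi => by
      rw [(hu _ (hd.mem i hi)).2, ← h0]
      exact ⟨fun e => hd.path.inj i hi 0 (Nat.zero_le _) e, fun e => e ▸ rfl⟩
  have v0 : app (fun _ => u) 0 w 0 = u := rfl
  have vs : ∀ i, app (fun _ => u) 0 w (i + 1) = w i := fun i => rfl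
  have hJ : ∀ j ∈ J.image (· + 1), ∃ l ∈ J, j = l + 1 := fun j hj => by
    obtain ⟨l, hl, rfl⟩ := Finset.mem_image.1 hj
    exact ⟨l, hl, rfl⟩
  refine ⟨hw, ?_, ?_, ?_, ?_, ?_, ?_, ?_, ?_, ?_, hd.end_mem, hd.end_ne, ?_, ?_,
    fun y hy e => hbF (hd.end_sub y hy e)⟩
  · rintro (_ | i) hi
    · rw [v0]; exact h.mem
    · rw [vs]; exact hbF (hd.mem i (by omega))
  · intro j hj
    obtain ⟨l, hl, rfl⟩ := hJ j hj
    have := hd.lt l hl; omega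
  · intro j hj
    obtain ⟨l, hl, rfl⟩ := hJ j hj
    exact hd.conn l hl
  · intro j hj
    obtain ⟨l, hl, rfl⟩ := hJ j hj
    exact hd.corner l hl
  · intro j hj
    obtain ⟨l, hl, rfl⟩ := hJ j hj
    exact (hd.subB l hl).trans hbF
  · intro j hj y hy i hi
    obtain ⟨l, hl, rfl⟩ := hJ j hj
    rcases i with _ | i
    · rw [v0]; exact (hu y (hd.subB l hl hy)).1.symm
    · rw [vs]; exact hd.ne l hl y hy i (by omega)
  · intro j hj y hy i hi
    obtain ⟨l, hl, rfl⟩ := hJ j hj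
    rcases i with _ | i
    · rw [v0]
      refine iff_of_false (fun e => ?_) (by omega)
      have := ((hu y (hd.subB l hl hy)).2).1 e.symm
      exact hd.ne l hl y hy 0 (Nat.zero_le _) (this.trans h0.symm)
    · rw [vs, hd.adj l hl y hy i (by omega)]
      simp
  · intro j hj j' hj' hjj
    obtain ⟨l, hl, rfl⟩ := hJ j hj
    obtain ⟨l', hl', rfl⟩ := hJ j' hj'
    exact hd.sep l hl l' hl' (by omega)
  · intro j hj
    obtain ⟨l, hl, rfl⟩ := hJ j hj
    exact hd.leaf l hl
  · rintro (_ | i) hi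
    · rw [v0]
      refine iff_of_false (fun e => ?_) (by omega)
      exact notMem_branch (hd.end_sub u huM e)
    · rw [vs, hd.end_adj i (by omega)]; omega
  · intro j hj
    obtain ⟨l, hl, rfl⟩ := hJ j hj
    exact hd.end_branch l hl

/-- A second neighbour `g'` of `u` is adjacent to `g` by the clique condition. Its branch is
therefore attached by a triangle to the first two vertices `u`, `g` of the spine, and has no other
edge to the branch in which the spine continues. -/
theorem add_branch (h : SpineState G X M p F u) (hM : MinConn G X D M)
    (hg : g ∈ F) (hug : G.Adj u g) {g' : V} (hg' : g' ∈ F) (hug' : G.Adj u g') (hne : g' ≠ g)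
    {w : ℕ → V} {k : ℕ} {J : Finset ℕ} {B : ℕ → Set V} {b ζ : ℕ → V} {ρ : V} (h0 : w 0 = u)
    (h1 : w 1 = g) (hk : 1 ≤ k) (hJ0 : 0 ∉ J) (hw : ∀ i, 1 ≤ i → i ≤ k → w i ∈ G.branch M g u)
    (hB : ∀ j ∈ J, B j ⊆ G.branch M g u) (hρ : ∀ y ∈ M, G.Adj ρ y → y ∈ G.branch M g u)
    (hd : SpineData G X M xL F w k J B b ζ ρ) :
    ∃ B' b' ζ', SpineData G X M xL F w k (insert 0 J) B' b' ζ' ρ := by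
  have huM := h.sub h.mem
  have hgM := h.sub hg
  have hg'M := h.sub hg'
  obtain ⟨z, hz, hzb⟩ := hM.exists_private_branch hg'M huM hug'.ne
  have hbb : ∀ x ∈ G.branch M g' u, ∀ y ∈ G.branch M g u, x ≠ y ∧ (G.Adj x y → x = g' ∧ y = g) :=
    fun x hx y hy => branch_branch hM.conn hg'M hgM huM hug'.ne hug.ne
      (mem_comp_of_adj hg'M hne hug') (mem_comp_of_adj hgM hne.symm hug) hx hy
  have hgg : G.Adj g' g := h.clique g' hg' g hg hug' hug hne
  have hsep : ∀ j ∈ J, G.Sep (G.branch M g' u) (B j) := by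
    intro j hj x hx y hy
    have := hbb x hx y (hB j hj hy)
    refine ⟨this.1, fun e => ?_⟩
    exact hd.ne j hj y hy 1 hk ((this.2 e).2.trans h1.symm)
  have hj0 : ∀ j ∈ J, j ≠ 0 := fun j hj e => hJ0 (e ▸ hj)
  refine ⟨fun j => if j = 0 then G.branch M g' u else B j, fun j => if j = 0 then g' else b j,
    fun j => if j = 0 then z else ζ j, ?_⟩
  refine ⟨hd.path, hd.mem, ?_, ?_, ?_, ?_, ?_, ?_, ?_, ?_, hd.end_mem, hd.end_ne, hd.end_adj, ?_,
    hd.end_sub⟩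
  · intro j hj
    rcases Finset.mem_insert.1 hj with rfl | hj
    · omega
    · exact hd.lt j hj
  · intro j hj
    rcases Finset.mem_insert.1 hj with rfl | hj
    · simpa using conn_branch hM.conn hg'M huM hug'.ne
    · simpa [hj0 j hj] using hd.conn j hj
  · intro j hj
    rcases Finset.mem_insert.1 hj with rfl | hj
    · simpa using self_mem_branch hg'M huM hug'.ne
    · simpa [hj0 j hj] using hd.corner j hj
  · intro j hj
    rcases Finset.mem_insert.1 hj with rfl | hj
    · simpa using h.branch_subset hg' hug'
    · simpa [hj0 j hj] using hd.subB j hj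
  · intro j hj y hy i hi
    rcases Finset.mem_insert.1 hj with rfl | hj
    · simp only [if_true] at hy
      rcases Nat.eq_zero_or_pos i with rfl | hi0
      · rw [h0]; exact fun e => notMem_branch (e ▸ hy)
      · exact (hbb y hy _ (hw i hi0 hi)).1
    · simp only [hj0 j hj, if_false] at hy
      exact hd.ne j hj y hy i hi
  · intro j hj y hy i hi
    rcases Finset.mem_insert.1 hj with rfl | hj
    · simp only [if_true] at hy ⊢
      rcases Nat.eq_zero_or_pos i with rfl | hi0
      · rw [h0]
        constructor
        · exact fun e => ⟨eq_of_adj_branch hy huM notMem_branch e, Or.inl rfl⟩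
        · rintro ⟨rfl, -⟩; exact hug'.symm
      · constructor
        · intro e
          have := (hbb y hy _ (hw i hi0 hi)).2 e
          exact ⟨this.1, Or.inr (hd.path.inj i hi 1 hk (this.2.trans h1.symm))⟩
        · rintro ⟨rfl, rfl | rfl⟩
          · omega
          · rw [Nat.zero_add, h1]; exact hgg
    · simp only [hj0 j hj, if_false] at hy ⊢
      exact hd.adj j hj y hy i hi
  · intro j hj l hl hjl
    rcases Finset.mem_insert.1 hj with rfl | hj <;> rcases Finset.mem_insert.1 hl with rfl | hl
    · exact (hjl rfl).elim
    · simpa [hj0 l hl] using hsep l hl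
    · simpa [hj0 j hj] using (hsep j hj).symm
    · simpa [hj0 j hj, hj0 l hl] using hd.sep j hj l hl hjl
  · intro j hj
    rcases Finset.mem_insert.1 hj with rfl | hj
    · simpa using ⟨hz, hzb⟩
    · simpa [hj0 j hj] using hd.leaf j hj
  · intro j hj y hy e
    rcases Finset.mem_insert.1 hj with rfl | hj
    · simp only [if_true] at hy
      exact (hbb y hy y (hρ y hy.1 e)).1 rfl
    · simp only [hj0 j hj, if_false] at hy
      exact hd.end_branch j hj y hy e

/-- Either many branches or many vertices of `X` with contacts on the path. -/
theorem exists_data {t : ℕ} (hM : MinConn G X D M) (hS : Setting G d a X D) (hK : G.CliqueFree t)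
    (hxL : ∀ y ∈ M, G.Adj xL y → y = p) (hxX : xL ∈ X) :
    ∀ N : ℕ, ∀ (F : Set V) (u : V), F.ncard ≤ N → SpineState G X M p F u →
      (∃ ρ ∈ X, ρ ≠ xL ∧ ∀ y ∈ M, G.Adj ρ y → y ∈ F) →
      ∀ nb nd, spineBound t nb nd ≤ {z ∈ X | G.Touches z F}.ncard →
      ∃ w k J B b ζ ρ, w 0 = u ∧ SpineData G X M xL F w k J B b ζ ρ ∧
        (nb ≤ J.card ∨ nd ≤ {z ∈ X | ∃ i ≤ k, G.Adj z (w i)}.ncard) := by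
  classical
  intro N
  induction N with
  | zero =>
    intro F u hF h
    have := (Set.ncard_pos (Set.toFinite F)).2 ⟨u, h.mem⟩
    omega
  | succ N ih =>
    intro F u hF h hρ nb nd hbound
    have huM := h.sub h.mem
    rcases nb with _ | nb
    · obtain ⟨w, k, ρ, h0, hd⟩ := h.exists_path hM hρ
      exact ⟨w, k, ∅, _, _, _, ρ, h0, hd, Or.inl (Nat.zero_le _)⟩
    rcases nd with _ | nd
    · obtain ⟨w, k, ρ, h0, hd⟩ := h.exists_path hM hρ
      exact ⟨w, k, ∅, _, _, _, ρ, h0, hd, Or.inr (Nat.zero_le _)⟩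
    rw [spineBound] at hbound
    have hZu := hS.ncard_nbrs_le_two (hM.sub huM)
    set Zu : Set V := {z ∈ X | G.Adj z u} with hZudef
    let Z : V → Set V := fun g => {z ∈ X | G.Touches z (G.branch M g u)}
    let Nb : Finset V := (Set.toFinite {g | g ∈ F ∧ G.Adj u g}).toFinset
    have hNb : ∀ g, g ∈ Nb ↔ g ∈ F ∧ G.Adj u g := fun g => by simp [Nb]
    have hcov : {z ∈ X | G.Touches z F} ⊆ Zu ∪ ⋃ g ∈ Nb, Z g := by
      rintro z ⟨hz, y, hy, hzy⟩
      rcases h.cover hM hS hy with rfl | ⟨g, hg, hug, hyb⟩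
      · exact Or.inl ⟨hz, hzy⟩
      · refine Or.inr ?_
        simp only [Set.mem_iUnion, exists_prop]
        exact ⟨g, (hNb g).2 ⟨hg, hug⟩, hz, y, hyb, hzy⟩
    have hNbne : Nb.Nonempty := by
      by_contra hc
      rw [Finset.not_nonempty_iff_eq_empty] at hc
      rw [hc] at hcov
      have := Set.ncard_le_ncard hcov (Set.toFinite _)
      simp only [Finset.notMem_empty, Set.iUnion_of_empty, Set.iUnion_empty, Set.union_empty] at this
      omega
    -- The spine continues into the branch touched by the most vertices of `X`.
    obtain ⟨g, hgNb, hgmax⟩ := Nb.exists_max_image (fun g => (Z g).ncard) hNbne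
    obtain ⟨hg, hug⟩ := (hNb g).1 hgNb
    have hgM := h.sub hg
    have hnext := h.next hM hS hg hug
    have hbF := h.branch_subset hg hug
    have hcardF : (G.branch M g u).ncard ≤ N := by
      have := Set.ncard_lt_ncard (Set.ssubset_iff_exists.2 ⟨hbF, u, h.mem, notMem_branch⟩)
        (Set.toFinite _)
      omega
    -- The private vertex of the branch differs from `xL`, whose only contact `p` is not in the
    -- branch.
    have hpriv : ∃ ρ ∈ X, ρ ≠ xL ∧ ∀ y ∈ M, G.Adj ρ y → y ∈ G.branch M g u := by
      obtain ⟨z, hz, hzb⟩ := hM.exists_private_branch hgM huM hug.ne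
      refine ⟨z, hz, ?_, hzb⟩
      rintro rfl
      obtain ⟨y, hy, e⟩ := hM.touches z hz
      obtain rfl := hxL y hy e
      have hyb := hzb y hy e
      exact notMem_branch (h.root (hbF hyb) ▸ hyb)
    have step : ∀ {w : ℕ → V} {k : ℕ} {J : Finset ℕ} {B : ℕ → Set V} {b ζ : ℕ → V} {ρ : V},
        w 0 = g → SpineData G X M xL (G.branch M g u) w k J B b ζ ρ →
        {z ∈ X | ∃ i ≤ k, G.Adj z (w i)} ⊆
          {z ∈ X | ∃ i ≤ k + 1, G.Adj z (app (fun _ => u) 0 w i)} ∧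
        (J.image (· + 1)).card = J.card := by
      intro w k J B b ζ ρ h0 hd
      refine ⟨?_, Finset.card_image_of_injective _ (add_left_injective 1)⟩
      rintro z ⟨hz, i, hi, e⟩
      exact ⟨hz, i + 1, by omega, e⟩
    by_cases hsingle : ∀ g' ∈ Nb, g' = g
    · have hcov' : {z ∈ X | G.Touches z F} ⊆ Zu ∪ Z g := by
        intro z hz
        rcases hcov hz with h' | h'
        · exact Or.inl h'
        · simp only [Set.mem_iUnion, exists_prop] at h'
          obtain ⟨g', hg', h'⟩ := h'
          rw [hsingle g' hg'] at h'
          exact Or.inr h'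
      -- A neighbour of `u` that does not touch the branch is counted once as a direct contact and
      -- never again; if there is none, nothing is lost and the same targets are pursued.
      by_cases hlost : ∃ z ∈ Zu, z ∉ Z g
      · obtain ⟨z, hz, hzg⟩ := hlost
        have hle := (Set.ncard_le_ncard hcov' (Set.toFinite _)).trans (Set.ncard_union_le _ _)
        obtain ⟨w, k, J, B, b, ζ, ρ, h0, hd, hor⟩ := ih _ g hcardF hnext hpriv (nb + 1) nd
          (show _ ≤ (Z g).ncard by omega)
        obtain ⟨hs1, hs2⟩ := step h0 hd
        refine ⟨_, _, _, _, _, _, ρ, rfl, h.cons_data hM hg hug h0 hd, hor.imp (fun h => by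
          rw [hs2]; exact h) fun h => ?_⟩
        have hnz : z ∉ {z ∈ X | ∃ i ≤ k, G.Adj z (w i)} := fun hz' => by
          obtain ⟨i, hi, e⟩ := hz'.2
          exact hzg ⟨hz.1, w i, hd.mem i hi, e⟩
        have := Set.ncard_le_ncard (s := insert z {z ∈ X | ∃ i ≤ k, G.Adj z (w i)})
          (t := {z ∈ X | ∃ i ≤ k + 1, G.Adj z (app (fun _ => u) 0 w i)}) (by
            rintro y (rfl | hy)
            · exact ⟨hz.1, 0, by omega, hz.2⟩
            · exact hs1 hy) (Set.toFinite _)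
        rw [Set.ncard_insert_of_notMem hnz (Set.toFinite _)] at this
        omega
      · push Not at hlost
        have hle := Set.ncard_le_ncard (hcov'.trans (Set.union_subset hlost le_rfl))
          (Set.toFinite _)
        obtain ⟨w, k, J, B, b, ζ, ρ, h0, hd, hor⟩ := ih _ g hcardF hnext hpriv (nb + 1) (nd + 1)
          (show _ ≤ (Z g).ncard by rw [spineBound]; omega)
        obtain ⟨hs1, hs2⟩ := step h0 hd
        refine ⟨_, _, _, _, _, _, ρ, rfl, h.cons_data hM hg hug h0 hd, hor.imp (fun h => by
          rw [hs2]; exact h) fun h => h.trans (Set.ncard_le_ncard hs1 (Set.toFinite _))⟩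
    · push Not at hsingle
      obtain ⟨g', hg'Nb, hne⟩ := hsingle
      obtain ⟨hg', hug'⟩ := (hNb g').1 hg'Nb
      -- The unexplored neighbours of `u` form a clique.
      have hNbt : Nb.card ≤ t := by
        have := hK.ncard_lt (S := {g | g ∈ F ∧ G.Adj u g}) fun x hx y hy hxy =>
          h.clique x hx.1 y hy.1 hx.2 hy.2 hxy
        rw [Set.ncard_eq_toFinset_card _ (Set.toFinite _)] at this
        exact this.le
      have hle : {z ∈ X | G.Touches z F}.ncard ≤ 2 + t * (Z g).ncard := by
        refine (Set.ncard_le_ncard hcov (Set.toFinite _)).trans ((Set.ncard_union_le _ _).trans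
          (Nat.add_le_add hZu ?_))
        refine (Finset.set_ncard_biUnion_le Nb Z).trans ?_
        refine (Finset.sum_le_card_nsmul Nb _ _ fun g' hg' => hgmax g' hg').trans ?_
        rw [smul_eq_mul]
        exact Nat.mul_le_mul_right _ hNbt
      have hlt : t * spineBound t nb (nd + 1) < t * (Z g).ncard := by omega
      obtain ⟨w, k, J, B, b, ζ, ρ, h0, hd, hor⟩ := ih _ g hcardF hnext hpriv nb (nd + 1)
        (show _ ≤ (Z g).ncard from (Nat.lt_of_mul_lt_mul_left hlt).le)
      obtain ⟨hs1, hs2⟩ := step h0 hd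
      have hd' := h.cons_data hM hg hug h0 hd
      have h0J : 0 ∉ J.image (· + 1) := by simp
      obtain ⟨B', b', ζ', hd''⟩ := h.add_branch hM hg hug hg' hug' hne (w := app (fun _ => u) 0 w)
        (k := k + 1) rfl h0 (by omega) h0J (by
          intro i hi hi'
          obtain ⟨i, rfl⟩ := Nat.exists_eq_add_of_le' hi
          exact hd.mem i (by omega)) (by
          intro j hj
          obtain ⟨l, hl, rfl⟩ := Finset.mem_image.1 hj
          exact hd.subB l hl) hd.end_sub hd'
      refine ⟨_, _, _, _, _, _, ρ, rfl, hd'', hor.imp (fun h => ?_) fun h =>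
        h.trans (Set.ncard_le_ncard hs1 (Set.toFinite _))⟩
      rw [Finset.card_insert_of_notMem h0J, hs2]
      omega

end SpineState

/-- The initial state: `p` is the only contact of some `xL ∈ X`. -/
theorem MinConn.spineState {d : ℕ} {a : V} {X D M : Set V} [Finite V] (hM : MinConn G X D M)
    (hS : Setting G d a X D) {p xL : V} (hp : p ∈ M) (hx : xL ∈ X)
    (hxL : ∀ y ∈ M, G.Adj xL y → y = p) : SpineState G X M p M p where
  mem := hp
  sub := le_rfl
  conn := hM.conn
  conn_compl := by
    rw [Set.sdiff_self]
    rw [show insert p (∅ : Set V) = {p} by simp]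
    exact Conn.singleton p
  clique := fun x hx' y hy hpx hpy hxy => hM.adj_of_private hS hx' hy hp hpx hpy hxy hx hxL
  root := fun _ => rfl

end SimpleGraph

/-! ### Crossings between two separated sides, and fans. -/

namespace SimpleGraph
variable {V : Type*} {G : SimpleGraph V} {d : ℕ} {a : V} {X D : Set V}

theorem Setting.ncard_touches_le_one [Finite V] (hS : Setting G d a X D) {C₁ C₂ : Set V}
    (h1 : G.Conn C₁) (h2 : G.Conn C₂) (hD1 : C₁ ⊆ D) (hD2 : C₂ ⊆ D) (hs : G.Sep C₁ C₂) :
    {x ∈ X | G.Touches x C₁ ∧ G.Touches x C₂}.ncard ≤ 1 :=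
  (Set.ncard_le_one (Set.toFinite _)).2 fun _ hx _ hy =>
    hS.eq_of_touches h1 h2 hD1 hD2 hs hx.1 hy.1 hx.2.1 hx.2.2 hy.2.1 hy.2.2

theorem XPath.ncard_nbrs_le {u : ℕ → V} {n : ℕ} (hu : G.XPath X D u n) (hS : Setting G d a X D)
    {x : V} (hx : x ∈ X) (h0 : x ≠ u 0) (hn : x ≠ u n) {S : Set V} (hSu : S ⊆ seg u 0 n)
    (hSx : S ⊆ G.neighborSet x) : S.ncard ≤ d := by
  classical
  let s := (Finset.range (n + 1)).filter fun i => u i ∈ S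
  have hsub : S ⊆ u '' (s : Set ℕ) := by
    intro y hy
    obtain ⟨k, -, hk, rfl⟩ := hSu hy
    refine ⟨k, ?_, rfl⟩
    simp only [s, Finset.coe_filter, Finset.mem_range]
    exact ⟨Nat.lt_succ_of_le hk, hy⟩
  calc S.ncard ≤ (u '' (s : Set ℕ)).ncard := Set.ncard_le_ncard hsub (s.finite_toSet.image u)
    _ ≤ (s : Set ℕ).ncard := Set.ncard_image_le s.finite_toSet
    _ = s.card := Set.ncard_coe_finset s
    _ ≤ d := hu.card_contacts_le hS hx h0 hn s fun i hi => by
      simp only [s, Finset.mem_filter, Finset.mem_range] at hi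
      exact ⟨Nat.le_of_lt_succ hi.1, hSx hi.2⟩

/-- An induced path in `D` from `L` to `R`, with no unnecessary contacts with `L` and `R`. -/
structure Crossing (G : SimpleGraph V) (D L R : Set V) (p : ℕ → V) (n : ℕ) : Prop where
  path : G.IndPath p n
  mem : ∀ i ≤ n, p i ∈ D
  left : ∀ i ≤ n, (G.Touches (p i) L ↔ i = 0)
  right : ∀ i ≤ n, (G.Touches (p i) R ↔ i = n)
  notMemL : ∀ i ≤ n, p i ∉ L
  notMemR : ∀ i ≤ n, p i ∉ R

/-- A connected pair `L`, `R` of separated subsets of `D`. -/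
structure SepPair (G : SimpleGraph V) (D L R : Set V) : Prop where
  connL : G.Conn L
  connR : G.Conn R
  subL : L ⊆ D
  subR : R ⊆ D
  sep : G.Sep L R

theorem SepPair.symm {L R : Set V} (h : SepPair G D L R) : SepPair G D R L :=
  ⟨h.connR, h.connL, h.subR, h.subL, h.sep.symm⟩

theorem Crossing.reverse {L R : Set V} {p : ℕ → V} {n : ℕ} (h : Crossing G D L R p n) :
    Crossing G D R L (fun k => p (n - k)) n where
  path := h.path.reverse
  mem i hi := h.mem _ (by omega)
  left i hi := by rw [h.right _ (by omega)]; omega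
  right i hi := by rw [h.left _ (by omega)]; omega
  notMemL i hi := h.notMemR _ (by omega)
  notMemR i hi := h.notMemL _ (by omega)

/-- The crossing without its first vertex, together with `R`, is connected and separated from `L`,
so at most one vertex of `Λ` touches it. The first vertex accounts for at most two more. -/
theorem Crossing.ncard_dirty_le [Finite V] {L R : Set V} {p : ℕ → V} {n : ℕ}
    (h : Crossing G D L R p n) (hLR : SepPair G D L R) (hS : Setting G d a X D) {Λ : Set V}
    (hΛX : Λ ⊆ X) (hΛ : ∀ x ∈ Λ, G.Touches x L) :
    {x ∈ Λ | G.Touches x R ∨ ∃ i ≤ n, G.Adj x (p i)}.ncard ≤ 3 := by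
  have hC : G.Conn (ico p 1 (n + 1) ∪ R) :=
    h.path.conn_tail hLR.connR le_rfl ((h.right n le_rfl).2 rfl) (by omega)
  have hsep : G.Sep L (ico p 1 (n + 1) ∪ R) := by
    refine (sep_union_left.2 ⟨sep_ico_left fun i hi hi' => ⟨h.notMemL i (by omega), fun e => ?_⟩,
      hLR.sep.symm⟩).symm
    have := (h.left i (by omega)).1 e
    omega
  have h1 := hS.ncard_touches_le_one hLR.connL hC hLR.subL
    (Set.union_subset (ico_subset fun i _ hi => h.mem i (by omega)) hLR.subR) hsep
  have h2 := hS.ncard_nbrs_le_two (h.mem 0 (by omega))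
  refine (Set.ncard_le_ncard (t := {x ∈ X | G.Touches x L ∧ G.Touches x (ico p 1 (n + 1) ∪ R)} ∪
    {x ∈ X | G.Adj x (p 0)}) ?_ (Set.toFinite _)).trans ((Set.ncard_union_le _ _).trans (by omega))
  rintro x ⟨hx, e | ⟨i, hi, e⟩⟩
  · exact Or.inl ⟨hΛX hx, hΛ x hx, e.mono Set.subset_union_right⟩
  · rcases Nat.eq_zero_or_pos i with rfl | hi0
    · exact Or.inr ⟨hΛX hx, e⟩
    · exact Or.inl ⟨hΛX hx, hΛ x hx, p i, Or.inl (mem_ico_of hi0 (by omega)), e⟩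

theorem Crossing.exists_clean_subset [Finite V] {L R : Set V} {p : ℕ → V} {n : ℕ}
    (h : Crossing G D L R p n) (hLR : SepPair G D L R) (hS : Setting G d a X D) {Λ : Set V}
    (hΛX : Λ ⊆ X) (hΛ : ∀ x ∈ Λ, G.Touches x L) :
    ∃ Λ' ⊆ Λ, Λ.ncard ≤ Λ'.ncard + 3 ∧ ∀ x ∈ Λ', ¬ G.Touches x R ∧ ∀ i ≤ n, ¬ G.Adj x (p i) := by
  have h1 := h.ncard_dirty_le hLR hS hΛX hΛ
  refine ⟨Λ \ {x ∈ Λ | G.Touches x R ∨ ∃ i ≤ n, G.Adj x (p i)}, Set.sdiff_subset, ?_,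
    fun x hx => ⟨fun e => hx.2 ⟨hx.1, Or.inl e⟩, fun i hi e => hx.2 ⟨hx.1, Or.inr ⟨i, hi, e⟩⟩⟩⟩
  have := Set.ncard_le_ncard_sdiff_add_ncard Λ
    {x ∈ Λ | G.Touches x R ∨ ∃ i ≤ n, G.Adj x (p i)} (Set.toFinite _)
  omega

theorem Crossing.exists_clean [Finite V] {L R : Set V} {p : ℕ → V} {n : ℕ}
    (h : Crossing G D L R p n) (hLR : SepPair G D L R) (hS : Setting G d a X D) {Λ : Set V}
    (hΛX : Λ ⊆ X) (hΛ : ∀ x ∈ Λ, G.Touches x L) (hcard : 4 ≤ Λ.ncard) :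
    ∃ x ∈ Λ, ¬ G.Touches x R ∧ ∀ i ≤ n, ¬ G.Adj x (p i) := by
  obtain ⟨Λ', hsub, hc, h'⟩ := h.exists_clean_subset hLR hS hΛX hΛ
  obtain ⟨x, hx⟩ := (Set.ncard_pos (Set.toFinite Λ')).1 (by omega)
  exact ⟨x, hsub hx, h' x hx⟩

/-- A crossing extends to an induced path with ends in `X`. -/
theorem Crossing.exists_xpath [Finite V] {L R : Set V} {p : ℕ → V} {n : ℕ}
    (h : Crossing G D L R p n) (hLR : SepPair G D L R) (hS : Setting G d a X D) {ΛL ΛR : Set V}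
    (hLX : ΛL ⊆ X) (hL : ∀ x ∈ ΛL, G.Touches x L) (hLcard : 4 ≤ ΛL.ncard)
    (hRX : ΛR ⊆ X) (hR : ∀ x ∈ ΛR, G.Touches x R) (hRcard : 4 ≤ ΛR.ncard) :
    ∃ u N o, G.XPath X D u N ∧ 2 ≤ o ∧ o + n + 2 ≤ N ∧ (∀ i ≤ n, u (o + i) = p i) ∧
      (∀ i, 1 ≤ i → i < o → u i ∈ L) ∧ (∀ i, o + n < i → i < N → u i ∈ R) ∧
      u 0 ∈ ΛL ∧ u N ∈ ΛR := by
  -- Both end vertices are chosen without neighbours on the crossing or on the opposite side, so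
  -- that shortest continuations through `L` and `R` leave the path induced.
  obtain ⟨lam, hlam, lamR, lamp⟩ := h.exists_clean hLR hS hLX hL hLcard
  obtain ⟨rho, hrho, rhoL, rhop⟩ := h.reverse.exists_clean hLR.symm hS hRX hR hRcard
  have rhop : ∀ i ≤ n, ¬ G.Adj rho (p i) := fun i hi => by
    have := rhop (n - i) (by omega)
    rwa [show n - (n - i) = i by omega] at this
  have hlD : lam ∉ D := hS.disj _ (hLX hlam)
  have hrD : rho ∉ D := hS.disj _ (hRX hrho)
  have hlr : lam ≠ rho := fun e => lamR (e ▸ hR _ hrho)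
  have hnlr : ¬ G.Adj lam rho := hS.stable _ (hLX hlam) _ (hRX hrho)
  obtain ⟨q, s, hq, hqm, q0, qs, q0', qs'⟩ := (hLR.connL.insert (hL _ hlam)).exists_minPath
    (· = lam) (G.Adj (p 0)) ⟨lam, Or.inl rfl, rfl⟩ (by
      obtain ⟨y, hy, e⟩ := (h.left 0 (by omega)).2 rfl
      exact ⟨y, Or.inr hy, e⟩)
  obtain ⟨r, s', hr, hrm, r0, rs, r0', rs'⟩ := (hLR.connR.insert (hR _ hrho)).exists_minPath
    (G.Adj (p n)) (· = rho) (by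
      obtain ⟨y, hy, e⟩ := (h.right n le_rfl).2 rfl
      exact ⟨y, Or.inr hy, e⟩) ⟨rho, Or.inl rfl, rfl⟩
  have hs0 : 1 ≤ s := by
    by_contra hs
    obtain rfl : s = 0 := by omega
    exact lamp 0 (by omega) (q0 ▸ qs.symm)
  have hs'0 : 1 ≤ s' := by
    by_contra hs
    obtain rfl : s' = 0 := by omega
    exact rhop n le_rfl (rs ▸ r0.symm)
  have hqL : ∀ i, 1 ≤ i → i ≤ s → q i ∈ L := fun i hi hi' => (hqm i hi').resolve_left fun e => by
    have := q0' i hi' e; omega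
  have hrR : ∀ i < s', r i ∈ R := fun i hi => (hrm i hi.le).resolve_left fun e => by
    have := rs' i hi.le e; omega
  have qcases : ∀ i ≤ s, (i = 0 ∧ q i = lam) ∨ q i ∈ L := fun i hi => by
    rcases Nat.eq_zero_or_pos i with rfl | h0
    · exact Or.inl ⟨rfl, q0⟩
    · exact Or.inr (hqL i h0 hi)
  have rcases' : ∀ i ≤ s', (i = s' ∧ r i = rho) ∨ r i ∈ R := fun i hi => by
    rcases hi.eq_or_lt with rfl | h0
    · exact Or.inl ⟨rfl, rs⟩
    · exact Or.inr (hrR i h0)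
  have p1 := hq.app h.path
    (fun i hi j hj e => by
      rcases qcases i hi with ⟨-, h'⟩ | h'
      · exact hlD (h' ▸ e ▸ h.mem j hj)
      · exact h.notMemL j hj (e ▸ h'))
    (fun i hi j hj => by
      constructor
      · intro e
        rcases qcases i hi with ⟨-, h'⟩ | h'
        · exact (lamp j hj (h' ▸ e)).elim
        · obtain rfl := (h.left j hj).1 ⟨_, h', e.symm⟩
          exact ⟨qs' i hi e.symm, rfl⟩
      · rintro ⟨rfl, rfl⟩; exact qs.symm)
  have p2 := p1.app hr
    (fun i hi j hj => by
      rcases app_cases (u := q) (v := p) hi with ⟨h1, h2⟩ | ⟨k, hk, h1, h2⟩ <;> rw [h2]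
      · rcases qcases i h1 with ⟨-, h'⟩ | h' <;> rcases rcases' j hj with ⟨-, h''⟩ | h''
        · rw [h', h'']; exact hlr
        · rw [h']; exact fun e => hlD (e ▸ hLR.subR h'')
        · rw [h'']; exact fun e => hrD (e ▸ hLR.subL h')
        · exact (hLR.sep _ h' _ h'').1
      · rcases rcases' j hj with ⟨-, h''⟩ | h''
        · rw [h'']; exact fun e => hrD (e ▸ h.mem k hk)
        · exact fun e => h.notMemR k hk (e ▸ h''))
    (fun i hi j hj => by
      rcases app_cases (u := q) (v := p) hi with ⟨h1, h2⟩ | ⟨k, hk, h1, h2⟩ <;> rw [h2]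
      · refine iff_of_false (fun e => ?_) (by omega)
        rcases qcases i h1 with ⟨-, h'⟩ | h' <;> rcases rcases' j hj with ⟨-, h''⟩ | h''
        · exact hnlr (h' ▸ h'' ▸ e)
        · exact lamR ⟨_, h'', h' ▸ e⟩
        · exact rhoL ⟨_, h', h'' ▸ e.symm⟩
        · exact (hLR.sep _ h' _ h'').2 e
      · constructor
        · intro e
          rcases rcases' j hj with ⟨-, h''⟩ | h''
          · exact (rhop k hk (h'' ▸ e.symm)).elim
          · obtain rfl := (h.right k hk).1 ⟨_, h'', e⟩
            exact ⟨h1, r0' j hj e⟩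
        · rintro ⟨h3, rfl⟩
          obtain rfl : k = n := by omega
          exact r0)
  have e1 : ∀ i ≤ s, app (app q s p) (s + 1 + n) r i = q i := fun i hi => by
    rw [app_left (by omega), app_left hi]
  have e2 : ∀ i ≤ n, app (app q s p) (s + 1 + n) r (s + 1 + i) = p i := fun i hi => by
    rw [app_left (by omega), app_right]
  have e3 : ∀ i, app (app q s p) (s + 1 + n) r (s + 1 + n + 1 + i) = r i := fun i => app_right
  refine ⟨_, s + 1 + n + 1 + s', s + 1, ⟨p2, by omega, ?_, ?_, ?_⟩, by omega, by omega, e2, ?_, ?_,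
    ?_, ?_⟩
  · rw [e1 0 (by omega), q0]; exact hLX hlam
  · rw [e3, rs]; exact hRX hrho
  · intro i hi hi'
    rcases Nat.lt_or_ge s i with h1 | h1
    · rcases Nat.lt_or_ge (s + 1 + n) i with h2 | h2
      · obtain ⟨k, rfl⟩ := Nat.exists_eq_add_of_le (show s + 1 + n + 1 ≤ i by omega)
        rw [e3]; exact hLR.subR (hrR k (by omega))
      · obtain ⟨k, rfl⟩ := Nat.exists_eq_add_of_le (show s + 1 ≤ i by omega)
        rw [e2 k (by omega)]; exact h.mem k (by omega)
    · rw [e1 i h1]; exact hLR.subL (hqL i hi h1)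
  · intro i hi hi'
    rw [e1 i (by omega)]; exact hqL i hi (by omega)
  · intro i hi hi'
    obtain ⟨k, rfl⟩ := Nat.exists_eq_add_of_le (show s + 1 + n + 1 ≤ i by omega)
    rw [e3]; exact hrR k (by omega)
  · rw [e1 0 (by omega), q0]; exact hlam
  · rw [e3, rs]; exact hrho

/-- The number of neighbours of a vertex of `X` on a crossing is at most `d`. -/
theorem Crossing.ncard_nbrs_le [Finite V] {L R : Set V} {p : ℕ → V} {n : ℕ}
    (h : Crossing G D L R p n) (hLR : SepPair G D L R) (hS : Setting G d a X D) {ΛL ΛR : Set V}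
    (hLX : ΛL ⊆ X) (hL : ∀ x ∈ ΛL, G.Touches x L) (hLcard : 4 ≤ ΛL.ncard)
    (hRX : ΛR ⊆ X) (hR : ∀ x ∈ ΛR, G.Touches x R) (hRcard : 4 ≤ ΛR.ncard) {z : V} (hz : z ∈ X)
    (hzL : z ∉ ΛL) (hzR : z ∉ ΛR) : (seg p 0 n ∩ G.neighborSet z).ncard ≤ d := by
  obtain ⟨u, N, o, hu, ho, hoN, hup, -, -, h0, hN⟩ := h.exists_xpath hLR hS hLX hL hLcard hRX hR hRcard
  refine hu.ncard_nbrs_le hS hz (fun e => hzL (e ▸ h0)) (fun e => hzR (e ▸ hN)) ?_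
    Set.inter_subset_right
  rintro _ ⟨⟨k, -, hk, rfl⟩, -⟩
  exact ⟨o + k, by omega, by omega, hup k hk⟩

/-- Induced paths from the vertices of `X` to `b`, inside `D`, pairwise disjoint except for `b`. -/
structure Fan (G : SimpleGraph V) (X D : Set V) (b : V) (P : V → ℕ → V) (len : V → ℕ) : Prop where
  mem_b : b ∈ D
  path : ∀ x ∈ X, G.IndPath (P x) (len x)
  zero : ∀ x ∈ X, P x 0 = x
  last : ∀ x ∈ X, P x (len x) = b
  mem : ∀ x ∈ X, ∀ i, 1 ≤ i → i ≤ len x → P x i ∈ D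
  disj : ∀ x ∈ X, ∀ y ∈ X, x ≠ y → ∀ i ≤ len x, ∀ j ≤ len y, P x i = P y j → P x i = b

namespace Fan
variable {b : V} {P : V → ℕ → V} {len : V → ℕ}

theorem len_pos (hF : Fan G X D b P len) (hS : Setting G d a X D) {x : V} (hx : x ∈ X) :
    1 ≤ len x := by
  by_contra hc
  have h1 := hF.last x hx
  rw [show len x = 0 by omega, hF.zero x hx] at h1
  exact hS.disj x hx (h1 ▸ hF.mem_b)

/-- All but at most one member of the fan contain a crossing from `L` to `R`. -/
theorem exists_crossing [Finite V] (hF : Fan G X D b P len) (hS : Setting G d a X D)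
    {L R : Set V} (hLR : SepPair G D L R) (hb : b ∈ R) :
    {x ∈ X | G.Touches x L ∧ ¬ ∃ k m, 1 ≤ k ∧ k + m < len x ∧
      Crossing G D L R (fun i => P x (k + i)) m}.ncard ≤ 1 := by
  classical
  have hnb : ∀ x ∈ X, ∀ i ≤ len x, G.Touches (P x i) L → i < len x := by
    intro x hx i hi ht
    refine lt_of_le_of_ne hi ?_
    rintro rfl
    rw [hF.last x hx] at ht
    exact (hLR.sep.symm.not_touches hb) ht
  -- Consider the last contact of the member with `L`. If it is not the first vertex, the piece from
  -- there to the next contact with `R` is a crossing. So for a member without a crossing,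
  -- everything after its first vertex is separated from `L`.
  have key : ∀ x ∈ X, G.Touches x L → (¬ ∃ k m, 1 ≤ k ∧ k + m < len x ∧
      Crossing G D L R (fun i => P x (k + i)) m) →
      G.Sep L (ico (P x) 1 (len x + 1)) := by
    intro x hx hxL hno
    have h0 : G.Touches (P x 0) L := by rwa [hF.zero x hx]
    have hk := Nat.findGreatest_spec (P := fun i => G.Touches (P x i) L) (Nat.zero_le (len x)) h0
    have hkle := Nat.findGreatest_le (P := fun i => G.Touches (P x i) L) (len x)
    have hkmax : ∀ i ≤ len x, G.Touches (P x i) L →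
        i ≤ Nat.findGreatest (fun i => G.Touches (P x i) L) (len x) :=
      fun i hi h => Nat.le_findGreatest (P := fun i => G.Touches (P x i) L) hi h
    set k := Nat.findGreatest (fun i => G.Touches (P x i) L) (len x)
    have hklt := hnb x hx k hkle hk
    have hnL : ∀ i, k ≤ i → i ≤ len x → P x i ∉ L := by
      intro i hi hi' hm
      rcases hi'.eq_or_lt with rfl | hi'
      · rw [hF.last x hx] at hm
        exact hLR.sep.notMem hm hb
      · have := hkmax (i + 1) hi' ⟨_, hm, ((hF.path x hx).adj_succ hi').symm⟩
        omega
    rcases Nat.eq_zero_or_pos k with hk0 | hk0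
    · refine (sep_ico_left fun i hi hi' => ⟨hnL i (by omega) (by omega), fun e => ?_⟩).symm
      have := hkmax i (by omega) e
      omega
    · exfalso
      have hex : ∃ i, k ≤ i ∧ G.Touches (P x i) R := by
        refine ⟨len x - 1, by omega, b, hb, ?_⟩
        have := (hF.path x hx).adj_succ (show len x - 1 < len x by omega)
        rwa [show len x - 1 + 1 = len x by omega, hF.last x hx] at this
      have hm := Nat.find_spec hex
      have hmmin : ∀ i, k ≤ i → G.Touches (P x i) R → Nat.find hex ≤ i := fun i h1 h2 =>
        Nat.find_min' hex ⟨h1, h2⟩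
      have hmlt : Nat.find hex < len x := by
        have := hmmin (len x - 1) (by omega) ⟨b, hb, by
          have := (hF.path x hx).adj_succ (show len x - 1 < len x by omega)
          rwa [show len x - 1 + 1 = len x by omega, hF.last x hx] at this⟩
        omega
      set m := Nat.find hex
      refine hno ⟨k, m - k, hk0, by omega, (hF.path x hx).shift hm.1 (by omega), ?_, ?_, ?_, ?_, ?_⟩
      · exact fun i hi => hF.mem x hx _ (by omega) (by omega)
      · intro i hi
        constructor
        · intro e; have := hkmax (k + i) (by omega) e; omega
        · rintro rfl; exact hk
      · intro i hi
        constructor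
        · intro e; have := hmmin (k + i) (by omega) e; omega
        · rintro rfl; rw [show k + (m - k) = m by omega]; exact hm.2
      · exact fun i hi => hnL _ (by omega) (by omega)
      · intro i hi hmem
        rcases Nat.eq_zero_or_pos i with rfl | hi0
        · exact hLR.sep.symm.not_touches hmem hk
        · have := hmmin (k + i - 1) (by omega) ⟨_, hmem, by
            have := (hF.path x hx).adj_succ (show k + i - 1 < len x by omega)
            rwa [show k + i - 1 + 1 = k + i by omega] at this⟩
          omega
  refine (Set.ncard_le_one (Set.toFinite _)).2 ?_
  rintro x ⟨hx, hxL, hxn⟩ y ⟨hy, hyL, hyn⟩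
  have lx := hF.len_pos hS hx
  have ly := hF.len_pos hS hy
  have tt : ∀ x ∈ X, G.Touches x (ico (P x) 1 (len x + 1)) := fun x hx => by
    have := hF.len_pos hS hx
    refine ⟨P x 1, mem_ico_of le_rfl (by omega), ?_⟩
    have h1 := (hF.path x hx).adj_succ (show 0 < len x by omega)
    rwa [hF.zero x hx] at h1
  have sub : ∀ x ∈ X, ico (P x) 1 (len x + 1) ⊆ D := fun x hx =>
    ico_subset fun i h1 h2 => hF.mem x hx i h1 (by omega)
  -- Two exceptional members meet at `b` and form one connected set separated from `L`, with `x` and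
  -- `y` as common attachments.
  have hc : G.Conn (ico (P x) 1 (len x + 1) ∪ ico (P y) 1 (len y + 1)) :=
    ((hF.path x hx).conn_ico (by omega) le_rfl).union_mem
      ((hF.path y hy).conn_ico (by omega) le_rfl) (x := b)
      ⟨len x, lx, by omega, hF.last x hx⟩ ⟨len y, ly, by omega, hF.last y hy⟩
  exact hS.eq_of_touches hLR.connL hc hLR.subL (Set.union_subset (sub x hx) (sub y hy))
    (sep_union_right.2 ⟨key x hx hxL hxn, key y hy hyL hyn⟩) hx hy hxL
    ((tt x hx).mono Set.subset_union_left) hyL ((tt y hy).mono Set.subset_union_right)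

end Fan
end SimpleGraph

/-! ### Disjoint contact intervals on a path, and detours around one of them. -/

namespace SimpleGraph
variable {V : Type*} {G : SimpleGraph V} {d : ℕ} {a : V} {X D : Set V}

theorem exists_three_lt {s : Finset ℕ} (h : 3 ≤ s.card) :
    ∃ i ∈ s, ∃ j ∈ s, ∃ k ∈ s, i < j ∧ j < k := by
  obtain ⟨t, hts, ht⟩ := Finset.exists_subset_card_eq h
  refine ⟨_, hts (t.orderEmbOfFin_mem ht 0), _, hts (t.orderEmbOfFin_mem ht 1), _,
    hts (t.orderEmbOfFin_mem ht 2), ?_, ?_⟩ <;>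
  exact (t.orderEmbOfFin ht).lt_iff_lt.2 (by decide)

theorem ico_reverse {u : ℕ → V} {k i j : ℕ} (hij : i ≤ j) (hj : j ≤ k + 1) :
    ico (fun p => u (k - p)) i j = ico u (k + 1 - j) (k + 1 - i) := by
  ext x
  constructor
  · rintro ⟨p, h1, h2, rfl⟩
    exact ⟨k - p, by omega, by omega, rfl⟩
  · rintro ⟨p, h1, h2, rfl⟩
    exact ⟨k - p, by omega, by omega, congrArg u (by omega)⟩

/-- A connected set meeting `L` and `R` contains a crossing. -/
theorem SepPair.exists_crossing {L R C : Set V} (h : SepPair G D L R) (hC : G.Conn C)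
    (hCD : C ⊆ D) (hL : (C ∩ L).Nonempty) (hR : (C ∩ R).Nonempty) :
    ∃ f m, Crossing G D L R f m ∧ ∀ g ≤ m, f g ∈ C := by
  obtain ⟨q, n, hq, hqC, q0, qn, q0', qn'⟩ := hC.exists_minPath (· ∈ L) (· ∈ R) hL hR
  have hn0 : n ≠ 0 := by rintro rfl; exact h.sep.notMem q0 qn
  have hn1 : n ≠ 1 := by
    rintro rfl
    exact (h.sep _ q0 _ qn).2 (hq.adj_succ (by omega))
  obtain ⟨f, m, hf, hfm, f0, fm, f0', fm'⟩ := (hq.conn_ico (i := 1) (j := n) (by omega)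
    (by omega)).exists_minPath (G.Touches · L) (G.Touches · R)
    ⟨q 1, mem_ico_of le_rfl (by omega), q 0, q0, (hq.adj_succ (by omega)).symm⟩
    ⟨q (n - 1), mem_ico_of (by omega) (by omega), q n, qn, by
      rw [hq.adj _ (by omega) _ le_rfl]; omega⟩
  have key : ∀ g ≤ m, f g ∈ C ∧ f g ∉ L ∧ f g ∉ R := by
    intro g hg
    obtain ⟨k, h1, h2, e⟩ := hfm g hg
    rw [← e]
    exact ⟨hqC k h2.le, fun h' => by have := q0' k h2.le h'; omega,
      fun h' => by have := qn' k h2.le h'; omega⟩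
  exact ⟨f, m, ⟨hf, fun g hg => hCD (key g hg).1, fun g hg => ⟨f0' g hg, by rintro rfl; exact f0⟩,
    fun g hg => ⟨fm' g hg, by rintro rfl; exact fm⟩, fun g hg => (key g hg).2.1,
    fun g hg => (key g hg).2.2⟩, fun g hg => (key g hg).1⟩

/-- An induced path `w 0, …, w k` in `D` and vertices `z e` of `X` whose contacts with the path lie
in disjoint intervals `[lo e, hi e]`, which all have length one or all have length at least two. -/
structure DirectSystem (G : SimpleGraph V) (X D : Set V) (w : ℕ → V) (k n : ℕ) (z : ℕ → V)
    (lo hi : ℕ → ℕ) : Prop where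
  path : G.IndPath w k
  mem : ∀ i ≤ k, w i ∈ D
  z_mem : ∀ e < n, z e ∈ X
  lt : ∀ e < n, lo e < hi e
  lt_next : ∀ e e', e < e' → e' < n → hi e < lo e'
  hi_le : ∀ e < n, hi e ≤ k
  adj_lo : ∀ e < n, G.Adj (z e) (w (lo e))
  adj_hi : ∀ e < n, G.Adj (z e) (w (hi e))
  between : ∀ e < n, ∀ i ≤ k, G.Adj (z e) (w i) → lo e ≤ i ∧ i ≤ hi e
  type : (∀ e < n, hi e = lo e + 1) ∨ ∀ e < n, lo e + 2 ≤ hi e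
  spread : ∀ v ∈ D, ∀ c μ e, c + 2 ≤ μ → μ + 2 ≤ e → e ≤ k →
    G.Adj (w c) v → G.Adj (w μ) v → G.Adj (w e) v → False

namespace DirectSystem
variable {w : ℕ → V} {k n : ℕ} {z : ℕ → V} {lo hi : ℕ → ℕ} {f : ℕ → V} {m : ℕ}

theorem reverse (h : DirectSystem G X D w k n z lo hi) :
    DirectSystem G X D (fun i => w (k - i)) k n (fun e => z (n - 1 - e))
      (fun e => k - hi (n - 1 - e)) (fun e => k - lo (n - 1 - e)) where
  path := h.path.reverse
  mem i hi := h.mem _ (by omega)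
  z_mem e he := h.z_mem _ (by omega)
  lt e he := by
    have := h.lt (n - 1 - e) (by omega); have := h.hi_le (n - 1 - e) (by omega); omega
  lt_next e e' h1 h2 := by
    have := h.lt_next (n - 1 - e') (n - 1 - e) (by omega) (by omega)
    have := h.hi_le (n - 1 - e) (by omega); have := h.lt (n - 1 - e) (by omega); omega
  hi_le e he := by omega
  adj_lo e he := by
    have := h.hi_le (n - 1 - e) (by omega)
    have h' := h.adj_hi (n - 1 - e) (by omega)
    show G.Adj _ (w (k - (k - hi (n - 1 - e))))
    rwa [show k - (k - hi (n - 1 - e)) = hi (n - 1 - e) by omega]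
  adj_hi e he := by
    have := h.hi_le (n - 1 - e) (by omega); have := h.lt (n - 1 - e) (by omega)
    have h' := h.adj_lo (n - 1 - e) (by omega)
    show G.Adj _ (w (k - (k - lo (n - 1 - e))))
    rwa [show k - (k - lo (n - 1 - e)) = lo (n - 1 - e) by omega]
  between e he i hi h' := by
    have := h.between (n - 1 - e) (by omega) _ (by omega) h'; omega
  type := h.type.imp
    (fun h' e he => by
      have := h' (n - 1 - e) (by omega); have := h.hi_le (n - 1 - e) (by omega); omega)
    (fun h' e he => by
      have := h' (n - 1 - e) (by omega); have := h.hi_le (n - 1 - e) (by omega); omega)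
  spread v hv c μ e h1 h2 h3 a1 a2 a3 :=
    h.spread v hv (k - e) (k - μ) (k - c) (by omega) (by omega) (by omega) a3 a2 a1

theorem inj (h : DirectSystem G X D w k n z lo hi) {e e' : ℕ} (he : e < n) (he' : e' < n)
    (hz : z e = z e') : e = e' := by
  by_contra hne
  have h1 := h.between e he _ ((h.lt e' he').le.trans (h.hi_le e' he')) (hz ▸ h.adj_lo e' he')
  have h2 := h.lt e' he'
  rcases Nat.lt_or_gt_of_ne hne with h' | h'
  · have := h.lt_next e e' h' he'; omega
  · have := h.lt_next e' e h' he; omega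

theorem sepPair (h : DirectSystem G X D w k n z lo hi) {e : ℕ} (h0 : 0 < e) (he : e + 1 < n) :
    SepPair G D (ico w 0 (lo e)) (ico w (hi e + 1) (k + 1)) := by
  have h1 := h.lt_next 0 e h0 (by omega)
  have h2 := h.lt_next e (e + 1) (by omega) he
  have h3 := h.hi_le (e + 1) he
  have h4 := h.lt (e + 1) he
  have h5 := h.lt e (by omega)
  exact ⟨h.path.conn_ico (by omega) (by omega), h.path.conn_ico (by omega) (by omega),
    ico_subset fun i _ _ => h.mem i (by omega), ico_subset fun i _ _ => h.mem i (by omega),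
    h.path.sep_ico (by omega) (by omega)⟩

/-- The crossing leaves the left side before two intervals that it does not touch. Two connected
sets then join these intervals: the segment from `hi l` to `lo r`, and the detour from `lo l` back
to `w c`, along `f`, and back on the path to `hi r`. For long intervals the two sets are separated,
yet have both `z l` and `z r` as attachments. For intervals of length one they form a prism with the
path `z l`, `a`, `z r`. -/
theorem false_of_double (h : DirectSystem G X D w k n z lo hi) (hS : Setting G d a X D) {e : ℕ}
    (he : e + 1 < n) (hf : Crossing G D (ico w 0 (lo e)) (ico w (hi e + 1) (k + 1)) f m)
    {l r c : ℕ} (hlr : l < r) (hre : r < e) (nl : ∀ g ≤ m, ¬ G.Adj (z l) (f g))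
    (nr : ∀ g ≤ m, ¬ G.Adj (z r) (f g)) (hcl : c < lo l) (hc : G.Adj (f 0) (w c))
    (hcmax : ∀ c' < lo e, G.Adj (f 0) (w c') → c' ≤ c) : False := by
  obtain ⟨_, ⟨q, hq, hqk, rfl⟩, hmq⟩ := (hf.right m le_rfl).2 rfl
  have l1 := h.lt l (by omega)
  have l2 := h.lt_next l r hlr (by omega)
  have l3 := h.lt r (by omega)
  have l4 := h.lt_next r e hre (by omega)
  have l5 := h.lt e (by omega)
  have hlX := h.z_mem l (by omega)
  have hrX := h.z_mem r (by omega)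
  have zne : ∀ {x y}, x ∈ X → y ∈ D → x ≠ y := fun hx hy e => hS.disj _ hx (e ▸ hy)
  have hnf : ∀ g ≤ m, ∀ i, c < i → i < lo e → w i ≠ f g ∧ ¬ G.Adj (w i) (f g) := by
    intro g hg i hi hi'
    refine ⟨fun e' => hf.notMemL g hg (e' ▸ mem_ico_of (by omega) hi'), fun e' => ?_⟩
    obtain rfl := (hf.left g hg).1 ⟨_, mem_ico_of (Nat.zero_le _) hi', e'.symm⟩
    have := hcmax i hi' e'.symm
    omega
  have hB : G.Conn (ico w (hi l) (lo r + 1)) := h.path.conn_ico (by omega) (by omega)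
  have hC : G.Conn ((ico w c (lo l + 1) ∪ ico f 0 (m + 1)) ∪ ico w (hi r) (q + 1)) :=
    ((h.path.conn_ico (by omega) (by omega)).union_adj
      (hf.path.conn_ico (by omega) (by omega)) (mem_ico_of (k := c) le_rfl (by omega))
      (mem_ico_of (k := 0) le_rfl (by omega)) hc.symm).union_adj
      (h.path.conn_ico (by omega) (by omega)) (Or.inr (mem_ico_of (k := m) (by omega) (by omega)))
      (mem_ico_of (k := q) (by omega) (by omega)) hmq
  rcases h.type with hp | hw
  · have p1 := hp l (by omega)
    have p2 := hp r (by omega)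
    have hA : G.Conn (insert (z l) ({a} ∪ {z r})) :=
      ((Conn.singleton a).union_adj (Conn.singleton (z r)) rfl rfl (hS.adj_a _ hrX)).insert
        ⟨a, Or.inl rfl, (hS.adj_a _ hlX).symm⟩
    have haD : ∀ y ∈ D, a ≠ y ∧ ¬ G.Adj a y := fun y hy =>
      ⟨fun e' => hS.a_notMem (e' ▸ hy), hS.not_adj_a y hy⟩
    refine hS.prism (hasPrism_of_conn' (a1 := z l) (a2 := w (hi l)) (a3 := w (lo l))
      (b1 := z r) (b2 := w (lo r)) (b3 := w (hi r)) (h.adj_hi l (by omega))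
      (h.adj_lo l (by omega)) ?_ (h.adj_lo r (by omega)) (h.adj_hi r (by omega)) ?_ ?_ ?_ ?_
      hA hB hC (Or.inl rfl) (Or.inr (Or.inr rfl)) (mem_ico_of (by omega) (by omega))
      (mem_ico_of (by omega) (by omega)) (Or.inl (Or.inl (mem_ico_of (by omega) (by omega))))
      (Or.inr (mem_ico_of (by omega) (by omega))) ?_ ?_ ?_)
    · rw [h.path.adj _ (by omega) _ (by omega)]; omega
    · rw [h.path.adj _ (by omega) _ (by omega)]; omega
    · exact fun e' => by have := h.inj (by omega) (by omega) e'; omega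
    · exact h.path.ne (by omega) (by omega) (by omega)
    · exact h.path.ne (by omega) (by omega) (by omega)
    · rintro _ (rfl | rfl | rfl) _ ⟨i, hi1, hi2, rfl⟩
      · refine ⟨zne hlX (h.mem i (by omega)), fun e' => Or.inl ⟨rfl, congrArg w ?_⟩⟩
        have := h.between l (by omega) i (by omega) e'; omega
      · have := haD _ (h.mem i (by omega))
        exact ⟨this.1, fun e' => (this.2 e').elim⟩
      · refine ⟨zne hrX (h.mem i (by omega)), fun e' => Or.inr ⟨rfl, congrArg w ?_⟩⟩
        have := h.between r (by omega) i (by omega) e'; omega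
    · rintro _ (rfl | rfl | rfl) _ ((⟨i, hi1, hi2, rfl⟩ | ⟨i, hi1, hi2, rfl⟩) | ⟨i, hi1, hi2, rfl⟩)
      · refine ⟨zne hlX (h.mem i (by omega)), fun e' => Or.inl ⟨rfl, congrArg w ?_⟩⟩
        have := h.between l (by omega) i (by omega) e'; omega
      · exact ⟨zne hlX (hf.mem i (by omega)), fun e' => (nl i (by omega) e').elim⟩
      · refine ⟨zne hlX (h.mem i (by omega)), fun e' => ?_⟩
        have := h.between l (by omega) i (by omega) e'; omega
      · have := haD _ (h.mem i (by omega))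
        exact ⟨this.1, fun e' => (this.2 e').elim⟩
      · have := haD _ (hf.mem i (by omega))
        exact ⟨this.1, fun e' => (this.2 e').elim⟩
      · have := haD _ (h.mem i (by omega))
        exact ⟨this.1, fun e' => (this.2 e').elim⟩
      · refine ⟨zne hrX (h.mem i (by omega)), fun e' => ?_⟩
        have := h.between r (by omega) i (by omega) e'; omega
      · exact ⟨zne hrX (hf.mem i (by omega)), fun e' => (nr i (by omega) e').elim⟩
      · refine ⟨zne hrX (h.mem i (by omega)), fun e' => Or.inr ⟨rfl, congrArg w ?_⟩⟩
        have := h.between r (by omega) i (by omega) e'; omega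
    · rintro _ ⟨i, hi1, hi2, rfl⟩ _ ((⟨j, hj1, hj2, rfl⟩ | ⟨j, hj1, hj2, rfl⟩) | ⟨j, hj1, hj2, rfl⟩)
      · refine ⟨h.path.ne (by omega) (by omega) (by omega), fun e' => Or.inl ?_⟩
        rw [h.path.adj _ (by omega) _ (by omega)] at e'
        exact ⟨congrArg w (by omega), congrArg w (by omega)⟩
      · have := hnf j (by omega) i (by omega) (by omega)
        exact ⟨this.1, fun e' => (this.2 e').elim⟩
      · refine ⟨h.path.ne (by omega) (by omega) (by omega), fun e' => Or.inr ?_⟩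
        rw [h.path.adj _ (by omega) _ (by omega)] at e'
        exact ⟨congrArg w (by omega), congrArg w (by omega)⟩
  · have p1 := hw l (by omega)
    have p2 := hw r (by omega)
    have subB : ico w (hi l) (lo r + 1) ⊆ D := ico_subset fun i _ _ => h.mem i (by omega)
    have subC : (ico w c (lo l + 1) ∪ ico f 0 (m + 1)) ∪ ico w (hi r) (q + 1) ⊆ D :=
      Set.union_subset (Set.union_subset (ico_subset fun i _ _ => h.mem i (by omega))
        (ico_subset fun i _ _ => hf.mem i (by omega))) (ico_subset fun i _ _ => h.mem i (by omega))
    refine absurd (hS.eq_of_touches hB hC subB subC ?_ hlX hrX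
      ⟨_, mem_ico_of le_rfl (by omega), h.adj_hi l (by omega)⟩
      ⟨_, Or.inl (Or.inl (mem_ico_of (k := lo l) (by omega) (by omega))), h.adj_lo l (by omega)⟩
      ⟨_, mem_ico_of (k := lo r) (by omega) (by omega), h.adj_lo r (by omega)⟩
      ⟨_, Or.inr (mem_ico_of (k := hi r) (by omega) (by omega)), h.adj_hi r (by omega)⟩) fun e' => by
        have := h.inj (by omega) (by omega) e'; omega
    refine sep_union_right.2 ⟨sep_union_right.2
      ⟨(h.path.sep_ico (by omega) (by omega)).symm, ?_⟩, h.path.sep_ico (by omega) (by omega)⟩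
    exact sep_ico fun i hi1 hi2 j hj1 hj2 => hnf j (by omega) i (by omega) (by omega)

/-- At most three of the vertices before `e` touch the crossing: two at `f 0`, and one elsewhere,
since they all touch the left side as well. Among six indices there remain three clean ones, and by
`false_of_double` for the latter two, the last contact of `f 0` lies beyond the interval of the
first. -/
theorem exists_left [Finite V] (h : DirectSystem G X D w k n z lo hi) (hS : Setting G d a X D)
    {e : ℕ} (h6 : 6 ≤ e) (he : e + 1 < n)
    (hf : Crossing G D (ico w 0 (lo e)) (ico w (hi e + 1) (k + 1)) f m) :
    ∃ l < e, (∀ g ≤ m, ¬ G.Adj (z l) (f g)) ∧ ∃ c, hi l < c ∧ c < lo e ∧ G.Adj (f 0) (w c) := by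
  classical
  have hLR := h.sepPair (by omega) he
  have l5 := h.lt e (by omega)
  have l6 := h.hi_le e (by omega)
  have hC : G.Conn (ico f 1 (m + 1) ∪ ico w (hi e + 1) (k + 1)) :=
    hf.path.conn_tail hLR.connR le_rfl ((hf.right m le_rfl).2 rfl) (by omega)
  have hsep : G.Sep (ico w 0 (lo e)) (ico f 1 (m + 1) ∪ ico w (hi e + 1) (k + 1)) := by
    refine (sep_union_left.2 ⟨sep_ico_left fun i hi hi' => ⟨hf.notMemL i (by omega), fun e => ?_⟩,
      hLR.sep.symm⟩).symm
    have := (hf.left i (by omega)).1 e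
    omega
  have h1 := hS.ncard_touches_le_one hLR.connL hC hLR.subL
    (Set.union_subset (ico_subset fun i _ hi => hf.mem i (by omega)) hLR.subR) hsep
  have h2 := hS.ncard_nbrs_le_two (hf.mem 0 (by omega))
  set bad := (Finset.range e).filter fun l => ∃ g ≤ m, G.Adj (z l) (f g) with hbad
  have hbad3 : bad.card ≤ 3 := by
    have hsub : z '' (bad : Set ℕ) ⊆ {x ∈ X | G.Touches x (ico w 0 (lo e)) ∧
        G.Touches x (ico f 1 (m + 1) ∪ ico w (hi e + 1) (k + 1))} ∪ {x ∈ X | G.Adj x (f 0)} := by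
      rintro _ ⟨l, hl, rfl⟩
      simp only [hbad, Finset.coe_filter, Finset.mem_range] at hl
      obtain ⟨hle, g, hg, hlg⟩ := hl
      have hX := h.z_mem l (by omega)
      rcases Nat.eq_zero_or_pos g with rfl | hg0
      · exact Or.inr ⟨hX, hlg⟩
      · have := h.lt l (by omega)
        have := h.lt_next l e hle (by omega)
        exact Or.inl ⟨hX, ⟨_, mem_ico_of (k := lo l) (by omega) (by omega), h.adj_lo l (by omega)⟩,
          _, Or.inl (mem_ico_of hg0 (by omega)), hlg⟩
    have hinj : Set.InjOn z (bad : Set ℕ) := fun i hi j hj e' => by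
      simp only [hbad, Finset.coe_filter, Finset.mem_range] at hi hj
      have := hi.1; have := hj.1
      exact h.inj (by omega) (by omega) e'
    have := (Set.ncard_le_ncard hsub (Set.toFinite _)).trans (Set.ncard_union_le _ _)
    rw [hinj.ncard_image, Set.ncard_coe_finset] at this
    omega
  have hgood : 3 ≤ (Finset.range e \ bad).card := by
    have := Finset.le_card_sdiff bad (Finset.range e)
    rw [Finset.card_range] at this
    omega
  obtain ⟨l1, m1, l2, m2, l3, m3, h12, h23⟩ := exists_three_lt hgood
  have hmem : ∀ l ∈ Finset.range e \ bad, l < e ∧ ∀ g ≤ m, ¬ G.Adj (z l) (f g) := by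
    intro l hl
    simp only [hbad, Finset.mem_sdiff, Finset.mem_range, Finset.mem_filter, not_and, not_exists] at hl
    exact ⟨hl.1, hl.2 hl.1⟩
  obtain ⟨e1, n1⟩ := hmem l1 m1
  obtain ⟨e2, n2⟩ := hmem l2 m2
  obtain ⟨e3, n3⟩ := hmem l3 m3
  obtain ⟨_, ⟨q, hq, hqk, rfl⟩, hmq⟩ := (hf.left 0 (Nat.zero_le _)).2 rfl
  let Q : ℕ → Prop := fun c => c < lo e ∧ G.Adj (f 0) (w c)
  have hc : Q (Nat.findGreatest Q (lo e)) := Nat.findGreatest_spec hqk.le ⟨hqk, hmq⟩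
  have hcmax : ∀ c < lo e, G.Adj (f 0) (w c) → c ≤ Nat.findGreatest Q (lo e) :=
    fun c h1 h2 => Nat.le_findGreatest h1.le ⟨h1, h2⟩
  refine ⟨l1, e1, n1, _, ?_, hc.1, hc.2⟩
  by_contra hlt
  have := h.lt_next l1 l2 h12 (by omega)
  exact h.false_of_double hS he hf h23 e3 n2 n3 (by omega) hc.2 hcmax

theorem exists_right [Finite V] (h : DirectSystem G X D w k n z lo hi) (hS : Setting G d a X D)
    {e : ℕ} (h6 : 6 ≤ e) (he : e + 6 < n)
    (hf : Crossing G D (ico w 0 (lo e)) (ico w (hi e + 1) (k + 1)) f m) :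
    ∃ r, e < r ∧ r < n ∧ (∀ g ≤ m, ¬ G.Adj (z r) (f g)) ∧
      ∃ c, hi e < c ∧ c < lo r ∧ G.Adj (f m) (w c) := by
  have l5 := h.lt e (by omega)
  have l6 := h.hi_le e (by omega)
  have hf' : Crossing G D (ico (fun p => w (k - p)) 0 (k - hi (n - 1 - (n - 1 - e))))
      (ico (fun p => w (k - p)) (k - lo (n - 1 - (n - 1 - e)) + 1) (k + 1))
      (fun g => f (m - g)) m := by
    rw [show n - 1 - (n - 1 - e) = e by omega, ico_reverse (by omega) (by omega),
      ico_reverse (by omega) (by omega), show k + 1 - (k - hi e) = hi e + 1 by omega,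
      show k + 1 - (k + 1) = 0 by omega, show k + 1 - (k - lo e + 1) = lo e by omega]
    exact hf.reverse
  obtain ⟨l, hl, hn, c, hc1, hc2, hc3⟩ := h.reverse.exists_left hS (e := n - 1 - e) (by omega)
    (by omega) hf'
  simp only [show n - 1 - (n - 1 - e) = e by omega] at hc2
  have := h.lt (n - 1 - l) (by omega)
  have := h.hi_le (n - 1 - l) (by omega)
  refine ⟨n - 1 - l, by omega, by omega, fun g hg => ?_, k - c, by omega, by omega, by simpa using hc3⟩
  have := hn (m - g) (by omega)
  rwa [show m - (m - g) = g by omega] at this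

/-- The neighbours of `z e` separate the two parts of the path. -/
theorem false_of_conn [Finite V] (h : DirectSystem G X D w k n z lo hi) (hS : Setting G d a X D)
    {e : ℕ} (h6 : 6 ≤ e) (he : e + 6 < n) {C : Set V} (hC : G.Conn C) (hCD : C ⊆ D)
    (hCz : ∀ y ∈ C, ¬ G.Adj (z e) y) (hA : (C ∩ ico w 0 (lo e)).Nonempty)
    (hB : (C ∩ ico w (hi e + 1) (k + 1)).Nonempty) : False := by
  have hLR := h.sepPair (e := e) (by omega) (by omega)
  have l5 := h.lt e (by omega)
  have l6 := h.hi_le e (by omega)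
  have heX := h.z_mem e (by omega)
  obtain ⟨f, m, hf, hfz⟩ := hLR.exists_crossing hC hCD hA hB
  have hfz : ∀ g ≤ m, ¬ G.Adj (z e) (f g) := fun g hg => hCz _ (hfz g hg)
  obtain ⟨l, hl, nl, c, c1, c2, c3⟩ := h.exists_left hS h6 (by omega) hf
  obtain ⟨r, hr, hrn, nr, q, q1, q2, q3⟩ := h.exists_right hS h6 he hf
  have a1 := h.lt l (by omega)
  have a2 := h.lt_next l e hl (by omega)
  have a3 := h.lt_next e r hr (by omega)
  have a4 := h.lt r hrn
  have a5 := h.hi_le r hrn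
  have hlX := h.z_mem l (by omega)
  have hrX := h.z_mem r hrn
  have zne : ∀ {x y}, x ∈ X → y ∈ D → x ≠ y := fun hx hy e => hS.disj _ hx (e ▸ hy)
  -- The path `u` runs from `z l` along `w` to `z r`, and the crossing `f` is a bypass of `{z e}` on
  -- it.
  set s := lo r - hi l with hs
  have hu1 : G.IndPath (app (fun _ => z l) 0 (fun i => w (hi l + i))) (0 + 1 + s) :=
    (IndPath.single (z l)).app (h.path.shift (i := hi l) (j := lo r) (by omega) (by omega))
      (fun i hi j hj => zne hlX (h.mem _ (by omega))) (fun i hi' j hj => by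
        constructor
        · intro e'
          have := h.between l (by omega) _ (by omega) e'
          omega
        · rintro ⟨rfl, rfl⟩
          exact h.adj_hi l (by omega))
  set u1 := app (fun _ => z l) 0 (fun i => w (hi l + i)) with hu1d
  have u10 : u1 0 = z l := app_left le_rfl
  have u1s : ∀ i, u1 (0 + 1 + i) = w (hi l + i) := fun i => app_right
  have hu : G.IndPath (app u1 (0 + 1 + s) (fun _ => z r)) (0 + 1 + s + 1 + 0) := by
    refine hu1.app (IndPath.single (z r)) (fun i hi j hj => ?_) (fun i hi' j hj => ?_)
    · rcases Nat.eq_zero_or_pos i with rfl | h0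
      · rw [u10]; exact fun e' => by have := h.inj (by omega) hrn e'; omega
      · obtain ⟨i, rfl⟩ := Nat.exists_eq_add_of_le (show 0 + 1 ≤ i by omega)
        rw [u1s]; exact (zne hrX (h.mem _ (by omega))).symm
    · rcases Nat.eq_zero_or_pos i with rfl | h0
      · rw [u10]; exact iff_of_false (hS.stable _ hlX _ hrX) (by omega)
      · obtain ⟨i, rfl⟩ := Nat.exists_eq_add_of_le (show 0 + 1 ≤ i by omega)
        rw [u1s]
        constructor
        · intro e'
          have := h.between r hrn _ (by omega) e'.symm
          omega
        · rintro ⟨h1, rfl⟩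
          rw [show hi l + i = lo r by omega]
          exact (h.adj_lo r hrn).symm
  set u := app u1 (0 + 1 + s) (fun _ => z r) with hud
  set N := 0 + 1 + s + 1 + 0 with hN
  have u0 : u 0 = z l := by rw [hud, app_left (by omega), u10]
  have us : ∀ i ≤ s, u (i + 1) = w (hi l + i) := fun i hi => by
    rw [hud, app_left (by omega), show i + 1 = 0 + 1 + i by omega, u1s]
  have uN : u N = z r := app_right
  have ucase : ∀ i ≤ N, (i = 0 ∧ u i = z l) ∨ (i = N ∧ u i = z r) ∨
      (0 < i ∧ i < N ∧ u i = w (hi l + (i - 1))) := by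
    intro i hi
    rcases Nat.eq_zero_or_pos i with rfl | h0
    · exact Or.inl ⟨rfl, u0⟩
    · rcases hi.eq_or_lt with rfl | h1
      · exact Or.inr (Or.inl ⟨rfl, uN⟩)
      · refine Or.inr (Or.inr ⟨h0, h1, ?_⟩)
        rw [← us _ (by omega), show i - 1 + 1 = i by omega]
  -- On `u` the vertex `w (hi l + i)` has position `i + 1`, as `z l` comes first.
  have b : Bypass G X D u N {z e} (1 + (lo e - hi l)) (1 + (hi e - hi l)) f m := by
    refine ⟨⟨hu, by omega, u0 ▸ hlX, uN ▸ hrX, fun i h1 h2 => ?_⟩, Conn.singleton _, ?_,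
      ⟨z e, rfl, heX⟩, fun i hiN => ?_, by omega, by omega, by omega, ?_, ?_, fun i hi' ht => ?_,
      hf.path, hf.mem, fun g hg => ?_, fun g hg ht => hfz g hg (touches_singleton.1 ht).symm,
      fun g hg i hi' hij => ?_, fun g hg i hi' hadj => ?_, fun g hg i hi' hi2 hadj => ?_, ?_, ?_⟩
    · rcases ucase i h2.le with h' | h' | h'
      · omega
      · omega
      · rw [h'.2.2]; exact h.mem _ (by omega)
    · rintro _ rfl; exact Or.inr heX
    · rintro (e' : u i = z e)
      rcases ucase i hiN with ⟨h1, h2⟩ | ⟨h1, h2⟩ | ⟨h1, h2, h3⟩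
      · have := h.inj (by omega) (by omega) (h2.symm.trans e'); omega
      · have := h.inj (by omega) (by omega) (h2.symm.trans e'); omega
      · exact zne heX (h.mem (hi l + (i - 1)) (by omega)) (e'.symm.trans h3)
    · rw [touches_singleton, show 1 + (lo e - hi l) = lo e - hi l + 1 by omega, us _ (by omega),
        show hi l + (lo e - hi l) = lo e by omega]
      exact (h.adj_lo e (by omega)).symm
    · rw [touches_singleton, show 1 + (hi e - hi l) = hi e - hi l + 1 by omega, us _ (by omega),
        show hi l + (hi e - hi l) = hi e by omega]
      exact (h.adj_hi e (by omega)).symm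
    · rw [touches_singleton] at ht
      rcases ucase i hi' with ⟨h1, h2⟩ | ⟨h1, h2⟩ | ⟨h1, h2, h3⟩
      · exact (hS.stable _ hlX _ heX (h2 ▸ ht)).elim
      · exact (hS.stable _ hrX _ heX (h2 ▸ ht)).elim
      · rw [h3] at ht
        have := h.between e (by omega) _ (by omega) ht.symm
        omega
    · rintro (e' : f g = z e)
      exact zne heX (hf.mem g hg) e'.symm
    · rcases ucase i hi' with ⟨h1, h2⟩ | ⟨h1, h2⟩ | ⟨h1, h2, h3⟩
      · rw [h2]; exact zne hlX (hf.mem g hg)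
      · rw [h2]; exact zne hrX (hf.mem g hg)
      · rw [h3]
        intro e'
        have hnz := hfz g hg
        rw [← e'] at hnz
        rcases hij with h4 | h4
        · rcases h4.eq_or_lt with rfl | h4
          · rw [show hi l + (1 + (lo e - hi l) - 1) = lo e by omega] at hnz
            exact hnz (h.adj_lo e (by omega))
          · exact hf.notMemL g hg (e' ▸ mem_ico_of (by omega) (by omega))
        · rcases h4.eq_or_lt with rfl | h4
          · rw [show hi l + (1 + (hi e - hi l) - 1) = hi e by omega] at hnz
            exact hnz (h.adj_hi e (by omega))
          · exact hf.notMemR g hg (e' ▸ mem_ico_of (by omega) (by omega))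
    · rcases ucase i (by omega) with ⟨h1, h2⟩ | ⟨h1, h2⟩ | ⟨h1, h2, h3⟩
      · exact (nl g hg (h2 ▸ hadj)).elim
      · omega
      · rw [h3] at hadj
        exact ⟨h1, (hf.left g hg).1 ⟨_, mem_ico_of (by omega) (by omega), hadj.symm⟩⟩
    · rcases ucase i (by omega) with ⟨h1, h2⟩ | ⟨h1, h2⟩ | ⟨h1, h2, h3⟩
      · omega
      · exact (nr g hg (h2 ▸ hadj)).elim
      · rw [h3] at hadj
        exact ⟨h2, (hf.right g hg).1 ⟨_, mem_ico_of (by omega) (by omega), hadj.symm⟩⟩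
    · refine ⟨c - hi l + 1, by omega, ?_⟩
      rw [us _ (by omega), show hi l + (c - hi l) = c by omega]
      exact c3.symm
    · refine ⟨q - hi l + 1, by omega, by omega, ?_⟩
      rw [us _ (by omega), show hi l + (q - hi l) = q by omega]
      exact q3.symm
  rcases h.type with hp | hw
  · exact b.false_of_pair hS (by have := hp e (by omega); omega)
  · refine b.false_of_wide hS fun v hv c' μ e' h0 h1 h2 h3 b1 b2 b3 => ?_
    have hk : ∀ i, 0 < i → i < N → u i = w (hi l + (i - 1)) := fun i h1 h2 => by
      rcases ucase i h2.le with h' | h' | h'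
      · omega
      · omega
      · exact h'.2.2
    rw [hk _ (by omega) (by omega)] at b1 b2 b3
    exact h.spread v hv _ _ _ (by omega) (by omega) (by omega) b1 b2 b3

end DirectSystem
end SimpleGraph

/-! ### Families of crossings in a fan, and the bound on disjoint contact intervals. -/

namespace SimpleGraph
variable {V : Type*} {G : SimpleGraph V} {d : ℕ} {a : V} {X D : Set V}

namespace Fan
variable {b : V} {P : V → ℕ → V} {len : V → ℕ}

/-- A family of disjoint crossings inside the members of a fan. -/
theorem exists_family [Finite V] (hF : Fan G X D b P len) (hS : Setting G d a X D)
    {L R : Set V} (hLR : SepPair G D L R) (hb : b ∈ R) {Λ : Set V} (hΛ : Λ ⊆ X)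
    (hL : ∀ x ∈ Λ, G.Touches x L) :
    ∃ (s : Finset V) (p : V → ℕ → V) (m : V → ℕ), Λ.ncard ≤ s.card + 1 ∧ (∀ x ∈ s, x ∈ Λ) ∧
      (∀ x ∈ s, Crossing G D L R (p x) (m x)) ∧
      ∀ x ∈ s, ∀ y ∈ s, x ≠ y → ∀ i ≤ m x, ∀ j ≤ m y, p x i ≠ p y j := by
  classical
  set bad := {x ∈ X | G.Touches x L ∧ ¬ ∃ k m, 1 ≤ k ∧ k + m < len x ∧
      Crossing G D L R (fun i => P x (k + i)) m} with hbad
  have h1 : bad.ncard ≤ 1 := hF.exists_crossing hS hLR hb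
  have hex : ∀ x, ∃ k m, x ∈ Λ \ bad → 1 ≤ k ∧ k + m < len x ∧
      Crossing G D L R (fun i => P x (k + i)) m := by
    intro x
    by_cases hx : x ∈ Λ \ bad
    · have hx2 := hx.2
      simp only [hbad, Set.mem_ofPred_eq, not_and, not_not] at hx2
      obtain ⟨k, m, h⟩ := hx2 (hΛ hx.1) (hL x hx.1)
      exact ⟨k, m, fun _ => h⟩
    · exact ⟨0, 0, fun h => (hx h).elim⟩
  choose k m hkm using hex
  have hfin : (Λ \ bad).Finite := Set.toFinite _
  refine ⟨hfin.toFinset, fun x i => P x (k x + i), m, ?_, fun x hx => ?_, fun x hx => ?_, ?_⟩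
  · rw [← Set.ncard_eq_toFinset_card _ hfin]
    have := Set.ncard_le_ncard_sdiff_add_ncard Λ bad (Set.toFinite _)
    omega
  · exact (hfin.mem_toFinset.1 hx).1
  · exact (hkm x (hfin.mem_toFinset.1 hx)).2.2
  · intro x hx y hy hxy i hi j hj e
    have hx' := hfin.mem_toFinset.1 hx
    have hy' := hfin.mem_toFinset.1 hy
    obtain ⟨-, h2, -⟩ := hkm x hx'
    obtain ⟨-, h3, -⟩ := hkm y hy'
    have h4 := hF.disj x (hΛ hx'.1) y (hΛ hy'.1) hxy _ (by omega) _ (by omega) e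
    rw [← hF.last x (hΛ hx'.1)] at h4
    have := (hF.path x (hΛ hx'.1)).inj _ (by omega) _ le_rfl h4
    omega

/-- Among five vertices of `X`, one is not adjacent to `b` and the component of `b` avoiding its
neighbours touches four other vertices of `X`. -/
theorem exists_rich :
    ∃ N : ℕ, ∀ {V : Type*} [Finite V] {G : SimpleGraph V} {d : ℕ} {a b : V} {X D : Set V}
      {P : V → ℕ → V} {len : V → ℕ}, Fan G X D b P len → Setting G d a X D → ∀ Z ⊆ X,
      N ≤ Z.ncard → ∃ z ∈ Z, ¬ G.Adj z b ∧
        4 ≤ {x ∈ X | x ≠ z ∧ G.Touches x (G.comp {y ∈ D | ¬ G.Adj z y} b)}.ncard := by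
  classical
  -- The colour of a pair tells which of the two touches the component of `b` belonging to the
  -- other. If either bit is constantly true, the first or the last of the five vertices serves.
  obtain ⟨N, hN⟩ := exists_ramsey (Bool × Bool) 5
  -- At most two vertices of `X` are adjacent to `b`.
  refine ⟨N + 2, fun {V} _ {G d a b X D P len} hF hS Z hZ hcard => ?_⟩
  have hfin : (Z \ {z ∈ X | G.Adj z b}).Finite := Set.toFinite _
  have hc : N ≤ hfin.toFinset.card := by
    rw [← Set.ncard_eq_toFinset_card _ hfin]
    have := Set.ncard_le_ncard_sdiff_add_ncard Z {z ∈ X | G.Adj z b} (Set.toFinite _)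
    have := hS.ncard_nbrs_le_two hF.mem_b
    omega
  set C : V → Set V := fun z => G.comp {y ∈ D | ¬ G.Adj z y} b with hC
  obtain ⟨f, c, hf, hinj, hcol⟩ := hN hfin.toFinset hc fun x y =>
    (decide (G.Touches x (C y)), decide (G.Touches y (C x)))
  have hfX : ∀ i, f i ∈ Z ∧ f i ∈ X ∧ ¬ G.Adj (f i) b := fun i => by
    have h := hfin.mem_toFinset.1 (hf i)
    exact ⟨h.1, hZ h.1, fun e => h.2 ⟨hZ h.1, e⟩⟩
  have four : ∀ i0 : Fin 5, (∀ i, i ≠ i0 → G.Touches (f i) (C (f i0))) →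
      4 ≤ {x ∈ X | x ≠ f i0 ∧ G.Touches x (C (f i0))}.ncard := by
    intro i0 h
    have hsub : f '' (({i0}ᶜ : Finset (Fin 5)) : Set (Fin 5)) ⊆
        {x ∈ X | x ≠ f i0 ∧ G.Touches x (C (f i0))} := by
      rintro _ ⟨i, hi, rfl⟩
      have hi' : i ≠ i0 := by simpa using hi
      exact ⟨(hfX i).2.1, fun e => hi' (hinj e), h i hi'⟩
    have := Set.ncard_le_ncard hsub (Set.toFinite _)
    rwa [Set.ncard_image_of_injective _ hinj, Set.ncard_coe_finset, Finset.card_compl,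
      Finset.card_singleton, Fintype.card_fin] at this
  have hcol1 : ∀ i j, i < j → decide (G.Touches (f i) (C (f j))) = c.1 := fun i j h =>
    congrArg Prod.fst (hcol i j h)
  have hcol2 : ∀ i j, i < j → decide (G.Touches (f j) (C (f i))) = c.2 := fun i j h =>
    congrArg Prod.snd (hcol i j h)
  rcases hc1 : c.1 with _ | _
  swap
  · refine ⟨f 4, (hfX 4).1, (hfX 4).2.2, four 4 fun i hi => ?_⟩
    have := hcol1 i 4 (lt_of_le_of_ne (Fin.le_last i) hi)
    rw [hc1] at this
    simpa using this
  rcases hc2 : c.2 with _ | _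
  swap
  · refine ⟨f 0, (hfX 0).1, (hfX 0).2.2, four 0 fun i hi => ?_⟩
    have := hcol2 0 i (Fin.pos_of_ne_zero hi)
    rw [hc2] at this
    simpa using this
  exfalso
  -- Beyond `P (f 0) 1` the fan path of `f 0` lies in the component belonging to `f 0`, so it
  -- contains no neighbour of `f j`. If `P (f 0) 1` were not adjacent to `f j` either, then `f 0`
  -- would touch the component belonging to `f j`. Thus `P (f 0) 1` has too many neighbours in `X`.
  have key : ∀ j, 0 < j → G.Adj (f j) (P (f 0) 1) := by
    intro j hj
    have n1 : ¬ G.Touches (f 0) (C (f j)) := by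
      have := hcol1 0 j hj; rw [hc1] at this; simpa using this
    have n2 : ¬ G.Touches (f j) (C (f 0)) := by
      have := hcol2 0 j hj; rw [hc2] at this; simpa using this
    obtain ⟨-, h0X, h0b⟩ := hfX 0
    obtain ⟨-, hjX, hjb⟩ := hfX j
    have hp := hF.path _ h0X
    have hl1 := hF.len_pos hS h0X
    have hz := hF.zero _ h0X
    have hlast := hF.last _ h0X
    have hl2 : 2 ≤ len (f 0) := by
      by_contra hlt
      have := hp.adj_succ (show 0 < len (f 0) by omega)
      rw [show 0 + 1 = len (f 0) by omega, hlast, hz] at this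
      exact h0b this
    by_contra hn
    have hsub : ico (P (f 0)) 2 (len (f 0) + 1) ⊆ C (f 0) := by
      refine (hp.conn_ico (by omega) le_rfl).subset_comp (w := b) (ico_subset fun i h1 h2 =>
        ⟨hF.mem _ h0X i (by omega) (by omega), fun e => ?_⟩) ⟨len (f 0), by omega, by omega, hlast⟩
        mem_comp_self
      have e' : G.Adj (P (f 0) 0) (P (f 0) i) := by rwa [hz]
      rw [hp.adj _ (by omega) _ (by omega)] at e'
      omega
    have hsub2 : ico (P (f 0)) 1 (len (f 0) + 1) ⊆ C (f j) := by
      refine (hp.conn_ico (by omega) le_rfl).subset_comp (w := b) (ico_subset fun i h1 h2 =>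
        ⟨hF.mem _ h0X i (by omega) (by omega), fun e => ?_⟩) ⟨len (f 0), by omega, by omega, hlast⟩
        mem_comp_self
      rcases h1.eq_or_lt with rfl | h1
      · exact hn e
      · exact n2 ⟨_, hsub (mem_ico_of h1 h2), e⟩
    refine n1 ⟨_, hsub2 (mem_ico_of (k := 1) le_rfl (by omega)), ?_⟩
    have := hp.adj_succ (show 0 < len (f 0) by omega)
    rwa [hz] at this
  have h0X := (hfX 0).2.1
  have hl1 := hF.len_pos hS h0X
  have a0 : G.Adj (f 0) (P (f 0) 1) := by
    have := (hF.path _ h0X).adj_succ (show 0 < len (f 0) by omega)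
    rwa [hF.zero _ h0X] at this
  exact hS.not_three_nbrs (hF.mem _ h0X 1 le_rfl hl1) h0X (hfX 1).2.1 (hfX 2).2.1
    (fun e => absurd (hinj e) (by decide)) (fun e => absurd (hinj e) (by decide))
    (fun e => absurd (hinj e) (by decide)) a0.symm (key 1 (by decide)).symm (key 2 (by decide)).symm

/-- The component of `b` avoiding the neighbours of `z` and another component cannot both touch
many vertices of `X`. -/
theorem exists_comp_bound (d t : ℕ) :
    ∃ N : ℕ, ∀ {V : Type*} [Finite V] {G : SimpleGraph V} {a b : V} {X D : Set V}
      {P : V → ℕ → V} {len : V → ℕ}, Fan G X D b P len → Setting G d a X D → G.CliqueFree t →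
      ∀ z ∈ X, ¬ G.Adj z b → ∀ v ∈ D, ¬ G.Adj z v → v ∉ G.comp {y ∈ D | ¬ G.Adj z y} b →
      4 ≤ {x ∈ X | x ≠ z ∧ G.Touches x (G.comp {y ∈ D | ¬ G.Adj z y} b)}.ncard →
      N ≤ {x ∈ X | x ≠ z ∧ G.Touches x (G.comp {y ∈ D | ¬ G.Adj z y} v)}.ncard → False := by
  classical
  obtain ⟨N, hN⟩ := exists_chunk_bound d t
  -- One member of the fan may lack a crossing, and four vertices touching the left side are needed
  -- to bound the contacts of `z` on a crossing by `d`.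
  refine ⟨N + 4, fun {V} _ {G a b X D P len} hF hS hK z hz hzb v hv hzv hvb h4 hcard => ?_⟩
  set H := {y ∈ D | ¬ G.Adj z y} with hH
  have hbH : b ∈ H := ⟨hF.mem_b, hzb⟩
  have hvH : v ∈ H := ⟨hv, hzv⟩
  have hsep : G.Sep (G.comp H v) (G.comp H b) := by
    refine (sep_comp.mono le_rfl fun y hy => ⟨comp_subset hvH hy, fun hyb => hvb ?_⟩).symm
    rw [← comp_eq hbH hyb, comp_eq hvH hy]
    exact mem_comp_self
  have hLR : SepPair G D (G.comp H v) (G.comp H b) :=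
    ⟨conn_comp hvH, conn_comp hbH, fun y hy => (comp_subset hvH hy).1,
      fun y hy => (comp_subset hbH hy).1, hsep⟩
  obtain ⟨s, p, m, hs, hsm, hcr, hdisj⟩ := hF.exists_family hS hLR mem_comp_self
    (Λ := {x ∈ X | x ≠ z ∧ G.Touches x (G.comp H v)}) (fun x hx => hx.1) (fun x hx => hx.2.2)
  have hzsep : ∀ w ∈ H, G.Sep {z} (G.comp H w) := fun w hw => sep_singleton_left.2
    ⟨fun e => hS.disj z hz (comp_subset hw e).1, fun ⟨y, hy, e⟩ => (comp_subset hw hy).2 e⟩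
  -- The two components are the sides of a chunk system centred at `z`; they are separated by the
  -- neighbours of `z` by their very definition.
  refine hN G hS.theta hS.evenWheel hK z s _ _ p m (by omega) ⟨hLR.connL, hLR.connR, hzsep v hvH,
    hzsep b hbH, fun l hl => (hcr l hl).path, hdisj, fun l hl i hi e => hS.disj z hz
      (e ▸ (hcr l hl).mem i hi), fun l hl => ((hcr l hl).left 0 (Nat.zero_le _)).2 rfl,
    fun l hl => ((hcr l hl).right _ le_rfl).2 rfl, fun l hl => ?_, ?_⟩
  · exact (hcr l hl).ncard_nbrs_le hLR hS
      (ΛL := {x ∈ X | x ≠ z ∧ G.Touches x (G.comp H v)})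
      (ΛR := {x ∈ X | x ≠ z ∧ G.Touches x (G.comp H b)}) (fun x hx => hx.1) (fun x hx => hx.2.2)
      (by omega) (fun x hx => hx.1) (fun x hx => hx.2.2) h4 hz (fun h => h.2.1 rfl)
      (fun h => h.2.1 rfl)
  · rintro C hC hCs hCz ⟨y, hy, hyv⟩ ⟨y', hy', hyb⟩
    have hCH : C ⊆ H := by
      refine fun x hx => ⟨?_, hCz x hx⟩
      rcases hCs x hx with h | h | ⟨l, hl, i, -, hi, rfl⟩
      · exact hLR.subL h
      · exact hLR.subR h
      · exact (hcr l hl).mem i hi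
    exact hsep.notMem hyv (hC.subset_comp hCH hy' hyb hy)

end Fan

/-- A path with many contacts in disjoint intervals does not exist. -/
theorem exists_directSystem_bound (d t : ℕ) :
    ∃ n : ℕ, ∀ {V : Type*} [Finite V] {G : SimpleGraph V} {a b : V} {X D : Set V}
      {P : V → ℕ → V} {len : V → ℕ}, Fan G X D b P len → Setting G d a X D → G.CliqueFree t →
      ∀ w k z lo hi, DirectSystem G X D w k n z lo hi → False := by
  classical
  obtain ⟨N₁, hN₁⟩ := Fan.exists_rich
  obtain ⟨N₂, hN₂⟩ := Fan.exists_comp_bound d t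
  -- Only the middle `N₁` indices are candidates for `e`. The `K` indices on either side provide the
  -- six intervals needed by `false_of_conn` and the attachments needed by `exists_comp_bound`.
  set K := N₂ + 6 with hKd
  refine ⟨K + N₁ + K, fun {V} _ {G a b X D P len} hF hS hK w k z lo hi h => ?_⟩
  have hinj : ∀ s : Finset ℕ, (∀ e ∈ s, e < K + N₁ + K) → (z '' (s : Set ℕ)).ncard = s.card := by
    intro s hs
    have : Set.InjOn z (s : Set ℕ) := fun i hi j hj e => h.inj (hs i hi) (hs j hj) e
    rw [this.ncard_image, Set.ncard_coe_finset]
  have hmid : ∀ e ∈ Finset.Ico K (K + N₁), e < K + N₁ + K := fun e he => by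
    rw [Finset.mem_Ico] at he; omega
  obtain ⟨_, ⟨e, he, rfl⟩, hzb, h4⟩ := hN₁ hF hS (z '' (Finset.Ico K (K + N₁) : Finset ℕ))
    (by rintro _ ⟨e, he, rfl⟩; exact h.z_mem e (hmid e he))
    (by rw [hinj _ hmid, Nat.card_Ico]; omega)
  have hmid' := hmid e he
  rw [Finset.mem_coe, Finset.mem_Ico] at he
  have hLR := h.sepPair (e := e) (by omega) (by omega)
  have hzX := h.z_mem e (by omega)
  set H := {y ∈ D | ¬ G.Adj (z e) y} with hH
  have hbH : b ∈ H := ⟨hF.mem_b, hzb⟩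
  have hk := h.hi_le e (by omega)
  have hlt := h.lt e (by omega)
  have hAH : ico w 0 (lo e) ⊆ H := ico_subset fun i h1 h2 => ⟨h.mem i (by omega), fun e' => by
    have := h.between e (by omega) i (by omega) e'; omega⟩
  have hBH : ico w (hi e + 1) (k + 1) ⊆ H := ico_subset fun i h1 h2 =>
    ⟨h.mem i (by omega), fun e' => by
      have := h.between e (by omega) i (by omega) e'; omega⟩
  have hfalse : ∀ (S : Set V) (s : Finset ℕ), G.Conn S → S ⊆ H → ¬ (G.comp H b ∩ S).Nonempty →
      (∀ l ∈ s, l < K + N₁ + K ∧ l ≠ e ∧ G.Touches (z l) S) → K ≤ s.card → False := by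
    intro S s hSc hSH hSn hs hcard
    obtain ⟨v, hv⟩ := hSc.1
    refine hN₂ hF hS hK (z e) hzX hzb v (hSH hv).1 (hSH hv).2 (fun h' => hSn ⟨v, h', hv⟩) h4 ?_
    have hsub : z '' (s : Set ℕ) ⊆ {x ∈ X | x ≠ z e ∧ G.Touches x (G.comp H v)} := by
      rintro _ ⟨l, hl, rfl⟩
      obtain ⟨h1, h2, h3⟩ := hs l hl
      exact ⟨h.z_mem l h1, fun e' => h2 (h.inj h1 (by omega) e'),
        h3.mono (hSc.subset_comp hSH hv mem_comp_self)⟩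
    have := Set.ncard_le_ncard hsub (Set.toFinite _)
    rw [hinj s fun l hl => (hs l hl).1] at this
    exact le_trans (by omega) this
  -- By `false_of_conn` the component of `b` misses one side of the path. The component containing
  -- that side is touched by at least `K` of the vertices `z l`.
  by_cases hA : (G.comp H b ∩ ico w 0 (lo e)).Nonempty
  · refine hfalse (ico w (hi e + 1) (k + 1)) (Finset.Ico (e + 1) (K + N₁ + K)) hLR.connR hBH
      (fun hB => h.false_of_conn hS (by omega) (by omega) (conn_comp hbH)
        (fun y hy => (comp_subset hbH hy).1) (fun y hy => (comp_subset hbH hy).2) hA hB)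
      (fun l hl => ?_) (by rw [Nat.card_Ico]; omega)
    rw [Finset.mem_Ico] at hl
    have := h.lt_next e l (by omega) hl.2
    have := h.hi_le l hl.2
    have := h.lt l hl.2
    exact ⟨hl.2, by omega, _, mem_ico_of (k := lo l) (by omega) (by omega), h.adj_lo l hl.2⟩
  · refine hfalse (ico w 0 (lo e)) (Finset.range e) hLR.connL hAH hA (fun l hl => ?_)
      (by rw [Finset.card_range]; omega)
    rw [Finset.mem_range] at hl
    have := h.lt_next l e hl (by omega)
    have := h.lt l (by omega)
    exact ⟨by omega, by omega, _, mem_ico_of (k := lo l) (by omega) (by omega),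
      h.adj_lo l (by omega)⟩

end SimpleGraph

/-! ### Contacts of `X` with a path between two pendant vertices. -/

namespace SimpleGraph
variable {V : Type*} {G : SimpleGraph V} {d : ℕ} {a : V} {X D : Set V}

/-- A vertex of `X` other than the pendant vertices at the ends of a path has zero or at least two
contacts with the path. -/
theorem Setting.lt_of_contacts (hS : Setting G d a X D) {w : ℕ → V} {k : ℕ} (hw : G.IndPath w k)
    (hwD : ∀ i ≤ k, w i ∈ D) {xL ρ z : V} (hxL : xL ∈ X) (hρ : ρ ∈ X) (hz : z ∈ X) (hLρ : xL ≠ ρ)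
    (hzL : z ≠ xL) (hzρ : z ≠ ρ) (hL : ∀ i ≤ k, (G.Adj xL (w i) ↔ i = 0))
    (hR : ∀ i ≤ k, (G.Adj ρ (w i) ↔ i = k)) {p : ℕ} (hp : p ≤ k) (hzp : G.Adj z (w p))
    (h : ∀ i ≤ k, G.Adj z (w i) → i = p) : False := by
  have xne : ∀ {x y}, x ∈ X → y ∈ D → x ≠ y := fun hx hy e => hS.disj _ hx (e ▸ hy)
  have hsub : ∀ x ∈ X, ∀ i j, j ≤ k + 1 → ico w i j ∪ {x} ⊆ D ∪ X := fun x hx i j hj =>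
    Set.union_subset (ico_subset fun q _ _ => Or.inl (hwD q (by omega)))
      (by rintro _ rfl; exact Or.inr hx)
  have hsepw : ∀ x ∈ X, ∀ i j, j ≤ k + 1 → (∀ q, i ≤ q → q < j → ¬ G.Adj x (w q)) →
      G.Sep {x} (ico w i j) := fun x hx i j hj hn => sep_singleton_left.2
    ⟨fun ⟨q, _, _, e⟩ => xne hx (hwD q (by omega)) e.symm, fun ⟨_, ⟨q, h1, h2, e⟩, e'⟩ =>
      hn q h1 h2 (e ▸ e')⟩
  have t0 : G.Touches (w 0) {xL} := touches_singleton.2 ((hL 0 (by omega)).2 rfl).symm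
  have tk : G.Touches (w k) {ρ} := touches_singleton.2 ((hR k le_rfl).2 rfl).symm
  -- From a unique contact `w p` the arms lead to `z` and along the path in both directions to `xL`
  -- and `ρ`.
  refine hS.not_trident (hwD p hp) (Conn.singleton z)
    (hw.conn_head (Conn.singleton xL) (i := 0) (j := p) (by omega) t0)
    (hw.conn_tail (Conn.singleton ρ) (i := p + 1) le_rfl tk (by omega)) ?_ ?_ ?_
    (by rintro _ rfl; exact Or.inr hz) (hsub _ hxL _ _ (by omega)) (hsub _ hρ _ _ (by omega))
    (fun e => xne hz (hwD p hp) (e : w p = z).symm) ?_ ?_ (touches_singleton.2 hzp.symm)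
    (hw.touches_head hp t0 (Nat.zero_le _)) (hw.touches_tail le_rfl tk hp) ⟨z, rfl, hz⟩
    ⟨xL, Or.inr rfl, hxL⟩ ⟨ρ, Or.inr rfl, hρ⟩
  · refine sep_union_right.2 ⟨hsepw z hz _ _ (by omega) fun q _ hq e => ?_,
      hS.sep_singletons hz hxL hzL⟩
    have := h q (by omega) e
    omega
  · refine sep_union_right.2 ⟨hsepw z hz _ _ (by omega) fun q hq hq' e => ?_,
      hS.sep_singletons hz hρ hzρ⟩
    have := h q (by omega) e
    omega
  · refine sep_union_right.2 ⟨sep_union_left.2 ⟨hw.sep_ico (by omega) le_rfl,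
      hsepw xL hxL _ _ le_rfl fun q hq hq' e => ?_⟩, sep_union_left.2
      ⟨(hsepw ρ hρ _ _ (by omega) fun q hq hq' e => ?_).symm, hS.sep_singletons hxL hρ hLρ⟩⟩
    · have := (hL q (by omega)).1 e
      omega
    · have := (hR q (by omega)).1 e
      omega
  · rintro (e | e)
    · exact hw.notMem_ico hp (by omega) (by omega) e
    · exact xne hxL (hwD p hp) (e : w p = xL).symm
  · rintro (e | e)
    · exact hw.notMem_ico hp (by omega) (by omega) e
    · exact xne hρ (hwD p hp) (e : w p = ρ).symm

/-- At most three vertices of `X` have contacts both up to and from a given index. -/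
theorem Setting.ncard_around_le [Finite V] (hS : Setting G d a X D) {w : ℕ → V} {k : ℕ}
    (hw : G.IndPath w k) (hwD : ∀ i ≤ k, w i ∈ D) {p : ℕ} (hp : p ≤ k) :
    {x ∈ X | (∃ i ≤ p, G.Adj x (w i)) ∧ ∃ j, p ≤ j ∧ j ≤ k ∧ G.Adj x (w j)}.ncard ≤ 3 := by
  have h1 := hS.ncard_nbrs_le_two (hwD p hp)
  -- The parts of the path before and after `w p` are separated, so they have at most one common
  -- attachment.
  have h2 : {x ∈ X | G.Touches x (ico w 0 p) ∧ G.Touches x (ico w (p + 1) (k + 1))}.ncard ≤ 1 := by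
    refine (Set.ncard_le_one (Set.toFinite _)).2 fun x hx y hy => ?_
    obtain ⟨hx, hx1, hx2⟩ := hx
    obtain ⟨hy, hy1, hy2⟩ := hy
    have ⟨_, ⟨i, _, hi, _⟩, _⟩ := hx1
    have ⟨_, ⟨j, hj, hj', _⟩, _⟩ := hx2
    exact hS.eq_of_touches (hw.conn_ico (by omega) (by omega)) (hw.conn_ico (by omega) le_rfl)
      (ico_subset fun i _ _ => hwD i (by omega)) (ico_subset fun i _ _ => hwD i (by omega))
      (hw.sep_ico le_rfl le_rfl) hx hy hx1 hx2 hy1 hy2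
  have hsub : {x ∈ X | (∃ i ≤ p, G.Adj x (w i)) ∧ ∃ j, p ≤ j ∧ j ≤ k ∧ G.Adj x (w j)} ⊆
      {x ∈ X | G.Adj x (w p)} ∪
      {x ∈ X | G.Touches x (ico w 0 p) ∧ G.Touches x (ico w (p + 1) (k + 1))} := by
    rintro x ⟨hx, ⟨i, hi, hxi⟩, j, hj, hjk, hxj⟩
    by_cases e : G.Adj x (w p)
    · exact Or.inl ⟨hx, e⟩
    · have hip : i ≠ p := fun h => e (h ▸ hxi)
      have hjp : j ≠ p := fun h => e (h ▸ hxj)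
      exact Or.inr ⟨hx, ⟨_, mem_ico_of (k := i) (by omega) (by omega), hxi⟩,
        _, mem_ico_of (k := j) (by omega) (by omega), hxj⟩
  have := (Set.ncard_le_ncard hsub (Set.toFinite _)).trans (Set.ncard_union_le _ _)
  omega

/-- A path between pendant vertices without spread-out triples of contacts has boundedly many
contacts in `X`. -/
theorem exists_direct_bound (d t : ℕ) :
    ∃ N : ℕ, ∀ {V : Type*} [Finite V] {G : SimpleGraph V} {a b : V} {X D : Set V}
      {P : V → ℕ → V} {len : V → ℕ}, Fan G X D b P len → Setting G d a X D → G.CliqueFree t →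
      ∀ (w : ℕ → V) (k : ℕ), G.IndPath w k → (∀ i ≤ k, w i ∈ D) →
      (∀ v ∈ D, ∀ c μ e, c + 2 ≤ μ → μ + 2 ≤ e → e ≤ k →
        G.Adj (w c) v → G.Adj (w μ) v → G.Adj (w e) v → False) →
      ∀ xL ∈ X, ∀ ρ ∈ X, xL ≠ ρ → (∀ i ≤ k, (G.Adj xL (w i) ↔ i = 0)) →
      (∀ i ≤ k, (G.Adj ρ (w i) ↔ i = k)) →
      N ≤ {z ∈ X | ∃ i ≤ k, G.Adj z (w i)}.ncard → False := by
  classical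
  obtain ⟨n, hn⟩ := exists_directSystem_bound d t
  -- The colour records whether the first interval lies to the left of the second, to its right, or
  -- meets it, and whether the first has length one. The last index serves only as a partner that
  -- reveals the type of the others; five extra indices also make the pairwise meeting case exceed
  -- three.
  obtain ⟨N, hN⟩ := exists_ramsey (Fin 3 × Bool) (n + 5)
  refine ⟨N + 2, fun {V} _ {G a b X D P len} hF hS hK w k hw hwD hsp xL hxL ρ hρ hLρ hL hR hc => ?_⟩
  set Z := {z ∈ X | ∃ i ≤ k, G.Adj z (w i)} with hZ
  have hfin : (Z \ {xL, ρ}).Finite := Set.toFinite _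
  have hcard : N ≤ hfin.toFinset.card := by
    rw [← Set.ncard_eq_toFinset_card _ hfin]
    have := Set.ncard_le_ncard_sdiff_add_ncard Z {xL, ρ} (Set.toFinite _)
    have : ({xL, ρ} : Set V).ncard ≤ 2 := (Set.ncard_insert_le _ _).trans (by simp)
    omega
  have hex : ∀ z, ∃ lo hi, z ∈ Z \ {xL, ρ} → lo < hi ∧ hi ≤ k ∧ G.Adj z (w lo) ∧ G.Adj z (w hi) ∧
      ∀ i ≤ k, G.Adj z (w i) → lo ≤ i ∧ i ≤ hi := by
    intro z
    by_cases hz : z ∈ Z \ {xL, ρ}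
    swap
    · exact ⟨0, 0, fun h => (hz h).elim⟩
    obtain ⟨⟨hzX, hzw⟩, hne⟩ := hz
    simp only [Set.mem_insert_iff, Set.mem_singleton_iff, not_or] at hne
    have hlo := Nat.find_spec hzw
    have hlomin : ∀ i ≤ k, G.Adj z (w i) → Nat.find hzw ≤ i := fun i h1 h2 => Nat.find_min' hzw ⟨h1, h2⟩
    have hhi := Nat.findGreatest_spec (P := fun i => G.Adj z (w i)) hlo.1 hlo.2
    have hhile := Nat.findGreatest_le (P := fun i => G.Adj z (w i)) k
    have hhimax : ∀ i ≤ k, G.Adj z (w i) → i ≤ Nat.findGreatest (fun i => G.Adj z (w i)) k :=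
      fun i h1 h2 => Nat.le_findGreatest (P := fun i => G.Adj z (w i)) h1 h2
    refine ⟨Nat.find hzw, Nat.findGreatest (fun i => G.Adj z (w i)) k, fun _ =>
      ⟨?_, hhile, hlo.2, hhi, fun i h1 h2 => ⟨hlomin i h1 h2, hhimax i h1 h2⟩⟩⟩
    by_contra hle
    refine hS.lt_of_contacts hw hwD hxL hρ hzX hLρ hne.1 hne.2 hL hR hlo.1 hlo.2 fun i h1 h2 => ?_
    have := hlomin i h1 h2
    have := hhimax i h1 h2
    omega
  choose lo hi hlohi using hex
  obtain ⟨f, c, hf, hinj, hcol⟩ := hN hfin.toFinset hcard fun x y =>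
    ((if hi x < lo y then 0 else if hi y < lo x then 1 else 2 : Fin 3), decide (hi x = lo x + 1))
  have hfm : ∀ i, f i ∈ Z \ {xL, ρ} := fun i => hfin.mem_toFinset.1 (hf i)
  have hcol1 : ∀ i j, i < j → (if hi (f i) < lo (f j) then 0 else
      if hi (f j) < lo (f i) then 1 else 2 : Fin 3) = c.1 := fun i j h => congrArg Prod.fst (hcol i j h)
  have hcol2 : ∀ i j, i < j → decide (hi (f i) = lo (f i) + 1) = c.2 := fun i j h =>
    congrArg Prod.snd (hcol i j h)
  have final : ∀ g : ℕ → Fin (n + 5), (∀ e < n, (g e).val < n + 4) →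
      (∀ e e', e < e' → e' < n → hi (f (g e)) < lo (f (g e'))) → False := by
    intro g hg hord
    refine hn hF hS hK w k (fun e => f (g e)) (fun e => lo (f (g e))) (fun e => hi (f (g e)))
      ⟨hw, hwD, fun e _ => (hfm (g e)).1.1, fun e _ => (hlohi _ (hfm (g e))).1, hord,
        fun e _ => (hlohi _ (hfm (g e))).2.1, fun e _ => (hlohi _ (hfm (g e))).2.2.1,
        fun e _ => (hlohi _ (hfm (g e))).2.2.2.1, fun e _ => (hlohi _ (hfm (g e))).2.2.2.2, ?_, hsp⟩
    have hty : ∀ e < n, decide (hi (f (g e)) = lo (f (g e)) + 1) = c.2 := fun e he =>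
      hcol2 _ (Fin.last _) (Fin.lt_def.2 (by have := hg e he; simpa using this))
    cases hc2 : c.2 with
    | true => exact Or.inl fun e he => by simpa [hc2] using hty e he
    | false =>
      refine Or.inr fun e he => ?_
      have h1 : hi (f (g e)) ≠ lo (f (g e)) + 1 := by simpa [hc2] using hty e he
      have h2 := (hlohi _ (hfm (g e))).1
      show lo (f (g e)) + 2 ≤ hi (f (g e))
      omega
  have hc3 : c.1 = 0 ∨ c.1 = 1 ∨ c.1 = 2 := by
    generalize c.1 = q
    revert q; decide
  rcases hc3 with h0 | h0 | h0
  · refine final (fun e => Fin.ofNat (n + 5) e) (fun e he => ?_) fun e e' h1 h2 => ?_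
    · simp only [Fin.val_ofNat]; rw [Nat.mod_eq_of_lt (by omega)]; omega
    · have := hcol1 (Fin.ofNat (n + 5) e) (Fin.ofNat (n + 5) e') (by
        simp only [Fin.lt_def, Fin.val_ofNat]
        rwa [Nat.mod_eq_of_lt (by omega), Nat.mod_eq_of_lt (by omega)])
      rw [h0] at this
      by_contra hlt
      rw [if_neg hlt] at this
      split_ifs at this <;> simp at this
  · refine final (fun e => Fin.ofNat (n + 5) (n - 1 - e)) (fun e he => ?_) fun e e' h1 h2 => ?_
    · simp only [Fin.val_ofNat]; rw [Nat.mod_eq_of_lt (by omega)]; omega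
    · have := hcol1 (Fin.ofNat (n + 5) (n - 1 - e')) (Fin.ofNat (n + 5) (n - 1 - e)) (by
        simp only [Fin.lt_def, Fin.val_ofNat]
        rw [Nat.mod_eq_of_lt (by omega), Nat.mod_eq_of_lt (by omega)]
        omega)
      rw [h0] at this
      by_contra hlt
      rw [if_neg hlt] at this
      split_ifs at this <;> simp at this
  -- Pairwise meeting intervals all contain the largest of their left ends, which `ncard_around_le`
  -- allows for at most three of them.
  · have hnlt : ∀ i j, i ≠ j → ¬ hi (f i) < lo (f j) := by
      intro i j hij hlt
      rcases lt_or_gt_of_ne hij with h | h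
      · have := hcol1 i j h
        rw [h0, if_pos hlt] at this
        simp at this
      · have := hcol1 j i h
        rw [h0] at this
        split_ifs at this <;> simp at this
    obtain ⟨M, -, hM⟩ := Finset.exists_max_image (Finset.univ : Finset (Fin (n + 5)))
      (fun i => lo (f i)) ⟨0, Finset.mem_univ _⟩
    have hMk := hlohi _ (hfm M)
    have h3 := hS.ncard_around_le hw hwD (p := lo (f M)) (by omega)
    have hsub : Set.range f ⊆ {x ∈ X | (∃ i ≤ lo (f M), G.Adj x (w i)) ∧
        ∃ j, lo (f M) ≤ j ∧ j ≤ k ∧ G.Adj x (w j)} := by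
      rintro _ ⟨i, rfl⟩
      have h1 := hlohi _ (hfm i)
      refine ⟨(hfm i).1.1, ⟨lo (f i), hM i (Finset.mem_univ _), h1.2.2.1⟩, hi (f i), ?_, h1.2.1,
        h1.2.2.2.1⟩
      rcases eq_or_ne i M with rfl | hne
      · exact h1.1.le
      · exact not_lt.1 (hnlt i M hne)
    have h4 := Set.ncard_le_ncard hsub (Set.toFinite _)
    rw [← Set.image_univ, Set.ncard_image_of_injective _ hinj, Set.ncard_univ, Nat.card_eq_fintype_card,
      Fintype.card_fin] at h4
    omega

end SimpleGraph

/-! ### Legs attached to a triangle between two sides. -/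

namespace SimpleGraph
variable {V : Type*} {G : SimpleGraph V} {d : ℕ} {a : V} {X D L R : Set V}

/-- A connected set `T` with exactly two consecutive contacts on a crossing meets every connected
set containing both sides. -/
theorem Crossing.false_of_pair [Finite V] {p : ℕ → V} {n : ℕ} (h : Crossing G D L R p n)
    (hLR : SepPair G D L R) (hS : Setting G d a X D) {ΛL ΛR : Set V}
    (hLX : ΛL ⊆ X) (hL : ∀ x ∈ ΛL, G.Touches x L) (hLcard : 4 ≤ ΛL.ncard)
    (hRX : ΛR ⊆ X) (hR : ∀ x ∈ ΛR, G.Touches x R) (hRcard : 4 ≤ ΛR.ncard) {T C : Set V}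
    (hT : G.Conn T) (hTD : T ⊆ D ∪ X) (hTX : (T ∩ X).Nonempty)
    (hΛT : ∀ x ∈ ΛL ∪ ΛR, x ∉ T ∧ ¬ G.Touches x T) (hC : G.Conn C) (hCD : C ⊆ D) (hLC : L ⊆ C)
    (hRC : R ⊆ C) (hCT : G.Sep C T)
    (huniq : ∀ x ∈ ΛL ∪ ΛR, ∀ y ∈ C, ∀ y' ∈ C, G.Adj x y → G.Adj x y' → y = y') {i : ℕ}
    (hi : i < n) (hpT : ∀ l ≤ n, p l ∉ T)
    (ht : ∀ l ≤ n, (G.Touches (p l) T ↔ l = i ∨ l = i + 1)) : False := by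
  obtain ⟨u, N, o, hu, ho, hoN, hup, huL, huR, hu0, huN⟩ :=
    h.exists_xpath hLR hS hLX hL hLcard hRX hR hRcard
  have hT1 : ∀ k ≤ N, u k ∉ T ∧ (G.Touches (u k) T → k = o + i ∨ k = o + i + 1) := by
    intro k hk
    rcases Nat.eq_zero_or_pos k with rfl | h0
    · have := hΛT _ (Or.inl hu0)
      exact ⟨this.1, fun e => (this.2 e).elim⟩
    rcases hk.eq_or_lt with rfl | hkN
    · have := hΛT _ (Or.inr huN)
      exact ⟨this.1, fun e => (this.2 e).elim⟩
    rcases Nat.lt_or_ge k o with h1 | h1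
    · have hm := hLC (huL k h0 h1)
      exact ⟨hCT.notMem hm, fun e => (hCT.not_touches hm e).elim⟩
    rcases Nat.lt_or_ge (o + n) k with h2 | h2
    · have hm := hRC (huR k h2 hkN)
      exact ⟨hCT.notMem hm, fun e => (hCT.not_touches hm e).elim⟩
    obtain ⟨l, rfl⟩ := Nat.exists_eq_add_of_le h1
    rw [hup l (by omega)]
    refine ⟨hpT l (by omega), fun e => ?_⟩
    have := (ht l (by omega)).1 e
    omega
  have hti : G.Touches (u (o + i)) T := by
    rw [hup i hi.le]; exact (ht i hi.le).2 (Or.inl rfl)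
  have hti' : G.Touches (u (o + i + 1)) T := by
    rw [show o + i + 1 = o + (i + 1) by omega, hup _ hi]; exact (ht _ hi).2 (Or.inr rfl)
  have hu1 : u 1 ∈ L := huL 1 le_rfl (by omega)
  have hu2 : u (N - 1) ∈ R := huR _ (by omega) (by omega)
  have hpair : SepPair G D (ico u 1 (o + i)) (ico u (o + i + 2) N) :=
    ⟨hu.conn_ico (by omega) (by omega), hu.conn_ico (by omega) (by omega),
      ico_subset fun k _ _ => hu.mem k (by omega) (by omega),
      ico_subset fun k _ _ => hu.mem k (by omega) (by omega), hu.sep_ico (by omega) (by omega)⟩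
  obtain ⟨f, m, hf, hfC⟩ := hpair.exists_crossing hC hCD
    ⟨u 1, hLC hu1, mem_ico_of le_rfl (by omega)⟩
    ⟨u (N - 1), hRC hu2, mem_ico_of (by omega) (by omega)⟩
  have hfX : ∀ g ≤ m, ∀ x ∈ X, x ≠ f g := fun g hg x hx e => hS.disj x hx (e ▸ hf.mem g hg)
  have b : Bypass G X D u N T (o + i) (o + i + 1) f m := by
    refine ⟨hu, hT, hTD, hTX, fun k hk => (hT1 k hk).1, by omega, by omega, by omega, hti, hti',
      fun k hk e => by have := (hT1 k hk).2 e; omega, hf.path, hf.mem,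
      fun g hg => hCT.notMem (hfC g hg), fun g hg => hCT.not_touches (hfC g hg),
      fun g hg k hk hk' e => ?_, fun g hg k hk e => ?_, fun g hg k hk hk' e => ?_, ?_, ?_⟩
    · have hno := hCT.not_touches (hfC g hg)
      rw [← e] at hno
      rcases Nat.eq_zero_or_pos k with rfl | h0
      · exact hfX g hg _ hu.left_mem e
      rcases hk.eq_or_lt with rfl | hkN
      · exact hfX g hg _ hu.right_mem e
      by_cases h1 : k = o + i
      · exact hno (h1 ▸ hti)
      by_cases h2 : k = o + i + 1
      · exact hno (h2 ▸ hti')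
      rcases hk' with h3 | h3
      · exact hf.notMemL g hg (e ▸ mem_ico_of h0 (by omega))
      · exact hf.notMemR g hg (e ▸ mem_ico_of (by omega) hkN)
    -- The end `u 0` already has the neighbour `u 1` in `C`, so it has no neighbour on `f`; likewise
    -- for `u N` below.
    · rcases Nat.eq_zero_or_pos k with rfl | h0
      · have h1 := huniq _ (Or.inl hu0) _ (hLC hu1) _ (hfC g hg) (hu.adj_succ (by omega)) e
        exact (hf.notMemL g hg (h1 ▸ mem_ico_of (k := 1) le_rfl (by omega))).elim
      · exact ⟨h0, (hf.left g hg).1 ⟨_, mem_ico_of h0 (by omega), e.symm⟩⟩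
    · rcases hk.eq_or_lt with rfl | hkN
      · have h1 := huniq _ (Or.inr huN) _ (hRC hu2) _ (hfC g hg)
          (by rw [hu.adj _ le_rfl _ (by omega)]; omega) e
        exact (hf.notMemR g hg (h1 ▸ mem_ico_of (k := k - 1) (by omega) (by omega))).elim
      · exact ⟨hkN, (hf.right g hg).1 ⟨_, mem_ico_of (by omega) hkN, e.symm⟩⟩
    · obtain ⟨_, ⟨k, h1, h2, rfl⟩, e⟩ := (hf.left 0 (Nat.zero_le _)).2 rfl
      exact ⟨k, h2, e.symm⟩
    · obtain ⟨_, ⟨k, h1, h2, rfl⟩, e⟩ := (hf.right m le_rfl).2 rfl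
      exact ⟨k, h2.le, by omega, e.symm⟩
  exact b.false_of_pair hS rfl

/-- An induced path `s 0, …, s r` from `s 0 ∈ X` that ends in a triangle `s r`, `c₁`, `c₂` linking
the sides `L` and `R`; the vertices of `ΛL` and `ΛR` are pendant at `L` and `R`. -/
structure LegConfig (G : SimpleGraph V) (X D L R : Set V) (c₁ c₂ : V) (s : ℕ → V) (r : ℕ)
    (ΛL ΛR : Set V) : Prop where
  sepPair : SepPair G D L R
  mem₁ : c₁ ∈ D
  mem₂ : c₂ ∈ D
  adj : G.Adj c₁ c₂
  touch₁ : G.Touches c₁ L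
  touch₂ : G.Touches c₂ R
  path : G.IndPath s r
  zero_mem : s 0 ∈ X
  mem : ∀ i, 1 ≤ i → i ≤ r → s i ∈ D
  sepL : G.Sep (seg s 0 r) L
  sepR : G.Sep (seg s 0 r) R
  ne : ∀ i ≤ r, s i ≠ c₁ ∧ s i ≠ c₂
  adj₁ : ∀ i ≤ r, (G.Adj (s i) c₁ ↔ i = r)
  adj₂ : ∀ i ≤ r, (G.Adj (s i) c₂ ↔ i = r)
  subL : ΛL ⊆ X
  subR : ΛR ⊆ X
  touchL : ∀ x ∈ ΛL, G.Touches x L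
  touchR : ∀ x ∈ ΛR, G.Touches x R
  cardL : 7 ≤ ΛL.ncard
  cardR : 7 ≤ ΛR.ncard
  sepΛ : ∀ x ∈ ΛL ∪ ΛR, ∀ i ≤ r, x ≠ s i ∧ ¬ G.Adj x (s i)
  uniq : ∀ x ∈ ΛL ∪ ΛR, ∀ y ∈ insert c₁ (insert c₂ (L ∪ R)), ∀ y' ∈ insert c₁ (insert c₂ (L ∪ R)),
    G.Adj x y → G.Adj x y' → y = y'

namespace LegConfig
variable {c₁ c₂ : V} {s : ℕ → V} {r : ℕ} {ΛL ΛR : Set V}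

theorem symm (h : LegConfig G X D L R c₁ c₂ s r ΛL ΛR) :
    LegConfig G X D R L c₂ c₁ s r ΛR ΛL where
  sepPair := h.sepPair.symm
  mem₁ := h.mem₂
  mem₂ := h.mem₁
  adj := h.adj.symm
  touch₁ := h.touch₂
  touch₂ := h.touch₁
  path := h.path
  zero_mem := h.zero_mem
  mem := h.mem
  sepL := h.sepR
  sepR := h.sepL
  ne i hi := (h.ne i hi).symm
  adj₁ := h.adj₂
  adj₂ := h.adj₁
  subL := h.subR
  subR := h.subL
  touchL := h.touchR
  touchR := h.touchL
  cardL := h.cardR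
  cardR := h.cardL
  sepΛ x hx := h.sepΛ x hx.symm
  uniq x hx y hy y' hy' := by
    rw [Set.insert_comm, Set.union_comm] at hy hy'
    exact h.uniq x hx.symm y hy y' hy'

theorem not_touches (h : LegConfig G X D L R c₁ c₂ s r ΛL ΛR) {x : V} (hx : x ∈ ΛL) :
    ¬ G.Touches x R := by
  rintro ⟨y, hy, e⟩
  obtain ⟨y', hy', e'⟩ := h.touchL x hx
  have := h.uniq x (Or.inl hx) y (Or.inr (Or.inr (Or.inr hy))) y'
    (Or.inr (Or.inr (Or.inl hy'))) e e'
  exact h.sepPair.sep.notMem hy' (this ▸ hy)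

theorem conn_seg (h : LegConfig G X D L R c₁ c₂ s r ΛL ΛR) {f : ℕ} (hf : f ≤ r) :
    G.Conn (seg s 0 f) := h.path.conn_seg (Nat.zero_le _) hf

theorem seg_sub (h : LegConfig G X D L R c₁ c₂ s r ΛL ΛR) {f : ℕ} (hf : f ≤ r) :
    seg s 0 f ⊆ D ∪ X := by
  rintro _ ⟨i, -, hi, rfl⟩
  rcases Nat.eq_zero_or_pos i with rfl | h0
  · exact Or.inr h.zero_mem
  · exact Or.inl (h.mem i h0 (by omega))

theorem seg_meet (h : LegConfig G X D L R c₁ c₂ s r ΛL ΛR) {f : ℕ} : (seg s 0 f ∩ X).Nonempty :=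
  ⟨s 0, mem_seg_of le_rfl (Nat.zero_le _), h.zero_mem⟩

theorem sepΛ_seg (h : LegConfig G X D L R c₁ c₂ s r ΛL ΛR) {f : ℕ} (hf : f ≤ r) {x : V}
    (hx : x ∈ ΛL ∪ ΛR) : G.Sep {x} (seg s 0 f) := by
  rintro _ rfl _ ⟨i, -, hi, rfl⟩
  exact h.sepΛ _ hx i (by omega)

theorem sep_insert (h : LegConfig G X D L R c₁ c₂ s r ΛL ΛR) (hS : Setting G d a X D) {x y : V}
    (hx : x ∈ ΛL) (hy : y ∈ ΛR) : G.Sep ({x} ∪ L) ({y} ∪ R) := by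
  have hxD : ∀ {z}, z ∈ X → ∀ {C}, C ⊆ D → z ∉ C := fun hz _ hC e => hS.disj _ hz (hC e)
  refine sep_union_left.2 ⟨sep_union_right.2 ⟨hS.sep_singletons (h.subL hx) (h.subR hy) ?_,
    sep_singleton_left.2 ⟨hxD (h.subL hx) h.sepPair.subR, h.not_touches hx⟩⟩,
    sep_union_right.2 ⟨sep_singleton_right.2 ⟨hxD (h.subR hy) h.sepPair.subL,
      h.symm.not_touches hy⟩, h.sepPair.sep⟩⟩
  rintro rfl
  exact h.not_touches hx (h.touchR _ hy)

theorem conn_insert (h : LegConfig G X D L R c₁ c₂ s r ΛL ΛR) {x : V} (hx : x ∈ ΛL) :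
    G.Conn ({x} ∪ L) := h.sepPair.connL.insert (h.touchL x hx)

theorem insert_sub (h : LegConfig G X D L R c₁ c₂ s r ΛL ΛR) {x : V} (hx : x ∈ ΛL) :
    {x} ∪ L ⊆ D ∪ X := by
  rintro y (rfl | hy)
  · exact Or.inr (h.subL hx)
  · exact Or.inl (h.sepPair.subL hy)

theorem notMem₂ (h : LegConfig G X D L R c₁ c₂ s r ΛL ΛR) : c₂ ∉ L := fun e =>
  (h.sepL _ (mem_seg_of (Nat.zero_le _) le_rfl) _ e).2 ((h.adj₂ r le_rfl).2 rfl)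

/-- Otherwise `c₂` would reach `X` separately through `L`, through `R` and along the leg. -/
theorem not_touches₂ (h : LegConfig G X D L R c₁ c₂ s r ΛL ΛR) (hS : Setting G d a X D) :
    ¬ G.Touches c₂ L := by
  intro e
  obtain ⟨x, hx⟩ : ΛL.Nonempty := Set.nonempty_of_ncard_ne_zero (by have := h.cardL; omega)
  obtain ⟨y, hy⟩ : ΛR.Nonempty := Set.nonempty_of_ncard_ne_zero (by have := h.cardR; omega)
  have hn : ∀ z ∈ X, c₂ ≠ z := fun z hz e' => hS.disj z hz (e' ▸ h.mem₂)
  refine hS.not_trident h.mem₂ (h.conn_insert hx) (h.symm.conn_insert hy) (h.conn_seg le_rfl)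
    (h.sep_insert hS hx hy) (sep_union_left.2 ⟨h.sepΛ_seg le_rfl (Or.inl hx), h.sepL.symm⟩)
    (sep_union_left.2 ⟨h.sepΛ_seg le_rfl (Or.inr hy), h.sepR.symm⟩) (h.insert_sub hx)
    (h.symm.insert_sub hy) (h.seg_sub le_rfl) ?_ ?_ ?_ (e.mono Set.subset_union_right)
    (h.touch₂.mono Set.subset_union_right)
    ⟨s r, mem_seg_of (Nat.zero_le _) le_rfl, ((h.adj₂ r le_rfl).2 rfl).symm⟩
    ⟨x, Or.inl rfl, h.subL hx⟩ ⟨y, Or.inl rfl, h.subR hy⟩ h.seg_meet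
  · rintro (e' | e')
    · exact hn x (h.subL hx) e'
    · exact h.notMem₂ e'
  · rintro (e' | e')
    · exact hn y (h.subR hy) e'
    · exact (h.sepR _ (mem_seg_of (Nat.zero_le _) le_rfl) _ e').2 ((h.adj₂ r le_rfl).2 rfl)
  · rintro ⟨i, -, hi, e'⟩
    exact (h.ne i hi).2 e'

/-- The edge `c₁`, `c₂` is itself a crossing, on which the leg has exactly two consecutive contacts,
so `Crossing.false_of_pair` can be applied to it. -/
theorem crossing (h : LegConfig G X D L R c₁ c₂ s r ΛL ΛR) (hS : Setting G d a X D) :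
    Crossing G D L R (fun i => if i = 0 then c₁ else c₂) 1 := by
  have h1 := h.not_touches₂ hS
  have h2 := h.symm.not_touches₂ hS
  have cases : ∀ i ≤ 1, i = 0 ∨ i = 1 := fun i hi => by omega
  refine ⟨⟨fun i hi j hj e => ?_, fun i hi j hj => ?_⟩, fun i hi => ?_, fun i hi => ?_,
    fun i hi => ?_, fun i hi => ?_, fun i hi => ?_⟩
  · rcases cases i hi with rfl | rfl <;> rcases cases j hj with rfl | rfl <;>
      simp only [if_true, one_ne_zero, if_false] at e <;> first | rfl | exact (h.adj.ne e).elim |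
      exact (h.adj.ne e.symm).elim
  · rcases cases i hi with rfl | rfl <;> rcases cases j hj with rfl | rfl <;>
      simp [h.adj, h.adj.symm]
  · rcases cases i hi with rfl | rfl <;> simp [h.mem₁, h.mem₂]
  · rcases cases i hi with rfl | rfl <;> simp [h.touch₁, h1]
  · rcases cases i hi with rfl | rfl <;> simp [h.touch₂, h2]
  · rcases cases i hi with rfl | rfl <;> simp [h.notMem₂]
    exact fun e => (h.sepL _ (mem_seg_of (Nat.zero_le _) le_rfl) _ e).2 ((h.adj₁ r le_rfl).2 rfl)
  · rcases cases i hi with rfl | rfl <;> simp [h.symm.notMem₂]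
    exact fun e => (h.sepR _ (mem_seg_of (Nat.zero_le _) le_rfl) _ e).2 ((h.adj₂ r le_rfl).2 rfl)

/-- The leg and its neighbours separate the two sides. -/
theorem false_of_conn [Finite V] (h : LegConfig G X D L R c₁ c₂ s r ΛL ΛR)
    (hS : Setting G d a X D) {C : Set V} (hC : G.Conn C) (hCD : C ⊆ D)
    (hCs : G.Sep C (seg s 0 r)) (hL : (C ∩ L).Nonempty) (hR : (C ∩ R).Nonempty) : False := by
  obtain ⟨f, m, hf, hfC⟩ := h.sepPair.exists_crossing hC hCD hL hR
  obtain ⟨ΛL', sL, cL, hL'⟩ := hf.exists_clean_subset h.sepPair hS h.subL h.touchL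
  obtain ⟨ΛR', sR, cR, hR'⟩ := hf.reverse.exists_clean_subset h.sepPair.symm hS h.subR h.touchR
  have hclean : ∀ x ∈ ΛL' ∪ ΛR', ∀ y ∈ ico f 0 (m + 1), ¬ G.Adj x y := by
    rintro x (hx | hx) _ ⟨i, -, hi, rfl⟩ e
    · exact (hL' x hx).2 i (by omega) e
    · exact (hR' x hx).2 (m - i) (by omega) (by rwa [show m - (m - i) = i by omega])
  have hsub : ∀ x ∈ ΛL' ∪ ΛR', x ∈ ΛL ∪ ΛR := fun x hx => hx.imp (fun h => sL h) fun h => sR h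
  have hcL := h.cardL
  have hcR := h.cardR
  -- The connected set is `L`, the new crossing and `R`. Of the seven pendant vertices on each side
  -- at most three touch `f` or the opposite side, which leaves the four required.
  refine (h.crossing hS).false_of_pair h.sepPair hS (sL.trans h.subL) (fun x hx => h.touchL x (sL hx))
    (by omega) (sR.trans h.subR) (fun x hx => h.touchR x (sR hx)) (by omega)
    (T := seg s 0 r) (C := (L ∪ ico f 0 (m + 1)) ∪ R) (i := 0) (h.conn_seg le_rfl)
    (h.seg_sub le_rfl) h.seg_meet
    (fun x hx => sep_singleton_left.1 (h.sepΛ_seg le_rfl (hsub x hx))) ?_ ?_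
    (fun x hx => Or.inl (Or.inl hx)) (fun x hx => Or.inr hx) ?_ ?_ Nat.one_pos ?_ ?_
  · obtain ⟨y, hy, e⟩ := (hf.left 0 (Nat.zero_le _)).2 rfl
    obtain ⟨y', hy', e'⟩ := (hf.right m le_rfl).2 rfl
    exact (h.sepPair.connL.union_adj (hf.path.conn_ico (by omega) (by omega)) hy
      (mem_ico_of (k := 0) le_rfl (by omega)) e.symm).union_adj h.sepPair.connR
      (Or.inr (mem_ico_of (k := m) (by omega) (by omega))) hy' e'
  · exact Set.union_subset (Set.union_subset h.sepPair.subL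
      (ico_subset fun i _ _ => hf.mem i (by omega))) h.sepPair.subR
  · exact sep_union_left.2 ⟨sep_union_left.2 ⟨h.sepL.symm,
      hCs.mono (ico_subset fun i _ _ => hfC i (by omega)) le_rfl⟩, h.sepR.symm⟩
  · have key : ∀ x ∈ ΛL' ∪ ΛR', ∀ y ∈ (L ∪ ico f 0 (m + 1)) ∪ R, G.Adj x y →
        y ∈ insert c₁ (insert c₂ (L ∪ R)) := by
      rintro x hx y ((hy | hy) | hy) e
      · exact Or.inr (Or.inr (Or.inl hy))
      · exact (hclean x hx y hy e).elim
      · exact Or.inr (Or.inr (Or.inr hy))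
    exact fun x hx y hy y' hy' e e' => h.uniq x (hsub x hx) y (key x hx y hy e) y'
      (key x hx y' hy' e') e e'
  · rintro l - ⟨i, -, hi, e⟩
    have := h.ne i hi
    split_ifs at e
    · exact this.1 e
    · exact this.2 e
  · intro l hl
    refine iff_of_true ⟨s r, mem_seg_of (Nat.zero_le _) le_rfl, ?_⟩ (by omega)
    split_ifs
    · exact ((h.adj₁ r le_rfl).2 rfl).symm
    · exact ((h.adj₂ r le_rfl).2 rfl).symm

end LegConfig
end SimpleGraph

/-! ### Menger's theorem. -/

namespace SimpleGraph
variable {V : Type*} {G : SimpleGraph V}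

/-- `u 0, …, u n` is a walk along the arcs `E` that may pause. -/
def LazyWalk (E : Finset (V × V)) (u : ℕ → V) (n : ℕ) : Prop :=
  ∀ i < n, u i = u (i + 1) ∨ (u i, u (i + 1)) ∈ E

namespace LazyWalk
variable {E : Finset (V × V)} {u v : ℕ → V} {n m : ℕ}

theorem mono {E' : Finset (V × V)} (h : LazyWalk E u n) (hE : E ⊆ E') : LazyWalk E' u n :=
  fun i hi => (h i hi).imp_right fun e => hE e

theorem prefix_le (h : LazyWalk E u n) {j : ℕ} (hj : j ≤ n) : LazyWalk E u j :=
  fun i hi => h i (by omega)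

theorem shift (h : LazyWalk E u n) (j : ℕ) : LazyWalk E (fun i => u (j + i)) (n - j) :=
  fun i hi => h (j + i) (by omega)

theorem app (hu : LazyWalk E u n) (hv : LazyWalk E v m) (h : u n = v 0 ∨ (u n, v 0) ∈ E) :
    LazyWalk E (app u n v) (n + 1 + m) := by
  intro i hi
  rcases Nat.lt_trichotomy i n with h1 | rfl | h1
  · rw [app_left h1.le, app_left h1]; exact hu i h1
  · rw [app_left le_rfl, show i + 1 = i + 1 + 0 from rfl, app_right]; exact h
  · obtain ⟨k, rfl⟩ := Nat.exists_eq_add_of_le (show n + 1 ≤ i by omega)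
    rw [app_right, show n + 1 + k + 1 = n + 1 + (k + 1) by omega, app_right]
    exact hv k (by omega)

theorem conn (h : LazyWalk E u n) (hE : ∀ p ∈ E, G.Adj p.1 p.2) : G.Conn (seg u 0 n) := by
  refine ⟨⟨u 0, mem_seg_of le_rfl (Nat.zero_le _)⟩, ?_⟩
  rintro S ⟨_, ⟨k, -, hk, rfl⟩, hS⟩ hcl
  have step : ∀ i < n, u i ∈ S ↔ u (i + 1) ∈ S := by
    intro i hi
    rcases h i hi with e | e
    · rw [e]
    · have m1 : u i ∈ seg u 0 n := mem_seg_of (Nat.zero_le _) hi.le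
      have m2 : u (i + 1) ∈ seg u 0 n := mem_seg_of (Nat.zero_le _) hi
      exact ⟨fun hs => hcl _ m1 hs _ m2 (hE _ e), fun hs => hcl _ m2 hs _ m1 (hE _ e).symm⟩
  have h0 : ∀ i ≤ n, u i ∈ S ↔ u 0 ∈ S := by
    intro i
    induction i with
    | zero => simp
    | succ i ih => exact fun hi => (step i hi).symm.trans (ih (by omega))
  rintro _ ⟨i, -, hi, rfl⟩
  exact (h0 i hi).2 ((h0 k hk).1 hS)

end LazyWalk

/-- `W` meets every walk from `A` to `B`. -/
def Separates (E : Finset (V × V)) (A B W : Set V) : Prop :=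
  ∀ u n, LazyWalk E u n → u 0 ∈ A → u n ∈ B → ∃ i ≤ n, u i ∈ W

/-- Disjoint walks from `A` to `B`. -/
structure Linkage (E : Finset (V × V)) (A B : Set V) {k : ℕ} (u : Fin k → ℕ → V) (n : Fin k → ℕ) :
    Prop where
  walk : ∀ i, LazyWalk E (u i) (n i)
  left : ∀ i, u i 0 ∈ A
  right : ∀ i, u i (n i) ∈ B
  disj : ∀ i j, i ≠ j → ∀ p ≤ n i, ∀ q ≤ n j, u i p ≠ u j q

namespace Linkage
variable {E : Finset (V × V)} {A B : Set V} {k : ℕ} {u : Fin k → ℕ → V} {n : Fin k → ℕ}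

/-- Stopping each walk at its first vertex in `B` makes the ends the only vertices of the linkage in
`B`, which is needed for gluing. -/
theorem exists_first (h : Linkage E A B u n) :
    ∃ n', Linkage E A B u n' ∧ ∀ i, ∀ p < n' i, u i p ∉ B := by
  classical
  have hex : ∀ i, ∃ p, u i p ∈ B := fun i => ⟨n i, h.right i⟩
  have hle : ∀ i, Nat.find (hex i) ≤ n i := fun i => Nat.find_min' (hex i) (h.right i)
  exact ⟨fun i => Nat.find (hex i), ⟨fun i => (h.walk i).prefix_le (hle i), h.left,
    fun i => Nat.find_spec (hex i), fun i j hij p hp q hq =>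
      h.disj i j hij p (hp.trans (hle i)) q (hq.trans (hle j))⟩, fun i p hp => Nat.find_min (hex i) hp⟩

theorem exists_last (h : Linkage E A B u n) :
    ∃ (u' : Fin k → ℕ → V) (n' : Fin k → ℕ), Linkage E A B u' n' ∧
      ∀ i, ∀ p ≤ n' i, 0 < p → u' i p ∉ A := by
  classical
  let f : Fin k → ℕ := fun i => Nat.findGreatest (fun p => u i p ∈ A) (n i)
  have hle : ∀ i, f i ≤ n i := fun i => Nat.findGreatest_le (n i)
  refine ⟨fun i p => u i (f i + p), fun i => n i - f i, ⟨fun i => (h.walk i).shift _,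
    fun i => Nat.findGreatest_spec (P := fun p => u i p ∈ A) (Nat.zero_le _) (h.left i),
    fun i => ?_, fun i j hij p hp q hq => h.disj i j hij _ ?_ _ ?_⟩, fun i p hp hp0 hA => ?_⟩
  · have := hle i
    show u i (f i + (n i - f i)) ∈ B
    rw [show f i + (n i - f i) = n i by omega]; exact h.right i
  · have := hle i; omega
  · have := hle j; omega
  · have h1 := hle i
    replace hp : p ≤ n i - f i := hp
    have : f i + p ≤ f i := Nat.le_findGreatest (P := fun p => u i p ∈ A) (by omega) hA
    omega

/-- By counting: the `k` distinct ends of a linkage exhaust a set of at most `k` vertices. -/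
theorem eq_range {w : Fin k → V} {W : Set V} [Finite V] (hw : Function.Injective w)
    (hW : ∀ i, w i ∈ W) (hc : W.ncard ≤ k) {t : V} (ht : t ∈ W) : ∃ i, w i = t := by
  have h1 : (Set.range w).ncard = k := by
    rw [← Set.image_univ, Set.ncard_image_of_injective _ hw, Set.ncard_univ, Nat.card_fin]
  have h2 : Set.range w = W := Set.eq_of_subset_of_ncard_le (by rintro _ ⟨i, rfl⟩; exact hW i)
    (by omega) (Set.toFinite _)
  rwa [← h2] at ht

end Linkage

/-- Menger's theorem for walks between two sets of vertices. -/
theorem exists_linkage [Finite V] (E : Finset (V × V)) : ∀ (A B : Set V) (k : ℕ),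
    (∀ W, Separates E A B W → k ≤ W.ncard) → ∃ u n, Linkage E A B (k := k) u n := by
  classical
  induction E using Finset.induction_on with
  | empty =>
    intro A B k h
    have hk : k ≤ (A ∩ B).ncard := h _ fun u n hu hA hB => by
      have h0 : ∀ i ≤ n, u i = u 0 := by
        intro i
        induction i with
        | zero => simp
        | succ i ih =>
          intro hi
          rcases hu i hi with e | e
          · rw [← e]; exact ih (by omega)
          · simp at e
      exact ⟨0, Nat.zero_le _, hA, h0 n le_rfl ▸ hB⟩
    have : Fintype (A ∩ B : Set V) := Fintype.ofFinite _
    rw [← Nat.card_coe_set_eq, Nat.card_eq_fintype_card] at hk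
    obtain ⟨f⟩ := Function.Embedding.nonempty_of_card_le (α := Fin k) (β := (A ∩ B : Set V))
      (by simpa using hk)
    exact ⟨fun i _ => f i, fun _ => 0, fun i p hp => by omega, fun i => (f i).2.1,
      fun i => (f i).2.2, fun i j hij _ _ _ _ e => hij (f.injective (Subtype.ext e))⟩
  -- If `E` alone admits a separator `W` with fewer than `k` vertices, then both `W` with `x` and
  -- `W` with `y` separate in the presence of the arc, so `W` has `k - 1` vertices and contains
  -- neither. Linkages in `E` from `A` to the former and from the latter to `B` are glued along `W`
  -- and along the new arc.
  | insert e E he ih =>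
    obtain ⟨x, y⟩ := e
    intro A B k h
    have hsub : E ⊆ insert (x, y) E := Finset.subset_insert _ _
    by_cases hall : ∀ W, Separates E A B W → k ≤ W.ncard
    · obtain ⟨u, n, hu⟩ := ih A B k hall
      exact ⟨u, n, fun i => (hu.walk i).mono hsub, hu.left, hu.right, hu.disj⟩
    push Not at hall
    obtain ⟨W, hW, hWk⟩ := hall
    have hx : k ≤ (insert x W).ncard := h _ fun u n hu hA hB => by
      by_contra! hc
      obtain ⟨i, hi, hiW⟩ := hW u n (fun i hi => (hu i hi).imp_right fun e =>
        (Finset.mem_insert.1 e).resolve_left fun e' =>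
          hc i hi.le (Or.inl (congrArg Prod.fst e'))) hA hB
      exact hc i hi (Or.inr hiW)
    have hy : k ≤ (insert y W).ncard := h _ fun u n hu hA hB => by
      by_contra! hc
      obtain ⟨i, hi, hiW⟩ := hW u n (fun i hi => (hu i hi).imp_right fun e =>
        (Finset.mem_insert.1 e).resolve_left fun e' =>
          hc (i + 1) hi (Or.inl (congrArg Prod.snd e'))) hA hB
      exact hc i hi (Or.inr hiW)
    have hxc := Set.ncard_insert_le x W
    have hyc := Set.ncard_insert_le y W
    have hxW : x ∉ W := fun e => by rw [Set.insert_eq_of_mem e] at hx; omega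
    have hyW : y ∉ W := fun e => by rw [Set.insert_eq_of_mem e] at hy; omega
    -- A walk stopped at its first vertex in `insert x W` has not used the arc from `x`, so a
    -- separator for `E` also separates `A` from `B`. Symmetrically, `v₀` starts from last visits.
    obtain ⟨u₀, n₀, hu₀⟩ := ih A (insert x W) k fun Z hZ => h Z fun u n hu hA hB => by
      have hex : ∃ i, i ≤ n ∧ u i ∈ insert x W := by
        by_contra! hc
        obtain ⟨i, hi, hiW⟩ := hW u n (fun i hi => (hu i hi).imp_right fun e =>
          (Finset.mem_insert.1 e).resolve_left fun e' =>
            hc i hi.le (Or.inl (congrArg Prod.fst e'))) hA hB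
        exact hc i hi (Or.inr hiW)
      have hi := Nat.find_spec hex
      obtain ⟨j, hj, hjZ⟩ := hZ u (Nat.find hex) (fun j hj => (hu j (by omega)).imp_right fun e =>
        (Finset.mem_insert.1 e).resolve_left fun e' =>
          Nat.find_min hex hj ⟨by omega, Or.inl (congrArg Prod.fst e')⟩) hA hi.2
      exact ⟨j, hj.trans hi.1, hjZ⟩
    obtain ⟨v₀, m₀, hv₀⟩ := ih (insert y W) B k fun Z hZ => h Z fun u n hu hA hB => by
      have hex : ∃ i, i ≤ n ∧ u i ∈ insert y W := by
        by_contra! hc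
        obtain ⟨i, hi, hiW⟩ := hW u n (fun i hi => (hu i hi).imp_right fun e =>
          (Finset.mem_insert.1 e).resolve_left fun e' =>
            hc (i + 1) hi (Or.inl (congrArg Prod.snd e'))) hA hB
        exact hc i hi (Or.inr hiW)
      obtain ⟨i₀, hi₀, hi₀W⟩ := hex
      have hsp := Nat.findGreatest_spec (P := fun i => u i ∈ insert y W) hi₀ hi₀W
      have hle := Nat.findGreatest_le (P := fun i => u i ∈ insert y W) n
      have hmax : ∀ i ≤ n, u i ∈ insert y W → i ≤ Nat.findGreatest (fun i => u i ∈ insert y W) n :=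
        fun i h1 h2 => Nat.le_findGreatest (P := fun i => u i ∈ insert y W) h1 h2
      set i := Nat.findGreatest (fun i => u i ∈ insert y W) n
      obtain ⟨j, hj, hjZ⟩ := hZ (fun p => u (i + p)) (n - i) (fun j hj =>
        (hu (i + j) (by omega)).imp_right fun e => (Finset.mem_insert.1 e).resolve_left fun e' => by
          have := hmax (i + j + 1) (by omega) (Or.inl (congrArg Prod.snd e'))
          omega) hsp (by rwa [show i + (n - i) = n by omega])
      exact ⟨i + j, by omega, hjZ⟩
    obtain ⟨n', hu, hfirst⟩ := hu₀.exists_first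
    obtain ⟨v, m, hv, hlast⟩ := hv₀.exists_last
    have hinj : Function.Injective fun j => v j 0 := fun i j e => by
      by_contra hij
      exact hv.disj i j hij 0 (Nat.zero_le _) 0 (Nat.zero_le _) e
    have hex : ∀ i, ∃ j, v j 0 = if u₀ i (n' i) = x then y else u₀ i (n' i) := by
      intro i
      refine Linkage.eq_range hinj hv.left (by omega) ?_
      split_ifs with hc
      · exact Or.inl rfl
      · exact Or.inr ((hu.right i).resolve_left hc)
    choose σ hσ using hex
    -- If a first half meets a second half, switching there gives a walk in `E` from `A` to `B`,
    -- which must meet `W`. The halves are in `W` at most at their ends, so the halves meet at the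
    -- vertex where they are glued.
    have hmeet : ∀ i j, ∀ p ≤ n' i, ∀ q ≤ m j, u₀ i p = v j q → j = σ i := by
      intro i j p hp q hq e
      obtain ⟨l, hl, hlW⟩ := hW _ _ (((hu.walk i).prefix_le hp).app ((hv.walk j).shift q)
        (Or.inl e)) (by rw [app_left (Nat.zero_le _)]; exact hu.left i) (by
          rw [app_right, show q + (m j - q) = m j by omega]; exact hv.right j)
      have hmem : u₀ i p ∈ W := by
        rcases app_cases (u := u₀ i) (v := fun r => v j (q + r)) hl with ⟨h1, h2⟩ | ⟨r, hr, -, h2⟩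
        · rw [h2] at hlW
          have : ¬ l < n' i := fun hlt => hfirst i l hlt (Or.inr hlW)
          rwa [show p = l by omega]
        · rw [h2] at hlW
          have : ¬ 0 < q + r := fun h0 => hlast j _ (by omega) h0 (Or.inr hlW)
          rw [e]
          rwa [show q + r = q by omega] at hlW
      have hp' : p = n' i := by
        by_contra hne
        exact hfirst i p (by omega) (Or.inr hmem)
      have hq' : q = 0 := by
        by_contra hne
        exact hlast j q hq (by omega) (Or.inr (e ▸ hmem))
      subst hp' hq'
      refine hinj (show v j 0 = v (σ i) 0 from ?_)
      rw [hσ, if_neg (fun e' : u₀ i (n' i) = x => hxW (e' ▸ hmem)), e]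
    have hσinj : ∀ i j, i ≠ j → σ i ≠ σ j := by
      intro i j hij e
      refine hu.disj i j hij _ le_rfl _ le_rfl ?_
      have h1 := hσ i
      rw [e, hσ j] at h1
      split_ifs at h1 with h2 h3 h3
      · rw [h2, h3]
      · exact (hyW (h1 ▸ (hu.right i).resolve_left h3)).elim
      · exact (hyW (h1 ▸ (hu.right j).resolve_left h2)).elim
      · exact h1.symm
    refine ⟨fun i => app (u₀ i) (n' i) (v (σ i)), fun i => n' i + 1 + m (σ i), fun i => ?_,
      fun i => ?_, fun i => ?_, fun i j hij p hp q hq e => ?_⟩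
    · refine ((hu.walk i).mono hsub).app ((hv.walk _).mono hsub) ?_
      rw [hσ i]
      split_ifs with hc
      · rw [hc]; exact Or.inr (Finset.mem_insert_self _ _)
      · exact Or.inl rfl
    · show app _ _ _ 0 ∈ A
      rw [app_left (Nat.zero_le _)]; exact hu.left i
    · show app _ _ _ _ ∈ B
      rw [app_right]; exact hv.right _
    · rcases app_cases (u := u₀ i) (v := v (σ i)) hp with ⟨h1, h2⟩ | ⟨r, hr, -, h2⟩ <;>
        rcases app_cases (u := u₀ j) (v := v (σ j)) hq with ⟨h3, h4⟩ | ⟨r', hr', -, h4⟩ <;>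
        rw [h2, h4] at e
      · exact hu.disj i j hij _ h1 _ h3 e
      · exact hσinj i j hij (hmeet i (σ j) _ h1 _ hr' e).symm
      · exact hσinj i j hij (hmeet j (σ i) _ h3 _ hr e.symm)
      · exact hv.disj _ _ (hσinj i j hij) _ hr _ hr' e

/-- Either many disjoint connected sets link `A` to `B` inside `Q`, or few vertices meet all of
them. -/
theorem exists_disjoint_or_separator [Finite V] (G : SimpleGraph V) (Q A B : Set V) (k : ℕ) :
    (∃ C : Fin k → Set V, (∀ i, G.Conn (C i) ∧ C i ⊆ Q ∧ (C i ∩ A).Nonempty ∧ (C i ∩ B).Nonempty) ∧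
      ∀ i j, i ≠ j → Disjoint (C i) (C j)) ∨
    ∃ W : Set V, W.ncard < k ∧ ∀ C, G.Conn C → C ⊆ Q → Disjoint C W → (C ∩ A).Nonempty →
      (C ∩ B).Nonempty → False := by
  classical
  have hfin : {p : V × V | p.1 ∈ Q ∧ p.2 ∈ Q ∧ G.Adj p.1 p.2}.Finite := Set.toFinite _
  have hE : ∀ p, p ∈ hfin.toFinset ↔ p.1 ∈ Q ∧ p.2 ∈ Q ∧ G.Adj p.1 p.2 := fun p => by simp
  -- The set `A` is restricted to `Q` because a walk that never moves uses no arc and would not be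
  -- confined to `Q`.
  by_cases h : ∀ W, Separates hfin.toFinset (A ∩ Q) B W → k ≤ W.ncard
  · obtain ⟨u, n, hu⟩ := exists_linkage _ _ _ _ h
    refine Or.inl ⟨fun i => seg (u i) 0 (n i), fun i => ⟨(hu.walk i).conn fun p hp =>
      ((hE p).1 hp).2.2, ?_, ⟨u i 0, mem_seg_of le_rfl (Nat.zero_le _), (hu.left i).1⟩,
      ⟨u i (n i), mem_seg_of (Nat.zero_le _) le_rfl, hu.right i⟩⟩, fun i j hij => ?_⟩
    · rintro _ ⟨p, -, hp, rfl⟩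
      induction p with
      | zero => exact (hu.left i).2
      | succ p ihp =>
        rcases hu.walk i p hp with e | e
        · rw [← e]; exact ihp (by omega)
        · exact ((hE _).1 e).2.1
    · refine Set.disjoint_left.2 ?_
      rintro _ ⟨p, -, hp, rfl⟩ ⟨q, -, hq, e⟩
      exact hu.disj i j hij p hp q hq e.symm
  · push Not at h
    obtain ⟨W, hW, hk⟩ := h
    refine Or.inr ⟨W, hk, fun C hC hCQ hCW hA hB => ?_⟩
    obtain ⟨u, n, hu, huC, h0, hn, -, -⟩ := hC.exists_minPath (· ∈ A) (· ∈ B) hA hB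
    obtain ⟨i, hi, hiW⟩ := hW u n (fun i hi => Or.inr ((hE _).2 ⟨hCQ (huC i hi.le),
      hCQ (huC _ hi), hu.adj_succ hi⟩)) ⟨h0, hCQ (huC 0 (Nat.zero_le _))⟩ hn
    exact Set.disjoint_left.1 hCW (huC i hi) hiW

end SimpleGraph

/-! ### Crossings past a leg, and the bound on their number. -/

namespace SimpleGraph
variable {V : Type*} {G : SimpleGraph V} {d : ℕ} {a : V} {X D L R : Set V}

namespace LegConfig
variable {c₁ c₂ : V} {s : ℕ → V} {r : ℕ} {ΛL ΛR : Set V} {p : ℕ → V} {n : ℕ}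

theorem conn_core (h : LegConfig G X D L R c₁ c₂ s r ΛL ΛR) :
    G.Conn (insert c₁ (insert c₂ (L ∪ R))) := by
  have := (h.sepPair.connL.insert h.touch₁).union_adj (h.sepPair.connR.insert h.touch₂)
    (Or.inl rfl) (Or.inl rfl) h.adj
  rwa [show insert c₁ L ∪ insert c₂ R = insert c₁ (insert c₂ (L ∪ R)) by
    ext; simp only [Set.mem_union, Set.mem_insert_iff]; tauto] at this

theorem core_sub (h : LegConfig G X D L R c₁ c₂ s r ΛL ΛR) :
    insert c₁ (insert c₂ (L ∪ R)) ⊆ D := by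
  rintro x (rfl | rfl | hx | hx)
  exacts [h.mem₁, h.mem₂, h.sepPair.subL hx, h.sepPair.subR hx]

theorem sep_core (h : LegConfig G X D L R c₁ c₂ s r ΛL ΛR) {f : ℕ} (hf : f < r) :
    G.Sep (insert c₁ (insert c₂ (L ∪ R))) (seg s 0 f) := by
  rintro x hx _ ⟨i, -, hi, rfl⟩
  have hm : s i ∈ seg s 0 r := mem_seg_of (Nat.zero_le _) (by omega)
  rcases hx with rfl | rfl | hx | hx
  · exact ⟨(h.ne i (by omega)).1.symm, fun e => by
      have := (h.adj₁ i (by omega)).1 e.symm; omega⟩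
  · exact ⟨(h.ne i (by omega)).2.symm, fun e => by
      have := (h.adj₂ i (by omega)).1 e.symm; omega⟩
  · exact h.sepL.symm x hx _ hm
  · exact h.sepR.symm x hx _ hm

/-- The part of a crossing before its `i`th vertex, extended by `L` and a pendant vertex. -/
theorem side (h : LegConfig G X D L R c₁ c₂ s r ΛL ΛR) (hS : Setting G d a X D)
    (hp : Crossing G D L R p n) {x : V} (hx : x ∈ ΛL) {i : ℕ} (hi : i ≤ n) :
    G.Conn (ico p 0 i ∪ ({x} ∪ L)) ∧ ico p 0 i ∪ ({x} ∪ L) ⊆ D ∪ X ∧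
      ((ico p 0 i ∪ ({x} ∪ L)) ∩ X).Nonempty ∧ p i ∉ ico p 0 i ∪ ({x} ∪ L) ∧
      G.Touches (p i) (ico p 0 i ∪ ({x} ∪ L)) := by
  have h0 : G.Touches (p 0) ({x} ∪ L) :=
    ((hp.left 0 (Nat.zero_le _)).2 rfl).mono Set.subset_union_right
  refine ⟨hp.path.conn_head (h.conn_insert hx) (by omega) h0, Set.union_subset
    (ico_subset fun j _ _ => Or.inl (hp.mem j (by omega))) (h.insert_sub hx),
    ⟨x, Or.inr (Or.inl rfl), h.subL hx⟩, ?_, hp.path.touches_head hi h0 (Nat.zero_le _)⟩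
  rintro (e | e | e)
  · exact hp.path.notMem_ico hi (by omega) (by omega) e
  · exact hS.disj x (h.subL hx) ((show p i = x from e) ▸ hp.mem i hi)
  · exact hp.notMemL i hi e

theorem side' (h : LegConfig G X D L R c₁ c₂ s r ΛL ΛR) (hS : Setting G d a X D)
    (hp : Crossing G D L R p n) {y : V} (hy : y ∈ ΛR) {i : ℕ} (hi : i ≤ n) :
    G.Conn (ico p (i + 1) (n + 1) ∪ ({y} ∪ R)) ∧ ico p (i + 1) (n + 1) ∪ ({y} ∪ R) ⊆ D ∪ X ∧
      ((ico p (i + 1) (n + 1) ∪ ({y} ∪ R)) ∩ X).Nonempty ∧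
      p i ∉ ico p (i + 1) (n + 1) ∪ ({y} ∪ R) ∧
      G.Touches (p i) (ico p (i + 1) (n + 1) ∪ ({y} ∪ R)) := by
  have := h.symm.side hS hp.reverse hy (i := n - i) (by omega)
  rwa [ico_reverse (by omega) (by omega), show n + 1 - (n - i) = i + 1 by omega,
    show n + 1 - 0 = n + 1 by omega, show n - (n - i) = i by omega] at this

theorem sep_sides (h : LegConfig G X D L R c₁ c₂ s r ΛL ΛR) (hS : Setting G d a X D)
    (hp : Crossing G D L R p n) {x y : V} (hx : x ∈ ΛL) (hy : y ∈ ΛR)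
    (hxp : ∀ i ≤ n, ¬ G.Adj x (p i)) (hyp : ∀ i ≤ n, ¬ G.Adj y (p i)) {i j : ℕ} (hij : i < j)
    (hi : i ≤ n) : G.Sep (ico p 0 i ∪ ({x} ∪ L)) (ico p j (n + 1) ∪ ({y} ∪ R)) := by
  have hcl : ∀ z ∈ X, (∀ i ≤ n, ¬ G.Adj z (p i)) → ∀ k l, l ≤ n + 1 → G.Sep {z} (ico p k l) :=
    fun z hz hzp k l hl => sep_singleton_left.2
      ⟨fun ⟨q, _, _, e⟩ => hS.disj z hz (e ▸ hp.mem q (by omega)),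
        fun ⟨_, ⟨q, _, _, e⟩, e'⟩ => hzp q (by omega) (e ▸ e')⟩
  refine sep_union_left.2 ⟨sep_union_right.2 ⟨hp.path.sep_ico hij le_rfl, sep_union_right.2
    ⟨(hcl y (h.subR hy) hyp _ _ (by omega)).symm, sep_ico_left fun q _ hq =>
      ⟨hp.notMemR q (by omega), fun e => ?_⟩⟩⟩, sep_union_right.2 ⟨sep_union_left.2
    ⟨hcl x (h.subL hx) hxp _ _ le_rfl, (sep_ico_left fun q hq hq' =>
      ⟨hp.notMemL q (by omega), fun e => ?_⟩).symm⟩, h.sep_insert hS hx hy⟩⟩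
  · have := (hp.right q (by omega)).1 e; omega
  · have := (hp.left q (by omega)).1 e; omega

/-- A crossing without neighbours of `s 0` has at most two neighbours of `s r`, and at least one. -/
theorem contacts [Finite V] (h : LegConfig G X D L R c₁ c₂ s r ΛL ΛR) (hS : Setting G d a X D)
    (hp : Crossing G D L R p n) (h0 : ∀ i ≤ n, ¬ G.Adj (s 0) (p i)) :
    (∀ i ≤ n, p i ≠ s r) ∧ (∃ i ≤ n, G.Adj (s r) (p i)) ∧
      (seg p 0 n ∩ G.neighborSet (s r)).ncard ≤ 2 := by
  classical
  have hcL := h.cardL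
  have hcR := h.cardR
  -- A crossing away from the leg would connect the two sides, contrary to `false_of_conn`. Below,
  -- `s f` is the first vertex of the leg with a contact.
  have hex : ∃ f, f ≤ r ∧ ∃ i ≤ n, p i = s f ∨ G.Adj (s f) (p i) := by
    by_contra! hc
    obtain ⟨y, hy, e⟩ := (hp.left 0 (Nat.zero_le _)).2 rfl
    obtain ⟨y', hy', e'⟩ := (hp.right n le_rfl).2 rfl
    refine h.false_of_conn hS (C := (L ∪ ico p 0 (n + 1)) ∪ R)
      ((h.sepPair.connL.union_adj (hp.path.conn_ico (by omega) le_rfl) hy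
        (mem_ico_of (k := 0) le_rfl (by omega)) e.symm).union_adj h.sepPair.connR
        (Or.inr (mem_ico_of (k := n) (by omega) (by omega))) hy' e')
      (Set.union_subset (Set.union_subset h.sepPair.subL (ico_subset fun i _ _ =>
        hp.mem i (by omega))) h.sepPair.subR)
      (sep_union_left.2 ⟨sep_union_left.2 ⟨h.sepL.symm, ?_⟩, h.sepR.symm⟩)
      ⟨y, Or.inl (Or.inl hy), hy⟩ ⟨y', Or.inr hy', hy'⟩
    rintro _ ⟨i, -, hi, rfl⟩ _ ⟨f, -, hf, rfl⟩
    exact ⟨(hc f hf i (by omega)).1, fun e => (hc f hf i (by omega)).2 e.symm⟩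
  obtain ⟨hfr, hfex⟩ := Nat.find_spec hex
  have hfmin : ∀ g < Nat.find hex, ∀ i ≤ n, p i ≠ s g ∧ ¬ G.Adj (s g) (p i) := fun g hg i hi =>
    ⟨fun e => Nat.find_min hex hg ⟨by omega, i, hi, Or.inl e⟩,
      fun e => Nat.find_min hex hg ⟨by omega, i, hi, Or.inr e⟩⟩
  set f := Nat.find hex
  have hpf : ∀ i ≤ n, p i ≠ s f := by
    intro i hi e
    rcases Nat.eq_zero_or_pos f with hf0 | hf0
    · rw [hf0] at e
      exact hS.disj _ h.zero_mem (e ▸ hp.mem i hi)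
    · refine (hfmin (f - 1) (by omega) i hi).2 ?_
      rw [e, h.path.adj _ (by omega) _ (by omega)]
      omega
  have hfa : ∃ i, i ≤ n ∧ G.Adj (s f) (p i) := by
    obtain ⟨i, hi, e⟩ := hfex
    exact ⟨i, hi, e.resolve_left (hpf i hi)⟩
  have hf0 : f ≠ 0 := by
    intro hf0
    obtain ⟨i, hi, e⟩ := hfa
    exact h0 i hi (hf0 ▸ e)
  have hlo := Nat.find_spec hfa
  have hlomin : ∀ i ≤ n, G.Adj (s f) (p i) → Nat.find hfa ≤ i := fun i h1 h2 =>
    Nat.find_min' hfa ⟨h1, h2⟩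
  set lo := Nat.find hfa
  have hhi := Nat.findGreatest_spec (P := fun i => G.Adj (s f) (p i)) hlo.1 hlo.2
  have hhile := Nat.findGreatest_le (P := fun i => G.Adj (s f) (p i)) n
  have hhimax : ∀ i ≤ n, G.Adj (s f) (p i) → i ≤ Nat.findGreatest (fun i => G.Adj (s f) (p i)) n :=
    fun i h1 h2 => Nat.le_findGreatest (P := fun i => G.Adj (s f) (p i)) h1 h2
  set hi := Nat.findGreatest (fun i => G.Adj (s f) (p i)) n
  have hlohi := hhimax lo hlo.1 hlo.2
  obtain ⟨x, hx, -, hxp⟩ := hp.exists_clean h.sepPair hS h.subL h.touchL (by omega)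
  obtain ⟨y, hy, -, hyp⟩ := hp.reverse.exists_clean h.sepPair.symm hS h.subR h.touchR (by omega)
  replace hyp : ∀ i ≤ n, ¬ G.Adj y (p i) := fun i hi => by
    have := hyp (n - i) (by omega)
    rwa [show n - (n - i) = i by omega] at this
  have sepA : ∀ i ≤ n, ∀ g ≤ r, G.Sep (ico p 0 i) (seg s 0 g) →
      G.Sep (ico p 0 i ∪ ({x} ∪ L)) (seg s 0 g) := fun i _ g hg h' => sep_union_left.2
    ⟨h', sep_union_left.2 ⟨h.sepΛ_seg hg (Or.inl hx), (h.sepL.mono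
      (A' := seg s 0 g) (by rintro z ⟨k, k1, k2, k3⟩; exact ⟨k, k1, k2.trans hg, k3⟩) le_rfl).symm⟩⟩
  have sepB : ∀ i, ∀ g ≤ r, G.Sep (ico p i (n + 1)) (seg s 0 g) →
      G.Sep (ico p i (n + 1) ∪ ({y} ∪ R)) (seg s 0 g) := fun i g hg h' => sep_union_left.2
    ⟨h', sep_union_left.2 ⟨h.sepΛ_seg hg (Or.inr hy), (h.sepR.mono
      (A' := seg s 0 g) (by rintro z ⟨k, k1, k2, k3⟩; exact ⟨k, k1, k2.trans hg, k3⟩) le_rfl).symm⟩⟩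
  have seps : ∀ k l g, l ≤ n + 1 → g ≤ f → (g < f ∨ ∀ q, k ≤ q → q < l → ¬ G.Adj (s f) (p q)) →
      G.Sep (ico p k l) (seg s 0 g) := by
    rintro k l g hl hg hc _ ⟨q, q1, q2, rfl⟩ _ ⟨e, -, he, rfl⟩
    rcases (he.trans hg).lt_or_eq with h1 | h1
    · have := hfmin e h1 q (by omega)
      exact ⟨this.1, fun e' => this.2 e'.symm⟩
    · rw [h1]
      exact ⟨hpf q (by omega), fun e' => (hc.resolve_left (by omega)) q q1 q2 e'.symm⟩
  -- With a single contact there is a trident at `p lo`, along the crossing to both sides and along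
  -- the leg back to `s 0`.
  by_cases hone : lo = hi
  · exfalso
    obtain ⟨a1, a2, a3, a4, a5⟩ := h.side hS hp hx hlo.1
    obtain ⟨b1, b2, b3, b4, b5⟩ := h.side' hS hp hy hlo.1
    refine hS.not_trident (hp.mem lo hlo.1) a1 b1 (h.conn_seg hfr)
      (h.sep_sides hS hp hx hy hxp hyp (by omega) hlo.1)
      (sepA lo hlo.1 f hfr (seps _ _ _ (by omega) le_rfl (Or.inr fun q _ hq e => ?_)))
      (sepB _ f hfr (seps _ _ _ le_rfl le_rfl (Or.inr fun q hq hq' e => ?_))) a2 b2 (h.seg_sub hfr)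
      a4 b4 ?_ a5 b5 ⟨s f, mem_seg_of (Nat.zero_le _) le_rfl, hlo.2.symm⟩ a3 b3 h.seg_meet
    · have := hlomin q (by omega) e; omega
    · have := hhimax q (by omega) e; omega
    · rintro ⟨g, -, hg, e⟩
      rcases hg.lt_or_eq with hg | rfl
      · exact (hfmin g hg lo hlo.1).1 e.symm
      · exact hpf lo hlo.1 e.symm
  -- With extreme contacts further apart there is a trident at `s f` itself, whose third arm is the
  -- leg before `s f`.
  by_cases htwo : hi = lo + 1
  swap
  · exfalso
    obtain ⟨a1, a2, a3, -, -⟩ := h.side hS hp hx (i := lo + 1) (by omega)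
    obtain ⟨b1, b2, b3, -, -⟩ := h.side' hS hp hy (i := hi - 1) (by omega)
    rw [show hi - 1 + 1 = hi by omega] at b1 b2 b3
    have hm : s f ∈ seg s 0 r := mem_seg_of (Nat.zero_le _) hfr
    refine hS.not_trident (h.mem f (by omega) hfr) a1 b1 (h.conn_seg (f := f - 1) (by omega))
      (h.sep_sides hS hp hx hy hxp hyp (by omega) (by omega))
      (sepA _ (by omega) _ (by omega) (seps _ _ _ (by omega) (by omega) (Or.inl (by omega))))
      (sepB _ _ (by omega) (seps _ _ _ le_rfl (by omega) (Or.inl (by omega)))) a2 b2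
      (h.seg_sub (by omega)) ?_ ?_ ?_
      ⟨p lo, Or.inl (mem_ico_of (Nat.zero_le _) (by omega)), hlo.2⟩
      ⟨p hi, Or.inl (mem_ico_of le_rfl (by omega)), hhi⟩
      ⟨s (f - 1), mem_seg_of (Nat.zero_le _) le_rfl, by
        rw [h.path.adj _ hfr _ (by omega)]; omega⟩ a3 b3 h.seg_meet
    · rintro (⟨q, -, hq, e⟩ | e | e)
      · exact hpf q (by omega) e
      · exact (h.sepΛ x (Or.inl hx) f hfr).1 (show s f = x from e).symm
      · exact h.sepL.notMem hm e
    · rintro (⟨q, -, hq, e⟩ | e | e)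
      · exact hpf q (by omega) e
      · exact (h.sepΛ y (Or.inr hy) f hfr).1 (show s f = y from e).symm
      · exact h.sepR.notMem hm e
    · rintro ⟨g, -, hg, e⟩
      have := h.path.inj g (by omega) f hfr e
      omega
  have hadj : ∀ i ≤ n, G.Adj (s f) (p i) ↔ i = lo ∨ i = lo + 1 := by
    intro i hi'
    constructor
    · intro e
      have := hlomin i hi' e
      have := hhimax i hi' e
      omega
    · rintro (rfl | rfl)
      · exact hlo.2
      · exact htwo ▸ hhi
  -- If `f < r`, the initial part of the leg up to `s f` has exactly two consecutive contacts on the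
  -- crossing and is separated from `L`, `c₁`, `c₂`, `R`, which connect the two sides;
  -- `Crossing.false_of_pair` excludes this.
  have hf : f = r := by
    by_contra hne
    refine hp.false_of_pair h.sepPair hS h.subL h.touchL (by omega) h.subR h.touchR (by omega)
      (h.conn_seg hfr) (h.seg_sub hfr) h.seg_meet
      (fun z hz => sep_singleton_left.1 (h.sepΛ_seg hfr hz)) h.conn_core h.core_sub
      (fun z hz => Or.inr (Or.inr (Or.inl hz))) (fun z hz => Or.inr (Or.inr (Or.inr hz)))
      (h.sep_core (by omega)) h.uniq (i := lo) (by omega) ?_ ?_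
    · rintro l hl ⟨g, -, hg, e⟩
      rcases hg.lt_or_eq with hg | rfl
      · exact (hfmin g hg l hl).1 e.symm
      · exact hpf l hl e.symm
    · intro l hl
      rw [← hadj l hl]
      constructor
      · rintro ⟨_, ⟨g, -, hg, rfl⟩, e⟩
        rcases hg.lt_or_eq with hg | rfl
        · exact ((hfmin g hg l hl).2 e.symm).elim
        · exact e.symm
      · exact fun e => ⟨s f, mem_seg_of (Nat.zero_le _) le_rfl, e.symm⟩
  rw [hf] at hpf hadj hlo
  refine ⟨hpf, ⟨lo, hlo⟩, ?_⟩
  refine (Set.ncard_le_ncard (t := {p lo, p (lo + 1)}) ?_ (Set.toFinite _)).trans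
    ((Set.ncard_insert_le _ _).trans (by simp))
  rintro _ ⟨⟨i, -, hi', rfl⟩, e⟩
  rcases (hadj i hi').1 e with rfl | rfl
  · exact Or.inl rfl
  · exact Or.inr rfl

/-- The side `R` can be enlarged by a connected set away from the leg. -/
theorem extend [Finite V] (h : LegConfig G X D L R c₁ c₂ s r ΛL ΛR) (hS : Setting G d a X D)
    {U : Set V} (hU : G.Conn (R ∪ U)) (hUD : U ⊆ D) (hUs : G.Sep U (seg s 0 r))
    (hUΛ : ∀ x ∈ ΛL ∪ ΛR, ¬ G.Touches x U) : LegConfig G X D L (R ∪ U) c₁ c₂ s r ΛL ΛR :=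
  { h with
    sepPair := by
      refine ⟨h.sepPair.connL, hU, h.sepPair.subL, Set.union_subset h.sepPair.subR hUD,
        sep_union_right.2 ⟨h.sepPair.sep, ?_⟩⟩
      -- If `L` and `U` were joined or met, the two sides would be connected away from the leg.
      by_contra hn
      have hLU : ∃ x ∈ L, ∃ y ∈ R ∪ U, x = y ∨ G.Adj x y := by
        by_contra! hc
        exact hn fun x hx y hy => hc x hx y (Or.inr hy)
      obtain ⟨x, hx⟩ := h.sepPair.connL.1
      obtain ⟨y, hy⟩ := h.sepPair.connR.1
      exact h.false_of_conn hS (h.sepPair.connL.union hU hLU)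
        (Set.union_subset h.sepPair.subL (Set.union_subset h.sepPair.subR hUD))
        (sep_union_left.2 ⟨h.sepL.symm, sep_union_left.2 ⟨h.sepR.symm, hUs⟩⟩)
        ⟨x, Or.inl hx, hx⟩ ⟨y, Or.inr (Or.inl hy), hy⟩
    touch₂ := h.touch₂.mono Set.subset_union_left
    sepR := sep_union_right.2 ⟨h.sepR, hUs.symm⟩
    touchR := fun x hx => (h.touchR x hx).mono Set.subset_union_left
    uniq := by
      have key : ∀ x ∈ ΛL ∪ ΛR, ∀ y ∈ insert c₁ (insert c₂ (L ∪ (R ∪ U))), G.Adj x y →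
          y ∈ insert c₁ (insert c₂ (L ∪ R)) := by
        rintro x hx y (hy | hy | hy | hy | hy) e
        · exact Or.inl hy
        · exact Or.inr (Or.inl hy)
        · exact Or.inr (Or.inr (Or.inl hy))
        · exact Or.inr (Or.inr (Or.inr hy))
        · exact (hUΛ x hx ⟨y, hy, e⟩).elim
      exact fun x hx y hy y' hy' e e' => h.uniq x hx y (key x hx y hy e) y' (key x hx y' hy' e') e e' }

end LegConfig

/-- There are boundedly many disjoint crossings between the sides of a leg. -/
theorem exists_leg_bound (d t : ℕ) :
    ∃ N : ℕ, ∀ {V : Type*} [Finite V] {G : SimpleGraph V} {a : V} {X D L R : Set V} {c₁ c₂ : V}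
      {s : ℕ → V} {r : ℕ} {ΛL ΛR : Set V}, LegConfig G X D L R c₁ c₂ s r ΛL ΛR →
      Setting G d a X D → G.CliqueFree t → ∀ {ι : Type*} (I : Finset ι) (p : ι → ℕ → V) (m : ι → ℕ),
      (∀ x ∈ I, Crossing G D L R (p x) (m x)) →
      (∀ x ∈ I, ∀ y ∈ I, x ≠ y → ∀ i ≤ m x, ∀ j ≤ m y, p x i ≠ p y j) → N ≤ I.card → False := by
  classical
  obtain ⟨N₁, hN₁⟩ := exists_chunk_bound 2 t
  obtain ⟨N₂, hN₂⟩ := exists_chunk_bound d t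
  refine ⟨N₁ + N₂, fun {V} _ {G a X D L R c₁ c₂ s r ΛL ΛR} h hS hK {ι} I p m hcr hdisj hc => ?_⟩
  have m0 : s 0 ∈ seg s 0 r := mem_seg_of le_rfl (Nat.zero_le _)
  have mr : s r ∈ seg s 0 r := mem_seg_of (Nat.zero_le _) le_rfl
  have hsep : ∀ z ∈ seg s 0 r, G.Sep {z} L ∧ G.Sep {z} R := fun z hz =>
    ⟨h.sepL.mono (by rintro _ rfl; exact hz) le_rfl, h.sepR.mono (by rintro _ rfl; exact hz) le_rfl⟩
  set Q : Set V := {v | (∃ x ∈ I, v ∈ seg (p x) 0 (m x)) ∧ ¬ G.Adj (s 0) v} with hQ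
  have hQD : Q ⊆ D := by
    rintro v ⟨⟨x, hx, i, -, hi, rfl⟩, -⟩
    exact (hcr x hx).mem i hi
  have hcross : ∀ C, G.Conn C → C ⊆ D → (C ∩ L).Nonempty → (C ∩ R).Nonempty →
      (∀ y ∈ C, y ∉ L → y ∉ R → y ∈ Q) →
      ∃ f n, Crossing G D L R f n ∧ ∀ i ≤ n, f i ∈ C ∧ f i ∈ Q := by
    intro C hC hCD hL hR hCQ
    obtain ⟨f, n, hf, hfC⟩ := h.sepPair.exists_crossing hC hCD hL hR
    exact ⟨f, n, hf, fun i hi => ⟨hfC i hi, hCQ _ (hfC i hi) (hf.notMemL i hi) (hf.notMemR i hi)⟩⟩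
  -- Menger's theorem among the vertices of the crossings that are not adjacent to `s 0`. Many
  -- disjoint connections give a chunk system centred at `s r`: each has at most two neighbours of
  -- `s r`, and by `contacts` every further connection has one.
  rcases exists_disjoint_or_separator G Q {v | G.Touches v L} {v | G.Touches v R} N₁ with
    ⟨C, hC, hCd⟩ | ⟨W, hW, hWC⟩
  · have hex : ∀ i, ∃ f n, Crossing G D L R f n ∧ ∀ j ≤ n, f j ∈ C i := by
      intro i
      obtain ⟨h1, h2, ⟨y, hy, z, hz, hyz⟩, y', hy', z', hz', hyz'⟩ := hC i
      obtain ⟨f, n, hf, hfC⟩ := h.sepPair.exists_crossing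
        ((h.sepPair.connL.union_adj h1 hz hy hyz.symm).union_adj h.sepPair.connR (Or.inr hy') hz' hyz')
        (Set.union_subset (Set.union_subset h.sepPair.subL (h2.trans hQD)) h.sepPair.subR)
        ⟨z, Or.inl (Or.inl hz), hz⟩ ⟨z', Or.inr hz', hz'⟩
      refine ⟨f, n, hf, fun j hj => ?_⟩
      rcases hfC j hj with (e | e) | e
      · exact (hf.notMemL j hj e).elim
      · exact e
      · exact (hf.notMemR j hj e).elim
    choose f n hf hfC using hex
    have hct : ∀ i, _ := fun i => h.contacts hS (hf i) fun j hj => ((hC i).2.1 (hfC i j hj)).2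
    refine hN₁ G hS.theta hS.evenWheel hK (s r) Finset.univ L R f n (by simp)
      ⟨h.sepPair.connL, h.sepPair.connR, (hsep _ mr).1, (hsep _ mr).2, fun i _ => (hf i).path,
        fun i _ j _ hij k hk l hl e => Set.disjoint_left.1 (hCd i j hij) (hfC i k hk)
          (e ▸ hfC j l hl), fun i _ => (hct i).1, fun i _ => ((hf i).left 0 (Nat.zero_le _)).2 rfl,
        fun i _ => ((hf i).right _ le_rfl).2 rfl, fun i _ => (hct i).2.2, ?_⟩
    intro C' hC' hsub hr hL hR
    obtain ⟨g, k, hg, hgC⟩ := hcross C' hC' (fun y hy => by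
      rcases hsub y hy with e | e | ⟨i, -, j, -, hj, rfl⟩
      · exact h.sepPair.subL e
      · exact h.sepPair.subR e
      · exact (hf i).mem j hj) hL hR (fun y hy hyL hyR => by
      obtain ⟨i, -, j, -, hj, rfl⟩ := ((hsub y hy).resolve_left hyL).resolve_left hyR
      exact (hC i).2.1 (hfC i j hj))
    obtain ⟨-, ⟨i, hi, e⟩, -⟩ := h.contacts hS hg fun i hi => (hgC i hi).2.2
    exact hr _ (hgC i hi).1 e
  -- The disjoint crossings meeting the small separator `W` are discarded. In the union of the
  -- others and the sides, the neighbours of `s 0` separate the sides, and each crossing has at most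
  -- `d` of them, so `s 0` is the centre.
  · set J := I.filter fun x => ∃ i ≤ m x, p x i ∈ W with hJ
    set I' := I \ J with hI'
    have hcard : N₂ ≤ I'.card := by
      have h1 : J.card ≤ W.ncard := by
        have hex : ∀ x, ∃ i, (∃ i ≤ m x, p x i ∈ W) → i ≤ m x ∧ p x i ∈ W := fun x => by
          by_cases hx : ∃ i ≤ m x, p x i ∈ W
          · obtain ⟨i, hi⟩ := hx
            exact ⟨i, fun _ => hi⟩
          · exact ⟨0, fun h' => (hx h').elim⟩
        choose g hg using hex
        rw [← Set.ncard_coe_finset]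
        refine Set.ncard_le_ncard_of_injOn (fun x => p x (g x)) (fun x hx => ?_) ?_ (Set.toFinite _)
        · exact (hg x (Finset.mem_filter.1 hx).2).2
        · intro x hx y hy e
          by_contra hxy
          rw [Finset.mem_coe, Finset.mem_filter] at hx hy
          exact hdisj x hx.1 y hy.1 hxy _ (hg x hx.2).1 _ (hg y hy.2).1 e
      have h2 : I.card - J.card ≤ I'.card := Finset.le_card_sdiff J I
      omega
    have hI : ∀ x ∈ I', x ∈ I := fun x hx => (Finset.mem_sdiff.1 hx).1
    have hcL := h.cardL
    have hcR := h.cardR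
    refine hN₂ G hS.theta hS.evenWheel hK (s 0) I' L R p m hcard
      ⟨h.sepPair.connL, h.sepPair.connR, (hsep _ m0).1, (hsep _ m0).2,
        fun x hx => (hcr x (hI x hx)).path, fun x hx y hy => hdisj x (hI x hx) y (hI y hy),
        fun x hx i hi e => hS.disj _ h.zero_mem (e ▸ (hcr x (hI x hx)).mem i hi),
        fun x hx => ((hcr x (hI x hx)).left 0 (Nat.zero_le _)).2 rfl,
        fun x hx => ((hcr x (hI x hx)).right _ le_rfl).2 rfl, fun x hx =>
          (hcr x (hI x hx)).ncard_nbrs_le h.sepPair hS h.subL h.touchL (by omega) h.subR h.touchR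
            (by omega) h.zero_mem (fun e => (h.sepΛ _ (Or.inl e) 0 (Nat.zero_le _)).1 rfl)
            (fun e => (h.sepΛ _ (Or.inr e) 0 (Nat.zero_le _)).1 rfl), ?_⟩
    intro C hC hsub h0 hL hR
    obtain ⟨g, k, hg, hgC⟩ := hcross C hC (fun y hy => by
      rcases hsub y hy with e | e | ⟨x, hx, j, -, hj, rfl⟩
      · exact h.sepPair.subL e
      · exact h.sepPair.subR e
      · exact (hcr x (hI x hx)).mem j hj) hL hR (fun y hy hyL hyR => by
      obtain ⟨x, hx, e⟩ := ((hsub y hy).resolve_left hyL).resolve_left hyR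
      exact ⟨⟨x, hI x hx, e⟩, h0 y hy⟩)
    refine hWC (seg g 0 k) (hg.path.conn_seg (Nat.zero_le _) le_rfl) ?_ ?_
      ⟨g 0, mem_seg_of le_rfl (Nat.zero_le _), (hg.left 0 (Nat.zero_le _)).2 rfl⟩
      ⟨g k, mem_seg_of (Nat.zero_le _) le_rfl, (hg.right k le_rfl).2 rfl⟩
    · rintro _ ⟨i, -, hi, rfl⟩
      exact (hgC i hi).2
    · refine Set.disjoint_left.2 ?_
      rintro _ ⟨i, -, hi, rfl⟩ hiW
      rcases hsub _ (hgC i hi).1 with e | e | ⟨x, hx, j, -, hj, e⟩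
      · exact hg.notMemL i hi e
      · exact hg.notMemR i hi e
      · exact (Finset.mem_sdiff.1 hx).2 (Finset.mem_filter.2 ⟨hI x hx, j, hj, e ▸ hiW⟩)

end SimpleGraph

/-! ### Paths with many legs. -/

namespace SimpleGraph
variable {V : Type*} {G : SimpleGraph V} {d : ℕ} {a : V} {X D : Set V}

theorem exists_middle {s : Finset ℕ} {K : ℕ} (h : 2 * K + 1 ≤ s.card) :
    ∃ e ∈ s, K ≤ (s.filter (· < e)).card ∧ K ≤ (s.filter (e < ·)).card := by
  obtain ⟨t, hts, ht⟩ := Finset.exists_subset_card_eq h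
  set g := t.orderEmbOfFin ht
  have hmem : ∀ i, g i ∈ s := fun i => hts (t.orderEmbOfFin_mem ht i)
  set c : Fin (2 * K + 1) := ⟨K, by omega⟩
  refine ⟨g c, hmem c, ?_, ?_⟩
  · have : (Finset.Iio c).map g.toEmbedding ⊆ s.filter (· < g c) := by
      intro x hx
      obtain ⟨i, hi, rfl⟩ := Finset.mem_map.1 hx
      exact Finset.mem_filter.2 ⟨hmem i, g.lt_iff_lt.2 (Finset.mem_Iio.1 hi)⟩
    simpa [c] using Finset.card_le_card this
  · have : (Finset.Ioi c).map g.toEmbedding ⊆ s.filter (g c < ·) := by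
      intro x hx
      obtain ⟨i, hi, rfl⟩ := Finset.mem_map.1 hx
      exact Finset.mem_filter.2 ⟨hmem i, g.lt_iff_lt.2 (Finset.mem_Ioi.1 hi)⟩
    have h2 := Finset.card_le_card this
    rw [Finset.card_map, Fin.card_Ioi] at h2
    have hv : (c : ℕ) = K := rfl
    omega

/-- A segment of the path `w` together with the legs `S l`, `l ∈ I`, without their first vertices. -/
def comb (w : ℕ → V) (S : ℕ → ℕ → V) (r : ℕ → ℕ) (i j : ℕ) (I : Finset ℕ) : Set V :=
  ico w i j ∪ ⋃ l ∈ (I : Set ℕ), seg (S l) 1 (r l)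

theorem mem_comb {w : ℕ → V} {S : ℕ → ℕ → V} {r : ℕ → ℕ} {i j : ℕ} {I : Finset ℕ} {v : V} :
    v ∈ comb w S r i j I ↔ (∃ q, i ≤ q ∧ q < j ∧ w q = v) ∨
      ∃ l ∈ I, ∃ q, 1 ≤ q ∧ q ≤ r l ∧ S l q = v := by
  simp only [comb, Set.mem_union, Set.mem_iUnion, exists_prop, Finset.mem_coe]
  rfl

/-- An induced path `w 0, …, w k` with legs `S j`, starting in `X`, whose last vertices are adjacent
to `w j` and `w (j + 1)`. -/
structure BranchSystem (G : SimpleGraph V) (X D : Set V) (w : ℕ → V) (k : ℕ) (J : Finset ℕ)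
    (S : ℕ → ℕ → V) (r : ℕ → ℕ) : Prop where
  path : G.IndPath w k
  mem : ∀ i ≤ k, w i ∈ D
  lt : ∀ j ∈ J, j < k
  spaced : ∀ j ∈ J, ∀ l ∈ J, j < l → j + 2 ≤ l
  leg : ∀ j ∈ J, G.IndPath (S j) (r j)
  leg_pos : ∀ j ∈ J, 1 ≤ r j
  zero_mem : ∀ j ∈ J, S j 0 ∈ X
  leg_mem : ∀ j ∈ J, ∀ i, 1 ≤ i → i ≤ r j → S j i ∈ D
  ne : ∀ j ∈ J, ∀ i ≤ r j, ∀ l ≤ k, S j i ≠ w l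
  adj : ∀ j ∈ J, ∀ i ≤ r j, ∀ l ≤ k, (G.Adj (S j i) (w l) ↔ i = r j ∧ (l = j ∨ l = j + 1))
  sep : ∀ j ∈ J, ∀ l ∈ J, j ≠ l → G.Sep (seg (S j) 0 (r j)) (seg (S l) 0 (r l))

namespace BranchSystem
variable {w : ℕ → V} {k : ℕ} {J I I' : Finset ℕ} {S : ℕ → ℕ → V} {r : ℕ → ℕ} {i j e : ℕ}

theorem comb_sub (h : BranchSystem G X D w k J S r) (hj : j ≤ k + 1) (hI : I ⊆ J) :
    comb w S r i j I ⊆ D := by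
  intro v hv
  rcases mem_comb.1 hv with ⟨q, h1, h2, rfl⟩ | ⟨l, hl, q, h1, h2, rfl⟩
  · exact h.mem q (by omega)
  · exact h.leg_mem l (hI hl) q h1 h2

theorem conn_comb (h : BranchSystem G X D w k J S r) (hij : i < j) (hj : j ≤ k + 1) (hI : I ⊆ J)
    (hl : ∀ l ∈ I, i ≤ l ∧ l < j) : G.Conn (comb w S r i j I) := by
  refine (h.path.conn_ico hij hj).biUnion fun l hlI => ?_
  have h1 := h.leg_pos l (hI hlI)
  have h2 := hl l hlI
  exact (h.path.conn_ico hij hj).union_adj ((h.leg l (hI hlI)).conn_seg h1 le_rfl)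
    (mem_ico_of h2.1 h2.2) (mem_seg_of h1 le_rfl)
    ((h.adj l (hI hlI) _ le_rfl l (h.lt l (hI hlI)).le).2 ⟨rfl, Or.inl rfl⟩).symm

theorem sep_leg (h : BranchSystem G X D w k J S r) (he : e ∈ J) (hj : j ≤ k + 1) (hI : I ⊆ J)
    (heI : e ∉ I) (hij : ∀ q, i ≤ q → q < j → q ≠ e ∧ q ≠ e + 1) :
    G.Sep (seg (S e) 0 (r e)) (comb w S r i j I) := by
  rintro _ ⟨g, -, hg, rfl⟩ v hv
  rcases mem_comb.1 hv with ⟨q, h1, h2, rfl⟩ | ⟨l, hl, q, h1, h2, rfl⟩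
  · refine ⟨h.ne e he g hg q (by omega), fun e' => ?_⟩
    have := (h.adj e he g hg q (by omega)).1 e'
    have := hij q h1 h2
    omega
  · exact h.sep e he l (hI hl) (fun e' => heI (e' ▸ hl)) _ (mem_seg_of (Nat.zero_le _) hg) _
      (mem_seg_of (Nat.zero_le _) h2)

theorem sep_comb (h : BranchSystem G X D w k J S r) (he : e + 1 ≤ k) (hI : I ⊆ J) (hI' : I' ⊆ J)
    (h1 : ∀ l ∈ I, l + 2 ≤ e) (h2 : ∀ l ∈ I', e + 2 ≤ l) :
    G.Sep (comb w S r 0 e I) (comb w S r (e + 2) (k + 1) I') := by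
  intro v hv v' hv'
  rcases mem_comb.1 hv with ⟨q, q1, q2, rfl⟩ | ⟨l, hl, q, q1, q2, rfl⟩
  · rcases mem_comb.1 hv' with ⟨q', q1', q2', rfl⟩ | ⟨l', hl', q', q1', q2', rfl⟩
    · exact h.path.sep_ico (i := 0) (j := e) (k := e + 2) (l := k + 1) (by omega) le_rfl _
        (mem_ico_of q1 q2) _ (mem_ico_of q1' q2')
    · have hl2 := h2 l' hl'
      exact (h.sep_leg (i := 0) (j := e) (I := ∅) (hI' hl') (by omega) (by simp) (by simp)
        (fun q _ _ => by omega)).symm _ (mem_comb.2 (Or.inl ⟨q, q1, q2, rfl⟩)) _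
        (mem_seg_of (Nat.zero_le _) q2')
  · have hl1 := h1 l hl
    exact h.sep_leg (hI hl) le_rfl hI' (fun e' => by have := h2 l e'; omega)
      (fun q h3 h4 => by omega) _ (mem_seg_of (Nat.zero_le _) q2) _ hv'

theorem nbr_eq (h : BranchSystem G X D w k J S r) {l : ℕ} (hl : l ∈ J) {y : V}
    (hy : y ∈ comb w S r 0 (k + 1) J) (hadj : G.Adj (S l 0) y) : y = S l 1 := by
  have hr := h.leg_pos l hl
  rcases mem_comb.1 hy with ⟨q, h1, h2, rfl⟩ | ⟨l', hl', q, h1, h2, rfl⟩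
  · have := (h.adj l hl 0 (by omega) q (by omega)).1 hadj
    omega
  · by_cases hll : l = l'
    · subst hll
      rw [(h.leg l hl).adj 0 (by omega) q h2] at hadj
      exact congrArg _ (by omega)
    · exact ((h.sep l hl l' hl' hll _ (mem_seg_of le_rfl (Nat.zero_le _)) _
        (mem_seg_of (Nat.zero_le _) h2)).2 hadj).elim

theorem inj (h : BranchSystem G X D w k J S r) (hI : I ⊆ J) :
    ((fun l => S l 0) '' (I : Set ℕ)).ncard = I.card := by
  have : Set.InjOn (fun l => S l 0) (I : Set ℕ) := fun l hl l' hl' e' => by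
    by_contra hne
    exact (h.sep l (hI hl) l' (hI hl') hne _ (mem_seg_of le_rfl (Nat.zero_le _)) _
      (mem_seg_of le_rfl (Nat.zero_le _))).1 e'
  rw [this.ncard_image, Set.ncard_coe_finset]

/-- The leg `e` divides the system at the edge `w e`, `w (e + 1)`; each side consists of the rest of
the path with all legs attached there. The spacing of the legs keeps them off this edge. Only the
legs in `I` and `I'` supply pendant vertices, so that inconvenient ones can be left out while their
legs remain in the sides. -/
theorem legConfig (h : BranchSystem G X D w k J S r) (he : e ∈ J) (hI : I ⊆ J.filter (· < e))
    (hI' : I' ⊆ J.filter (e < ·)) (hc : 7 ≤ I.card) (hc' : 7 ≤ I'.card) :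
    LegConfig G X D (comb w S r 0 e (J.filter (· < e)))
      (comb w S r (e + 2) (k + 1) (J.filter (e < ·))) (w e) (w (e + 1)) (S e) (r e)
      ((fun l => S l 0) '' (I : Set ℕ)) ((fun l => S l 0) '' (I' : Set ℕ)) := by
  have hJ1 : J.filter (· < e) ⊆ J := Finset.filter_subset _ _
  have hJ2 : J.filter (e < ·) ⊆ J := Finset.filter_subset _ _
  have f1 : ∀ l ∈ J.filter (· < e), l + 2 ≤ e := fun l hl =>
    h.spaced l (hJ1 hl) e he (Finset.mem_filter.1 hl).2
  have f2 : ∀ l ∈ J.filter (e < ·), e + 2 ≤ l := fun l hl =>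
    h.spaced e he l (hJ2 hl) (Finset.mem_filter.1 hl).2
  obtain ⟨l1, hl1⟩ := Finset.card_pos.1 (show 0 < I.card by omega)
  obtain ⟨l2, hl2⟩ := Finset.card_pos.1 (show 0 < I'.card by omega)
  have b1 := f1 l1 (hI hl1)
  have b2 := f2 l2 (hI' hl2)
  have b3 := h.lt l2 (hJ2 (hI' hl2))
  have hsub : insert (w e) (insert (w (e + 1)) (comb w S r 0 e (J.filter (· < e)) ∪
      comb w S r (e + 2) (k + 1) (J.filter (e < ·)))) ⊆ comb w S r 0 (k + 1) J := by
    rintro v (rfl | rfl | hv | hv)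
    · exact mem_comb.2 (Or.inl ⟨e, by omega, by omega, rfl⟩)
    · exact mem_comb.2 (Or.inl ⟨e + 1, by omega, by omega, rfl⟩)
    · rcases mem_comb.1 hv with ⟨q, h1, h2, rfl⟩ | ⟨l, hl, q, h1, h2, rfl⟩
      · exact mem_comb.2 (Or.inl ⟨q, by omega, by omega, rfl⟩)
      · exact mem_comb.2 (Or.inr ⟨l, hJ1 hl, q, h1, h2, rfl⟩)
    · rcases mem_comb.1 hv with ⟨q, h1, h2, rfl⟩ | ⟨l, hl, q, h1, h2, rfl⟩
      · exact mem_comb.2 (Or.inl ⟨q, by omega, by omega, rfl⟩)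
      · exact mem_comb.2 (Or.inr ⟨l, hJ2 hl, q, h1, h2, rfl⟩)
  have hΛ : ∀ x ∈ (fun l => S l 0) '' (I : Set ℕ) ∪ (fun l => S l 0) '' (I' : Set ℕ),
      ∃ l ∈ J, l ≠ e ∧ S l 0 = x := by
    rintro _ (⟨l, hl, rfl⟩ | ⟨l, hl, rfl⟩)
    · have := Finset.mem_filter.1 (hI hl)
      exact ⟨l, this.1, by omega, rfl⟩
    · have := Finset.mem_filter.1 (hI' hl)
      exact ⟨l, this.1, by omega, rfl⟩
  have htouch : ∀ l ∈ J, ∀ i j (T : Finset ℕ), l ∈ T → G.Touches (S l 0) (comb w S r i j T) := by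
    intro l hl i j T hT
    have := h.leg_pos l hl
    exact ⟨S l 1, mem_comb.2 (Or.inr ⟨l, hT, 1, le_rfl, this, rfl⟩), (h.leg l hl).adj_succ this⟩
  exact
    { sepPair := ⟨h.conn_comb (by omega) (by omega) hJ1 fun l hl => by have := f1 l hl; omega,
        h.conn_comb (by omega) le_rfl hJ2 fun l hl => by
          have := f2 l hl; have := h.lt l (hJ2 hl); omega,
        h.comb_sub (by omega) hJ1, h.comb_sub le_rfl hJ2, h.sep_comb (by omega) hJ1 hJ2 f1 f2⟩
      mem₁ := h.mem _ (by omega)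
      mem₂ := h.mem _ (by omega)
      adj := h.path.adj_succ (by omega)
      touch₁ := ⟨w (e - 1), mem_comb.2 (Or.inl ⟨e - 1, by omega, by omega, rfl⟩), by
        rw [h.path.adj _ (by omega) _ (by omega)]; omega⟩
      touch₂ := ⟨w (e + 2), mem_comb.2 (Or.inl ⟨e + 2, by omega, by omega, rfl⟩),
        h.path.adj_succ (by omega)⟩
      path := h.leg e he
      zero_mem := h.zero_mem e he
      mem := h.leg_mem e he
      sepL := h.sep_leg he (by omega) hJ1 (by simp) fun q _ _ => by omega
      sepR := h.sep_leg he le_rfl hJ2 (by simp) fun q _ _ => by omega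
      ne := fun i hi => ⟨h.ne e he i hi _ (by omega), h.ne e he i hi _ (by omega)⟩
      adj₁ := fun i hi => by rw [h.adj e he i hi _ (by omega)]; omega
      adj₂ := fun i hi => by rw [h.adj e he i hi _ (by omega)]; omega
      subL := by rintro _ ⟨l, hl, rfl⟩; exact h.zero_mem l (hJ1 (hI hl))
      subR := by rintro _ ⟨l, hl, rfl⟩; exact h.zero_mem l (hJ2 (hI' hl))
      touchL := by rintro _ ⟨l, hl, rfl⟩; exact htouch l (hJ1 (hI hl)) _ _ _ (hI hl)
      touchR := by rintro _ ⟨l, hl, rfl⟩; exact htouch l (hJ2 (hI' hl)) _ _ _ (hI' hl)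
      cardL := by rw [h.inj (hI.trans hJ1)]; exact hc
      cardR := by rw [h.inj (hI'.trans hJ2)]; exact hc'
      sepΛ := fun x hx i hi => by
        obtain ⟨l, hl, hne, rfl⟩ := hΛ x hx
        exact h.sep l hl e he hne _ (mem_seg_of le_rfl (Nat.zero_le _)) _
          (mem_seg_of (Nat.zero_le _) hi)
      uniq := fun x hx y hy y' hy' e1 e2 => by
        obtain ⟨l, hl, -, rfl⟩ := hΛ x hx
        rw [h.nbr_eq hl (hsub hy) e1, h.nbr_eq hl (hsub hy') e2] }

end BranchSystem
end SimpleGraph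

/-! ### Bounding the number of legs. -/

namespace SimpleGraph
variable {V : Type*} {G : SimpleGraph V} {d : ℕ} {a : V} {X D : Set V}

namespace BranchSystem
variable {w : ℕ → V} {k : ℕ} {J : Finset ℕ} {S : ℕ → ℕ → V} {r : ℕ → ℕ}

/-- A vertex of `D` off the legs touches at most two legs. -/
theorem card_touched_le (h : BranchSystem G X D w k J S r) (hS : Setting G d a X D) {v : V}
    (hv : v ∈ D) {I : Finset ℕ} (hI : I ⊆ J)
    (hvI : ∀ l ∈ I, v ∉ seg (S l) 0 (r l) ∧ G.Touches v (seg (S l) 0 (r l))) : I.card ≤ 2 := by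
  by_contra hc
  obtain ⟨l₁, m₁, l₂, m₂, l₃, m₃, h12, h13, h23⟩ := Finset.two_lt_card.1 (not_le.1 hc)
  have hconn : ∀ l ∈ I, G.Conn (seg (S l) 0 (r l)) := fun l hl =>
    (h.leg l (hI hl)).conn_seg (Nat.zero_le _) le_rfl
  have hsub : ∀ l ∈ I, seg (S l) 0 (r l) ⊆ D ∪ X := by
    rintro l hl _ ⟨i, -, hi, rfl⟩
    rcases Nat.eq_zero_or_pos i with rfl | h0
    · exact Or.inr (h.zero_mem l (hI hl))
    · exact Or.inl (h.leg_mem l (hI hl) i h0 hi)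
  have hX : ∀ l ∈ I, (seg (S l) 0 (r l) ∩ X).Nonempty := fun l hl =>
    ⟨S l 0, mem_seg_of le_rfl (Nat.zero_le _), h.zero_mem l (hI hl)⟩
  exact hS.not_trident hv (hconn _ m₁) (hconn _ m₂) (hconn _ m₃) (h.sep _ (hI m₁) _ (hI m₂) h12)
    (h.sep _ (hI m₁) _ (hI m₃) h13) (h.sep _ (hI m₂) _ (hI m₃) h23) (hsub _ m₁) (hsub _ m₂)
    (hsub _ m₃) (hvI _ m₁).1 (hvI _ m₂).1 (hvI _ m₃).1 (hvI _ m₁).2 (hvI _ m₂).2 (hvI _ m₃).2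
    (hX _ m₁) (hX _ m₂) (hX _ m₃)

/-- All but seven legs are avoided by a connected set joining `b` to the rest of the system. -/
theorem exists_good [Finite V] (h : BranchSystem G X D w k J S r) (hS : Setting G d a X D)
    (hD : G.Conn D) {b : V} (hb : b ∈ D) (hk : 1 ≤ k) :
    ∃ (U : Set V) (m : V) (I : Finset ℕ), G.Conn U ∧ U ⊆ D ∧ b ∈ U ∧ G.Touches m U ∧
      m ∈ comb w S r 0 (k + 1) J ∧ I ⊆ J ∧ J.card ≤ I.card + 7 ∧ ∀ l ∈ I,
        ¬ G.Touches (S l 0) U ∧ G.Sep U (seg (S l) 0 (r l)) ∧ m ≠ w l ∧ m ≠ w (l + 1) := by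
  classical
  set M := comb w S r 0 (k + 1) J with hM
  have hMc : G.Conn M := h.conn_comb (by omega) le_rfl le_rfl fun l hl => by
    have := h.lt l hl; omega
  have hMD : M ⊆ D := h.comb_sub le_rfl le_rfl
  have hwM : ∀ i ≤ k, w i ∈ M := fun i hi => mem_comb.2 (Or.inl ⟨i, by omega, by omega, rfl⟩)
  have hMt : ∀ y ∈ M, G.Touches y M := by
    intro y hy
    obtain ⟨x, ⟨-, rfl⟩, y', hy', e⟩ := hMc.exists_adj_of_ne (S := {y}) ⟨y, hy, rfl⟩ fun hsub =>
      h.path.ne (i := 0) (j := 1) (by omega) hk (by omega)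
        ((hsub (hwM 0 (by omega))).trans (hsub (hwM 1 hk)).symm)
    exact ⟨y', hy'.1, e⟩
  -- A shortest path from `b` to a vertex touching the comb; only its last vertex `q n` has
  -- neighbours in the comb.
  obtain ⟨q, n, hq, hqD, q0, ⟨m, hm, hqm⟩, -, qn'⟩ := hD.exists_minPath (· = b) (G.Touches · M)
    ⟨b, hb, rfl⟩ ⟨w 0, h.mem 0 (by omega), hMt _ (hwM 0 (by omega))⟩
  have hqM : ∀ i < n, q i ∉ M ∧ ¬ G.Touches (q i) M := by
    refine fun i hi => ⟨fun e => ?_, fun e => ?_⟩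
    · have := qn' i hi.le (hMt _ e); omega
    · have := qn' i hi.le e; omega
  have h0M : ∀ l ∈ J, G.Touches (S l 0) M := fun l hl =>
    ⟨S l 1, mem_comb.2 (Or.inr ⟨l, hl, 1, le_rfl, h.leg_pos l hl, rfl⟩),
      (h.leg l hl).adj_succ (h.leg_pos l hl)⟩
  -- Four kinds of bad legs, at most `3 + 1 + 2 + 1` in all: the first vertex touches the path from
  -- `b`; the leg contains `q n`; the leg is touched by `q n` from outside; the leg is attached at
  -- `m`.
  set B₁ := J.filter fun l => G.Touches (S l 0) (seg q 0 n) with hB₁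
  set B₂ := J.filter fun l => q n ∈ seg (S l) 0 (r l) with hB₂
  set B₃ := J.filter fun l => q n ∉ seg (S l) 0 (r l) ∧ G.Touches (q n) (seg (S l) 0 (r l)) with hB₃
  set B₄ := J.filter fun l => m = w l ∨ m = w (l + 1) with hB₄
  have c₁ : B₁.card ≤ 3 := by
    have h1 : {x ∈ X | G.Touches x (ico q 0 n) ∧ G.Touches x M}.ncard ≤ 1 := by
      refine (Set.ncard_le_one (Set.toFinite _)).2 fun x hx y hy => ?_
      have ⟨_, ⟨i, _, hi, _⟩, _⟩ := hx.2.1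
      exact hS.eq_of_touches (hq.conn_ico (i := 0) (j := n) (by omega) (by omega)) hMc
        (ico_subset fun i _ _ => hqD i (by omega)) hMD (sep_ico_left fun i _ hi => hqM i hi) hx.1 hy.1
        hx.2.1 hx.2.2 hy.2.1 hy.2.2
    have h2 := hS.ncard_nbrs_le_two (hqD n le_rfl)
    rw [← h.inj (Finset.filter_subset _ J)]
    refine (Set.ncard_le_ncard (t := {x ∈ X | G.Touches x (ico q 0 n) ∧ G.Touches x M} ∪
      {x ∈ X | G.Adj x (q n)}) ?_ (Set.toFinite _)).trans ((Set.ncard_union_le _ _).trans (by omega))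
    rintro _ ⟨l, hl, rfl⟩
    obtain ⟨hlJ, _, ⟨i, -, hi, rfl⟩, e⟩ := Finset.mem_filter.1 hl
    rcases hi.lt_or_eq with hi | rfl
    · exact Or.inl ⟨h.zero_mem l hlJ, ⟨_, mem_ico_of (Nat.zero_le _) hi, e⟩, h0M l hlJ⟩
    · exact Or.inr ⟨h.zero_mem l hlJ, e⟩
  have c₂ : B₂.card ≤ 1 := by
    refine Finset.card_le_one.2 fun l hl l' hl' => ?_
    obtain ⟨hl, h1⟩ := Finset.mem_filter.1 hl
    obtain ⟨hl', h2⟩ := Finset.mem_filter.1 hl'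
    by_contra hne
    exact (h.sep l hl l' hl' hne).notMem h1 h2
  have c₃ : B₃.card ≤ 2 := h.card_touched_le hS (hqD n le_rfl) (Finset.filter_subset _ _)
    fun l hl => (Finset.mem_filter.1 hl).2
  have c₄ : B₄.card ≤ 1 := by
    refine Finset.card_le_one.2 fun l hl l' hl' => ?_
    obtain ⟨hl, h1⟩ := Finset.mem_filter.1 hl
    obtain ⟨hl', h2⟩ := Finset.mem_filter.1 hl'
    have k1 := h.lt l hl
    have k2 := h.lt l' hl'
    by_contra hne
    have key : ∀ i j, i ≤ k → j ≤ k → m = w i → m = w j → i = j := fun i j hi hj e1 e2 =>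
      h.path.inj i hi j hj (e1 ▸ e2)
    have hsp : l + 2 ≤ l' ∨ l' + 2 ≤ l := by
      rcases Nat.lt_or_gt_of_ne hne with h' | h'
      · exact Or.inl (h.spaced l hl l' hl' h')
      · exact Or.inr (h.spaced l' hl' l hl h')
    rcases h1 with h1 | h1 <;> rcases h2 with h2 | h2 <;>
      · have := key _ _ (by omega) (by omega) h1 h2
        omega
  refine ⟨seg q 0 n, m, J \ (B₁ ∪ B₂ ∪ (B₃ ∪ B₄)), hq.conn_seg (Nat.zero_le _) le_rfl, ?_,
    ⟨0, le_rfl, Nat.zero_le _, q0⟩, ⟨q n, mem_seg_of (Nat.zero_le _) le_rfl, hqm.symm⟩, hm,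
    Finset.sdiff_subset, ?_, fun l hl => ?_⟩
  · rintro _ ⟨i, -, hi, rfl⟩
    exact hqD i hi
  · have u1 := Finset.card_union_le (B₁ ∪ B₂) (B₃ ∪ B₄)
    have u2 := Finset.card_union_le B₁ B₂
    have u3 := Finset.card_union_le B₃ B₄
    have := Finset.le_card_sdiff (B₁ ∪ B₂ ∪ (B₃ ∪ B₄)) J
    omega
  · obtain ⟨hlJ, hl⟩ := Finset.mem_sdiff.1 hl
    have n1 : ¬ G.Touches (S l 0) (seg q 0 n) := fun e => hl (Finset.mem_union_left _
      (Finset.mem_union_left _ (Finset.mem_filter.2 ⟨hlJ, e⟩)))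
    have n2 : q n ∉ seg (S l) 0 (r l) := fun e => hl (Finset.mem_union_left _
      (Finset.mem_union_right _ (Finset.mem_filter.2 ⟨hlJ, e⟩)))
    have n3 : ¬ G.Touches (q n) (seg (S l) 0 (r l)) := fun e => hl (Finset.mem_union_right _
      (Finset.mem_union_left _ (Finset.mem_filter.2 ⟨hlJ, n2, e⟩)))
    have n4 : ¬ (m = w l ∨ m = w (l + 1)) := fun e => hl (Finset.mem_union_right _
      (Finset.mem_union_right _ (Finset.mem_filter.2 ⟨hlJ, e⟩)))
    refine ⟨n1, ?_, fun e => n4 (Or.inl e), fun e => n4 (Or.inr e)⟩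
    rintro _ ⟨i, -, hi, rfl⟩ _ ⟨g, -, hg, rfl⟩
    rcases hi.lt_or_eq with hin | rfl
    · rcases Nat.eq_zero_or_pos g with rfl | hg0
      · exact ⟨fun e => hS.disj _ (h.zero_mem l hlJ) (e ▸ hqD i hi),
          fun e => n1 ⟨_, mem_seg_of (Nat.zero_le _) hi, e.symm⟩⟩
      · have hgM : S l g ∈ M := mem_comb.2 (Or.inr ⟨l, hlJ, g, hg0, hg, rfl⟩)
        exact ⟨fun e => (hqM i hin).1 (e ▸ hgM), fun e => (hqM i hin).2 ⟨_, hgM, e⟩⟩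
    · exact ⟨fun e => n2 ⟨g, Nat.zero_le _, hg, e.symm⟩,
        fun e => n3 ⟨_, mem_seg_of (Nat.zero_le _) hg, e⟩⟩

end BranchSystem

/-- A branch system with many legs does not exist. -/
theorem exists_branch_bound (d t : ℕ) :
    ∃ N : ℕ, ∀ {V : Type*} [Finite V] {G : SimpleGraph V} {a b : V} {X D : Set V}
      {P : V → ℕ → V} {len : V → ℕ}, Fan G X D b P len → Setting G d a X D → G.CliqueFree t →
      G.Conn D → ∀ w k J S r, BranchSystem G X D w k J S r → N ≤ J.card → False := by
  classical
  obtain ⟨K, hK⟩ := exists_leg_bound d t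
  -- Seven legs are lost to `exists_good`, and `2 * (K + 7) + 1` are needed for a middle leg with `K
  -- + 7` good ones on either side.
  refine ⟨2 * (K + 7) + 8, fun {V} _ {G a b X D P len} hF hS hG hD w k J S r h hc => ?_⟩
  obtain ⟨l₀, hl₀⟩ := Finset.card_pos.1 (show 0 < J.card by omega)
  obtain ⟨U, m, I, hU, hUD, hbU, hmU, hm, hIJ, hIc, hI⟩ := h.exists_good hS hD hF.mem_b
    (by have := h.lt l₀ hl₀; omega)
  obtain ⟨e, he, c1, c2⟩ := exists_middle (s := I) (K := K + 7) (by omega)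
  obtain ⟨-, hUe, me, me'⟩ := hI e he
  have cfg := h.legConfig (hIJ he) (I := I.filter (· < e)) (I' := I.filter (e < ·))
    (Finset.filter_subset_filter _ hIJ) (Finset.filter_subset_filter _ hIJ) (by omega) (by omega)
  have hΛU : ∀ x ∈ (fun l => S l 0) '' ((I.filter (· < e) : Finset ℕ) : Set ℕ) ∪
      (fun l => S l 0) '' ((I.filter (e < ·) : Finset ℕ) : Set ℕ), ¬ G.Touches x U := by
    rintro _ (⟨l, hl, rfl⟩ | ⟨l, hl, rfl⟩) <;> exact (hI l (Finset.mem_filter.1 hl).1).1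
  have n1 := h.inj (I := I.filter (· < e)) ((Finset.filter_subset _ _).trans hIJ)
  have n2 := h.inj (I := I.filter (e < ·)) ((Finset.filter_subset _ _).trans hIJ)
  -- The side that contains `m` is enlarged by `U` and so contains `b`. The fan paths of the pendant
  -- vertices of the other side, with at most one exception, then contain crossings.
  have main : ∀ {L R ΛL ΛR c₁ c₂}, LegConfig G X D L R c₁ c₂ (S e) (r e) ΛL ΛR → m ∈ R →
      (∀ x ∈ ΛL ∪ ΛR, ¬ G.Touches x U) → K + 7 ≤ ΛL.ncard → False := by
    intro L R ΛL ΛR c₁ c₂ cfg hmR hΛ hcard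
    obtain ⟨y, hy, hmy⟩ := hmU
    have cfg' := cfg.extend hS (cfg.sepPair.connR.union_adj hU hmR hy hmy) hUD hUe hΛ
    obtain ⟨s, p, n, hs, -, hcr, hdisj⟩ := hF.exists_family hS cfg'.sepPair (Or.inr hbU) cfg'.subL
      cfg'.touchL
    exact hK cfg' hS hG s p n hcr hdisj (by omega)
  rcases mem_comb.1 hm with ⟨q, q1, q2, rfl⟩ | ⟨l, hl, q, q1, q2, rfl⟩
  · have hqe : q ≠ e := fun e' => me (e' ▸ rfl)
    have hqe' : q ≠ e + 1 := fun e' => me' (e' ▸ rfl)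
    rcases Nat.lt_or_ge q e with h1 | h1
    · exact main cfg.symm (mem_comb.2 (Or.inl ⟨q, by omega, h1, rfl⟩)) (fun x hx => hΛU x hx.symm)
        (by omega)
    · exact main cfg (mem_comb.2 (Or.inl ⟨q, by omega, q2, rfl⟩)) hΛU (by omega)
  · have hle : l ≠ e := by
      rintro rfl
      obtain ⟨y, hy, e'⟩ := hmU
      exact (hUe y hy _ (mem_seg_of (Nat.zero_le _) q2)).2 e'.symm
    rcases Nat.lt_or_gt_of_ne hle with h1 | h1
    · exact main cfg.symm (mem_comb.2 (Or.inr ⟨l, Finset.mem_filter.2 ⟨hl, h1⟩, q, q1, q2, rfl⟩))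
        (fun x hx => hΛU x hx.symm) (by omega)
    · exact main cfg (mem_comb.2 (Or.inr ⟨l, Finset.mem_filter.2 ⟨hl, h1⟩, q, q1, q2, rfl⟩)) hΛU
        (by omega)

end SimpleGraph

/-! ### From the spine to the bound on fans, and from disjoint paths to fans. -/

namespace SimpleGraph
variable {V : Type*} {G : SimpleGraph V} {d : ℕ} {a : V} {X D : Set V}

/-- Shortest paths from the pendant vertices to the corners turn every other branch into a leg. -/
theorem SpineData.exists_branchSystem {M F : Set V} {xL ρ : V} {w : ℕ → V} {k n : ℕ} {J : Finset ℕ}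
    {B : ℕ → Set V} {b ζ : ℕ → V} (h : SpineData G X M xL F w k J B b ζ ρ)
    (hM : MinConn G X D M) (hS : Setting G d a X D) (hF : F ⊆ M) (hn : 2 * n + 1 ≤ J.card) :
    ∃ J' S r, BranchSystem G X D w k J' S r ∧ n ≤ J'.card := by
  classical
  -- Attachment positions of one parity are at least two apart.
  obtain ⟨c, hc⟩ := exists_large_fiber J (fun j => decide (j % 2 = 0)) n
    (by rw [Fintype.card_bool]; omega) (by omega)
  have hBM : ∀ j ∈ J, B j ⊆ M := fun j hj => (h.subB j hj).trans hF
  have hζM : ∀ j ∈ J, ζ j ∉ M := fun j hj e => hS.disj _ (h.leaf j hj).1 (hM.sub e)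
  have hζt : ∀ j ∈ J, G.Touches (ζ j) (B j) := fun j hj => by
    obtain ⟨y, hy, e⟩ := hM.touches _ (h.leaf j hj).1
    exact ⟨y, (h.leaf j hj).2 y hy e, e⟩
  have hex : ∀ j, ∃ (u : ℕ → V) (m : ℕ), j ∈ J → G.IndPath u m ∧
      (∀ i ≤ m, u i ∈ insert (ζ j) (B j)) ∧ u 0 = ζ j ∧ u m = b j ∧
      (∀ i ≤ m, u i = ζ j → i = 0) ∧ ∀ i ≤ m, u i = b j → i = m := by
    intro j
    by_cases hj : j ∈ J
    · obtain ⟨u, m, h1⟩ := ((h.conn j hj).insert (hζt j hj)).exists_minPath (· = ζ j) (· = b j)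
        ⟨_, Or.inl rfl, rfl⟩ ⟨_, Or.inr (h.corner j hj), rfl⟩
      exact ⟨u, m, fun _ => h1⟩
    · exact ⟨fun _ => ζ j, 0, fun e => (hj e).elim⟩
  choose S r hSr using hex
  have hmemB : ∀ j ∈ J, ∀ i, 1 ≤ i → i ≤ r j → S j i ∈ B j := fun j hj i h1 hi => by
    obtain ⟨-, h2, -, -, h3, -⟩ := hSr j hj
    exact (h2 i hi).resolve_left fun e => by have := h3 i hi e; omega
  have hζw : ∀ j ∈ J, ∀ l ≤ k, ¬ G.Adj (ζ j) (w l) := fun j hj l hl e =>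
    h.ne j hj _ ((h.leaf j hj).2 _ (hF (h.mem l hl)) e) l hl rfl
  have hbζ : ∀ j ∈ J, b j ≠ ζ j := fun j hj e => hζM j hj (e ▸ hBM j hj (h.corner j hj))
  have hrpos : ∀ j ∈ J, 1 ≤ r j := fun j hj => by
    obtain ⟨-, -, h0, hr, -, -⟩ := hSr j hj
    by_contra hc
    rw [show r j = 0 by omega, h0] at hr
    exact hbζ j hj hr.symm
  have hcross : ∀ j ∈ J, ∀ l ∈ J, j ≠ l → G.Sep {ζ j} (B l) := by
    intro j hj l hl hjl
    refine sep_singleton_left.2 ⟨fun e => hζM j hj (hBM l hl e), fun ⟨y, hy, e⟩ => ?_⟩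
    exact (h.sep j hj l hl hjl y ((h.leaf j hj).2 y (hBM l hl hy) e) y hy).1 rfl
  have hζζ : ∀ j ∈ J, ∀ l ∈ J, j ≠ l → ζ j ≠ ζ l := by
    intro j hj l hl hjl e
    exact (sep_singleton_left.1 (hcross j hj l hl hjl)).2 (e ▸ hζt l hl)
  have hJ : J.filter (fun j => decide (j % 2 = 0) = c) ⊆ J := Finset.filter_subset _ _
  refine ⟨_, S, r, ⟨h.path, fun i hi => hM.sub (hF (h.mem i hi)), fun j hj => h.lt j (hJ hj), ?_,
    fun j hj => (hSr j (hJ hj)).1, fun j hj => hrpos j (hJ hj), ?_, ?_, ?_, ?_, ?_⟩, hc⟩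
  · intro j hj l hl hjl
    have h1 := (Finset.mem_filter.1 hj).2.trans (Finset.mem_filter.1 hl).2.symm
    rw [decide_eq_decide] at h1
    omega
  · intro j hj
    rw [(hSr j (hJ hj)).2.2.1]
    exact (h.leaf j (hJ hj)).1
  · exact fun j hj i h1 hi => hM.sub (hBM j (hJ hj) (hmemB j (hJ hj) i h1 hi))
  · intro j hj i hi l hl
    have hj := hJ hj
    rcases Nat.eq_zero_or_pos i with rfl | h0
    · rw [(hSr j hj).2.2.1]
      exact fun e => hζM j hj (e ▸ hF (h.mem l hl))
    · exact h.ne j hj _ (hmemB j hj i h0 hi) l hl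
  · intro j hj i hi l hl
    have hj := hJ hj
    rcases Nat.eq_zero_or_pos i with rfl | h0
    · rw [(hSr j hj).2.2.1]
      exact ⟨fun e => (hζw j hj l hl e).elim, fun e => by have := hrpos j hj; omega⟩
    · rw [h.adj j hj _ (hmemB j hj i h0 hi) l hl]
      have : S j i = b j ↔ i = r j :=
        ⟨(hSr j hj).2.2.2.2.2 i hi, fun e => e ▸ (hSr j hj).2.2.2.1⟩
      rw [this]
  · intro j hj l hl hjl
    have hj := hJ hj
    have hl := hJ hl
    have hsub : ∀ j ∈ J, seg (S j) 0 (r j) ⊆ {ζ j} ∪ B j := by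
      rintro j hj _ ⟨i, -, hi, rfl⟩
      exact (hSr j hj).2.1 i hi
    exact (sep_union_left.2
      ⟨sep_union_right.2 ⟨hS.sep_singletons (h.leaf j hj).1 (h.leaf l hl).1 (hζζ j hj l hl hjl),
        hcross j hj l hl hjl⟩,
      sep_union_right.2 ⟨(hcross l hl j hj hjl.symm).symm, h.sep j hj l hl hjl⟩⟩).mono
      (hsub j hj) (hsub l hl)

/-- A fan with many members does not exist. -/
theorem exists_fan_bound (d t : ℕ) :
    ∃ N : ℕ, ∀ {V : Type*} [Finite V] {G : SimpleGraph V} {a b : V} {X D : Set V}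
      {P : V → ℕ → V} {len : V → ℕ}, Fan G X D b P len → Setting G d a X D → G.CliqueFree t →
      G.Conn D → (∀ x ∈ X, G.Touches x D) → N ≤ X.ncard → False := by
  obtain ⟨nd, hnd⟩ := exists_direct_bound d t
  obtain ⟨nb, hnb⟩ := exists_branch_bound d t
  refine ⟨spineBound t (2 * nb + 1) nd + 3,
    fun {V} _ {G a b X D P len} hF hS hG hD hX hc => ?_⟩
  obtain ⟨M, hM⟩ := exists_minConn hD hX
  -- A single vertex touched by all of `X` would have three neighbours in `X`.
  have hM2 : 2 ≤ M.ncard := by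
    by_contra hlt
    have hpos := (Set.ncard_pos (Set.toFinite M)).2 hM.conn.1
    obtain ⟨q, rfl⟩ := Set.ncard_eq_one.1 (show M.ncard = 1 by omega)
    obtain ⟨x, hx, y, hy, z, hz, hxy, hxz, hyz⟩ := (Set.two_lt_ncard (Set.toFinite X)).1
      (show 2 < X.ncard by omega)
    have hadj : ∀ x ∈ X, G.Adj q x := fun x hx => (touches_singleton.1 (hM.touches x hx)).symm
    exact hS.not_three_nbrs (hM.sub rfl) hx hy hz hxy hxz hyz (hadj x hx) (hadj y hy) (hadj z hz)
  obtain ⟨p, hp, xL, hxL, hpL⟩ := hM.exists_leaf hM2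
  obtain ⟨ρ', hρ', hρL'⟩ := Set.exists_ne_of_one_lt_ncard (show 1 < X.ncard by omega) xL
  have hall : {z ∈ X | G.Touches z M} = X := Set.sep_eq_self_iff_mem_true.2 hM.touches
  obtain ⟨w, k, J, B, β, ζ, ρ, h0, hd, hor⟩ := SpineState.exists_data hM hS hG hpL hxL M.ncard M p
    le_rfl (hM.spineState hS hp hxL hpL) ⟨ρ', hρ', hρL', fun _ hy _ => hy⟩ (2 * nb + 1) nd
    (by rw [hall]; omega)
  rcases hor with hJ | hw
  · obtain ⟨J', S, r, hB, hJ'⟩ := hd.exists_branchSystem hM hS le_rfl hJ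
    exact hnb hF hS hG hD w k J' S r hB hJ'
  · refine hnd hF hS hG w k hd.path (fun i hi => hM.sub (hd.mem i hi))
      (fun v hv c μ e h1 h2 h3 a1 a2 a3 =>
        hM.not_three_spread hS hd.path hd.mem hv h1 h2 h3 a1 a2 a3)
      xL hxL ρ hd.end_mem hd.end_ne.symm ?_ hd.end_adj hw
    intro i hi
    have hLp : G.Adj xL p := by
      obtain ⟨y, hy, e⟩ := hM.touches xL hxL
      exact hpL y hy e ▸ e
    refine ⟨fun e => hd.path.inj i hi 0 (Nat.zero_le _) ?_, fun e => by rw [e, h0]; exact hLp⟩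
    rw [h0, hpL _ (hd.mem i hi) e]

theorem Walk.IsInducedPath.indPath {u v : V} {p : G.Walk u v} (hp : p.IsInducedPath) :
    G.IndPath p.getVert p.length := by
  have hinj : ∀ i ≤ p.length, ∀ j ≤ p.length, p.getVert i = p.getVert j → i = j :=
    fun i hi j hj e => hp.1.getVert_injOn hi hj e
  refine ⟨hinj, fun i hi j hj => ⟨fun e => ?_, ?_⟩⟩
  · obtain ⟨m, hm, he⟩ := p.mk_mem_edges_iff_exists.1
      (hp.2.mem_edges (p.getVert_mem_support i) (p.getVert_mem_support j) e)
    rcases Sym2.eq_iff.1 he with ⟨h1, h2⟩ | ⟨h1, h2⟩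
    · have := hinj _ (by omega) _ hi h1
      have := hinj _ (by omega) _ hj h2
      omega
    · have := hinj _ (by omega) _ hj h1
      have := hinj _ (by omega) _ hi h2
      omega
  · rintro (rfl | rfl)
    · exact p.adj_getVert_succ (by omega)
    · exact (p.adj_getVert_succ (by omega)).symm

/-- A family of internally disjoint induced paths between non-adjacent vertices yields a fan. -/
theorem exists_fan [Finite V] {b : V} {n N k : ℕ} (hN : ∀ s : Finset V, N ≤ s.card →
      ∃ s' ⊆ s, s'.card = n ∧ ∀ x ∈ s', ∀ y ∈ s', ¬ G.Adj x y) (hNk : N ≤ k) (hn : 0 < n)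
    (h1 : ¬ G.HasTheta) (h2 : ¬ G.HasPrism) (h3 : ¬ G.HasEvenWheel) (hab : a ≠ b)
    (hadj : ¬ G.Adj a b) (hd : ∀ v, G.Adj a v → ¬ G.IsSubstantial d v)
    (P : Fin k → G.Walk a b) (hP : ∀ i, (P i).IsInducedPath)
    (hdisj : ∀ i j, i ≠ j → Disjoint (P i).interior (P j).interior) :
    ∃ (X D : Set V) (Q : V → ℕ → V) (len : V → ℕ), X.ncard = n ∧ Fan G X D b Q len ∧
      Setting G d a X D ∧ G.Conn D ∧ ∀ x ∈ X, G.Touches x D := by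
  classical
  have hi := fun i => (hP i).indPath
  have hz : ∀ i, (P i).getVert 0 = a := fun i => (P i).getVert_zero
  have hl : ∀ i, (P i).getVert (P i).length = b := fun i => (P i).getVert_length
  have haz : ∀ i, ∀ m ≤ (P i).length, (G.Adj a ((P i).getVert m) ↔ m = 1) := fun i m hm => by
    have := (hi i).adj 0 (Nat.zero_le _) m hm
    simp only [Walk.getVert_zero] at this
    rw [this]; omega
  have hlen : ∀ i, 2 ≤ (P i).length := by
    intro i
    by_contra hc
    have e := hl i
    rcases (show (P i).length = 0 ∨ (P i).length = 1 by omega) with h | h <;> rw [h] at e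
    · exact hab ((hz i).symm.trans e)
    · exact hadj (e ▸ (haz i 1 h.ge).2 rfl)
  have hint : ∀ i j m l, 1 ≤ m → m < (P i).length → 1 ≤ l → l < (P j).length →
      (P i).getVert m = (P j).getVert l → i = j := by
    intro i j m l m1 m2 l1 l2 e
    by_contra hij
    have key : ∀ i m, 1 ≤ m → m < (P i).length → (P i).getVert m ∈ (P i).interior := by
      refine fun i m m1 m2 => ⟨(P i).getVert_mem_support m, fun e => ?_, fun e => ?_⟩
      · have := (hi i).inj m m2.le 0 (Nat.zero_le _) (e.trans (hz i).symm); omega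
      · have := (hi i).inj m m2.le _ le_rfl (e.trans (hl i).symm); omega
    exact Set.disjoint_left.1 (hdisj i j hij) (key i m m1 m2) (e ▸ key j l l1 l2)
  have hinj : Function.Injective fun i => (P i).getVert 1 := fun i j e =>
    hint i j 1 1 le_rfl (hlen i) le_rfl (hlen j) e
  obtain ⟨s, hs, hsc, hst⟩ := hN (Finset.univ.image fun i => (P i).getVert 1)
    (by rw [Finset.card_image_of_injective _ hinj, Finset.card_fin]; exact hNk)
  obtain ⟨x₀, hx₀⟩ := Finset.card_pos.1 (hsc ▸ hn)
  have hex : ∀ x, ∃ i, x ∈ s → (P i).getVert 1 = x := by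
    intro x
    by_cases hx : x ∈ s
    · obtain ⟨i, -, h⟩ := Finset.mem_image.1 (hs hx)
      exact ⟨i, fun _ => h⟩
    · obtain ⟨i, -, -⟩ := Finset.mem_image.1 (hs hx₀)
      exact ⟨i, fun h => (hx h).elim⟩
  choose f hf using hex
  set len : V → ℕ := fun x => (P (f x)).length - 1 with hlendef
  have hlen' : ∀ x, len x + 1 = (P (f x)).length := fun x =>
    Nat.sub_add_cancel (one_le_two.trans (hlen (f x)))
  -- The fan path of `x` is the given path without `a`; dropping `x` too leaves the part that goes
  -- into `D`, which includes `b`.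
  set D : Set V := {v | ∃ x ∈ s, ∃ m, 1 ≤ m ∧ m ≤ len x ∧ (P (f x)).getVert (m + 1) = v} with hD
  have hlast : ∀ x, (P (f x)).getVert (len x + 1) = b := fun x => by rw [hlen', hl]
  have hbD : b ∈ D := ⟨x₀, hx₀, len x₀, by have := hlen' x₀; have := hlen (f x₀); omega, le_rfl,
    hlast x₀⟩
  have hQ : ∀ x, G.IndPath (fun m => (P (f x)).getVert (m + 1)) (len x) := fun x => by
    have := hlen' x
    refine ⟨fun i hi' j hj' e => ?_, fun i hi' j hj' => ?_⟩
    · have := (hi (f x)).inj (i + 1) (by omega) (j + 1) (by omega) e; omega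
    · rw [(hi (f x)).adj (i + 1) (by omega) (j + 1) (by omega)]; omega
  have hmem : ∀ x ∈ s, ∀ m, 1 ≤ m → m ≤ len x → (P (f x)).getVert (m + 1) ∈ D :=
    fun x hx m m1 m2 => ⟨x, hx, m, m1, m2, rfl⟩
  refine ⟨s, D, fun x m => (P (f x)).getVert (m + 1), len, by rw [Set.ncard_coe_finset, hsc],
    ⟨hbD, fun x _ => hQ x, hf, fun x _ => hlast x, hmem, ?_⟩,
    ⟨h1, h2, h3, ?_, ?_, ?_, hst, ?_, ?_⟩, ?_, ?_⟩
  · intro x hx y hy hxy i hix j hjy e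
    have hx' := hlen' x
    have hy' := hlen' y
    -- Two fan paths can meet only at `b`: elsewhere they run through interiors of distinct given
    -- paths.
    have hlt : i = len x ∨ j = len y := by
      by_contra! hc
      refine hxy ?_
      rw [← hf x hx, hint (f x) (f y) (i + 1) (j + 1) (by omega) (by omega) (by omega) (by omega) e,
        hf y hy]
    rcases hlt with rfl | rfl
    · exact hlast x
    · exact e.trans (hlast y)
  · intro x hx
    rw [← hf x hx]
    exact (haz _ 1 (one_le_two.trans (hlen _))).2 rfl
  · rintro _ ⟨x, hx, m, m1, m2, rfl⟩ e
    have := hlen' x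
    have := (haz _ _ (by omega)).1 e
    omega
  · rintro ⟨x, hx, m, m1, m2, e⟩
    have := hlen' x
    have := (hi (f x)).inj (m + 1) (by omega) 0 (by omega) (e.trans (hz _).symm)
    omega
  · rintro x hx ⟨y, hy, m, m1, m2, e⟩
    have hx' := hlen (f x)
    have hy' := hlen' y
    have hfx := hf x hx
    rcases Nat.lt_or_eq_of_le m2 with h | rfl
    · have h' := hint (f x) (f y) 1 (m + 1) (by omega) (by omega) (by omega) (by omega)
        (hfx.trans e.symm)
      rw [h'] at hfx
      have := (hi (f y)).inj (m + 1) (by omega) 1 (by omega) (e.trans hfx.symm)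
      omega
    · rw [hlast] at e
      have := (hi (f x)).inj _ le_rfl 1 (by omega) ((hl _).trans (e.trans hfx.symm))
      omega
  · intro x hx
    refine hd x ?_
    rw [← hf x hx]
    exact (haz _ 1 (one_le_two.trans (hlen _))).2 rfl
  · refine conn_of_forall_mem hbD fun S hS hcl => ?_
    obtain ⟨v, ⟨x, hx, m, m1, m2, e⟩, hvS⟩ := hS
    have key : ∀ j, m + j ≤ len x → (P (f x)).getVert (m + j + 1) ∈ S := by
      intro j
      induction j with
      | zero => exact fun _ => e ▸ hvS
      | succ j ih =>
        intro hj
        exact hcl _ (hmem x hx (m + j) (by omega) (by omega)) (ih (by omega)) _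
          (hmem x hx (m + (j + 1)) (by omega) hj)
          (((hQ x).adj (m + j) (by omega) (m + (j + 1)) hj).2 (Or.inl (by omega)))
    have := key (len x - m) (by omega)
    rwa [show m + (len x - m) = len x by omega, hlast] at this
  · intro x hx
    have := hlen' x
    have := hlen (f x)
    refine ⟨_, hmem x hx 1 le_rfl (by omega), ?_⟩
    have := ((hQ x).adj 0 (by omega) 1 (by omega)).2 (Or.inl rfl)
    rwa [hf x hx] at this

end SimpleGraph

theorem corollary5p2 :
    ∀ d t : ℕ, 1 ≤ d → 1 ≤ t → ∃ k : ℕ,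
      ∀ (V : Type*) [Finite V] (G : SimpleGraph V),
        ¬ G.HasTheta → ¬ G.HasPrism → ¬ G.HasEvenWheel → G.CliqueFree t →
        ∀ a b : V, a ≠ b → ¬ G.Adj a b →
          (∀ v : V, G.Adj a v → ¬ G.IsSubstantial d v) →
          ¬ ∃ P : Fin k → G.Walk a b,
            (∀ i, (P i).IsInducedPath) ∧
            ∀ i j, i ≠ j → Disjoint (P i).interior (P j).interior := by
  intro d t _ _
  obtain ⟨n, hn⟩ := SimpleGraph.exists_fan_bound d t
  -- Asking for `n + 1` instead of `n` ensures that the stable set is nonempty, as `exists_fan`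
  -- requires.
  obtain ⟨k, hk⟩ := SimpleGraph.exists_stable_of_cliqueFree t (n + 1)
  refine ⟨k, fun V _ G h1 h2 h3 hG a b hab hadj hd ⟨P, hP, hdisj⟩ => ?_⟩
  obtain ⟨X, D, Q, len, hX, hF, hS, hD, hXD⟩ := SimpleGraph.exists_fan (hk G hG) le_rfl
    (Nat.succ_pos n) h1 h2 h3 hab hadj hd P hP hdisj
  exact hn hF hS hG hD hXD (by omega)
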